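/- **Theorem 1.4.** Let $n\ge 1$, let $D,D'\subset\mathbb C^{n+1}$ be domains with smooth boundaries, and let $p\in\partial D$, $p'\in\partial D'$ be points at which $\partial D$, respectively $\partial D'$, is strongly pseudoconvex. Let $\mathcal J_{p,p'}(D,D')$ be the set of germs at $p$ of holomorphic maps $F\colon U\cap D\to D'$ ($U$ a neighborhood of $p$) which extend smoothly to a neighborhood of $p$ and satisfy $F(p)=p'$. Then $\mathcal J_{p,p'}(D,D')$ contains a $2$-flat germ if and only if $(\partial D,p)$ and $(\partial D',p')$ are biholomorphically equivalent up to weighted order $5$. Here the following terminology is used. Coordinates of $\mathbb C^{n+1}$ are written $(z,w)\in\mathbb C^n\times\mathbb C$, and for functions of $(z,u)\in\mathbb C^n\times\mathbb R$ the variables $z,\bar z$ have weight $1$ and $u$ has weight $2$. A smooth function vanishes at $0$ up to weighted order $k$ if all terms of weight at most $k$ in its Taylor expansion at $0$ are zero. *Normal coordinates.* Local holomorphic coordinates $(z,w)$ vanishing at $p$ are Chern–Moser normal coordinates for $\partial D$ (up to weighted order $5$) if near $0$ the domain $D$ is given by $\operatorname{Im} w>\varphi(z,\operatorname{Re}w)$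 with $\varphi$ smooth and $$\varphi(z,u)=\|z\|^2+N_{22}(z,\bar z)+N_{32}(z,\bar z)+\overline{N_{32}(z,\bar z)}+(\text{terms of weight}\ge 6),$$ where $N_{22}$ is real-valued and $N_{kl}$ is a polynomial homogeneous of degree $k$ in $z$ and $l$ in $\bar z$, with $\operatorname{tr}N_{22}=0$ and $\operatorname{tr}^2N_{32}=0$. Here $\operatorname{tr}$ is the contraction of one $z$-index with one $\bar z$-index of the symmetric coefficients. *$2$-flatness.* A germ $F\in\mathcal J_{p,p'}(D,D')$ is $2$-flat if there are such coordinates $h$ at $p$ for $\partial D$ and $g$ at $p'$ for $\partial D'$ with $g\circ F\circ h^{-1}=\mathrm{id}+o(2)$, that is, the difference from the identity vanishes at $0$ together with all its derivatives of order at most $2$. *Equivalence.* Real hypersurfaces $M,M'$ through $q$ are tangent at $q$ up to weighted order $k$ if, for some local defining function $\rho$ of $M'$ and some local parametrization $\gamma\colon\mathbb C^n\times\mathbb R\to\mathbb C^{n+1}$ of $M$ with $\gamma(0)=q$ and $d\gamma_0(\mathbb C^n\times\{0\})$ equal to the complex tangent space of $M$ at $q$, the function $\rho\circ\gamma$ vanishes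 at $0$ up to weighted order $k$. The pairs $(\partial D,p)$ and $(\partial D',p')$ are biholomorphically equivalent up to weighted order $k$ if there is a local biholomorphic map of $\mathbb C^{n+1}$ near $p$ which sends $p$ to $p'$ and $\partial D$ to a real hypersurface tangent to $\partial D'$ at $p'$ up to weighted order $k$. -/

import Mathlib

open scoped ContDiff Topology ComplexConjugate

/-- The space `ℂⁿ⁺¹ = ℂⁿ × ℂ`, with points written `(z, w)`. -/
abbrev CSpace (n : ℕ) : Type := EuclideanSpace ℂ (Fin n) × ℂ

/-- The space `ℂⁿ × ℝ` of parameters `(z, u)`. -/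
abbrev ParamSpace (n : ℕ) : Type := EuclideanSpace ℂ (Fin n) × ℝ

/-- `ρ` is a smooth local defining function of the set `D` near `q`:
`D = {ρ < 0}` near `q` and `dρ` does not vanish at `q`. -/
def IsDomainDefiningFunctionAt {n : ℕ} (D : Set (CSpace n)) (q : CSpace n)
    (ρ : CSpace n → ℝ) : Prop :=
  ∃ U : Set (CSpace n), IsOpen U ∧ q ∈ U ∧ ContDiffOn ℝ ∞ ρ U ∧ fderiv ℝ ρ q ≠ 0 ∧
    ∀ x ∈ U, (x ∈ D ↔ ρ x < 0)

/-- `ρ` is a smooth local defining function of the real hypersurface `M` near `q`: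
`M = {ρ = 0}` near `q` and `dρ` does not vanish at `q`. -/
def IsHypersurfaceDefiningFunctionAt {n : ℕ} (M : Set (CSpace n)) (q : CSpace n)
    (ρ : CSpace n → ℝ) : Prop :=
  ∃ U : Set (CSpace n), IsOpen U ∧ q ∈ U ∧ ContDiffOn ℝ ∞ ρ U ∧ fderiv ℝ ρ q ≠ 0 ∧
    ∀ x ∈ U, (x ∈ M ↔ ρ x = 0)

/-- A domain in `ℂⁿ⁺¹` with smooth boundary. -/
structure IsSmoothDomain {n : ℕ} (D : Set (CSpace n)) : Prop where
  isOpen : IsOpen D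
  isConnected : IsConnected D
  smooth_boundary : ∀ q ∈ frontier D, ∃ ρ : CSpace n → ℝ, IsDomainDefiningFunctionAt D q ρ

/-- The boundary of `D` is strongly pseudoconvex at its point `p`: the Levi form of a local defining
function `ρ` (with `D = {ρ < 0}`) is positive definite on the complex tangent space at `p`. In terms
of real derivatives four times the Levi form is `v ↦ D²ρ(v, v) + D²ρ(iv, iv)`, and the
complex tangent space is `{v | dρ(v) = dρ(iv) = 0}`. -/
def IsStronglyPseudoconvexAt {n : ℕ} (D : Set (CSpace n)) (p : CSpace n) : Prop :=
  ∃ ρ : CSpace n → ℝ, IsDomainDefiningFunctionAt D p ρ ∧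
    ∀ v : CSpace n, v ≠ 0 → fderiv ℝ ρ p v = 0 → fderiv ℝ ρ p (Complex.I • v) = 0 →
      0 < fderiv ℝ (fderiv ℝ ρ) p v v
        + fderiv ℝ (fderiv ℝ ρ) p (Complex.I • v) (Complex.I • v)

/-- `F` represents a germ at `p` of holomorphic maps from `D` to `D'` that extends smoothly to a
neighbourhood of `p` and sends `p` to `p'`. Only the restriction of `F` to `U ∩ D` is required to
be holomorphic; its jets at `p` do not depend on the chosen smooth extension. -/
def IsSmoothMapGerm {n : ℕ} (D D' : Set (CSpace n)) (p p' : CSpace n)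
    (F : CSpace n → CSpace n) : Prop :=
  ∃ U : Set (CSpace n), IsOpen U ∧ p ∈ U ∧ ContDiffOn ℝ ∞ F U ∧
    DifferentiableOn ℂ F (U ∩ D) ∧ Set.MapsTo F (U ∩ D) D' ∧ F p = p'

/-- `h` is a local biholomorphic map of `ℂⁿ⁺¹` defined near `p` and sending `p` to `q`. -/
structure IsLocalBiholomorphism {n : ℕ} (h : OpenPartialHomeomorph (CSpace n) (CSpace n))
    (p q : CSpace n) : Prop where
  mem_source : p ∈ h.source
  map_eq : h p = q
  holomorphic : DifferentiableOn ℂ h h.source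
  holomorphic_symm : DifferentiableOn ℂ h.symm h.target

/-- `f` vanishes at the origin of `ℂⁿ × ℝ` up to weighted order `k`, where `z` and `z̄` have weight
`1` and `u` has weight `2`. For smooth `f` this says that all monomials of weight at most `k`
in the Taylor expansion of `f` at the origin have coefficient zero. -/
def VanishesToWeightedOrder {n : ℕ} (k : ℕ) (f : ParamSpace n → ℝ) : Prop :=
  f =o[𝓝 0] fun x : ParamSpace n => (‖x.1‖ + √|x.2|) ^ k

/-- The polynomial `∑ a_{ijkl} z_i z_j z̄_k z̄_l` of bidegree `(2, 2)`. -/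
def poly22 {n : ℕ} (a : Fin n → Fin n → Fin n → Fin n → ℂ) (z : EuclideanSpace ℂ (Fin n)) : ℂ :=
  ∑ i, ∑ j, ∑ k, ∑ l, a i j k l * (z i * z j * conj (z k) * conj (z l))

/-- The polynomial `∑ b_{ijklm} z_i z_j z_k z̄_l z̄_m` of bidegree `(3, 2)`. -/
def poly32 {n : ℕ} (b : Fin n → Fin n → Fin n → Fin n → Fin n → ℂ)
    (z : EuclideanSpace ℂ (Fin n)) : ℂ :=
  ∑ i, ∑ j, ∑ k, ∑ l, ∑ m, b i j k l m * (z i * z j * z k * conj (z l) * conj (z m))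

/-- Coefficients of a real-valued polynomial of bidegree `(2, 2)` with vanishing trace. -/
structure IsNormal22 {n : ℕ} (a : Fin n → Fin n → Fin n → Fin n → ℂ) : Prop where
  symm_left : ∀ i j k l, a j i k l = a i j k l
  symm_right : ∀ i j k l, a i j l k = a i j k l
  real : ∀ i j k l, a k l i j = conj (a i j k l)
  trace_eq_zero : ∀ i k, ∑ j, a i j k j = 0

/-- Coefficients of a polynomial of bidegree `(3, 2)` whose iterated trace `tr²` vanishes. -/
structure IsNormal32 {n : ℕ} (b : Fin n → Fin n → Fin n → Fin n → Fin n → ℂ) : Prop where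
  symm_left₁ : ∀ i j k l m, b j i k l m = b i j k l m
  symm_left₂ : ∀ i j k l m, b i k j l m = b i j k l m
  symm_right : ∀ i j k l m, b i j k m l = b i j k l m
  trace_trace_eq_zero : ∀ i, ∑ j, ∑ k, b i j k j k = 0

/-- The graph `Im w = φ(z, Re w)` is in Chern–Moser normal form at the origin up to weighted
order `5`:
`φ(z, u) = ‖z‖² + N₂₂(z, z̄) + N₃₂(z, z̄) + N₂₃(z, z̄) + (terms of weight at least 6)`,
where `N₂₂` is real with `tr N₂₂ = 0` and `N₂₃` is the conjugate of `N₃₂` with `tr² N₃₂ = 0`.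
All other monomials of weight at most `5` are divisible by fewer than two `z`'s or fewer than
two `z̄`'s and do not occur in a normal form. -/
def IsChernMoserGraph {n : ℕ} (φ : ParamSpace n → ℝ) : Prop :=
  ∃ (a : Fin n → Fin n → Fin n → Fin n → ℂ) (b : Fin n → Fin n → Fin n → Fin n → Fin n → ℂ),
    IsNormal22 a ∧ IsNormal32 b ∧
    VanishesToWeightedOrder 5 fun x : ParamSpace n =>
      φ x - (‖x.1‖ ^ 2 + (poly22 a x.1).re + 2 * (poly32 b x.1).re)

/-- `h` is a system of local holomorphic coordinates vanishing at `p` in which the boundary of `D`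
is in Chern–Moser normal form up to weighted order `5`: near the origin `h(D)` is
`{Im w > φ(z, Re w)}`, so that `h(∂D)` is `{Im w = φ(z, Re w)}`, with `φ` smooth and normal. -/
def IsChernMoserChart {n : ℕ} (D : Set (CSpace n)) (p : CSpace n)
    (h : OpenPartialHomeomorph (CSpace n) (CSpace n)) : Prop :=
  IsLocalBiholomorphism h p 0 ∧
  ∃ (V : Set (ParamSpace n)) (φ : ParamSpace n → ℝ), IsOpen V ∧ (0 : ParamSpace n) ∈ V ∧
    ContDiffOn ℝ ∞ φ V ∧ IsChernMoserGraph φ ∧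
    ∀ᶠ y : CSpace n in 𝓝 0, (h.symm y ∈ D ↔ φ (y.1, y.2.re) < y.2.im)

/-- The germ of `F` at `p` is `2`-flat: there are Chern–Moser normal coordinates `h` at `p` for `∂D`
and `g` at `p'` for `∂D'` such that `g ∘ F ∘ h⁻¹ = id + o(2)` at the origin. -/
def IsTwoFlat {n : ℕ} (D D' : Set (CSpace n)) (p p' : CSpace n)
    (F : CSpace n → CSpace n) : Prop :=
  ∃ h g : OpenPartialHomeomorph (CSpace n) (CSpace n),
    IsChernMoserChart D p h ∧ IsChernMoserChart D' p' g ∧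
    (fun y : CSpace n => g (F (h.symm y)) - y) =o[𝓝 0] fun y : CSpace n => ‖y‖ ^ 2

/-- `γ` is a smooth local parametrization of the real hypersurface `M` near `q` by `ℂⁿ × ℝ` with
`γ(0) = q`, such that `dγ₀(ℂⁿ × {0})` is the complex tangent space `T ∩ iT` of `M` at `q`,
where `T` is the real tangent space of `M` at `q`, that is, the range of `dγ₀`. -/
structure IsAdaptedParametrization {n : ℕ} (M : Set (CSpace n)) (q : CSpace n)
    (γ : ParamSpace n → CSpace n) : Prop where
  map_zero : γ 0 = q
  smooth : ∃ V : Set (ParamSpace n), IsOpen V ∧ (0 : ParamSpace n) ∈ V ∧ ContDiffOn ℝ ∞ γ V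
  immersion : Function.Injective (fderiv ℝ γ 0)
  onto_germ : Filter.map γ (𝓝 0) = 𝓝[M] q
  adapted : Set.range (fun z : EuclideanSpace ℂ (Fin n) => fderiv ℝ γ 0 (z, 0)) =
    {v | v ∈ Set.range (fderiv ℝ γ 0) ∧ Complex.I • v ∈ Set.range (fderiv ℝ γ 0)}

/-- The real hypersurfaces `M` and `M'` are tangent at `q` up to weighted order `k`. -/
def IsTangentToWeightedOrder {n : ℕ} (k : ℕ) (M M' : Set (CSpace n)) (q : CSpace n) : Prop :=
  ∃ (ρ : CSpace n → ℝ) (γ : ParamSpace n → CSpace n),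
    IsHypersurfaceDefiningFunctionAt M' q ρ ∧ IsAdaptedParametrization M q γ ∧
    VanishesToWeightedOrder k (ρ ∘ γ)

/-- `(M, p)` and `(M', p')` are biholomorphically equivalent up to weighted order `k`. -/
def AreEquivalentToWeightedOrder {n : ℕ} (k : ℕ) (M M' : Set (CSpace n)) (p p' : CSpace n) :
    Prop :=
  ∃ Φ : OpenPartialHomeomorph (CSpace n) (CSpace n), IsLocalBiholomorphism Φ p p' ∧
    IsTangentToWeightedOrder k (Φ '' (Φ.source ∩ M)) M' p'

/-! Everything is compared in coordinates in which a boundary is a graph Im w = φ(z, u), u = Re w,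
and functions of (z, u) are sorted by weight, z counting 1 and u counting 2; the gauge `wnorm` and
the dilations `dil` implement this.

Normal coordinates exist at strongly pseudoconvex points (`exists_normalChart`). Positivity of the
Levi form makes the weight 2 part ‖z‖². A further change (z + f, w + g) alters the terms of weight
k, to leading order, by 2 Re⟨z, f⟩ − Im g evaluated at w = u + i‖z‖². The range of this operator
(`homSub`) is everything in weight 3, and has the trace-free (2,2) polynomials as a complement in
weight 4 and the (3,2) polynomials with tr² = 0 in weight 5; only the spanning half of this is
needed (`re_mem_of_weight_three`, `re_mem_of_weight_four`, `re_mem_of_weight_five`).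

A 2-flat germ gives an equivalence. In normal coordinates the germ becomes G = id + o(2), and its
Taylor polynomials at 0 are holomorphic because G is smooth up to the boundary and holomorphic on
one side. As D is mapped into D', the function R = Im G₂ − φ'(G₁, Re G₂) is nonnegative on the graph
of φ (`eventually_graph_le`). Its lowest weighted part is therefore nonnegative, in weights 3, 4 and
5 successively (`nonneg_parts`). The weight 3 and weight 5 parts are odd in z, hence zero. In weight
4, averaging over rotations z ↦ e^{iθ}z removes every contribution of G and leaves N₂₂ − N₂₂' ≥ 0. A
nonnegative trace-free polynomial of bidegree (2,2) vanishes (`IsNormal22.re_eq_zero`): averaging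
over the torus reduces this to its coefficients c_{ijij}. The rest of weight 4 then vanishes too,
and in weight 5 rotations by multiples of π/4 isolate Re(N₃₂ − N₃₂') = 0 (`normal_terms_eq_zero`).
So the two graphs agree up to weighted order 5, and g⁻¹ ∘ h is the required equivalence.

Conversely, let Φ be an equivalence and g a normal chart for D'. In the chart g ∘ Φ the boundary of
D is a graph that agrees with that of D' up to weighted order 5 (`exists_graph_of_tangent`). A
priori D could lie below this graph; this is impossible, since D would then contain a punctured
complex disc touching its boundary from inside at p, against the strong pseudoconvexity of D and the
open mapping theorem (`not_eventually_subgraph`). Thus φ − φ' = e u³ + O(‖z‖⁶ + ‖z‖²u² + u⁴): u³ is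
the only monomial of weight at least 6 that this bound does not control. The polynomial map (z +
Azw², w + (A − ie)w³ + iAw⁴) cancels e u³ and gains A(‖z‖⁶ + ‖z‖²u² + u⁴) to leading order, so for
large A it sends the first graph into the closed supergraph of the second
(`exists_cubicPerturbation_graph_le`). Points above the graph land strictly above
(`eventually_lt_of_graph_le`), and the map is id + o(2), which gives the 2-flat germ. -/

/-! ### Smoothness of holomorphic maps in several variables -/

section Holomorphic

open Metric MeasureTheory

variable {X Y : Type*} [NormedAddCommGroup X] [NormedSpace ℂ X]
  [NormedAddCommGroup Y] [NormedSpace ℂ Y]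

/-- Cauchy's estimate on the complex line through y in the direction w. The radius R/(2‖w‖) keeps
the closed disc inside the open ball and costs the factor 2. -/
lemma norm_fderiv_le_of_norm_le {f : X → Y} {y : X} {R M : ℝ} (hR : 0 < R)
    (hd : ∀ x ∈ ball y R, DifferentiableAt ℂ f x) (hM : ∀ x ∈ ball y R, ‖f x‖ ≤ M) :
    ‖fderiv ℂ f y‖ ≤ 2 * M / R := by
  have hM0 : 0 ≤ M := (norm_nonneg _).trans (hM y (mem_ball_self hR))
  refine ContinuousLinearMap.opNorm_le_bound _ (by positivity) fun w => ?_
  rcases eq_or_ne w 0 with rfl | hw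
  · simp
  have hw' : 0 < ‖w‖ := norm_pos_iff.2 hw
  have hr : 0 < R / (2 * ‖w‖) := by positivity
  have hmem : ∀ ζ ∈ closedBall (0 : ℂ) (R / (2 * ‖w‖)), y + ζ • w ∈ ball y R := by
    intro ζ hζ
    rw [mem_closedBall_zero_iff] at hζ
    rw [mem_ball_iff_norm, add_sub_cancel_left, norm_smul]
    calc ‖ζ‖ * ‖w‖ ≤ R / (2 * ‖w‖) * ‖w‖ := by gcongr
      _ = R / 2 := by field_simp
      _ < R := by linarith
  have hder : ∀ ζ ∈ closedBall (0 : ℂ) (R / (2 * ‖w‖)),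
      HasDerivAt (fun ζ : ℂ => f (y + ζ • w)) (fderiv ℂ f (y + ζ • w) w) ζ := by
    intro ζ hζ
    have h1 : HasDerivAt (fun ζ : ℂ => y + ζ • w) w ζ := by
      simpa using ((hasDerivAt_id ζ).smul_const w).const_add y
    exact (hd _ (hmem ζ hζ)).hasFDerivAt.comp_hasDerivAt ζ h1
  have hdc : DiffContOnCl ℂ (fun ζ : ℂ => f (y + ζ • w)) (ball 0 (R / (2 * ‖w‖))) := by
    apply DifferentiableOn.diffContOnCl
    rw [closure_ball _ hr.ne']
    exact fun ζ hζ => (hder ζ hζ).differentiableAt.differentiableWithinAt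
  have := Complex.norm_deriv_le_of_forall_mem_sphere_norm_le hr hdc
    (fun ζ hζ => hM _ (hmem ζ (sphere_subset_closedBall hζ)))
  rw [(hder 0 (mem_closedBall_self hr.le)).deriv] at this
  simp only [zero_smul, add_zero] at this
  refine this.trans (le_of_eq ?_)
  field_simp

/-- A directional derivative is a Cauchy integral of f over the circle x + ζv with |ζ| fixed, so it
inherits complex differentiability in x by differentiation under the integral sign. Iteration over
directions then gives all orders of smoothness. -/
lemma differentiableOn_fderiv_apply [FiniteDimensional ℂ X] [FiniteDimensional ℂ Y] {f : X → Y}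
    {U : Set X} (hU : IsOpen U) (hf : DifferentiableOn ℂ f U) (v : X) :
    DifferentiableOn ℂ (fun x => fderiv ℂ f x v) U := by
  intro x₀ hx₀
  apply DifferentiableAt.differentiableWithinAt
  have : CompleteSpace Y := FiniteDimensional.complete ℂ Y
  let _ : MeasurableSpace X := borel X
  have : BorelSpace X := ⟨rfl⟩
  have hdU : ∀ x ∈ U, DifferentiableAt ℂ f x := fun x hx => hf.differentiableAt (hU.mem_nhds hx)
  -- The radius 3R leaves room for two steps: circles around points of the ball of radius R stay
  -- within 2R, and Cauchy's estimate at their points uses a further ball of radius R.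
  obtain ⟨R, hR, hRU⟩ : ∃ R > 0, ∀ y ∈ ball x₀ (3 * R), y ∈ U ∧ ‖f y‖ ≤ ‖f x₀‖ + 1 := by
    have h1 : ∀ᶠ y in 𝓝 x₀, y ∈ U ∧ ‖f y‖ ≤ ‖f x₀‖ + 1 :=
      Filter.Eventually.and (hU.mem_nhds hx₀) (Filter.Tendsto.eventually_le_const (by simp)
        (hdU x₀ hx₀).continuousAt.norm)
    obtain ⟨ε, hε, h⟩ := Metric.eventually_nhds_iff_ball.1 h1
    exact ⟨ε / 3, by positivity, fun y hy => h y (by rwa [mul_div_cancel₀ _ (by norm_num)] at hy)⟩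
  set M := ‖f x₀‖ + 1
  set r : ℝ := R / (‖v‖ + 1) with hrdef
  have hr : 0 < r := by positivity
  have hrv : r * ‖v‖ ≤ R := by
    rw [hrdef, div_mul_eq_mul_div, div_le_iff₀ (by positivity)]
    nlinarith [norm_nonneg v]
  have hmem : ∀ x ∈ ball x₀ R, ∀ ζ ∈ closedBall (0 : ℂ) r, x + ζ • v ∈ ball x₀ (2 * R) := by
    intro x hx ζ hζ
    rw [mem_closedBall_zero_iff] at hζ
    rw [mem_ball_iff_norm] at hx ⊢
    calc ‖x + ζ • v - x₀‖ = ‖(x - x₀) + ζ • v‖ := by congr 1; abel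
      _ ≤ ‖x - x₀‖ + ‖ζ‖ * ‖v‖ := (norm_add_le _ _).trans (by rw [norm_smul])
      _ < R + R := by
        have : ‖ζ‖ * ‖v‖ ≤ r * ‖v‖ := by gcongr
        linarith
      _ = 2 * R := by ring
  have hbig : ball x₀ (2 * R) ⊆ ball x₀ (3 * R) := ball_subset_ball (by linarith)
  have hbound : ∀ y ∈ ball x₀ (2 * R), ‖fderiv ℂ f y‖ ≤ 2 * M / R := by
    intro y hy
    have hs : ball y R ⊆ ball x₀ (3 * R) := ball_subset_ball' (by
      rw [mem_ball] at hy; linarith)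
    exact norm_fderiv_le_of_norm_le hR (fun x hx => hdU x (hRU x (hs hx)).1)
      (fun x hx => (hRU x (hs hx)).2)
  have hformula : ∀ x ∈ ball x₀ R, fderiv ℂ f x v =
      (2 * Real.pi * Complex.I : ℂ)⁻¹ • ∫ θ in (0 : ℝ)..2 * Real.pi,
        (deriv (circleMap 0 r) θ * (1 / (circleMap 0 r θ) ^ 2)) • f (x + circleMap 0 r θ • v) := by
    intro x hx
    have hder : ∀ ζ ∈ closedBall (0 : ℂ) r,
        HasDerivAt (fun ζ : ℂ => f (x + ζ • v)) (fderiv ℂ f (x + ζ • v) v) ζ := by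
      intro ζ hζ
      have h1 : HasDerivAt (fun ζ : ℂ => x + ζ • v) v ζ := by
        simpa using ((hasDerivAt_id ζ).smul_const v).const_add x
      exact (hdU _ (hRU _ (hbig (hmem x hx ζ hζ))).1).hasFDerivAt.comp_hasDerivAt ζ h1
    have hdc : DiffContOnCl ℂ (fun ζ : ℂ => f (x + ζ • v)) (ball 0 r) := by
      apply DifferentiableOn.diffContOnCl
      rw [closure_ball _ hr.ne']
      exact fun ζ hζ => (hder ζ hζ).differentiableAt.differentiableWithinAt
    have h2 := hdc.deriv_eq_smul_circleIntegral hr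
    rw [(hder 0 (mem_closedBall_self hr.le)).deriv] at h2
    simp only [zero_smul, add_zero, sub_zero] at h2
    have hpi : (2 * Real.pi * Complex.I : ℂ) ≠ 0 := by simp [Real.pi_ne_zero]
    rw [← inv_smul_eq_iff₀ hpi] at h2
    rw [← h2, circleIntegral]
    simp only [smul_smul]
  have hcirc : ∀ θ : ℝ, circleMap 0 r θ ∈ closedBall (0 : ℂ) r := fun θ =>
    circleMap_mem_closedBall 0 hr.le θ
  have hcont : ∀ x ∈ ball x₀ R, Continuous fun θ : ℝ =>
      (deriv (circleMap 0 r) θ * (1 / (circleMap 0 r θ) ^ 2)) • f (x + circleMap 0 r θ • v) := by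
    intro x hx
    have hne : ∀ θ : ℝ, circleMap 0 r θ ≠ 0 := fun θ => circleMap_ne_center hr.ne'
    have h1 : Continuous fun θ : ℝ => f (x + circleMap 0 r θ • v) := by
      rw [continuous_iff_continuousAt]
      intro θ
      have h3 : ContinuousAt (fun θ : ℝ => x + circleMap 0 r θ • v) θ := by
        have := continuous_circleMap 0 r
        fun_prop
      exact ContinuousAt.comp (f := fun θ : ℝ => x + circleMap 0 r θ • v)
        (hdU _ (hRU _ (hbig (hmem x hx _ (hcirc θ)))).1).continuousAt h3
    have h2 : Continuous fun θ : ℝ => deriv (circleMap 0 r) θ * (1 / (circleMap 0 r θ) ^ 2) := by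
      simp only [deriv_circleMap]
      have := continuous_circleMap 0 r
      exact (this.mul continuous_const).mul (continuous_const.div (this.pow 2)
        fun θ => pow_ne_zero 2 (hne θ))
    exact h2.smul h1
  have key : HasFDerivAt (𝕜 := ℂ) (fun x => ∫ θ in (0 : ℝ)..2 * Real.pi,
        (deriv (circleMap 0 r) θ * (1 / (circleMap 0 r θ) ^ 2)) • f (x + circleMap 0 r θ • v))
      (∫ θ in (0 : ℝ)..2 * Real.pi, (deriv (circleMap 0 r) θ * (1 / (circleMap 0 r θ) ^ 2)) •
        fderiv ℂ f (x₀ + circleMap 0 r θ • v)) x₀ := by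
    -- Domination comes from Cauchy's estimate. Continuity of the derivative of f is not known at
    -- this stage, so its dependence on θ enters only through measurability.
    refine intervalIntegral.hasFDerivAt_integral_of_dominated_of_fderiv_le (𝕜 := ℂ)
      (bound := fun _ => r * (1 / r ^ 2) * (2 * M / R))
      (F' := fun x θ => (deriv (circleMap 0 r) θ * (1 / (circleMap 0 r θ) ^ 2)) •
        fderiv ℂ f (x + circleMap 0 r θ • v)) (ball_mem_nhds x₀ hR) ?_ ?_ ?_ ?_ ?_ ?_
    · filter_upwards [ball_mem_nhds x₀ hR] with x hx
      exact (hcont x hx).aestronglyMeasurable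
    · exact (hcont x₀ (mem_ball_self hR)).intervalIntegrable _ _
    · have h2 : Continuous fun θ : ℝ => deriv (circleMap 0 r) θ * (1 / (circleMap 0 r θ) ^ 2) := by
        simp only [deriv_circleMap]
        have := continuous_circleMap 0 r
        exact (this.mul continuous_const).mul (continuous_const.div (this.pow 2)
          fun θ => pow_ne_zero 2 (circleMap_ne_center hr.ne'))
      refine h2.aestronglyMeasurable.smul ?_
      have : FiniteDimensional ℂ (X →L[ℂ] Y) := inferInstance
      have : ProperSpace (X →L[ℂ] Y) := FiniteDimensional.proper ℂ _
      have h3 : Measurable fun θ : ℝ => fderiv ℂ f (x₀ + circleMap 0 r θ • v) := by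
        have := continuous_circleMap 0 r
        exact (measurable_fderiv ℂ f).comp (show Continuous _ by fun_prop).measurable
      exact h3.aestronglyMeasurable
    · refine Filter.Eventually.of_forall fun θ _ x hx => ?_
      rw [norm_smul]
      have h5 := hbound _ (hmem x hx _ (hcirc θ))
      have h6 : ‖deriv (circleMap 0 r) θ * (1 / (circleMap 0 r θ) ^ 2)‖ = r * (1 / r ^ 2) := by
        simp [deriv_circleMap, abs_of_pos hr]
      rw [h6]
      gcongr
    · exact intervalIntegrable_const
    · refine Filter.Eventually.of_forall fun θ _ x hx => ?_
      have h7 := (hdU _ (hRU _ (hbig (hmem x hx _ (hcirc θ)))).1).hasFDerivAt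
      have h8 : HasFDerivAt (fun y : X => y + circleMap 0 r θ • v) (.id ℂ X) x :=
        (hasFDerivAt_id x).add_const _
      exact (h7.comp x h8).const_smul _
  refine ((key.const_smul ((2 * Real.pi * Complex.I : ℂ)⁻¹)).congr_of_eventuallyEq ?_).differentiableAt
  filter_upwards [ball_mem_nhds x₀ hR] with x hx
  exact hformula x hx

theorem contDiffOn_nat_of_differentiableOn [FiniteDimensional ℂ X] [FiniteDimensional ℂ Y]
    {U : Set X} (hU : IsOpen U) (m : ℕ) {f : X → Y} (hf : DifferentiableOn ℂ f U) :
    ContDiffOn ℂ m f U := by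
  induction m generalizing f with
  | zero => exact contDiffOn_zero.2 hf.continuousOn
  | succ m ih =>
    rw [Nat.cast_succ, contDiffOn_succ_iff_fderiv_apply hU.uniqueDiffOn]
    refine ⟨hf, by simp, fun v => ?_⟩
    refine (ih (differentiableOn_fderiv_apply hU hf v)).congr fun x hx => ?_
    rw [fderivWithin_of_isOpen hU hx]

/-- A map that is complex differentiable on an open subset of a finite-dimensional space
is smooth. -/
theorem contDiffOn_complex_of_differentiableOn [FiniteDimensional ℂ X] [FiniteDimensional ℂ Y]
    {U : Set X} (hU : IsOpen U) {f : X → Y} (hf : DifferentiableOn ℂ f U) :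
    ContDiffOn ℂ ∞ f U :=
  contDiffOn_infty.2 fun m => contDiffOn_nat_of_differentiableOn hU m hf

theorem contDiffOn_real_of_differentiableOn [FiniteDimensional ℂ X] [FiniteDimensional ℂ Y]
    [NormedSpace ℝ X] [NormedSpace ℝ Y] [IsScalarTower ℝ ℂ X] [IsScalarTower ℝ ℂ Y]
    {U : Set X} (hU : IsOpen U) {f : X → Y} (hf : DifferentiableOn ℂ f U) :
    ContDiffOn ℝ ∞ f U :=
  (contDiffOn_complex_of_differentiableOn hU hf).restrict_scalars ℝ

end Holomorphic

/-! ### Taylor's formula with remainder -/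

section Taylor

variable {X Y : Type*} [NormedAddCommGroup X] [NormedSpace ℝ X]
  [NormedAddCommGroup Y] [NormedSpace ℝ Y]

open Asymptotics

/-- Restricting f to the segment from 0 to x reduces Taylor's formula to one variable; derivatives
are taken within [0, 1] because the one-variable remainder bound is phrased that way. -/
lemma iteratedDerivWithin_comp_smul {f : X → Y} {U : Set X} (hU : IsOpen U)
    {N : ℕ} (hf : ContDiffOn ℝ N f U) {x : X} (hx : ∀ t ∈ Set.Icc (0 : ℝ) 1, t • x ∈ U)
    {m : ℕ} (hm : m ≤ N) : ∀ t ∈ Set.Icc (0 : ℝ) 1,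
    iteratedDerivWithin m (fun t : ℝ => f (t • x)) (Set.Icc 0 1) t =
      iteratedFDeriv ℝ m f (t • x) fun _ => x := by
  induction m with
  | zero => intro t _; simp
  | succ m ih =>
    intro t ht
    have huniq : UniqueDiffWithinAt ℝ (Set.Icc (0 : ℝ) 1) t := uniqueDiffOn_Icc_zero_one t ht
    rw [iteratedDerivWithin_succ, derivWithin_congr (ih (by omega)) (ih (by omega) t ht),
      iteratedFDeriv_succ_apply_left]
    refine HasDerivWithinAt.derivWithin (HasDerivAt.hasDerivWithinAt ?_) huniq
    have h1 : DifferentiableAt ℝ (iteratedFDeriv ℝ m f) (t • x) :=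
      (hf.contDiffAt (hU.mem_nhds (hx t ht))).differentiableAt_iteratedFDeriv
        (by exact_mod_cast hm)
    have h2 : HasDerivAt (fun t : ℝ => t • x) x t := by
      simpa using (hasDerivAt_id t).smul_const x
    have h3 := h1.hasFDerivAt.comp_hasDerivAt t h2
    exact (ContinuousMultilinearMap.apply ℝ (fun _ : Fin m => X) Y
      (fun _ => x)).hasFDerivAt.comp_hasDerivAt t h3

/-- Taylor's formula at the origin with a remainder estimate. -/
theorem taylor_isBigO {f : X → Y} {N : ℕ} (hf : ContDiffAt ℝ (N + 1 : ℕ) f 0) :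
    (fun x => f x - ∑ m ∈ Finset.range (N + 1),
      (m.factorial : ℝ)⁻¹ • iteratedFDeriv ℝ m f 0 fun _ => x) =O[𝓝 0]
        fun x => ‖x‖ ^ (N + 1) := by
  obtain ⟨U, hU, hfU⟩ := hf.contDiffOn le_rfl (by simp)
  have hcont : ContinuousAt (iteratedFDeriv ℝ (N + 1) f) 0 :=
    hf.continuousAt_iteratedFDeriv le_rfl
  set C := ‖iteratedFDeriv ℝ (N + 1) f 0‖ + 1
  have h1 : ∀ᶠ y in 𝓝 (0 : X), y ∈ interior U ∧ ‖iteratedFDeriv ℝ (N + 1) f y‖ ≤ C :=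
    Filter.Eventually.and (interior_mem_nhds.2 hU) (Filter.Tendsto.eventually_le_const
      (by simp [C]) hcont.norm)
  obtain ⟨ε, hε, h⟩ := Metric.eventually_nhds_iff_ball.1 h1
  refine IsBigO.of_bound (C / N.factorial) ?_
  filter_upwards [Metric.ball_mem_nhds 0 hε] with x hx
  have hseg : ∀ t ∈ Set.Icc (0 : ℝ) 1, t • x ∈ Metric.ball (0 : X) ε := by
    intro t ht
    rw [mem_ball_zero_iff] at hx ⊢
    rw [norm_smul, Real.norm_of_nonneg ht.1]
    exact (mul_le_of_le_one_left (norm_nonneg _) ht.2).trans_lt hx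
  have hfi := hfU.mono interior_subset
  have hiter := fun (m : ℕ) (hm : m ≤ N + 1) => iteratedDerivWithin_comp_smul isOpen_interior hfi
    (fun t ht => (h _ (hseg t ht)).1) hm
  have hg : ContDiffOn ℝ (N + 1) (fun t : ℝ => f (t • x)) (Set.Icc 0 1) := by
    refine ContDiffOn.comp (t := interior U) (by exact_mod_cast hfi) ?_
      fun t ht => (h _ (hseg t ht)).1
    exact (contDiff_id.smul contDiff_const).contDiffOn
  have hrem := taylor_mean_remainder_bound (C := C * ‖x‖ ^ (N + 1)) zero_le_one hg
    (Set.right_mem_Icc.2 zero_le_one) (fun t ht => by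
      rw [hiter (N + 1) le_rfl t ht]
      refine (ContinuousMultilinearMap.le_opNorm _ _).trans ?_
      simp only [Finset.prod_const, Finset.card_univ, Fintype.card_fin]
      gcongr
      exact (h _ (hseg t ht)).2)
  rw [taylor_within_apply] at hrem
  simp only [one_smul, sub_zero, one_pow, mul_one] at hrem
  rw [norm_pow, norm_norm, div_mul_eq_mul_div]
  refine le_trans (le_of_eq ?_) hrem
  congr 2
  refine Finset.sum_congr rfl fun m hm => ?_
  rw [hiter m (by simp at hm; omega) 0 (Set.left_mem_Icc.2 zero_le_one), zero_smul]

end Taylor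

/-! ### The weighted gauge and expansions by weight -/

section Weights

open Asymptotics Filter

variable {n : ℕ}

/-- The weighted gauge `‖z‖ + √|u|`. -/
noncomputable def wnorm (x : ParamSpace n) : ℝ := ‖x.1‖ + √|x.2|

/-- The weighted dilation `(z, u) ↦ (t z, t² u)`. -/
noncomputable def dil (t : ℝ) (x : ParamSpace n) : ParamSpace n := (t • x.1, t ^ 2 * x.2)

@[simp] lemma dil_fst (t : ℝ) (x : ParamSpace n) : (dil t x).1 = t • x.1 := rfl
@[simp] lemma dil_snd (t : ℝ) (x : ParamSpace n) : (dil t x).2 = t ^ 2 * x.2 := rfl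

lemma wnorm_nonneg (x : ParamSpace n) : 0 ≤ wnorm x := by unfold wnorm; positivity

@[simp] lemma wnorm_zero : wnorm (0 : ParamSpace n) = 0 := by simp [wnorm]

lemma continuous_wnorm : Continuous (wnorm (n := n)) := by unfold wnorm; fun_prop

lemma norm_fst_le_wnorm (x : ParamSpace n) : ‖x.1‖ ≤ wnorm x := by
  unfold wnorm; linarith [Real.sqrt_nonneg |x.2|]

lemma abs_snd_le_wnorm (x : ParamSpace n) : |x.2| ≤ wnorm x ^ 2 := by
  have h : √|x.2| ≤ wnorm x := by unfold wnorm; linarith [norm_nonneg x.1]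
  calc |x.2| = √|x.2| ^ 2 := (Real.sq_sqrt (abs_nonneg _)).symm
    _ ≤ wnorm x ^ 2 := by gcongr

lemma wnorm_dil {t : ℝ} (ht : 0 ≤ t) (x : ParamSpace n) : wnorm (dil t x) = t * wnorm x := by
  simp only [wnorm, dil_fst, dil_snd, norm_smul, Real.norm_of_nonneg ht, abs_mul, abs_pow,
    abs_of_nonneg ht]
  rw [Real.sqrt_mul (by positivity), Real.sqrt_sq ht]
  ring

lemma continuous_dil (x : ParamSpace n) : Continuous fun t : ℝ => dil t x := by
  unfold dil; fun_prop

lemma tendsto_dil (x : ParamSpace n) : Tendsto (fun t : ℝ => dil t x) (𝓝[>] 0) (𝓝 0) := by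
  have := (continuous_dil x).tendsto 0
  simp only [dil, zero_smul, ne_eq, OfNat.ofNat_ne_zero, not_false_eq_true, zero_pow,
    zero_mul] at this
  exact this.mono_left nhdsWithin_le_nhds

lemma tendsto_wnorm : Tendsto (wnorm (n := n)) (𝓝 0) (𝓝 0) := by
  simpa using continuous_wnorm.tendsto (0 : ParamSpace n)

lemma eventually_wnorm_le {ε : ℝ} (hε : 0 < ε) : ∀ᶠ x : ParamSpace n in 𝓝 0, wnorm x ≤ ε :=
  tendsto_wnorm.eventually_le_const hε

lemma eventually_norm_le_wnorm : ∀ᶠ x : ParamSpace n in 𝓝 0, ‖x‖ ≤ wnorm x := by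
  filter_upwards [eventually_wnorm_le (n := n) one_pos] with x hx
  refine max_le (norm_fst_le_wnorm x) ?_
  calc |x.2| ≤ wnorm x ^ 2 := abs_snd_le_wnorm x
    _ ≤ wnorm x := by nlinarith [wnorm_nonneg x]

lemma norm_isBigO_wnorm : (fun x : ParamSpace n => ‖x‖) =O[𝓝 0] wnorm := by
  refine IsBigO.of_bound 1 ?_
  filter_upwards [eventually_norm_le_wnorm] with x hx
  rwa [norm_norm, one_mul, Real.norm_of_nonneg (wnorm_nonneg x)]

lemma wnorm_pow_isBigO {k l : ℕ} (h : k ≤ l) :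
    (fun x : ParamSpace n => wnorm x ^ l) =O[𝓝 0] fun x => wnorm x ^ k := by
  refine IsBigO.of_bound 1 ?_
  filter_upwards [eventually_wnorm_le (n := n) one_pos] with x hx
  rw [one_mul, Real.norm_of_nonneg (pow_nonneg (wnorm_nonneg x) _),
    Real.norm_of_nonneg (pow_nonneg (wnorm_nonneg x) _)]
  exact pow_le_pow_of_le_one (wnorm_nonneg x) hx h

lemma wnorm_pow_isLittleO {k l : ℕ} (h : k < l) :
    (fun x : ParamSpace n => wnorm x ^ l) =o[𝓝 0] fun x => wnorm x ^ k := by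
  obtain ⟨j, rfl⟩ := Nat.exists_eq_add_of_lt h
  have h1 : (fun x : ParamSpace n => wnorm x ^ (j + 1)) =o[𝓝 0] fun _ => (1 : ℝ) := by
    rw [isLittleO_one_iff]
    simpa using (tendsto_wnorm (n := n)).pow (j + 1)
  simpa [pow_add, mul_assoc] using (isBigO_refl (fun x : ParamSpace n => wnorm x ^ k) _).mul_isLittleO h1

lemma wnorm_dil_pow_isBigO (x : ParamSpace n) (k : ℕ) :
    (fun t : ℝ => wnorm (dil t x) ^ k) =O[𝓝[>] 0] fun t => t ^ k := by
  refine IsBigO.of_bound (wnorm x ^ k) ?_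
  filter_upwards [self_mem_nhdsWithin] with t ht
  rw [wnorm_dil (le_of_lt ht), mul_pow, norm_mul, mul_comm, Real.norm_of_nonneg
    (pow_nonneg (wnorm_nonneg x) _)]

/-- The lower coefficients vanish by induction, so X^j divides P; the quotient tends to 0, and its
limit at 0 is the coefficient in question. One-sided limits suffice, as the dilations use t > 0. -/
lemma coeff_eq_zero_of_isLittleO {P : Polynomial ℝ} {k : ℕ}
    (h : (fun t : ℝ => P.eval t) =o[𝓝[>] 0] fun t => t ^ k) : ∀ j ≤ k, P.coeff j = 0 := by
  intro j
  induction j using Nat.strong_induction_on with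
  | _ j ih =>
    intro hj
    have hX : Polynomial.X ^ j ∣ P := by
      rw [Polynomial.X_pow_dvd_iff]
      exact fun d hd => ih d hd (hd.le.trans hj)
    obtain ⟨Q, rfl⟩ := hX
    have h1 : (fun t : ℝ => t ^ j * Q.eval t) =o[𝓝[>] 0] fun t => t ^ j := by
      refine (h.congr_left fun t => by simp).trans_isBigO (IsBigO.of_bound 1 ?_)
      filter_upwards [Ioo_mem_nhdsGT (zero_lt_one' ℝ)] with t ht
      rw [one_mul, norm_pow, norm_pow, Real.norm_of_nonneg ht.1.le]
      exact pow_le_pow_of_le_one ht.1.le ht.2.le hj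
    have h2 : (fun t : ℝ => Q.eval t) =o[𝓝[>] 0] fun _ => (1 : ℝ) := by
      rw [isLittleO_iff] at h1 ⊢
      intro c hc
      filter_upwards [h1 hc, self_mem_nhdsWithin] with t ht htpos
      rw [norm_mul] at ht
      have : 0 < ‖t ^ j‖ := norm_pos_iff.2 (pow_ne_zero _ (ne_of_gt htpos))
      rw [norm_one, mul_one]
      nlinarith
    rw [isLittleO_one_iff] at h2
    have h3 : Tendsto (fun t : ℝ => Q.eval t) (𝓝[>] 0) (𝓝 (Q.eval 0)) :=
      (Q.continuous.tendsto 0).mono_left nhdsWithin_le_nhds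
    have h4 := tendsto_nhds_unique h2 h3
    have h5 := Polynomial.coeff_X_pow_mul Q j 0
    rw [zero_add] at h5
    rw [h5, Polynomial.coeff_zero_eq_eval_zero, ← h4]

/-- Functions of type `(a, b, c)`: combinations of monomials of degree `a` in `z`, `b` in `z̄`
and `c` in `u`. -/
def triSpan (n : ℕ) (i : ℕ × ℕ × ℕ) : Submodule ℂ (ParamSpace n → ℂ) :=
  Submodule.span ℂ (Set.range fun st : (Fin i.1 → Fin n) × (Fin i.2.1 → Fin n) =>
    fun x : ParamSpace n =>
      (∏ k, x.1 (st.1 k)) * (∏ k, conj (x.1 (st.2 k))) * (x.2 : ℂ) ^ i.2.2)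

/-- The weight of the type `(a, b, c)`. -/
def wt (i : ℕ × ℕ × ℕ) : ℕ := i.1 + i.2.1 + 2 * i.2.2

lemma triSpan_mul_coord {a b c : ℕ} {f : ParamSpace n → ℂ}
    (hf : f ∈ triSpan n (a, b, c))
    (s : Fin n) : (fun x => x.1 s * f x) ∈ triSpan n (a + 1, b, c) := by
  refine Submodule.span_induction (p := fun f _ => (fun x => x.1 s * f x) ∈
    triSpan n (a + 1, b, c)) ?_ ?_ ?_ ?_ hf
  · rintro _ ⟨st, rfl⟩
    refine Submodule.subset_span ⟨(Fin.cons s st.1, st.2), ?_⟩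
    funext x
    simp [Fin.prod_univ_succ, mul_assoc]
  · simp only [Pi.zero_apply, mul_zero]; exact Submodule.zero_mem _
  · intro f g _ _ hf hg
    simpa only [mul_add, Pi.add_apply] using! Submodule.add_mem _ hf hg
  · intro d f _ hf
    have := Submodule.smul_mem _ d hf
    convert this using 1
    funext x; simp; ring

lemma triSpan_mul_conj_coord {a b c : ℕ} {f : ParamSpace n → ℂ}
    (hf : f ∈ triSpan n (a, b, c))
    (s : Fin n) : (fun x => conj (x.1 s) * f x) ∈ triSpan n (a, b + 1, c) := by
  refine Submodule.span_induction (p := fun f _ => (fun x => conj (x.1 s) * f x) ∈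
    triSpan n (a, b + 1, c)) ?_ ?_ ?_ ?_ hf
  · rintro _ ⟨st, rfl⟩
    refine Submodule.subset_span ⟨(st.1, Fin.cons s st.2), ?_⟩
    funext x
    simp [Fin.prod_univ_succ]
    ring
  · simp only [Pi.zero_apply, mul_zero]; exact Submodule.zero_mem _
  · intro f g _ _ hf hg
    simpa only [mul_add, Pi.add_apply] using! Submodule.add_mem _ hf hg
  · intro d f _ hf
    have := Submodule.smul_mem _ d hf
    convert this using 1
    funext x; simp; ring

lemma triSpan_mul_real {a b c : ℕ} {f : ParamSpace n → ℂ}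
    (hf : f ∈ triSpan n (a, b, c)) :
    (fun x => (x.2 : ℂ) * f x) ∈ triSpan n (a, b, c + 1) := by
  refine Submodule.span_induction (p := fun f _ => (fun x => (x.2 : ℂ) * f x) ∈
    triSpan n (a, b, c + 1)) ?_ ?_ ?_ ?_ hf
  · rintro _ ⟨st, rfl⟩
    refine Submodule.subset_span ⟨st, ?_⟩
    funext x
    simp
    ring
  · simp only [Pi.zero_apply, mul_zero]; exact Submodule.zero_mem _
  · intro f g _ _ hf hg
    simpa only [mul_add, Pi.add_apply] using! Submodule.add_mem _ hf hg
  · intro d f _ hf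
    have := Submodule.smul_mem _ d hf
    convert this using 1
    funext x; simp; ring

lemma triSpan_conj {a b c : ℕ} {f : ParamSpace n → ℂ}
    (hf : f ∈ triSpan n (a, b, c)) :
    (fun x => conj (f x)) ∈ triSpan n (b, a, c) := by
  refine Submodule.span_induction (p := fun f _ => (fun x => conj (f x)) ∈
    triSpan n (b, a, c)) ?_ ?_ ?_ ?_ hf
  · rintro _ ⟨st, rfl⟩
    refine Submodule.subset_span ⟨(st.2, st.1), ?_⟩
    funext x
    simp only [map_mul, map_prod, map_pow, Complex.conj_ofReal, Complex.conj_conj]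
    ring
  · simp only [Pi.zero_apply, map_zero]; exact Submodule.zero_mem _
  · intro f g _ _ hf hg
    simpa only [map_add, Pi.add_apply] using! Submodule.add_mem _ hf hg
  · intro d f _ hf
    have := Submodule.smul_mem _ (conj d) hf
    convert this using 1
    funext x; simp

lemma triSpan_dil {i : ℕ × ℕ × ℕ} {f : ParamSpace n → ℂ} (hf : f ∈ triSpan n i) (t : ℝ)
    (x : ParamSpace n) : f (dil t x) = (t : ℂ) ^ wt i * f x := by
  refine Submodule.span_induction (p := fun f _ => f (dil t x) = (t : ℂ) ^ wt i * f x)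
    ?_ ?_ ?_ ?_ hf
  · rintro _ ⟨st, rfl⟩
    simp only [dil_fst, dil_snd, wt, PiLp.smul_apply, Complex.real_smul, map_mul,
      Complex.conj_ofReal, Finset.prod_mul_distrib, Finset.prod_const, Finset.card_univ,
      Fintype.card_fin, Complex.ofReal_mul, Complex.ofReal_pow]
    ring
  · simp
  · intro f g _ _ hf hg
    simp [hf, hg, mul_add]
  · intro c f _ hf
    simp [hf]; ring

lemma triSpan_bound {i : ℕ × ℕ × ℕ} {f : ParamSpace n → ℂ} (hf : f ∈ triSpan n i) :
    ∃ C : ℝ, 0 ≤ C ∧ ∀ x, ‖f x‖ ≤ C * (‖x.1‖ ^ (i.1 + i.2.1) * |x.2| ^ i.2.2) := by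
  refine Submodule.span_induction (p := fun f _ => ∃ C : ℝ, 0 ≤ C ∧ ∀ x, ‖f x‖ ≤
    C * (‖x.1‖ ^ (i.1 + i.2.1) * |x.2| ^ i.2.2)) ?_ ?_ ?_ ?_ hf
  · rintro _ ⟨st, rfl⟩
    refine ⟨1, zero_le_one, fun x => ?_⟩
    have h : ∀ s : Fin n, ‖x.1 s‖ ≤ ‖x.1‖ := fun s => PiLp.norm_apply_le x.1 s
    rw [norm_mul, norm_mul, norm_pow, Complex.norm_real, one_mul, pow_add, Real.norm_eq_abs,
      norm_prod, norm_prod]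
    gcongr
    · exact (Finset.prod_le_prod (fun _ _ => norm_nonneg _) fun k _ => h _).trans (by simp)
    · refine (Finset.prod_le_prod (fun _ _ => norm_nonneg _)
        (fun k _ => (RCLike.norm_conj _).trans_le (h _))).trans (by simp)
  · exact ⟨0, le_rfl, by simp⟩
  · rintro f g _ _ ⟨C, hC, hf⟩ ⟨C', hC', hg⟩
    refine ⟨C + C', by positivity, fun x => ?_⟩
    rw [add_mul]
    exact (norm_add_le _ _).trans (add_le_add (hf x) (hg x))
  · rintro c f _ ⟨C, hC, hf⟩
    refine ⟨‖c‖ * C, by positivity, fun x => ?_⟩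
    rw [Pi.smul_apply, norm_smul, mul_assoc]
    gcongr
    exact hf x

lemma triSpan_isBigO {i : ℕ × ℕ × ℕ} {f : ParamSpace n → ℂ} (hf : f ∈ triSpan n i) :
    f =O[𝓝 0] fun x => wnorm x ^ wt i := by
  obtain ⟨C, hC, h⟩ := triSpan_bound hf
  refine IsBigO.of_bound C (Eventually.of_forall fun x => (h x).trans ?_)
  rw [Real.norm_of_nonneg (pow_nonneg (wnorm_nonneg x) _), wt, pow_add _ _ (2 * _), pow_mul _ 2]
  have := wnorm_nonneg x
  gcongr
  · exact norm_fst_le_wnorm x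
  · exact abs_snd_le_wnorm x

/-- The types of total degree `m`. -/
def degIdx (m : ℕ) : Finset (ℕ × ℕ × ℕ) :=
  (Finset.range (m + 1) ×ˢ Finset.range (m + 1) ×ˢ Finset.range (m + 1)).filter
    fun i => i.1 + i.2.1 + i.2.2 = m

/-- The types of total degree at most `5`. -/
def lowIdx : Finset (ℕ × ℕ × ℕ) :=
  (Finset.range 6 ×ˢ Finset.range 6 ×ˢ Finset.range 6).filter
    fun i => i.1 + i.2.1 + i.2.2 ≤ 5

lemma mem_degIdx {m : ℕ} {i : ℕ × ℕ × ℕ} : i ∈ degIdx m ↔ i.1 + i.2.1 + i.2.2 = m := by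
  simp only [degIdx, Finset.mem_filter, Finset.mem_product, Finset.mem_range,
    and_iff_right_iff_imp]
  omega

lemma mem_lowIdx {i : ℕ × ℕ × ℕ} : i ∈ lowIdx ↔ i.1 + i.2.1 + i.2.2 ≤ 5 := by
  simp only [lowIdx, Finset.mem_filter, Finset.mem_product, Finset.mem_range,
    and_iff_right_iff_imp]
  omega

lemma mul_mem_iSup_degIdx {m : ℕ} {g : ParamSpace n → ℂ}
    (hg : ∀ i f, f ∈ triSpan n i → (fun x => g x * f x) ∈
      ⨆ j ∈ degIdx (i.1 + i.2.1 + i.2.2 + 1), triSpan n j)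
    {f : ParamSpace n → ℂ} (hf : f ∈ ⨆ i ∈ degIdx m, triSpan n i) :
    (fun x => g x * f x) ∈ ⨆ i ∈ degIdx (m + 1), triSpan n i := by
  let L : (ParamSpace n → ℂ) →ₗ[ℂ] (ParamSpace n → ℂ) := LinearMap.mulLeft ℂ g
  have : (⨆ i ∈ degIdx m, triSpan n i) ≤ (⨆ i ∈ degIdx (m + 1), triSpan n i).comap L := by
    refine iSup₂_le fun i hi f hf => ?_
    have := hg i f hf
    rw [mem_degIdx.1 hi] at this
    exact this
  exact this hf

/-- The values of a real multilinear form on the diagonal form a sum of monomials. -/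
lemma multilinear_diag_mem (m : ℕ) (M : ContinuousMultilinearMap ℝ (fun _ : Fin m => ParamSpace n) ℝ) :
    (fun x => ((M fun _ => x : ℝ) : ℂ)) ∈ ⨆ i ∈ degIdx m, triSpan n i := by
  induction m with
  | zero =>
    refine Submodule.mem_iSup_of_mem (0, 0, 0) (Submodule.mem_iSup_of_mem (by simp [mem_degIdx]) ?_)
    have h : (fun _ : ParamSpace n => (1 : ℂ)) ∈ triSpan n (0, 0, 0) :=
      Submodule.subset_span ⟨(Fin.elim0, Fin.elim0), by funext x; simp⟩
    convert Submodule.smul_mem _ ((M 0 : ℝ) : ℂ) h using 1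
    funext x
    simp only [Pi.smul_apply, smul_eq_mul, mul_one]
    congr 2
    exact Subsingleton.elim _ _
  | succ m ih =>
    set S := ⨆ i ∈ degIdx (m + 1), triSpan n i with hS
    have hz : ∀ (s : Fin n) f, f ∈ ⨆ i ∈ degIdx m, triSpan n i → (fun x => x.1 s * f x) ∈ S := by
      intro s f hf
      refine mul_mem_iSup_degIdx (?_) hf
      rintro ⟨a, b, c⟩ f hf
      exact Submodule.mem_iSup_of_mem _ (Submodule.mem_iSup_of_mem
        (by simp [mem_degIdx]; omega) (triSpan_mul_coord hf s))
    have hzbar : ∀ (s : Fin n) f, f ∈ ⨆ i ∈ degIdx m, triSpan n i →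
        (fun x => conj (x.1 s) * f x) ∈ S := by
      intro s f hf
      refine mul_mem_iSup_degIdx (g := fun x => conj (x.1 s)) (?_) hf
      rintro ⟨a, b, c⟩ f hf
      exact Submodule.mem_iSup_of_mem _ (Submodule.mem_iSup_of_mem
        (by simp [mem_degIdx]; omega) (triSpan_mul_conj_coord hf s))
    have hu : ∀ f, f ∈ ⨆ i ∈ degIdx m, triSpan n i → (fun x => (x.2 : ℂ) * f x) ∈ S := by
      intro f hf
      refine mul_mem_iSup_degIdx (g := fun x => (x.2 : ℂ)) (?_) hf
      rintro ⟨a, b, c⟩ f hf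
      exact Submodule.mem_iSup_of_mem _ (Submodule.mem_iSup_of_mem
        (by simp [mem_degIdx]; omega) (triSpan_mul_real hf))
    let e : Fin n → ParamSpace n := fun s => (EuclideanSpace.single s 1, 0)
    let e' : Fin n → ParamSpace n := fun s => (EuclideanSpace.single s Complex.I, 0)
    have hx : ∀ x : ParamSpace n, x = (∑ s, ((x.1 s).re • e s + (x.1 s).im • e' s)) +
        x.2 • ((0, 1) : ParamSpace n) := by
      intro x
      refine Prod.ext ?_ ?_
      · ext s
        simp only [Prod.fst_add, Prod.fst_sum, Prod.smul_fst, e, e', smul_zero, add_zero,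
          PiLp.add_apply, WithLp.ofLp_sum, Finset.sum_apply, PiLp.smul_apply]
        simp only [PiLp.single_apply, Complex.real_smul]
        simp [Finset.sum_add_distrib, Complex.re_add_im]
      · simp [e, e', Prod.snd_sum]
    -- One argument is expanded in the real basis e_s, i e_s, ∂_u. Writing Re z_s and Im z_s through
    -- z_s and its conjugate exhibits the form as a combination of z_s, z̄_s and u times forms of
    -- degree m.
    have key : (fun x => ((M fun _ => x : ℝ) : ℂ)) = fun x =>
        (∑ s, ((x.1 s + conj (x.1 s)) * (1 / 2) * ((M.curryLeft (e s) fun _ => x : ℝ) : ℂ) +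
          (x.1 s - conj (x.1 s)) * (1 / (2 * Complex.I)) *
            ((M.curryLeft (e' s) fun _ => x : ℝ) : ℂ))) +
          (x.2 : ℂ) * ((M.curryLeft (0, 1) fun _ => x : ℝ) : ℂ) := by
      funext x
      have h1 : M (fun _ => x) = M.curryLeft x fun _ => x := by
        rw [ContinuousMultilinearMap.curryLeft_apply]
        congr 1
        funext i
        refine Fin.cases ?_ (fun _ => ?_) i <;> simp
      rw [h1]
      conv_lhs => enter [1, 1, 2]; rw [hx x]
      simp only [map_add, map_sum, map_smul, add_apply,
        sum_apply, smul_apply, smul_eq_mul,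
        Complex.ofReal_add, Complex.ofReal_sum, Complex.ofReal_mul]
      congr 1
      refine Finset.sum_congr rfl fun s _ => ?_
      rw [Complex.re_eq_add_conj, Complex.im_eq_sub_conj]
      ring
    rw [key]
    have hsum : ∀ F : Fin n → ParamSpace n → ℂ, (∀ s, F s ∈ S) → (fun x => ∑ s, F s x) ∈ S := by
      intro F hF
      have := Submodule.sum_mem S (t := Finset.univ) (f := F) fun s _ => hF s
      convert this using 1
      funext x; simp
    refine Submodule.add_mem _ (hsum _ fun s => ?_) (hu _ (ih _))
    have h1 := Submodule.smul_mem _ (1 / 2 : ℂ)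
      (Submodule.add_mem _ (hz s _ (ih (M.curryLeft (e s)))) (hzbar s _ (ih (M.curryLeft (e s)))))
    have h2 := Submodule.smul_mem _ (1 / (2 * Complex.I) : ℂ)
      (Submodule.sub_mem _ (hz s _ (ih (M.curryLeft (e' s)))) (hzbar s _ (ih (M.curryLeft (e' s)))))
    convert Submodule.add_mem _ h1 h2 using 1
    funext x
    simp only [Pi.add_apply, Pi.smul_apply, Pi.sub_apply, smul_eq_mul]
    ring

/-- Taylor expansion of a smooth real function into monomials in `z`, `z̄`, `u`. -/
theorem exists_trinomial_expansion {ψ : ParamSpace n → ℝ} (hψ : ContDiffAt ℝ ∞ ψ 0) :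
    ∃ q : ℕ × ℕ × ℕ → ParamSpace n → ℂ, (∀ i, q i ∈ triSpan n i) ∧
      (fun x => ψ x - ∑ i ∈ lowIdx, (q i x).re) =O[𝓝 0] fun x => ‖x‖ ^ 6 := by
  -- Order 5 suffices: near 0 one has ‖x‖ ≤ `wnorm x`, so a remainder O(‖x‖⁶) is of weight at least
  -- 6.
  have h1 := taylor_isBigO (N := 5) (contDiffAt_infty.1 hψ _)
  have h2 : (fun x => ((∑ m ∈ Finset.range (5 + 1), (m.factorial : ℝ)⁻¹ •
      iteratedFDeriv ℝ m ψ 0 fun _ => x : ℝ) : ℂ)) ∈ ⨆ i ∈ lowIdx, triSpan n i := by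
    have h3 : ∀ m ∈ Finset.range (5 + 1), (fun x => (((m.factorial : ℝ)⁻¹ •
        iteratedFDeriv ℝ m ψ 0 fun _ => x : ℝ) : ℂ)) ∈ ⨆ i ∈ lowIdx, triSpan n i := by
      intro m hm
      have h4 : (⨆ i ∈ degIdx m, triSpan n i) ≤ ⨆ i ∈ lowIdx, triSpan n i := by
        refine biSup_mono fun i hi => ?_
        rw [mem_degIdx] at hi
        rw [mem_lowIdx]
        simp at hm
        omega
      exact h4 (multilinear_diag_mem m ((m.factorial : ℝ)⁻¹ • iteratedFDeriv ℝ m ψ 0))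
    convert Submodule.sum_mem _ h3 using 1
    funext x
    simp
  obtain ⟨μ, hμ⟩ := (Submodule.mem_iSup_finset_iff_exists_sum _ _).1 h2
  refine ⟨fun i => μ i, fun i => (μ i).2, h1.congr_left fun x => ?_⟩
  have h5 := congrArg Complex.re (congrFun hμ x)
  simp only [Finset.sum_apply, Complex.re_sum, Complex.ofReal_re] at h5
  rw [h5]

/-- If a smooth function vanishes up to weighted order `k`, then only monomials of weight greater
than `k` contribute to its expansion. -/
theorem exists_weighted_expansion {ψ : ParamSpace n → ℝ} (hψ : ContDiffAt ℝ ∞ ψ 0) {k : ℕ}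
    (hk : k ≤ 5) (h0 : ψ =o[𝓝 0] fun x => wnorm x ^ k) :
    ∃ q : ℕ × ℕ × ℕ → ParamSpace n → ℂ, (∀ i, q i ∈ triSpan n i) ∧
      (fun x => ψ x - ∑ i ∈ lowIdx with k < wt i, (q i x).re) =O[𝓝 0] fun x => ‖x‖ ^ 6 := by
  obtain ⟨q, hq, hexp⟩ := exists_trinomial_expansion hψ
  refine ⟨q, hq, hexp.congr_left fun x => ?_⟩
  rw [← Finset.sum_filter_add_sum_filter_not lowIdx (fun i => k < wt i)]
  -- The individual q i need not vanish, since real parts of the types (a, b, c) and (b, a, c) may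
  -- cancel. Only the sum in each weight does, as a coefficient of the polynomial obtained by
  -- dilating x.
  suffices h : ∑ i ∈ lowIdx with ¬ k < wt i, (q i x).re = 0 by rw [h, add_zero]
  let P : Polynomial ℝ := ∑ i ∈ lowIdx, Polynomial.C (q i x).re * Polynomial.X ^ wt i
  have hP : ∀ t : ℝ, P.eval t = ∑ i ∈ lowIdx, (q i (dil t x)).re := by
    intro t
    simp only [P, Polynomial.eval_finsetSum, Polynomial.eval_mul, Polynomial.eval_C,
      Polynomial.eval_pow, Polynomial.eval_X]
    refine Finset.sum_congr rfl fun i _ => ?_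
    rw [triSpan_dil (hq i), ← Complex.ofReal_pow, Complex.re_ofReal_mul, mul_comm]
  have h1 : (fun t : ℝ => P.eval t) =o[𝓝[>] 0] fun t => t ^ k := by
    have h2 : (fun y => ψ y - ∑ i ∈ lowIdx, (q i y).re) =o[𝓝 0] fun y => wnorm y ^ k :=
      (hexp.trans (norm_isBigO_wnorm.pow 6)).trans_isLittleO (wnorm_pow_isLittleO (by omega))
    have h3 := (h0.sub h2).comp_tendsto (tendsto_dil x)
    refine (h3.congr_left fun t => ?_).trans_isBigO (wnorm_dil_pow_isBigO x k)
    simp [hP]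
  have h2 := coeff_eq_zero_of_isLittleO h1
  have h3 : ∀ j ≤ k, ∑ i ∈ lowIdx with wt i = j, (q i x).re = 0 := by
    intro j hj
    rw [← h2 j hj]
    simp [P, Polynomial.finsetSum_coeff, Polynomial.coeff_X_pow, Finset.sum_filter, eq_comm]
  have h4 := Finset.sum_fiberwise_of_maps_to (s := lowIdx.filter fun i => ¬ k < wt i)
    (t := Finset.range (k + 1)) (g := wt) (f := fun i => (q i x).re)
    (fun i hi => by simp at hi ⊢; omega)
  rw [← h4]
  refine Finset.sum_eq_zero fun j hj => ?_
  simp only [Finset.mem_range] at hj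
  rw [← h3 j (by omega), Finset.filter_filter]
  refine Finset.sum_congr (Finset.filter_congr fun i _ => ?_) fun _ _ => rfl
  omega

end Weights

/-! ### Jets of maps that are holomorphic on one side -/

section HolomorphicJets

open Asymptotics Filter

variable {X Y : Type*} [NormedAddCommGroup X] [NormedSpace ℂ X] [NormedSpace ℝ X]
  [IsScalarTower ℝ ℂ X] [NormedAddCommGroup Y] [NormedSpace ℂ Y] [NormedSpace ℝ Y]
  [IsScalarTower ℝ ℂ Y]

/-- The derivatives of a smooth map at a boundary point of an open set on which it is holomorphic
are complex multilinear. -/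
lemma iteratedFDeriv_update_smul [FiniteDimensional ℂ X] [FiniteDimensional ℂ Y] {G : X → Y} {p : X}
    (hG : ContDiffAt ℝ ∞ G p) {Ω : Set X} (hΩ : IsOpen Ω) (hp : p ∈ closure Ω)
    (hol : DifferentiableOn ℂ G Ω) (m : ℕ) (v : Fin m → X) (i : Fin m) (c : ℂ) :
    iteratedFDeriv ℝ m G p (Function.update v i (c • v i)) = c • iteratedFDeriv ℝ m G p v := by
  -- Complex homogeneity in each slot holds at the points of Ω and is a closed condition, so it
  -- passes to p by continuity of the real derivatives.
  have : (𝓝[Ω] p).NeBot := mem_closure_iff_nhdsWithin_neBot.1 hp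
  have hcont : ContinuousAt (iteratedFDeriv ℝ m G) p :=
    (contDiffAt_infty.1 hG m).continuousAt_iteratedFDeriv le_rfl
  have hev : ∀ w : Fin m → X, Tendsto (fun x => iteratedFDeriv ℝ m G x w) (𝓝[Ω] p)
      (𝓝 (iteratedFDeriv ℝ m G p w)) := fun w =>
    ((ContinuousMultilinearMap.apply ℝ (fun _ : Fin m => X) Y w).continuous.tendsto _).comp
      (hcont.tendsto.mono_left nhdsWithin_le_nhds)
  refine tendsto_nhds_unique_of_eventuallyEq (hev _) ((hev v).const_smul c) ?_
  filter_upwards [self_mem_nhdsWithin] with x hx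
  have h1 : ContDiffAt ℂ m G x :=
    (contDiffOn_nat_of_differentiableOn hΩ m hol).contDiffAt (hΩ.mem_nhds hx)
  have h2 := h1.restrictScalars_iteratedFDeriv (𝕜 := ℝ)
  rw [← h2]
  simp only [Function.comp_apply, ContinuousMultilinearMap.coe_restrictScalars]
  rw [ContinuousMultilinearMap.map_update_smul, Function.update_eq_self]

/-- The bihomogeneous expansion of a smooth map at a boundary point of an open set on which it is
holomorphic. -/
theorem exists_bihomogeneous_expansion {n : ℕ} {G : CSpace n → CSpace n}
    (hG : ContDiffAt ℝ ∞ G 0) {Ω : Set (CSpace n)} (hΩ : IsOpen Ω) (hp : 0 ∈ closure Ω)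
    (hol : DifferentiableOn ℂ G Ω) :
    ∃ P : ℕ → ℕ → CSpace n → CSpace n, (∀ m a, Continuous (P m a)) ∧
      (∀ m, ∀ a ≤ m, ∀ (s t : ℂ) (z : EuclideanSpace ℂ (Fin n)) (w : ℂ),
        P m a (s • z, t * w) = (s ^ a * t ^ (m - a)) • P m a (z, w)) ∧
      (fun y => G y - ∑ m ∈ Finset.range 6, ∑ a ∈ Finset.range (m + 1), P m a y) =O[𝓝 0]
        fun y => ‖y‖ ^ 6 := by
  let D : ∀ m : ℕ, ContinuousMultilinearMap ℝ (fun _ : Fin m => CSpace n) (CSpace n) :=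
    fun m => iteratedFDeriv ℝ m G 0
  let DC : ∀ m : ℕ, MultilinearMap ℂ (fun _ : Fin m => CSpace n) (CSpace n) := fun m =>
    { toFun := D m
      map_update_add' := by
        intro _ v i x y
        convert (D m).map_update_add v i x y
      map_update_smul' := by
        intro inst v i c x
        obtain rfl : inst = instDecidableEqFin m := Subsingleton.elim _ _
        have := iteratedFDeriv_update_smul hG hΩ hp hol m (Function.update v i x) i c
        simpa using this }
  let ι₁ : CSpace n → CSpace n := fun y => (y.1, 0)
  let ι₂ : CSpace n → CSpace n := fun y => (0, y.2)
  -- With y = (z, 0) + (0, w), multilinearity expands the m-th derivative over the subsets of slots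
  -- that receive (z, 0); P m a collects the subsets with a elements and is thus of bidegree (a, m −
  -- a) in (z, w).
  let P : ℕ → ℕ → CSpace n → CSpace n := fun m a y =>
    ∑ s ∈ Finset.powersetCard a (Finset.univ : Finset (Fin m)),
      (m.factorial : ℝ)⁻¹ • D m (s.piecewise (fun _ => ι₁ y) fun _ => ι₂ y)
  refine ⟨P, fun m a => ?_, fun m a ha s t z w => ?_, ?_⟩
  · refine continuous_finsetSum _ fun s _ => ?_
    have h : Continuous fun y : CSpace n =>
        s.piecewise (fun _ : Fin m => ι₁ y) fun _ => ι₂ y := by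
      refine continuous_pi fun i => ?_
      by_cases hi : i ∈ s
      · simp only [Finset.piecewise, hi, if_true, ι₁]; fun_prop
      · simp only [Finset.piecewise, hi, if_false, ι₂]; fun_prop
    have h' : Continuous fun y : CSpace n => D m (s.piecewise (fun _ : Fin m => ι₁ y) fun _ => ι₂ y) :=
      (D m).cont.comp h
    exact h'.const_smul ((m.factorial : ℝ)⁻¹)
  · simp only [P, Finset.smul_sum]
    refine Finset.sum_congr rfl fun S hS => ?_
    have hcard : S.card = a := (Finset.mem_powersetCard.1 hS).2
    rw [smul_comm]
    congr 1
    change DC m _ = _ • DC m _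
    have h1 : (S.piecewise (fun _ => ι₁ (s • z, t * w)) fun _ => ι₂ (s • z, t * w)) =
        S.piecewise (fun i => s • (Sᶜ.piecewise (fun i => t • S.piecewise (fun _ => ι₁ (z, w))
          (fun _ => ι₂ (z, w)) i) (S.piecewise (fun _ => ι₁ (z, w)) fun _ => ι₂ (z, w))) i)
          (Sᶜ.piecewise (fun i => t • S.piecewise (fun _ => ι₁ (z, w))
          (fun _ => ι₂ (z, w)) i) (S.piecewise (fun _ => ι₁ (z, w)) fun _ => ι₂ (z, w))) := by
      funext i
      by_cases hi : i ∈ S <;> simp [Finset.piecewise, hi, ι₁, ι₂]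
    rw [h1, MultilinearMap.map_piecewise_smul, MultilinearMap.map_piecewise_smul, smul_smul]
    simp [hcard, Finset.card_compl]
  · have h1 := taylor_isBigO (N := 5) (contDiffAt_infty.1 hG _)
    refine h1.congr_left fun y => ?_
    congr 1
    refine Finset.sum_congr rfl fun m _ => ?_
    have h2 : (fun _ : Fin m => y) = (fun _ => ι₁ y) + fun _ => ι₂ y := by
      funext i
      simp [ι₁, ι₂]
    have h3 := (D m).toMultilinearMap.map_add_univ (fun _ => ι₁ y) fun _ => ι₂ y
    rw [← h2, ← Finset.powerset_univ, Finset.sum_powerset] at h3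
    simp only [Finset.card_univ, Fintype.card_fin] at h3
    simp only [P, ← Finset.smul_sum]
    congr 1

end HolomorphicJets

/-! ### Implicit graphs and local inverses -/

section ImplicitGraph

open Asymptotics Filter

variable {n : ℕ}

/-- The point `(z, u + i v)`. -/
noncomputable def toC (p : ParamSpace n × ℝ) : CSpace n := (p.1.1, p.1.2 + p.2 * Complex.I)

/-- The projection `(z, w) ↦ (z, Re w)`. -/
def toP (y : CSpace n) : ParamSpace n := (y.1, y.2.re)

@[simp] lemma toC_fst (p : ParamSpace n × ℝ) : (toC p).1 = p.1.1 := rfl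
@[simp] lemma toC_re (p : ParamSpace n × ℝ) : (toC p).2.re = p.1.2 := by simp [toC]
@[simp] lemma toC_im (p : ParamSpace n × ℝ) : (toC p).2.im = p.2 := by simp [toC]
@[simp] lemma toP_toC (p : ParamSpace n × ℝ) : toP (toC p) = p.1 := by
  simp [toP]
@[simp] lemma toP_fst (y : CSpace n) : (toP y).1 = y.1 := rfl
@[simp] lemma toP_snd (y : CSpace n) : (toP y).2 = y.2.re := rfl
@[simp] lemma toP_zero : toP (0 : CSpace n) = 0 := rfl
@[simp] lemma toC_zero : toC (0 : ParamSpace n × ℝ) = 0 := by simp [toC]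

lemma toC_toP (y : CSpace n) : toC (toP y, y.2.im) = y := by
  simp [toC, toP, Complex.re_add_im]

/-- `toC` as a real linear map. -/
noncomputable def toCL (n : ℕ) : (ParamSpace n × ℝ) →L[ℝ] CSpace n :=
  ((ContinuousLinearMap.fst ℝ _ _).comp (ContinuousLinearMap.fst ℝ _ _)).prod
    ((Complex.ofRealCLM.comp ((ContinuousLinearMap.snd ℝ _ _).comp
      (ContinuousLinearMap.fst ℝ _ _))) +
      (Complex.ofRealCLM.comp (ContinuousLinearMap.snd ℝ _ _)).smulRight Complex.I)

lemma toCL_apply (p : ParamSpace n × ℝ) : toCL n p = toC p := by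
  simp [toCL, toC, ContinuousLinearMap.smulRight]

/-- `toP` as a real linear map. -/
noncomputable def toPL (n : ℕ) : CSpace n →L[ℝ] ParamSpace n :=
  (ContinuousLinearMap.fst ℝ _ _).prod (Complex.reCLM.comp (ContinuousLinearMap.snd ℝ _ _))

lemma toPL_apply (y : CSpace n) : toPL n y = toP y := rfl

lemma contDiff_toC : ContDiff ℝ ∞ (toC (n := n)) := by
  have := (toCL n).contDiff (n := ∞)
  rwa [show ⇑(toCL n) = toC from funext toCL_apply] at this

lemma contDiff_toP : ContDiff ℝ ∞ (toP (n := n)) := (toPL n).contDiff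

lemma continuous_toC : Continuous (toC (n := n)) := contDiff_toC.continuous
lemma continuous_toP : Continuous (toP (n := n)) := contDiff_toP.continuous

lemma hasFDerivAt_toC (p : ParamSpace n × ℝ) : HasFDerivAt toC (toCL n) p := by
  have := (toCL n).hasFDerivAt (x := p)
  rwa [show ⇑(toCL n) = toC from funext toCL_apply] at this

lemma hasFDerivAt_toP (y : CSpace n) : HasFDerivAt toP (toPL n) y := (toPL n).hasFDerivAt

/-- The implicit function theorem for real hypersurfaces with tangent space `Im w = 0`. -/
theorem exists_graph {σ : CSpace n → ℝ} {U : Set (CSpace n)} (hU : IsOpen U)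
    (h0U : (0 : CSpace n) ∈ U) (hσ : ContDiffOn ℝ ∞ σ U) (hσ0 : σ 0 = 0) {c : ℝ} (hc : 0 < c)
    (hd : ∀ y, fderiv ℝ σ 0 y = -(c * y.2.im)) :
    ∃ (V : Set (ParamSpace n)) (φ : ParamSpace n → ℝ), IsOpen V ∧ (0 : ParamSpace n) ∈ V ∧
      ContDiffOn ℝ ∞ φ V ∧ φ 0 = 0 ∧ fderiv ℝ φ 0 = 0 ∧
      ∀ᶠ y : CSpace n in 𝓝 0, (σ y < 0 ↔ φ (toP y) < y.2.im) ∧ (σ y = 0 ↔ φ (toP y) = y.2.im) := by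
  -- The inverse function theorem is applied to (x, v) ↦ (x, σ); φ x will be the last coordinate of
  -- the preimage of (x, 0).
  let T : ParamSpace n × ℝ → ParamSpace n × ℝ := fun p => (p.1, σ (toC p))
  let U' : Set (ParamSpace n × ℝ) := toC ⁻¹' U
  have hU' : IsOpen U' := hU.preimage continuous_toC
  have h0U' : (0 : ParamSpace n × ℝ) ∈ U' := by simpa [U'] using h0U
  have hT : ContDiffOn ℝ ∞ T U' :=
    contDiff_fst.contDiffOn.prodMk (hσ.comp contDiff_toC.contDiffOn fun _ h => h)
  have hσd : ∀ p ∈ U', HasFDerivAt (fun p => σ (toC p)) ((fderiv ℝ σ (toC p)).comp (toCL n)) p :=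
    fun p hp => (((hσ.contDiffAt (hU.mem_nhds hp)).differentiableAt (by simp)).hasFDerivAt).comp p
      (hasFDerivAt_toC p)
  let L : (ParamSpace n × ℝ) ≃L[ℝ] (ParamSpace n × ℝ) :=
    (ContinuousLinearEquiv.refl ℝ _).prodCongr (ContinuousLinearEquiv.unitsEquivAut ℝ
      (Units.mk0 (-c) (by linarith [hc])))
  have hL : HasFDerivAt T (L : (ParamSpace n × ℝ) →L[ℝ] (ParamSpace n × ℝ)) 0 := by
    have h1 := hasFDerivAt_fst (𝕜 := ℝ) (p := (0 : ParamSpace n × ℝ))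
    refine (h1.prodMk (hσd 0 h0U')).congr_fderiv ?_
    refine ContinuousLinearMap.ext fun p => Prod.ext (by simp [L]) ?_
    simp only [ContinuousLinearMap.prod_apply, ContinuousLinearMap.comp_apply, toCL_apply,
      toC_zero, hd, toC_im]
    simp [L, mul_comm]
  have hT0 : ContDiffAt ℝ ∞ T 0 := hT.contDiffAt (hU'.mem_nhds h0U')
  let f := hT0.toOpenPartialHomeomorph T hL (by simp)
  have hfT : ∀ p, f p = T p := fun p => rfl
  have h0s : (0 : ParamSpace n × ℝ) ∈ f.source :=
    hT0.mem_toOpenPartialHomeomorph_source hL (by simp)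
  have hT00 : T 0 = 0 := by simp [T, hσ0]
  have h0t : (0 : ParamSpace n × ℝ) ∈ f.target := by
    have := f.map_source h0s
    rwa [hfT, hT00] at this
  have hsymm0 : f.symm 0 = 0 := by
    have := f.left_inv h0s
    rwa [hfT, hT00] at this
  -- The local inverse is smooth at the images of the points where the derivative of T is
  -- invertible. This condition is open, which makes φ smooth on a whole neighbourhood and not just
  -- at 0.
  let Gd : Set (ParamSpace n × ℝ) := U' ∩ (fderiv ℝ T) ⁻¹'
    Set.range (ContinuousLinearEquiv.toContinuousLinearMap (σ₁₂ := RingHom.id ℝ)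
      (M₁ := ParamSpace n × ℝ) (M₂ := ParamSpace n × ℝ))
  have hGd : IsOpen Gd :=
    (hT.continuousOn_fderiv_of_isOpen hU' (by simp)).isOpen_inter_preimage hU'
      ContinuousLinearEquiv.isOpen
  have h0Gd : (0 : ParamSpace n × ℝ) ∈ Gd := ⟨h0U', L, hL.fderiv.symm⟩
  let Tg : Set (ParamSpace n × ℝ) := f.target ∩ f.symm ⁻¹' Gd
  have hTg : IsOpen Tg := f.symm.isOpen_inter_preimage hGd
  have h0Tg : (0 : ParamSpace n × ℝ) ∈ Tg := ⟨h0t, by rw [Set.mem_preimage, hsymm0]; exact h0Gd⟩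
  have hsm : ∀ q ∈ Tg, ContDiffAt ℝ ∞ f.symm q := by
    rintro q ⟨hq1, hq2, L', hL'⟩
    refine f.contDiffAt_symm (f₀' := L') hq1 ?_ (hT.contDiffAt (hU'.mem_nhds hq2))
    rw [hL']
    exact ((hT.contDiffAt (hU'.mem_nhds hq2)).differentiableAt (by simp)).hasFDerivAt
  let ι : ParamSpace n → ParamSpace n × ℝ := fun x => (x, 0)
  have hι : ContDiff ℝ ∞ ι := contDiff_id.prodMk contDiff_const
  let φ : ParamSpace n → ℝ := fun x => (f.symm (ι x)).2
  have hφs : ∀ x, ι x ∈ Tg → ContDiffAt ℝ ∞ φ x := fun x hx =>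
    contDiffAt_snd.comp x ((hsm _ hx).comp x hι.contDiffAt)
  have hφ : ∀ x, ι x ∈ Tg → toC (x, φ x) ∈ U ∧ σ (toC (x, φ x)) = 0 := by
    intro x hx
    have h1 := f.right_inv hx.1
    rw [hfT] at h1
    have h2 : (f.symm (ι x)).1 = x := congrArg Prod.fst h1
    have h3 : σ (toC (f.symm (ι x))) = 0 := congrArg Prod.snd h1
    have h4 : f.symm (ι x) = (x, φ x) := Prod.ext h2 rfl
    rw [← h4]
    exact ⟨hx.2.1, h3⟩
  have hφ0 : φ 0 = 0 := by
    change (f.symm (0 : ParamSpace n × ℝ)).2 = 0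
    rw [hsymm0]; rfl
  have hVopen : IsOpen (ι ⁻¹' Tg) := hTg.preimage hι.continuous
  have h0V : (0 : ParamSpace n) ∈ ι ⁻¹' Tg := h0Tg
  refine ⟨ι ⁻¹' Tg, φ, hVopen, h0V,
    fun x hx => (hφs x hx).contDiffWithinAt, hφ0, ?_, ?_⟩
  · have h1 : HasFDerivAt φ (fderiv ℝ φ 0) 0 :=
      ((hφs 0 h0V).differentiableAt (by simp)).hasFDerivAt
    have h2 : HasFDerivAt (fun x : ParamSpace n => (x, φ x)) ((ContinuousLinearMap.id ℝ _).prod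
      (fderiv ℝ φ 0)) 0 := (hasFDerivAt_id 0).prodMk h1
    have h3 := hσd (0, φ 0) (by rw [hφ0]; exact h0U')
    have h4 := h3.comp (0 : ParamSpace n) h2
    have h5 : HasFDerivAt (fun x : ParamSpace n => σ (toC (x, φ x)))
        (0 : ParamSpace n →L[ℝ] ℝ) 0 := by
      refine (hasFDerivAt_const (0 : ℝ) _).congr_of_eventuallyEq ?_
      filter_upwards [hVopen.mem_nhds h0V] with x hx using (hφ x hx).2
    have h6 := h4.unique h5
    refine ContinuousLinearMap.ext fun x => ?_
    have h7 := congrArg (fun M : ParamSpace n →L[ℝ] ℝ => M x) h6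
    simp only [ContinuousLinearMap.comp_apply, ContinuousLinearMap.prod_apply, hφ0, toCL_apply,
      show toC ((0 : ParamSpace n), (0 : ℝ)) = 0 from toC_zero, hd, toC_im] at h7
    simp only [zero_apply, neg_eq_zero, mul_eq_zero, hc.ne', false_or] at h7
    simpa using h7
  -- Near the origin ∂σ/∂v < 0, so σ is strictly decreasing on short vertical segments and its sign
  -- is decided by the position relative to the zero φ x.
  · have hneg : ∀ᶠ p : ParamSpace n × ℝ in 𝓝 0, p ∈ U' ∧
        fderiv ℝ σ (toC p) (0, Complex.I) < 0 := by
      refine Filter.Eventually.and (hU'.mem_nhds h0U') ?_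
      have h1 : ContinuousAt (fun p : ParamSpace n × ℝ => fderiv ℝ σ (toC p) (0, Complex.I)) 0 := by
        have h2 : ContinuousAt (fderiv ℝ σ) (toC 0) := by
          rw [toC_zero]
          exact (hσ.contDiffAt (hU.mem_nhds h0U)).continuousAt_fderiv (by simp)
        have h3 : ContinuousAt (fun p : ParamSpace n × ℝ => fderiv ℝ σ (toC p)) 0 :=
          ContinuousAt.comp h2 continuous_toC.continuousAt
        exact h3.clm_apply continuousAt_const
      refine h1.eventually_lt continuousAt_const ?_
      simp [hd, hc]
    obtain ⟨ε, hε, hball⟩ := Metric.eventually_nhds_iff_ball.1 hneg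
    have hmem : ∀ x : ParamSpace n, ‖x‖ < ε → ∀ v ∈ Set.Ioo (-ε) ε,
        (x, v) ∈ Metric.ball (0 : ParamSpace n × ℝ) ε := by
      intro x hx v hv
      rw [mem_ball_zero_iff, Prod.norm_def]
      exact max_lt hx (abs_lt.2 hv)
    have hanti : ∀ x : ParamSpace n, ‖x‖ < ε →
        StrictAntiOn (fun v : ℝ => σ (toC (x, v))) (Set.Ioo (-ε) ε) := by
      intro x hx
      have hder : ∀ v ∈ Set.Ioo (-ε) ε, HasDerivAt (fun v : ℝ => σ (toC (x, v)))
          (fderiv ℝ σ (toC (x, v)) (0, Complex.I)) v := by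
        intro v hv
        have h1 : HasDerivAt (fun v : ℝ => (x, v)) ((0 : ParamSpace n), (1 : ℝ)) v :=
          (hasDerivAt_const v x).prodMk (hasDerivAt_id v)
        have h2 : HasDerivAt (fun v : ℝ => σ (toC (x, v))) _ v :=
          (hσd (x, v) (hball _ (hmem x hx v hv)).1).comp_hasDerivAt v h1
        convert h2 using 1
        simp [toCL_apply, toC]
      refine strictAntiOn_of_deriv_neg (convex_Ioo _ _)
        (fun v hv => (hder v hv).continuousAt.continuousWithinAt) fun v hv => ?_
      rw [interior_Ioo] at hv
      rw [(hder v hv).deriv]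
      exact (hball _ (hmem x hx v hv)).2
    have hφc : ContinuousAt φ 0 := (hφs 0 h0V).continuousAt
    have hev : ∀ᶠ x : ParamSpace n in 𝓝 0, x ∈ ι ⁻¹' Tg ∧ ‖x‖ < ε ∧ φ x ∈ Set.Ioo (-ε) ε := by
      refine Filter.Eventually.and (hVopen.mem_nhds h0V) (Filter.Eventually.and ?_ ?_)
      · exact (continuous_norm.tendsto' 0 0 (by simp)).eventually_lt_const hε
      · exact hφc.eventually_mem (Ioo_mem_nhds (by rw [hφ0]; linarith) (by rw [hφ0]; linarith))
    have hP : Tendsto (toP (n := n)) (𝓝 0) (𝓝 0) := continuous_toP.tendsto' 0 0 rfl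
    have him : ∀ᶠ y : CSpace n in 𝓝 0, y.2.im ∈ Set.Ioo (-ε) ε := by
      have : Continuous fun y : CSpace n => y.2.im := by fun_prop
      exact this.continuousAt.eventually_mem (Ioo_mem_nhds (by simpa using hε) (by simpa using hε))
    filter_upwards [hP.eventually hev, him] with y ⟨hy1, hy2, hy3⟩ hy4
    have h1 := hanti (toP y) hy2
    have h2 := (hφ _ hy1).2
    have h3 := h1.lt_iff_gt hy4 hy3
    have h4 := h1.injOn.eq_iff hy4 hy3
    simp only [toC_toP, h2] at h3 h4
    exact ⟨h3, by rw [h4, eq_comm]⟩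

/-- A holomorphic map with invertible derivative is locally biholomorphic. -/
theorem exists_localBiholomorphism {Ψ : CSpace n → CSpace n} (hΨ : Differentiable ℂ Ψ)
    (h0 : Ψ 0 = 0) {L : CSpace n ≃L[ℂ] CSpace n}
    (hL : HasFDerivAt Ψ (L : CSpace n →L[ℂ] CSpace n) 0) :
    ∃ k : OpenPartialHomeomorph (CSpace n) (CSpace n), IsLocalBiholomorphism k 0 0 ∧
      ∀ x, k x = Ψ x := by
  have hc : ContDiffAt ℂ 1 Ψ 0 := by
    have := contDiffOn_nat_of_differentiableOn isOpen_univ 1 hΨ.differentiableOn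
    exact_mod_cast this.contDiffAt univ_mem
  let f := hc.toOpenPartialHomeomorph Ψ hL (by simp)
  have hf : ∀ x, f x = Ψ x := fun _ => rfl
  have h0s : (0 : CSpace n) ∈ f.source := hc.mem_toOpenPartialHomeomorph_source hL (by simp)
  have h0t : (0 : CSpace n) ∈ f.target := by
    have := f.map_source h0s
    rwa [hf, h0] at this
  have hsymm0 : f.symm 0 = 0 := by
    have := f.left_inv h0s
    rwa [hf, h0] at this
  have hsm : ContDiffAt ℂ 1 f.symm 0 :=
    f.contDiffAt_symm (f₀' := L) h0t (by rwa [hsymm0]) (by rwa [hsymm0])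
  have hev := hsm.eventually (by simp)
  obtain ⟨s, hs, hso, h0⟩ := eventually_nhds_iff.1 hev
  -- The restriction is made on the side of the inverse, to an open set on which the inverse is
  -- differentiable; Ψ is holomorphic everywhere.
  refine ⟨(f.symm.restrOpen s hso).symm, ⟨?_, ?_, ?_, ?_⟩, fun x => rfl⟩
  · change (0 : CSpace n) ∈ (f.symm.restrOpen s hso).target
    have h1 : (0 : CSpace n) ∈ (f.symm.restrOpen s hso).source := by
      rw [OpenPartialHomeomorph.restrOpen_source]
      exact ⟨h0t, h0⟩
    have h2 := (f.symm.restrOpen s hso).map_source h1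
    rwa [show (f.symm.restrOpen s hso) 0 = 0 from hsymm0] at h2
  · assumption
  · exact hΨ.differentiableOn
  · intro x hx
    have hx' : x ∈ (f.symm.restrOpen s hso).source := hx
    rw [OpenPartialHomeomorph.restrOpen_source] at hx'
    exact ((hs x hx'.2).differentiableAt (by simp)).differentiableWithinAt

end ImplicitGraph

/-! ### Independence of weighted order from the parametrization -/

section Transfer

open Asymptotics Filter

variable {n : ℕ}

lemma sub_fderiv_isBigO {X Y : Type*} [NormedAddCommGroup X] [NormedSpace ℝ X]
    [NormedAddCommGroup Y] [NormedSpace ℝ Y] {f : X → Y} (hf : ContDiffAt ℝ 2 f 0) :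
    (fun x => f x - f 0 - fderiv ℝ f 0 x) =O[𝓝 0] fun x => ‖x‖ ^ 2 := by
  refine (taylor_isBigO (N := 1) hf).congr_left fun x => ?_
  simp [Finset.sum_range_succ, iteratedFDeriv_one_apply, sub_sub]

/-- Smooth maps respecting the complex tangent space at the origin respect the weighted gauge. -/
lemma wnorm_comp_isBigO {κ : ParamSpace n → ParamSpace n} (hκ : ContDiffAt ℝ 2 κ 0)
    (h0 : κ 0 = 0) (hT : ∀ z, (fderiv ℝ κ 0 (z, 0)).2 = 0) :
    (fun x => wnorm (κ x)) =O[𝓝 0] wnorm := by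
  set L := fderiv ℝ κ 0
  have h1 := sub_fderiv_isBigO hκ
  rw [h0] at h1
  simp only [sub_zero] at h1
  obtain ⟨C, hC, h2⟩ := h1.exists_nonneg
  refine IsBigO.of_bound ((‖L‖ + C) + √(‖L‖ + C)) ?_
  filter_upwards [h2.bound, eventually_norm_le_wnorm, eventually_wnorm_le (n := n) one_pos]
    with x hx1 hx2 hx3
  have hw := wnorm_nonneg x
  rw [Real.norm_of_nonneg (wnorm_nonneg _), Real.norm_of_nonneg hw]
  rw [norm_pow, norm_norm] at hx1
  have hxw : ‖x‖ ^ 2 ≤ wnorm x ^ 2 := by gcongr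
  have hA : ‖(κ x).1‖ ≤ (‖L‖ + C) * wnorm x := by
    calc ‖(κ x).1‖ ≤ ‖κ x‖ := norm_fst_le _
      _ = ‖L x + (κ x - L x)‖ := by congr 1; abel
      _ ≤ ‖L x‖ + ‖κ x - L x‖ := norm_add_le _ _
      _ ≤ ‖L‖ * ‖x‖ + C * ‖x‖ ^ 2 := add_le_add (L.le_opNorm x) hx1
      _ ≤ ‖L‖ * wnorm x + C * wnorm x := by
        gcongr
        nlinarith
      _ = _ := by ring
  -- By hT the linear part of the u-component sees only u, which has weight 2; the remainder is
  -- quadratic and hence also of weight 2.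
  have hB : |(κ x).2| ≤ (‖L‖ + C) * wnorm x ^ 2 := by
    have h3 : (L x).2 = (L (0, x.2)).2 := by
      have : x = (x.1, 0) + (0, x.2) := by simp
      conv_lhs => rw [this, map_add, Prod.snd_add, hT, zero_add]
    have h4 : |(L x).2| ≤ ‖L‖ * wnorm x ^ 2 := by
      rw [h3]
      calc |(L (0, x.2)).2| ≤ ‖L (0, x.2)‖ := norm_snd_le (L (0, x.2))
        _ ≤ ‖L‖ * ‖((0, x.2) : ParamSpace n)‖ := L.le_opNorm _
        _ ≤ ‖L‖ * wnorm x ^ 2 := by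
          gcongr
          rw [Prod.norm_def]
          simpa using abs_snd_le_wnorm x
    calc |(κ x).2| = |(L x).2 + (κ x - L x).2| := by simp
      _ ≤ |(L x).2| + |(κ x - L x).2| := abs_add_le _ _
      _ ≤ ‖L‖ * wnorm x ^ 2 + C * wnorm x ^ 2 := by
        refine add_le_add h4 ((norm_snd_le _).trans (hx1.trans ?_))
        gcongr
      _ = _ := by ring
  have hS : √|(κ x).2| ≤ √(‖L‖ + C) * wnorm x := by
    calc √|(κ x).2| ≤ √((‖L‖ + C) * wnorm x ^ 2) := Real.sqrt_le_sqrt hB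
      _ = √(‖L‖ + C) * wnorm x := by rw [Real.sqrt_mul (by positivity), Real.sqrt_sq hw]
  change ‖(κ x).1‖ + √|(κ x).2| ≤ _
  rw [add_mul]
  exact add_le_add hA hS

/-- Vanishing up to weighted order `k` does not depend on the parametrization. -/
theorem isLittleO_of_comp {F : Type*} [NormedAddCommGroup F] {χ : ParamSpace n → ParamSpace n}
    (hχ : ContDiffAt ℝ 2 χ 0) (h0 : χ 0 = 0)
    (hinj : Function.Injective (fderiv ℝ χ 0)) (hT : ∀ z, (fderiv ℝ χ 0 (z, 0)).2 = 0)
    {e : ParamSpace n → F} {k : ℕ}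
    (he : (fun x => e (χ x)) =o[𝓝 0] fun x => wnorm x ^ k) :
    e =o[𝓝 0] fun x => wnorm x ^ k := by
  let Le : ParamSpace n ≃L[ℝ] ParamSpace n :=
    (LinearEquiv.ofInjectiveEndo (fderiv ℝ χ 0 : ParamSpace n →ₗ[ℝ] ParamSpace n)
      hinj).toContinuousLinearEquiv
  have hLe : ∀ x, Le x = fderiv ℝ χ 0 x := fun x => rfl
  have hd : HasFDerivAt χ (Le : ParamSpace n →L[ℝ] ParamSpace n) 0 := by
    refine (hχ.differentiableAt (by simp)).hasFDerivAt.congr_fderiv ?_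
    exact ContinuousLinearMap.ext fun x => (hLe x).symm
  let κ := hχ.localInverse hd (by simp)
  have hs := hχ.hasStrictFDerivAt' hd (by simp)
  have hκ : ContDiffAt ℝ 2 κ 0 := by
    have := hχ.to_localInverse hd (by simp)
    rwa [h0] at this
  have hκ0 : κ 0 = 0 := by
    have := hχ.localInverse_apply_image hd (by simp)
    rwa [h0] at this
  have hκd : HasFDerivAt κ (Le.symm : ParamSpace n →L[ℝ] ParamSpace n) 0 := by
    have := hs.to_localInverse.hasFDerivAt
    rwa [h0] at this
  have hinv : ∀ᶠ y in 𝓝 0, χ (κ y) = y := by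
    have := hs.eventually_right_inverse
    rwa [h0] at this
  -- The derivative maps ℂⁿ × {0} injectively into itself, hence onto itself by dimension, so the
  -- inverse preserves this subspace as well.
  have hTs : ∀ z, (Le.symm (z, 0)).2 = 0 := by
    let ι : EuclideanSpace ℂ (Fin n) →ₗ[ℝ] ParamSpace n := LinearMap.inl ℝ _ _
    let A : EuclideanSpace ℂ (Fin n) →ₗ[ℝ] EuclideanSpace ℂ (Fin n) :=
      (LinearMap.fst ℝ _ _).comp ((Le : ParamSpace n →ₗ[ℝ] ParamSpace n).comp ι)
    have hA : ∀ z, Le (z, 0) = (A z, 0) := fun z => Prod.ext rfl (hT z)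
    have hAi : Function.Injective A := by
      intro z z' h
      have : Le (z, 0) = Le (z', 0) := by rw [hA, hA, h]
      exact congrArg Prod.fst (Le.injective this)
    intro z
    obtain ⟨z', rfl⟩ := LinearMap.injective_iff_surjective.1 hAi z
    rw [← hA, Le.symm_apply_apply]
  have hw := wnorm_comp_isBigO hκ hκ0 fun z => by rw [hκd.fderiv]; exact hTs z
  have htend : Tendsto κ (𝓝 0) (𝓝 0) := by
    have := hκ.continuousAt.tendsto
    rwa [hκ0] at this
  have h1 := (he.comp_tendsto htend).trans_isBigO (hw.pow k)
  refine h1.congr' ?_ (EventuallyEq.refl _ _)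
  filter_upwards [hinv] with y hy
  simp [hy]

end Transfer

/-! ### Algebra of the normal form: removable terms and their complements -/

section NormalForm

variable {n : ℕ}

/-- Symmetrization of coefficients of bidegree `(2, 2)`. -/
noncomputable def sym22 (a : Fin n → Fin n → Fin n → Fin n → ℂ) (i j k l : Fin n) : ℂ :=
  (a i j k l + a j i k l + a i j l k + a j i l k) / 4

/-- Symmetrization of coefficients of bidegree `(3, 2)`. -/
noncomputable def sym32 (b : Fin n → Fin n → Fin n → Fin n → Fin n → ℂ) (i j k l m : Fin n) : ℂ :=
  (b i j k l m + b i k j l m + b j i k l m + b j k i l m + b k i j l m + b k j i l m +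
    b i j k m l + b i k j m l + b j i k m l + b j k i m l + b k i j m l + b k j i m l) / 12

lemma poly22_add (a a' : Fin n → Fin n → Fin n → Fin n → ℂ) (z : EuclideanSpace ℂ (Fin n)) :
    poly22 (fun i j k l => a i j k l + a' i j k l) z = poly22 a z + poly22 a' z := by
  simp only [poly22, add_mul, Finset.sum_add_distrib]

lemma poly22_smul (c : ℂ) (a : Fin n → Fin n → Fin n → Fin n → ℂ)
    (z : EuclideanSpace ℂ (Fin n)) :
    poly22 (fun i j k l => c * a i j k l) z = c * poly22 a z := by
  simp only [poly22, mul_assoc, Finset.mul_sum]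

lemma poly32_add (b b' : Fin n → Fin n → Fin n → Fin n → Fin n → ℂ)
    (z : EuclideanSpace ℂ (Fin n)) :
    poly32 (fun i j k l m => b i j k l m + b' i j k l m) z = poly32 b z + poly32 b' z := by
  simp only [poly32, add_mul, Finset.sum_add_distrib]

lemma poly32_smul (c : ℂ) (b : Fin n → Fin n → Fin n → Fin n → Fin n → ℂ)
    (z : EuclideanSpace ℂ (Fin n)) :
    poly32 (fun i j k l m => c * b i j k l m) z = c * poly32 b z := by
  simp only [poly32, mul_assoc, Finset.mul_sum]

lemma poly22_swap_left (a : Fin n → Fin n → Fin n → Fin n → ℂ) (z : EuclideanSpace ℂ (Fin n)) :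
    poly22 (fun i j k l => a j i k l) z = poly22 a z := by
  unfold poly22
  rw [Finset.sum_comm]
  refine Finset.sum_congr rfl fun i _ => Finset.sum_congr rfl fun j _ =>
    Finset.sum_congr rfl fun k _ => Finset.sum_congr rfl fun l _ => by ring

lemma poly22_swap_right (a : Fin n → Fin n → Fin n → Fin n → ℂ) (z : EuclideanSpace ℂ (Fin n)) :
    poly22 (fun i j k l => a i j l k) z = poly22 a z := by
  unfold poly22
  refine Finset.sum_congr rfl fun i _ => Finset.sum_congr rfl fun j _ => ?_
  rw [Finset.sum_comm]
  refine Finset.sum_congr rfl fun k _ => Finset.sum_congr rfl fun l _ => by ring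

lemma poly22_conj (a : Fin n → Fin n → Fin n → Fin n → ℂ) (z : EuclideanSpace ℂ (Fin n)) :
    poly22 (fun i j k l => conj (a k l i j)) z = conj (poly22 a z) := by
  simp only [poly22, map_sum, map_mul, Complex.conj_conj]
  have h1 : ∀ F : Fin n → Fin n → Fin n → Fin n → ℂ,
      ∑ i, ∑ j, ∑ k, ∑ l, F i j k l = ∑ i, ∑ j, ∑ k, ∑ l, F k l i j := by
    intro F
    calc ∑ i, ∑ j, ∑ k, ∑ l, F i j k l
        = ∑ i, ∑ k, ∑ j, ∑ l, F i j k l := Finset.sum_congr rfl fun i _ => Finset.sum_comm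
      _ = ∑ k, ∑ i, ∑ j, ∑ l, F i j k l := Finset.sum_comm
      _ = ∑ k, ∑ i, ∑ l, ∑ j, F i j k l := Finset.sum_congr rfl fun k _ =>
          Finset.sum_congr rfl fun i _ => Finset.sum_comm
      _ = ∑ k, ∑ l, ∑ i, ∑ j, F i j k l := Finset.sum_congr rfl fun k _ => Finset.sum_comm
  rw [h1]
  refine Finset.sum_congr rfl fun i _ => Finset.sum_congr rfl fun j _ =>
    Finset.sum_congr rfl fun k _ => Finset.sum_congr rfl fun l _ => by ring

lemma poly22_sym22 (a : Fin n → Fin n → Fin n → Fin n → ℂ) (z : EuclideanSpace ℂ (Fin n)) :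
    poly22 (sym22 a) z = poly22 a z := by
  have h : sym22 a = fun i j k l => (1 / 4 : ℂ) * (((a i j k l + a j i k l) + a i j l k) +
      a j i l k) := by
    funext i j k l
    simp only [sym22]
    ring
  rw [h, poly22_smul, poly22_add, poly22_add, poly22_add, poly22_swap_left,
    poly22_swap_right, poly22_swap_left (fun i j k l => a i j l k), poly22_swap_right]
  ring

lemma poly32_swap₁ (b : Fin n → Fin n → Fin n → Fin n → Fin n → ℂ)
    (z : EuclideanSpace ℂ (Fin n)) :
    poly32 (fun i j k l m => b j i k l m) z = poly32 b z := by
  unfold poly32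
  rw [Finset.sum_comm]
  refine Finset.sum_congr rfl fun i _ => Finset.sum_congr rfl fun j _ =>
    Finset.sum_congr rfl fun k _ => Finset.sum_congr rfl fun l _ =>
    Finset.sum_congr rfl fun m _ => by ring

lemma poly32_swap₂ (b : Fin n → Fin n → Fin n → Fin n → Fin n → ℂ)
    (z : EuclideanSpace ℂ (Fin n)) :
    poly32 (fun i j k l m => b i k j l m) z = poly32 b z := by
  unfold poly32
  refine Finset.sum_congr rfl fun i _ => ?_
  rw [Finset.sum_comm]
  refine Finset.sum_congr rfl fun j _ =>
    Finset.sum_congr rfl fun k _ => Finset.sum_congr rfl fun l _ =>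
    Finset.sum_congr rfl fun m _ => by ring

lemma poly32_swap₃ (b : Fin n → Fin n → Fin n → Fin n → Fin n → ℂ)
    (z : EuclideanSpace ℂ (Fin n)) :
    poly32 (fun i j k l m => b i j k m l) z = poly32 b z := by
  unfold poly32
  refine Finset.sum_congr rfl fun i _ => Finset.sum_congr rfl fun j _ =>
    Finset.sum_congr rfl fun k _ => ?_
  rw [Finset.sum_comm]
  refine Finset.sum_congr rfl fun l _ => Finset.sum_congr rfl fun m _ => by ring

lemma poly32_sym32 (b : Fin n → Fin n → Fin n → Fin n → Fin n → ℂ)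
    (z : EuclideanSpace ℂ (Fin n)) : poly32 (sym32 b) z = poly32 b z := by
  have h1 : ∀ b : Fin n → Fin n → Fin n → Fin n → Fin n → ℂ,
      poly32 (fun i j k l m => (1 / 6 : ℂ) * (((((b i j k l m + b i k j l m) + b j i k l m) +
        b j k i l m) + b k i j l m) + b k j i l m)) z = poly32 b z := by
    intro b
    have e₁ : poly32 (fun i j k l m => b k i j l m) z = poly32 b z :=
      (poly32_swap₂ (fun i j k l m => b j i k l m) z).trans (poly32_swap₁ b z)
    have e₂ : poly32 (fun i j k l m => b j k i l m) z = poly32 b z :=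
      (poly32_swap₁ (fun i j k l m => b i k j l m) z).trans (poly32_swap₂ b z)
    have e₃ : poly32 (fun i j k l m => b k j i l m) z = poly32 b z :=
      (poly32_swap₁ (fun i j k l m => b k i j l m) z).trans e₁
    rw [poly32_smul, poly32_add, poly32_add, poly32_add, poly32_add, poly32_add,
      poly32_swap₂ b, poly32_swap₁ b,
      e₁, e₂, e₃]
    ring
  have h2 : sym32 b = fun i j k l m => (1 / 2 : ℂ) * ((1 / 6 : ℂ) * (((((b i j k l m +
      b i k j l m) + b j i k l m) + b j k i l m) + b k i j l m) + b k j i l m) +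
      (1 / 6 : ℂ) * (((((b i j k m l +
      b i k j m l) + b j i k m l) + b j k i m l) + b k i j m l) + b k j i m l)) := by
    funext i j k l m
    simp only [sym32]
    ring
  rw [h2, poly32_smul, poly32_add, h1, h1 (fun i j k l m => b i j k m l), poly32_swap₃]
  ring

/-- The complex coordinate `w = u + i ‖z‖²` of the model hypersurface. -/
noncomputable def modelW (x : ParamSpace n) : ℂ := x.2 + Complex.I * (‖x.1‖ : ℂ) ^ 2

/-- Holomorphic maps that are homogeneous of weight `m`. -/
def wHol (n m : ℕ) (F : Type*) [NormedAddCommGroup F] [NormedSpace ℂ F] :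
    Submodule ℂ (CSpace n → F) where
  carrier := {f | Differentiable ℂ f ∧ ∀ (t : ℝ) (y : CSpace n),
    f ((t : ℂ) • y.1, (t : ℂ) ^ 2 * y.2) = (t : ℂ) ^ m • f y}
  add_mem' := by
    rintro f g ⟨hf, hf'⟩ ⟨hg, hg'⟩
    exact ⟨hf.add hg, fun t y => by rw [Pi.add_apply, hf', hg', Pi.add_apply, smul_add]⟩
  zero_mem' := ⟨differentiable_const _, fun t y => by simp⟩
  smul_mem' := by
    rintro c f ⟨hf, hf'⟩
    exact ⟨hf.const_smul c, fun t y => by rw [Pi.smul_apply, hf', Pi.smul_apply, smul_comm c]⟩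

/-- The terms of weight `k` that can be changed by a coordinate transformation
`(z + f, w + g)`. -/
def homSub (n k : ℕ) : Submodule ℝ (ParamSpace n → ℝ) where
  -- Pairing with z raises the weight by one, so f has weight k − 1 where g has weight k.
  carrier := {q | ∃ f ∈ wHol n (k - 1) (EuclideanSpace ℂ (Fin n)), ∃ g ∈ wHol n k ℂ,
    ∀ x, q x = 2 * (inner ℂ x.1 (f (x.1, modelW x))).re - (g (x.1, modelW x)).im}
  add_mem' := by
    rintro q q' ⟨f, hf, g, hg, h⟩ ⟨f', hf', g', hg', h'⟩
    refine ⟨f + f', Submodule.add_mem _ hf hf', g + g', Submodule.add_mem _ hg hg', fun x => ?_⟩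
    simp only [Pi.add_apply, h, h', inner_add_right, Complex.add_re, Complex.add_im]
    ring
  zero_mem' := ⟨0, Submodule.zero_mem _, 0, Submodule.zero_mem _, by simp⟩
  smul_mem' := by
    rintro c q ⟨f, hf, g, hg, h⟩
    refine ⟨(c : ℂ) • f, Submodule.smul_mem _ _ hf, (c : ℂ) • g, Submodule.smul_mem _ _ hg,
      fun x => ?_⟩
    simp only [Pi.smul_apply, smul_eq_mul, h, inner_smul_right, Complex.re_ofReal_mul,
      Complex.im_ofReal_mul]
    ring

/-- The monomials generating `triSpan`. -/
noncomputable def mono (i : ℕ × ℕ × ℕ) (s : Fin i.1 → Fin n) (t : Fin i.2.1 → Fin n)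
    (x : ParamSpace n) : ℂ :=
  (∏ k, x.1 (s k)) * (∏ k, conj (x.1 (t k))) * (x.2 : ℂ) ^ i.2.2

lemma mono_mem (i : ℕ × ℕ × ℕ) (s : Fin i.1 → Fin n) (t : Fin i.2.1 → Fin n) :
    mono i s t ∈ triSpan n i := Submodule.subset_span ⟨(s, t), rfl⟩

/-- Types are complex spans while taking real parts is only real linear; allowing an arbitrary
complex factor c makes the induction over the span work. -/
lemma re_mem_of_mono {S : Submodule ℝ (ParamSpace n → ℝ)} {i : ℕ × ℕ × ℕ}
    (h : ∀ (c : ℂ) s t, (fun x => (c * mono i s t x).re) ∈ S) {f : ParamSpace n → ℂ}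
    (hf : f ∈ triSpan n i) : (fun x => (f x).re) ∈ S := by
  have key : ∀ c : ℂ, (fun x => (c * f x).re) ∈ S := by
    refine Submodule.span_induction (p := fun f _ => ∀ c : ℂ, (fun x => (c * f x).re) ∈ S)
      ?_ ?_ ?_ ?_ hf
    · rintro _ ⟨st, rfl⟩ c
      exact h c st.1 st.2
    · intro c
      simp only [Pi.zero_apply, mul_zero, Complex.zero_re]
      exact Submodule.zero_mem S
    · intro f g _ _ hf hg c
      simpa [mul_add] using! Submodule.add_mem S (hf c) (hg c)
    · intro d f _ hf c
      simpa [mul_assoc] using hf (c * d)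
  simpa using key 1

/-- The holomorphic monomial `z_{s 1} ⋯ z_{s a} w^c`. -/
noncomputable def hmono {a : ℕ} (s : Fin a → Fin n) (c : ℕ) (y : CSpace n) : ℂ :=
  (∏ k, y.1 (s k)) * y.2 ^ c

lemma hmono_mem {a : ℕ} (s : Fin a → Fin n) (c : ℕ) : hmono s c ∈ wHol n (a + 2 * c) ℂ := by
  refine ⟨?_, fun t y => ?_⟩
  · refine Differentiable.mul ?_ (differentiable_snd.pow _)
    have h : ContDiff ℂ 1 fun y : CSpace n => ∏ k, y.1 (s k) :=
      contDiff_prod (f := fun k (y : CSpace n) => y.1 (s k)) fun k _ =>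
        (EuclideanSpace.proj (𝕜 := ℂ) (s k)).contDiff.comp contDiff_fst
    exact h.differentiable (by simp)
  · simp only [hmono, PiLp.smul_apply, smul_eq_mul, Finset.prod_mul_distrib, Finset.prod_const,
      Finset.card_univ, Fintype.card_fin]
    ring

lemma single_mem {m : ℕ} {g : CSpace n → ℂ} (hg : g ∈ wHol n m ℂ) (t : Fin n) :
    (fun y => EuclideanSpace.single t (g y)) ∈ wHol n m (EuclideanSpace ℂ (Fin n)) := by
  have h : ∀ c : ℂ, EuclideanSpace.single t c = c • EuclideanSpace.single t (1 : ℂ) := fun c => by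
    ext j; simp [PiLp.single_apply]
  refine ⟨?_, fun r y => ?_⟩
  · have : Differentiable ℂ fun y => g y • EuclideanSpace.single t (1 : ℂ) :=
      hg.1.smul_const _
    simpa only [← h] using this
  · change EuclideanSpace.single t (g _) = _ • EuclideanSpace.single t (g y)
    rw [hg.2, h, h (g y), smul_smul, smul_eq_mul]

/-- Only w is moved, by −ig, since −Im(−ig) = Re g. -/
lemma im_mem_homSub {k : ℕ} {g : CSpace n → ℂ} (hg : g ∈ wHol n k ℂ) :
    (fun x : ParamSpace n => (g (x.1, modelW x)).re) ∈ homSub n k := by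
  refine ⟨0, Submodule.zero_mem _, (-Complex.I) • g, Submodule.smul_mem _ _ hg, fun x => ?_⟩
  simp

/-- Only the coordinate z_t is moved, by g/2; the half compensates the factor in 2 Re⟨z, f⟩. -/
lemma conj_mul_mem_homSub {k : ℕ} {g : CSpace n → ℂ} (hg : g ∈ wHol n k ℂ) (t : Fin n) :
    (fun x : ParamSpace n => (conj (x.1 t) * g (x.1, modelW x)).re) ∈ homSub n (k + 1) := by
  refine ⟨fun y => EuclideanSpace.single t (((1 / 2 : ℂ) • g) y),
    single_mem (Submodule.smul_mem _ _ hg) t, 0, Submodule.zero_mem _, fun x => ?_⟩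
  have : inner ℂ x.1 (EuclideanSpace.single t (((1 / 2 : ℂ) • g) (x.1, modelW x))) =
      (1 / 2 : ℝ) * (conj (x.1 t) * g (x.1, modelW x)) := by
    rw [EuclideanSpace.inner_single_right]
    simp
    ring
  rw [this, Complex.re_ofReal_mul]
  simp

lemma norm_sq_eq_sum (z : EuclideanSpace ℂ (Fin n)) :
    (‖z‖ : ℂ) ^ 2 = ∑ j, z j * conj (z j) := by
  rw [← Complex.ofReal_pow, EuclideanSpace.norm_sq_eq, Complex.ofReal_sum]
  exact Finset.sum_congr rfl fun j _ => by rw [Complex.mul_conj, Complex.normSq_eq_norm_sq]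

lemma triSpan_mul_normSq {a b c : ℕ} {f : ParamSpace n → ℂ} (hf : f ∈ triSpan n (a, b, c)) :
    (fun x => (‖x.1‖ : ℂ) ^ 2 * f x) ∈ triSpan n (a + 1, b + 1, c) := by
  have h : ∀ j ∈ (Finset.univ : Finset (Fin n)), (fun x : ParamSpace n =>
      x.1 j * (conj (x.1 j) * f x)) ∈ triSpan n (a + 1, b + 1, c) := fun j _ =>
    triSpan_mul_coord (triSpan_mul_conj_coord hf j) j
  convert Submodule.sum_mem _ h using 1
  funext x
  simp only [norm_sq_eq_sum, Finset.sum_mul, Finset.sum_apply, mul_assoc]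

/-- The monomial `z_{s 1} ⋯ z_{s a}`. -/
noncomputable def zmono {a : ℕ} (s : Fin a → Fin n) (x : ParamSpace n) : ℂ := ∏ k, x.1 (s k)

lemma zmono_mem {a : ℕ} (s : Fin a → Fin n) : zmono s ∈ triSpan n (a, 0, 0) := by
  have h := mono_mem (n := n) (a, 0, 0) s Fin.elim0
  have h' : mono (n := n) (a, 0, 0) s Fin.elim0 = zmono s := by
    funext x; simp [mono, zmono]
  rwa [h'] at h

lemma hmono_eq {a : ℕ} (s : Fin a → Fin n) (c : ℕ) (x : ParamSpace n) :
    hmono s c (x.1, modelW x) = zmono s x * modelW x ^ c := rfl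

lemma re_mem_of_zmono {S : Submodule ℝ (ParamSpace n → ℝ)} {a c : ℕ}
    (h : ∀ (d : ℂ) (s : Fin a → Fin n), (fun x => (d * (zmono s x * (x.2 : ℂ) ^ c)).re) ∈ S)
    {f : ParamSpace n → ℂ} (hf : f ∈ triSpan n (a, 0, c)) : (fun x => (f x).re) ∈ S := by
  refine re_mem_of_mono (fun d s t => ?_) hf
  have : mono (a, 0, c) s t = fun x => zmono s x * (x.2 : ℂ) ^ c := by
    funext x; simp [mono, zmono]
  rw [this]
  exact h d s

lemma re_mem_of_zmono_conj {S : Submodule ℝ (ParamSpace n → ℝ)} {a c : ℕ}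
    (h : ∀ (d : ℂ) (s : Fin a → Fin n) (t : Fin n),
      (fun x => (d * (zmono s x * conj (x.1 t) * (x.2 : ℂ) ^ c)).re) ∈ S)
    {f : ParamSpace n → ℂ} (hf : f ∈ triSpan n (a, 1, c)) : (fun x => (f x).re) ∈ S := by
  refine re_mem_of_mono (fun d s t => ?_) hf
  have : mono (a, 1, c) s t = fun x => zmono s x * conj (x.1 (t 0)) * (x.2 : ℂ) ^ c := by
    funext x
    rw [mono, zmono]
    congr 2
    exact Fin.prod_univ_one _
  rw [this]
  exact h d s (t 0)

lemma zmono_conj_mem {a : ℕ} (s : Fin a → Fin n) (t : Fin n) :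
    (fun x => conj (x.1 t) * zmono s x) ∈ triSpan n (a, 1, 0) :=
  triSpan_mul_conj_coord (zmono_mem s) t

lemma zmono_u_mem {a : ℕ} (s : Fin a → Fin n) :
    (fun x => (x.2 : ℂ) * zmono s x) ∈ triSpan n (a, 0, 1) :=
  triSpan_mul_real (zmono_mem s)

lemma zmono_normSq_mem {a : ℕ} (s : Fin a → Fin n) :
    (fun x => (‖x.1‖ : ℂ) ^ 2 * zmono s x) ∈ triSpan n (a + 1, 1, 0) :=
  triSpan_mul_normSq (zmono_mem s)

lemma zmono_normSq_sq_mem {a : ℕ} (s : Fin a → Fin n) :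
    (fun x => (‖x.1‖ : ℂ) ^ 2 * ((‖x.1‖ : ℂ) ^ 2 * zmono s x)) ∈ triSpan n (a + 2, 2, 0) :=
  triSpan_mul_normSq (zmono_normSq_mem s)

lemma zmono_conj_normSq_mem {a : ℕ} (s : Fin a → Fin n) (t : Fin n) :
    (fun x => (‖x.1‖ : ℂ) ^ 2 * (conj (x.1 t) * zmono s x)) ∈ triSpan n (a + 1, 2, 0) :=
  triSpan_mul_normSq (zmono_conj_mem s t)

lemma zmono_u_normSq_mem {a : ℕ} (s : Fin a → Fin n) :
    (fun x => (‖x.1‖ : ℂ) ^ 2 * ((x.2 : ℂ) * zmono s x)) ∈ triSpan n (a + 1, 1, 1) :=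
  triSpan_mul_normSq (zmono_u_mem s)

lemma re_mem_holo {a : ℕ} {f : ParamSpace n → ℂ} (hf : f ∈ triSpan n (a, 0, 0)) :
    (fun x => (f x).re) ∈ homSub n a := by
  refine re_mem_of_zmono (fun c s => ?_) hf
  have := im_mem_homSub (Submodule.smul_mem _ c (hmono_mem s 0))
  simpa [hmono_eq] using this

lemma re_mem_one {a : ℕ} {f : ParamSpace n → ℂ} (hf : f ∈ triSpan n (a, 1, 0)) :
    (fun x => (f x).re) ∈ homSub n (a + 1) := by
  refine re_mem_of_zmono_conj (fun c s t => ?_) hf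
  have h := conj_mul_mem_homSub (Submodule.smul_mem _ c (hmono_mem s 0)) t
  refine cast (congrArg (· ∈ homSub n (a + 1)) ?_) h
  funext x
  simp only [hmono_eq, Pi.smul_apply, smul_eq_mul]
  congr 1
  ring

/-- On the model u = w − i‖z‖², so the monomial times u is holomorphic up to a term of type (a + 1,
1, 0), which is removable by `re_mem_one`. -/
lemma re_mem_holo_u {a : ℕ} {f : ParamSpace n → ℂ} (hf : f ∈ triSpan n (a, 0, 1)) :
    (fun x => (f x).re) ∈ homSub n (a + 2) := by
  refine re_mem_of_zmono (fun c s => ?_) hf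
  have h1 := im_mem_homSub (Submodule.smul_mem _ c (hmono_mem s 1))
  have h2 := re_mem_one (Submodule.smul_mem _ (c * Complex.I) (zmono_normSq_mem s))
  refine cast (congrArg (· ∈ homSub n (a + 2)) ?_) (Submodule.sub_mem _ h1 h2)
  funext x
  simp only [hmono_eq, Pi.smul_apply, smul_eq_mul, Pi.sub_apply, ← Complex.sub_re]
  rw [modelW]
  congr 1
  ring

/-- Again u = w − i‖z‖², but the correction now has type (a + 1, 2, 0), which in weights 4 and 5
meets the normal terms; hence the larger space S. The numbers k and d enter through equations so
that the numerals of the applications fit. -/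
lemma re_mem_one_u {a d k : ℕ} {S : Submodule ℝ (ParamSpace n → ℝ)} (hk : k = a + 3)
    (hd : d = a + 1) (hS : homSub n k ≤ S)
    (h22 : ∀ f ∈ triSpan n (d, 2, 0), (fun x => (f x).re) ∈ S)
    {f : ParamSpace n → ℂ} (hf : f ∈ triSpan n (a, 1, 1)) :
    (fun x => (f x).re) ∈ S := by
  subst hk hd
  refine re_mem_of_zmono_conj (fun c s t => ?_) hf
  have h1 := hS (conj_mul_mem_homSub (Submodule.smul_mem _ c (hmono_mem s 1)) t)
  have h2 := h22 _ (Submodule.smul_mem _ (c * Complex.I) (zmono_conj_normSq_mem s t))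
  refine cast (congrArg (· ∈ S) ?_) (Submodule.sub_mem _ h1 h2)
  funext x
  simp only [hmono_eq, Pi.smul_apply, smul_eq_mul, Pi.sub_apply, ← Complex.sub_re]
  rw [modelW]
  congr 1
  ring

/-- On the model u² = w² − 2iu‖z‖² + ‖z‖⁴, with corrections of types (a + 1, 1, 1) and (a + 2, 2,
0). -/
lemma re_mem_holo_u_sq {a d k : ℕ} {S : Submodule ℝ (ParamSpace n → ℝ)} (hk : k = a + 4)
    (hd : d = a + 2) (hS : homSub n k ≤ S)
    (h22 : ∀ f ∈ triSpan n (d, 2, 0), (fun x => (f x).re) ∈ S)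
    {f : ParamSpace n → ℂ} (hf : f ∈ triSpan n (a, 0, 2)) :
    (fun x => (f x).re) ∈ S := by
  subst hk hd
  refine re_mem_of_zmono (fun c s => ?_) hf
  have h1 := hS (im_mem_homSub (Submodule.smul_mem _ c (hmono_mem s 2)))
  have h2 := re_mem_one_u (a := a + 1) rfl rfl hS h22
    (Submodule.smul_mem _ (2 * c * Complex.I) (zmono_u_normSq_mem s))
  have h3 := h22 _ (Submodule.smul_mem _ c (zmono_normSq_sq_mem s))
  refine cast (congrArg (· ∈ S) ?_) (Submodule.add_mem _ (Submodule.sub_mem _ h1 h2) h3)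
  funext x
  simp only [hmono_eq, Pi.smul_apply, smul_eq_mul, Pi.sub_apply, Pi.add_apply,
    ← Complex.sub_re, ← Complex.add_re]
  rw [modelW]
  congr 1
  linear_combination (c * zmono s x * (‖x.1‖ : ℂ) ^ 4) * Complex.I_sq

lemma re_mem_swap {S : Submodule ℝ (ParamSpace n → ℝ)} {a b c : ℕ}
    (h : ∀ f ∈ triSpan n (b, a, c), (fun x => (f x).re) ∈ S)
    {f : ParamSpace n → ℂ} (hf : f ∈ triSpan n (a, b, c)) : (fun x => (f x).re) ∈ S := by
  simpa using h _ (triSpan_conj hf)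

lemma exists_poly22 {f : ParamSpace n → ℂ} (hf : f ∈ triSpan n (2, 2, 0)) :
    ∃ a, ∀ x, f x = poly22 a x.1 := by
  refine Submodule.span_induction (p := fun f _ => ∃ a, ∀ x, f x = poly22 a x.1) ?_ ?_ ?_ ?_ hf
  · rintro _ ⟨⟨s, t⟩, rfl⟩
    refine ⟨fun i j k l => if i = s 0 then if j = s 1 then if k = t 0 then if l = t 1 then 1
      else 0 else 0 else 0 else 0, fun x => ?_⟩
    have h1 : ∏ k, x.1 (s k) = x.1 (s 0) * x.1 (s 1) := Fin.prod_univ_two _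
    have h2 : ∏ k, conj (x.1 (t k)) = conj (x.1 (t 0)) * conj (x.1 (t 1)) := Fin.prod_univ_two _
    simp only [h1, h2, poly22, ite_mul, zero_mul, one_mul, Finset.sum_ite_irrel,
      Finset.sum_const_zero, Finset.sum_ite_eq', Finset.mem_univ, if_true, pow_zero, mul_one]
    ring
  · exact ⟨0, fun x => by simp [poly22]⟩
  · rintro f g _ _ ⟨a, ha⟩ ⟨a', ha'⟩
    exact ⟨_, fun x => by rw [Pi.add_apply, ha, ha', ← poly22_add]⟩
  · rintro c f _ ⟨a, ha⟩
    exact ⟨_, fun x => by rw [Pi.smul_apply, ha, smul_eq_mul, ← poly22_smul]⟩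

lemma exists_poly32 {f : ParamSpace n → ℂ} (hf : f ∈ triSpan n (3, 2, 0)) :
    ∃ b, ∀ x, f x = poly32 b x.1 := by
  refine Submodule.span_induction (p := fun f _ => ∃ b, ∀ x, f x = poly32 b x.1) ?_ ?_ ?_ ?_ hf
  · rintro _ ⟨⟨s, t⟩, rfl⟩
    refine ⟨fun i j k l m => if i = s 0 then if j = s 1 then if k = s 2 then if l = t 0 then
      if m = t 1 then 1 else 0 else 0 else 0 else 0 else 0, fun x => ?_⟩
    have h1 : ∏ k, x.1 (s k) = x.1 (s 0) * x.1 (s 1) * x.1 (s 2) := Fin.prod_univ_three _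
    have h2 : ∏ k, conj (x.1 (t k)) = conj (x.1 (t 0)) * conj (x.1 (t 1)) := Fin.prod_univ_two _
    simp only [h1, h2, poly32, ite_mul, zero_mul, one_mul, Finset.sum_ite_irrel,
      Finset.sum_const_zero, Finset.sum_ite_eq', Finset.mem_univ, if_true, pow_zero, mul_one]
    ring
  · exact ⟨0, fun x => by simp [poly32]⟩
  · rintro f g _ _ ⟨a, ha⟩ ⟨a', ha'⟩
    exact ⟨_, fun x => by rw [Pi.add_apply, ha, ha', ← poly32_add]⟩
  · rintro c f _ ⟨a, ha⟩
    exact ⟨_, fun x => by rw [Pi.smul_apply, ha, smul_eq_mul, ← poly32_smul]⟩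

/-- The real parts of normal polynomials of bidegree `(2, 2)`. -/
def nor22 (n : ℕ) : Submodule ℝ (ParamSpace n → ℝ) where
  carrier := {q | ∃ a, IsNormal22 a ∧ ∀ x, q x = (poly22 a x.1).re}
  add_mem' := by
    rintro q q' ⟨a, ha, h⟩ ⟨a', ha', h'⟩
    refine ⟨fun i j k l => a i j k l + a' i j k l, ⟨?_, ?_, ?_, ?_⟩, fun x => ?_⟩
    · intro i j k l; rw [ha.symm_left, ha'.symm_left]
    · intro i j k l; rw [ha.symm_right, ha'.symm_right]
    · intro i j k l; rw [ha.real, ha'.real, map_add]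
    · intro i k; rw [Finset.sum_add_distrib, ha.trace_eq_zero, ha'.trace_eq_zero, add_zero]
    · rw [poly22_add, Pi.add_apply, h, h', Complex.add_re]
  zero_mem' := ⟨0, ⟨by simp, by simp, by simp, by simp⟩, fun x => by simp [poly22]⟩
  smul_mem' := by
    rintro c q ⟨a, ha, h⟩
    refine ⟨fun i j k l => c * a i j k l, ⟨?_, ?_, ?_, ?_⟩, fun x => ?_⟩
    · intro i j k l; rw [ha.symm_left]
    · intro i j k l; rw [ha.symm_right]
    · intro i j k l; rw [ha.real, map_mul, Complex.conj_ofReal]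
    · intro i k; rw [← Finset.mul_sum, ha.trace_eq_zero, mul_zero]
    · rw [poly22_smul, Pi.smul_apply, h, Complex.re_ofReal_mul, smul_eq_mul]

/-- Twice the real parts of normal polynomials of bidegree `(3, 2)`. -/
def nor32 (n : ℕ) : Submodule ℝ (ParamSpace n → ℝ) where
  carrier := {q | ∃ b, IsNormal32 b ∧ ∀ x, q x = 2 * (poly32 b x.1).re}
  add_mem' := by
    rintro q q' ⟨a, ha, h⟩ ⟨a', ha', h'⟩
    refine ⟨fun i j k l m => a i j k l m + a' i j k l m, ⟨?_, ?_, ?_, ?_⟩, fun x => ?_⟩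
    · intro i j k l m; rw [ha.symm_left₁, ha'.symm_left₁]
    · intro i j k l m; rw [ha.symm_left₂, ha'.symm_left₂]
    · intro i j k l m; rw [ha.symm_right, ha'.symm_right]
    · intro i
      simp only [Finset.sum_add_distrib, ha.trace_trace_eq_zero, ha'.trace_trace_eq_zero, add_zero]
    · rw [poly32_add, Pi.add_apply, h, h', Complex.add_re]; ring
  zero_mem' := ⟨0, ⟨by simp, by simp, by simp, by simp⟩, fun x => by simp [poly32]⟩
  smul_mem' := by
    rintro c q ⟨a, ha, h⟩
    refine ⟨fun i j k l m => c * a i j k l m, ⟨?_, ?_, ?_, ?_⟩, fun x => ?_⟩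
    · intro i j k l m; rw [ha.symm_left₁]
    · intro i j k l m; rw [ha.symm_left₂]
    · intro i j k l m; rw [ha.symm_right]
    · intro i
      simp only [← Finset.mul_sum, ha.trace_trace_eq_zero, mul_zero]
    · rw [poly32_smul, Pi.smul_apply, h, Complex.re_ofReal_mul, smul_eq_mul]; ring

/-- Coefficients of `‖z‖² ∑ K_{ik} z_i z̄_k` before symmetrization. -/
def base22 (K : Fin n → Fin n → ℂ) (i j k l : Fin n) : ℂ := if j = l then K i k else 0

lemma poly22_base22 (K : Fin n → Fin n → ℂ) (z : EuclideanSpace ℂ (Fin n)) :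
    poly22 (base22 K) z = (∑ i, ∑ k, K i k * (z i * conj (z k))) * (‖z‖ : ℂ) ^ 2 := by
  simp only [poly22, base22, ite_mul, zero_mul, Finset.sum_ite_eq, Finset.mem_univ, if_true]
  rw [norm_sq_eq_sum, Finset.sum_mul]
  refine Finset.sum_congr rfl fun i _ => ?_
  rw [Finset.sum_comm, Finset.sum_mul]
  refine Finset.sum_congr rfl fun k _ => ?_
  rw [Finset.mul_sum]
  exact Finset.sum_congr rfl fun j _ => by ring

/-- The four arrangements of K ⊗ δ contract to nK, K, K and (tr K)δ. -/
lemma trace_sym22_base22 (K : Fin n → Fin n → ℂ) (i k : Fin n) :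
    ∑ j, sym22 (base22 K) i j k j = ((n + 2) * K i k + if i = k then ∑ j, K j j else 0) / 4 := by
  simp only [sym22, base22, ← Finset.sum_div, Finset.sum_add_distrib]
  congr 1
  simp only [if_true, Finset.sum_const, Finset.card_univ, Fintype.card_fin, nsmul_eq_mul,
    Finset.sum_ite_eq, Finset.sum_ite_eq', Finset.mem_univ, Finset.sum_ite_irrel]
  ring_nf

lemma sym22_real {a : Fin n → Fin n → Fin n → Fin n → ℂ}
    (h : ∀ i j k l, a k l i j = conj (a i j k l)) (i j k l : Fin n) :
    sym22 a k l i j = conj (sym22 a i j k l) := by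
  have h' : ∀ i j k l, conj (a i j k l) = a k l i j := fun i j k l => (h i j k l).symm
  simp only [sym22, map_div₀, map_add, h', map_ofNat]
  ring

/-- The trace decomposition: a real (2,2) polynomial is a trace-free one plus ‖z‖² times a Hermitian
form, and the latter product is removable. -/
lemma re_mem_22 {f : ParamSpace n → ℂ} (hf : f ∈ triSpan n (2, 2, 0)) :
    (fun x => (f x).re) ∈ homSub n 4 ⊔ nor22 n := by
  obtain ⟨a₀, ha₀⟩ := exists_poly22 hf
  -- Hermitian symmetrization replaces the polynomial by its real part, the only thing that matters
  -- here.
  let a₁ : Fin n → Fin n → Fin n → Fin n → ℂ := fun i j k l =>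
    (1 / 2 : ℂ) * (a₀ i j k l + conj (a₀ k l i j))
  have hreal₁ : ∀ i j k l, a₁ k l i j = conj (a₁ i j k l) := by
    intro i j k l
    simp only [a₁, map_mul, map_add, Complex.conj_conj, map_div₀, map_one, map_ofNat]
    ring
  let a₂ := sym22 a₁
  have hpoly₂ : ∀ z, poly22 a₂ z = ((poly22 a₀ z).re : ℂ) := by
    intro z
    rw [poly22_sym22, poly22_smul, poly22_add, poly22_conj, Complex.re_eq_add_conj]
    ring
  have hreal₂ := sym22_real hreal₁
  let T : Fin n → Fin n → ℂ := fun i k => ∑ j, a₂ i j k j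
  have hT : ∀ i k, T k i = conj (T i k) := by
    intro i k
    simp only [T, map_sum]
    exact Finset.sum_congr rfl fun j _ => hreal₂ _ _ _ _
  -- The subtracted part must have trace T, that is, (n + 2)K + (tr K)δ = 4T. Taking traces gives tr
  -- K = 2 tr T/(n + 1) = τ, and then K.
  let τ : ℂ := 2 / (n + 1) * ∑ j, T j j
  have hτ : conj τ = τ := by
    simp only [τ, map_mul, map_div₀, map_add, map_one, map_ofNat, map_natCast, map_sum, ← hT]
  let K : Fin n → Fin n → ℂ := fun i k => (4 * T i k - if i = k then τ else 0) / (n + 2)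
  have hn1 : (n + 1 : ℂ) ≠ 0 := by exact_mod_cast Nat.succ_ne_zero n
  have hn2 : (n + 2 : ℂ) ≠ 0 := by exact_mod_cast Nat.succ_ne_zero (n + 1)
  have hK : ∀ i k, K k i = conj (K i k) := by
    intro i k
    simp only [K, map_div₀, map_sub, map_mul, map_add, map_ofNat, map_natCast, ← hT,
      apply_ite conj, hτ, map_zero, eq_comm (a := i)]
  have htrK : ∑ j, K j j = τ := by
    simp only [K, if_true, ← Finset.sum_div, Finset.sum_sub_distrib, ← Finset.mul_sum,
      Finset.sum_const, Finset.card_univ, Fintype.card_fin, nsmul_eq_mul]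
    simp only [τ]
    field_simp
    ring
  let a₃ : Fin n → Fin n → Fin n → Fin n → ℂ := fun i j k l =>
    a₂ i j k l + (-1) * sym22 (base22 K) i j k l
  have hbreal : ∀ i j k l, base22 K k l i j = conj (base22 K i j k l) := by
    intro i j k l
    simp only [base22, hK i k, apply_ite conj, map_zero, eq_comm (a := j)]
  have hnorm : IsNormal22 a₃ := by
    refine ⟨?_, ?_, ?_, ?_⟩
    · intro i j k l; simp only [a₃, a₂, sym22]; ring
    · intro i j k l; simp only [a₃, a₂, sym22]; ring
    · intro i j k l
      simp only [a₃, a₂, sym22_real hreal₁ i j, sym22_real hbreal i j, map_add, map_mul, map_neg,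
        map_one]
    · intro i k
      simp only [a₃, Finset.sum_add_distrib, ← Finset.mul_sum, trace_sym22_base22, htrK]
      change T i k + _ = 0
      simp only [K]
      field_simp
      ring
  have hK0 : ∀ z : EuclideanSpace ℂ (Fin n),
      (∑ i, ∑ k, K i k * (z i * conj (z k))).im = 0 := by
    intro z
    rw [← Complex.conj_eq_iff_im]
    simp only [map_sum, map_mul, Complex.conj_conj, ← hK]
    rw [Finset.sum_comm]
    exact Finset.sum_congr rfl fun i _ => Finset.sum_congr rfl fun k _ => by ring
  -- As K is Hermitian, K(z, z̄) is real and Re(−iK(z, z̄)w) = ‖z‖²K(z, z̄) on the model. So this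
  -- term is produced by an f that is w times a linear map of z.
  have hmem : (fun x : ParamSpace n => (poly22 (base22 K) x.1).re) ∈ homSub n 4 := by
    have h1 : ∀ i ∈ (Finset.univ : Finset (Fin n)), ∀ k ∈ (Finset.univ : Finset (Fin n)),
        (fun x : ParamSpace n => (conj (x.1 k) * ((-Complex.I * K i k) •
          hmono (fun _ : Fin 1 => i) 1) (x.1, modelW x)).re) ∈ homSub n 4 := fun i _ k _ =>
      conj_mul_mem_homSub (Submodule.smul_mem _ _ (hmono_mem (fun _ : Fin 1 => i) 1)) k
    have h2 := Submodule.sum_mem _ fun i hi => Submodule.sum_mem _ fun k hk => h1 i hi k hk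
    refine cast (congrArg (· ∈ homSub n 4) ?_) h2
    funext x
    have h3 : (∑ i, ∑ k, conj (x.1 k) * ((-Complex.I * K i k) •
          hmono (fun _ : Fin 1 => i) 1) (x.1, modelW x)) =
        -Complex.I * (∑ i, ∑ k, K i k * (x.1 i * conj (x.1 k))) * modelW x := by
      simp only [Finset.mul_sum, Finset.sum_mul]
      refine Finset.sum_congr rfl fun i _ => Finset.sum_congr rfl fun k _ => ?_
      simp only [Pi.smul_apply, smul_eq_mul, hmono, Fin.prod_univ_one]
      ring
    simp only [Finset.sum_apply, ← Complex.re_sum]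
    rw [h3, poly22_base22, ← Complex.re_add_im (∑ i, ∑ k, K i k * (x.1 i * conj (x.1 k))),
      hK0 x.1, modelW, ← Complex.ofReal_pow]
    simp
  have hsum : (fun x : ParamSpace n => (f x).re) =
      (fun x => (poly22 (base22 K) x.1).re) + fun x => (poly22 a₃ x.1).re := by
    funext x
    simp only [Pi.add_apply, a₃, poly22_add, poly22_smul, poly22_sym22, ha₀, hpoly₂,
      Complex.add_re, Complex.ofReal_re]
    simp
  rw [hsum]
  exact Submodule.add_mem_sup hmem ⟨a₃, hnorm, fun x => rfl⟩

/-- Coefficients of `‖z‖⁴ ∑ m_i z_i` before symmetrization. -/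
def base32 (m : Fin n → ℂ) (i j k l p : Fin n) : ℂ :=
  if j = l then if k = p then m i else 0 else 0

lemma poly32_base32 (m : Fin n → ℂ) (z : EuclideanSpace ℂ (Fin n)) :
    poly32 (base32 m) z = (∑ i, m i * z i) * (‖z‖ : ℂ) ^ 4 := by
  have h : (‖z‖ : ℂ) ^ 4 = (‖z‖ : ℂ) ^ 2 * (‖z‖ : ℂ) ^ 2 := by ring
  simp only [poly32, base32, ite_mul, zero_mul, Finset.sum_ite_irrel, Finset.sum_const_zero,
    Finset.sum_ite_eq, Finset.mem_univ, if_true]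
  rw [h, norm_sq_eq_sum, Finset.sum_mul]
  refine Finset.sum_congr rfl fun i _ => ?_
  rw [Finset.sum_mul_sum, Finset.mul_sum]
  refine Finset.sum_congr rfl fun j _ => ?_
  rw [Finset.mul_sum]
  exact Finset.sum_congr rfl fun k _ => by ring

/-- Of the twelve arrangements, those in which m carries the free index contribute 2n(n + 1)m in
total and those in which it carries a contracted one 4(n + 1)m. -/
lemma trace_sym32_base32 (m : Fin n → ℂ) (i : Fin n) :
    ∑ j, ∑ k, sym32 (base32 m) i j k j k = (n + 1) * (n + 2) / 6 * m i := by
  simp only [sym32, base32, ← Finset.sum_div, Finset.sum_add_distrib]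
  simp only [if_true, Finset.sum_const, Finset.card_univ, Fintype.card_fin, nsmul_eq_mul,
    Finset.sum_ite_eq, Finset.sum_ite_eq', Finset.mem_univ, Finset.sum_ite_irrel, mul_ite, mul_zero]
  ring

/-- A (3,2) polynomial is one with vanishing double trace plus ‖z‖⁴ times a linear form μ, and the
real part of the latter product is removable. -/
lemma re_mem_32 {f : ParamSpace n → ℂ} (hf : f ∈ triSpan n (3, 2, 0)) :
    (fun x => (f x).re) ∈ homSub n 5 ⊔ nor32 n := by
  obtain ⟨b₀, hb₀⟩ := exists_poly32 hf
  let b₁ := sym32 b₀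
  let T : Fin n → ℂ := fun i => ∑ j, ∑ k, b₁ i j k j k
  let m : Fin n → ℂ := fun i => 6 / ((n + 1) * (n + 2)) * T i
  have hn1 : (n + 1 : ℂ) ≠ 0 := by exact_mod_cast Nat.succ_ne_zero n
  have hn2 : (n + 2 : ℂ) ≠ 0 := by exact_mod_cast Nat.succ_ne_zero (n + 1)
  -- The factor 1/2 matches the normalization 2 Re N₃₂ of the normal part.
  let b₂ : Fin n → Fin n → Fin n → Fin n → Fin n → ℂ := fun i j k l p =>
    (1 / 2 : ℂ) * (b₁ i j k l p + (-1) * sym32 (base32 m) i j k l p)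
  have hnorm : IsNormal32 b₂ := by
    refine ⟨?_, ?_, ?_, ?_⟩
    · intro i j k l p; simp only [b₂, b₁, sym32]; ring
    · intro i j k l p; simp only [b₂, b₁, sym32]; ring
    · intro i j k l p; simp only [b₂, b₁, sym32]; ring
    · intro i
      simp only [b₂, ← Finset.mul_sum, Finset.sum_add_distrib, trace_sym32_base32]
      change 1 / 2 * (T i + _) = 0
      simp only [m]
      field_simp
      ring
  let μ : EuclideanSpace ℂ (Fin n) → ℂ := fun z => ∑ i, m i * z i
  -- For w = u + i‖z‖² the combination 2μ̄w² + 8i‖z‖²μw − 2μw² has real part −8‖z‖⁴ Re μ, all terms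
  -- with u cancelling. The first two summands are contributions of f, the last one of g.
  have hmem : (fun x : ParamSpace n => (poly32 (base32 m) x.1).re) ∈ homSub n 5 := by
    have h1 : ∀ i ∈ (Finset.univ : Finset (Fin n)),
        (fun x : ParamSpace n => (conj (x.1 i) * ((2 * conj (m i)) •
          hmono (fun k : Fin 0 => k.elim0) 2) (x.1, modelW x)).re) ∈ homSub n 5 := fun i _ =>
      conj_mul_mem_homSub (Submodule.smul_mem _ _ (hmono_mem _ 2)) i
    have h2 : ∀ i ∈ (Finset.univ : Finset (Fin n)), ∀ j ∈ (Finset.univ : Finset (Fin n)),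
        (fun x : ParamSpace n => (conj (x.1 j) * ((8 * Complex.I * m i) •
          hmono ![i, j] 1) (x.1, modelW x)).re) ∈ homSub n 5 := fun i _ j _ =>
      conj_mul_mem_homSub (Submodule.smul_mem _ _ (hmono_mem _ 1)) j
    have h3 : ∀ i ∈ (Finset.univ : Finset (Fin n)),
        (fun x : ParamSpace n => (((-2 * m i) • hmono (fun _ : Fin 1 => i) 2)
          (x.1, modelW x)).re) ∈ homSub n 5 := fun i _ =>
      im_mem_homSub (Submodule.smul_mem _ _ (hmono_mem _ 2))
    have h4 := Submodule.add_mem _ (Submodule.add_mem _ (Submodule.sum_mem _ h1)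
      (Submodule.sum_mem _ fun i hi => Submodule.sum_mem _ fun j hj => h2 i hi j hj))
      (Submodule.sum_mem _ h3)
    have h5 := Submodule.smul_mem _ (-1 / 8 : ℝ) h4
    refine cast (congrArg (· ∈ homSub n 5) ?_) h5
    funext x
    have e1 : (∑ i, conj (x.1 i) * ((2 * conj (m i)) •
          hmono (fun k : Fin 0 => k.elim0) 2) (x.1, modelW x)) =
        2 * conj (μ x.1) * modelW x ^ 2 := by
      simp only [μ, Finset.mul_sum, Finset.sum_mul, map_sum, map_mul]
      refine Finset.sum_congr rfl fun i _ => ?_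
      simp only [Pi.smul_apply, smul_eq_mul, hmono, Finset.univ_eq_empty, Finset.prod_empty]
      ring
    have e2 : (∑ i, ∑ j, conj (x.1 j) * ((8 * Complex.I * m i) •
          hmono ![i, j] 1) (x.1, modelW x)) =
        8 * Complex.I * μ x.1 * (‖x.1‖ : ℂ) ^ 2 * modelW x := by
      simp only [μ, norm_sq_eq_sum, Finset.mul_sum, Finset.sum_mul]
      rw [Finset.sum_comm]
      refine Finset.sum_congr rfl fun j _ => Finset.sum_congr rfl fun i _ => ?_
      simp only [Pi.smul_apply, smul_eq_mul, hmono, Fin.prod_univ_two, Matrix.cons_val_zero,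
        Matrix.cons_val_one]
      ring
    have e3 : (∑ i, ((-2 * m i) • hmono (fun _ : Fin 1 => i) 2) (x.1, modelW x)) =
        -2 * μ x.1 * modelW x ^ 2 := by
      simp only [μ, Finset.mul_sum, Finset.sum_mul]
      refine Finset.sum_congr rfl fun i _ => ?_
      simp only [Pi.smul_apply, smul_eq_mul, hmono, Fin.prod_univ_one]
      ring
    simp only [Pi.smul_apply] at e1 e2 e3
    simp only [Pi.smul_apply, Pi.add_apply, Finset.sum_apply, ← Complex.re_sum, e1, e2, e3]
    rw [poly32_base32, modelW, show (‖x.1‖ : ℂ) ^ 4 = ((‖x.1‖ ^ 4 : ℝ) : ℂ) by push_cast; rfl,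
      ← Complex.ofReal_pow]
    change _ = (μ x.1 * _).re
    simp only [Complex.mul_re, Complex.ofReal_re, Complex.ofReal_im]
    simp [pow_two, Complex.add_re, Complex.mul_re]
    ring_nf
  have hsum : (fun x : ParamSpace n => (f x).re) =
      (fun x => (poly32 (base32 m) x.1).re) + fun x => 2 * (poly32 b₂ x.1).re := by
    funext x
    have h : poly32 b₂ x.1 = ((1 / 2 : ℝ) : ℂ) * (poly32 b₀ x.1 + -1 * poly32 (base32 m) x.1) := by
      simp only [b₂, b₁, poly32_smul, poly32_add, poly32_sym32]
      push_cast
      ring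
    simp only [Pi.add_apply, hb₀, h, Complex.re_ofReal_mul]
    simp
  rw [hsum]
  exact Submodule.add_mem_sup hmem ⟨b₂, hnorm, fun x => rfl⟩

theorem re_mem_of_weight_three {i : ℕ × ℕ × ℕ} (hi : wt i = 3) {f : ParamSpace n → ℂ}
    (hf : f ∈ triSpan n i) : (fun x => (f x).re) ∈ homSub n 3 := by
  obtain ⟨a, b, c⟩ := i
  have h : (a, b, c) = (3, 0, 0) ∨ (a, b, c) = (2, 1, 0) ∨ (a, b, c) = (1, 2, 0) ∨
      (a, b, c) = (0, 3, 0) ∨ (a, b, c) = (1, 0, 1) ∨ (a, b, c) = (0, 1, 1) := by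
    simp only [wt, Prod.mk.injEq] at hi ⊢
    omega
  rcases h with h | h | h | h | h | h <;> rw [h] at hf
  · exact re_mem_holo hf
  · exact re_mem_one hf
  · exact re_mem_swap (fun f hf => re_mem_one hf) hf
  · exact re_mem_swap (fun f hf => re_mem_holo hf) hf
  · exact re_mem_holo_u hf
  · exact re_mem_swap (fun f hf => re_mem_holo_u hf) hf

theorem re_mem_of_weight_four {i : ℕ × ℕ × ℕ} (hi : wt i = 4) {f : ParamSpace n → ℂ}
    (hf : f ∈ triSpan n i) : (fun x => (f x).re) ∈ homSub n 4 ⊔ nor22 n := by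
  obtain ⟨a, b, c⟩ := i
  have hS : homSub n 4 ≤ homSub n 4 ⊔ nor22 n := le_sup_left
  have h : (a, b, c) = (4, 0, 0) ∨ (a, b, c) = (3, 1, 0) ∨ (a, b, c) = (2, 2, 0) ∨
      (a, b, c) = (1, 3, 0) ∨ (a, b, c) = (0, 4, 0) ∨ (a, b, c) = (2, 0, 1) ∨
      (a, b, c) = (1, 1, 1) ∨ (a, b, c) = (0, 2, 1) ∨ (a, b, c) = (0, 0, 2) := by
    have hi : a + b + 2 * c = 4 := hi
    obtain rfl : a = 4 - b - 2 * c := by omega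
    have hc : c ≤ 2 := by omega
    have hb : b ≤ 4 := by omega
    interval_cases c <;> interval_cases b <;> first | omega | simp
  rcases h with h | h | h | h | h | h | h | h | h <;> rw [h] at hf
  · exact hS (re_mem_holo hf)
  · exact hS (re_mem_one hf)
  · exact re_mem_22 hf
  · exact hS (re_mem_swap (fun f hf => re_mem_one hf) hf)
  · exact hS (re_mem_swap (fun f hf => re_mem_holo hf) hf)
  · exact hS (re_mem_holo_u hf)
  · exact re_mem_one_u (a := 1) rfl rfl hS (fun f hf => re_mem_22 hf) hf
  · exact hS (re_mem_swap (fun f hf => re_mem_holo_u hf) hf)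
  · exact re_mem_holo_u_sq (a := 0) rfl rfl hS (fun f hf => re_mem_22 hf) hf

theorem re_mem_of_weight_five {i : ℕ × ℕ × ℕ} (hi : wt i = 5) {f : ParamSpace n → ℂ}
    (hf : f ∈ triSpan n i) : (fun x => (f x).re) ∈ homSub n 5 ⊔ nor32 n := by
  obtain ⟨a, b, c⟩ := i
  have hS : homSub n 5 ≤ homSub n 5 ⊔ nor32 n := le_sup_left
  have h : (a, b, c) = (5, 0, 0) ∨ (a, b, c) = (4, 1, 0) ∨ (a, b, c) = (3, 2, 0) ∨
      (a, b, c) = (2, 3, 0) ∨ (a, b, c) = (1, 4, 0) ∨ (a, b, c) = (0, 5, 0) ∨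
      (a, b, c) = (3, 0, 1) ∨ (a, b, c) = (2, 1, 1) ∨ (a, b, c) = (1, 2, 1) ∨
      (a, b, c) = (0, 3, 1) ∨ (a, b, c) = (1, 0, 2) ∨ (a, b, c) = (0, 1, 2) := by
    have hi : a + b + 2 * c = 5 := hi
    obtain rfl : a = 5 - b - 2 * c := by omega
    have hc : c ≤ 2 := by omega
    have hb : b ≤ 5 := by omega
    interval_cases c <;> interval_cases b <;> first | omega | simp
  have h21 : ∀ f ∈ triSpan n (2, 1, 1), (fun x => (f x).re) ∈ homSub n 5 ⊔ nor32 n :=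
    fun f hf => re_mem_one_u (a := 2) rfl rfl hS (fun f hf => re_mem_32 hf) hf
  have h10 : ∀ f ∈ triSpan n (1, 0, 2), (fun x => (f x).re) ∈ homSub n 5 ⊔ nor32 n :=
    fun f hf => re_mem_holo_u_sq (a := 1) rfl rfl hS (fun f hf => re_mem_32 hf) hf
  rcases h with h | h | h | h | h | h | h | h | h | h | h | h <;> rw [h] at hf
  · exact hS (re_mem_holo hf)
  · exact hS (re_mem_one hf)
  · exact re_mem_32 hf
  · exact re_mem_swap (fun f hf => re_mem_32 hf) hf
  · exact hS (re_mem_swap (fun f hf => re_mem_one hf) hf)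
  · exact hS (re_mem_swap (fun f hf => re_mem_holo hf) hf)
  · exact hS (re_mem_holo_u hf)
  · exact h21 _ hf
  · exact re_mem_swap h21 hf
  · exact hS (re_mem_swap (fun f hf => re_mem_holo_u hf) hf)
  · exact h10 _ hf
  · exact re_mem_swap h10 hf

end NormalForm

/-! ### Graph charts and changes of coordinates -/

section Charts

open Asymptotics Filter

variable {n : ℕ}

namespace IsLocalBiholomorphism

variable {f g : OpenPartialHomeomorph (CSpace n) (CSpace n)} {p q r : CSpace n}

lemma mem_target (hf : IsLocalBiholomorphism f p q) : q ∈ f.target :=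
  hf.map_eq ▸ f.map_source hf.mem_source

lemma symm_map_eq (hf : IsLocalBiholomorphism f p q) : f.symm q = p :=
  hf.map_eq ▸ f.left_inv hf.mem_source

lemma symm (hf : IsLocalBiholomorphism f p q) : IsLocalBiholomorphism f.symm q p :=
  ⟨hf.mem_target, hf.symm_map_eq, hf.holomorphic_symm, hf.holomorphic⟩

lemma trans (hf : IsLocalBiholomorphism f p q) (hg : IsLocalBiholomorphism g q r) :
    IsLocalBiholomorphism (f.trans g) p r where
  mem_source := by
    rw [OpenPartialHomeomorph.trans_source]
    exact ⟨hf.mem_source, by rw [Set.mem_preimage, hf.map_eq]; exact hg.mem_source⟩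
  map_eq := by rw [OpenPartialHomeomorph.coe_trans, Function.comp_apply, hf.map_eq, hg.map_eq]
  holomorphic := by
    rw [OpenPartialHomeomorph.trans_source, OpenPartialHomeomorph.coe_trans]
    exact hg.holomorphic.comp (hf.holomorphic.mono Set.inter_subset_left) fun x hx => hx.2
  holomorphic_symm := by
    rw [OpenPartialHomeomorph.trans_target, OpenPartialHomeomorph.coe_trans_symm]
    exact hf.holomorphic_symm.comp (hg.holomorphic_symm.mono Set.inter_subset_left) fun x hx => hx.2

lemma contDiffOn (hf : IsLocalBiholomorphism f p q) : ContDiffOn ℝ ∞ f f.source :=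
  contDiffOn_real_of_differentiableOn f.open_source hf.holomorphic

lemma contDiffAt (hf : IsLocalBiholomorphism f p q) : ContDiffAt ℝ ∞ f p :=
  hf.contDiffOn.contDiffAt (f.open_source.mem_nhds hf.mem_source)

lemma source_mem (hf : IsLocalBiholomorphism f p q) : f.source ∈ 𝓝 p :=
  f.open_source.mem_nhds hf.mem_source

lemma tendsto (hf : IsLocalBiholomorphism f p q) : Tendsto f (𝓝 p) (𝓝 q) := by
  have := hf.contDiffAt.continuousAt
  rwa [ContinuousAt, hf.map_eq] at this

lemma eventually_left_inv (hf : IsLocalBiholomorphism f p q) : ∀ᶠ x in 𝓝 p, f.symm (f x) = x :=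
  f.eventually_left_inverse hf.mem_source

lemma eventually_right_inv (hf : IsLocalBiholomorphism f p q) : ∀ᶠ y in 𝓝 q, f (f.symm y) = y :=
  f.eventually_right_inverse hf.mem_target

lemma exists_hasFDerivAt (hf : IsLocalBiholomorphism f p q) : ∃ L : CSpace n ≃L[ℂ] CSpace n,
    HasFDerivAt f (L : CSpace n →L[ℂ] CSpace n) p ∧
    HasFDerivAt f.symm (L.symm : CSpace n →L[ℂ] CSpace n) q := by
  have h1 : HasFDerivAt f (fderiv ℂ f p) p :=
    (hf.holomorphic.differentiableAt hf.source_mem).hasFDerivAt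
  have h2 : HasFDerivAt f.symm (fderiv ℂ f.symm q) q :=
    (hf.holomorphic_symm.differentiableAt hf.symm.source_mem).hasFDerivAt
  have h3 : (fderiv ℂ f.symm q).comp (fderiv ℂ f p) = ContinuousLinearMap.id ℂ _ := by
    have h := (show HasFDerivAt f.symm (fderiv ℂ f.symm q) (f p) by rwa [hf.map_eq]).comp p h1
    exact h.unique ((hasFDerivAt_id p).congr_of_eventuallyEq hf.eventually_left_inv)
  have h4 : (fderiv ℂ f p).comp (fderiv ℂ f.symm q) = ContinuousLinearMap.id ℂ _ := by
    have h := (show HasFDerivAt f (fderiv ℂ f p) (f.symm q) by rwa [hf.symm_map_eq]).comp q h2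
    exact h.unique ((hasFDerivAt_id q).congr_of_eventuallyEq hf.eventually_right_inv)
  exact ⟨ContinuousLinearEquiv.equivOfInverse _ _ (fun x => DFunLike.congr_fun h3 x)
    (fun x => DFunLike.congr_fun h4 x), h1, h2⟩

end IsLocalBiholomorphism

/-- In the coordinates `h` at `p` the set `D` is `{Im w > φ(z, Re w)}` with `φ` smooth,
`φ(0) = 0` and `dφ(0) = 0`. -/
structure IsGraphChart (D : Set (CSpace n)) (p : CSpace n)
    (h : OpenPartialHomeomorph (CSpace n) (CSpace n)) (φ : ParamSpace n → ℝ) : Prop where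
  isLocalBiholomorphism : IsLocalBiholomorphism h p 0
  smooth : ∃ V : Set (ParamSpace n), IsOpen V ∧ (0 : ParamSpace n) ∈ V ∧ ContDiffOn ℝ ∞ φ V
  map_zero : φ 0 = 0
  fderiv_zero : fderiv ℝ φ 0 = 0
  eventually_mem : ∀ᶠ y : CSpace n in 𝓝 0, (h.symm y ∈ D ↔ φ (toP y) < y.2.im)

/-- The parametrization of the graph of `φ`. -/
noncomputable def graphMap (φ : ParamSpace n → ℝ) (x : ParamSpace n) : CSpace n := toC (x, φ x)

lemma graphMap_fst (φ : ParamSpace n → ℝ) (x : ParamSpace n) : (graphMap φ x).1 = x.1 := rfl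

@[simp] lemma toP_graphMap (φ : ParamSpace n → ℝ) (x : ParamSpace n) : toP (graphMap φ x) = x := by
  simp [graphMap]

@[simp] lemma graphMap_im (φ : ParamSpace n → ℝ) (x : ParamSpace n) :
    (graphMap φ x).2.im = φ x := by
  simp [graphMap]

lemma graphMap_zero {φ : ParamSpace n → ℝ} (h : φ 0 = 0) : graphMap φ 0 = 0 := by
  rw [graphMap, h, ← toCL_apply]
  exact _root_.map_zero (toCL n)

lemma contDiffAt_graphMap {φ : ParamSpace n → ℝ} {m : WithTop ℕ∞} (hm : m ≤ ∞)
    (h : ContDiffAt ℝ m φ 0) : ContDiffAt ℝ m (graphMap φ) 0 :=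
  (contDiff_toC.of_le hm).contDiffAt.comp (0 : ParamSpace n) (contDiffAt_id.prodMk h)

/-- The inclusion of `ℂⁿ × ℝ` into `ℂⁿ × ℂ`. -/
noncomputable def inclL (n : ℕ) : ParamSpace n →L[ℝ] CSpace n :=
  (toCL n).comp (ContinuousLinearMap.inl ℝ (ParamSpace n) ℝ)

lemma inclL_apply (x : ParamSpace n) : inclL n x = (x.1, (x.2 : ℂ)) := by
  simp [inclL, toCL_apply, toC]

lemma hasFDerivAt_graphMap {φ : ParamSpace n → ℝ} (h : DifferentiableAt ℝ φ 0)
    (h' : fderiv ℝ φ 0 = 0) : HasFDerivAt (graphMap φ) (inclL n) 0 := by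
  have h1 := h.hasFDerivAt
  rw [h'] at h1
  have := (hasFDerivAt_toC _).comp (0 : ParamSpace n) ((hasFDerivAt_id (0 : ParamSpace n)).prodMk h1)
  exact this

namespace IsGraphChart

variable {D : Set (CSpace n)} {p : CSpace n} {h : OpenPartialHomeomorph (CSpace n) (CSpace n)}
  {φ : ParamSpace n → ℝ}

lemma contDiffAt (H : IsGraphChart D p h φ) : ContDiffAt ℝ ∞ φ 0 := by
  obtain ⟨V, hV, h0, hφ⟩ := H.smooth
  exact hφ.contDiffAt (hV.mem_nhds h0)

lemma differentiableAt (H : IsGraphChart D p h φ) : DifferentiableAt ℝ φ 0 :=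
  H.contDiffAt.differentiableAt (by simp)

lemma tendsto_graphMap (H : IsGraphChart D p h φ) : Tendsto (graphMap φ) (𝓝 0) (𝓝 0) := by
  have := (contDiffAt_graphMap le_rfl H.contDiffAt).continuousAt
  rwa [ContinuousAt, graphMap_zero H.map_zero] at this

lemma isBigO (H : IsGraphChart D p h φ) : φ =O[𝓝 0] fun x => ‖x‖ ^ 2 := by
  simpa [H.map_zero, H.fderiv_zero] using sub_fderiv_isBigO (contDiffAt_infty.1 H.contDiffAt 2)

/-- Change of coordinates by a map tangent to the identity in the direction of `w`. -/
theorem exists_trans (H : IsGraphChart D p h φ) {Ψ : CSpace n → CSpace n}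
    (hΨ : Differentiable ℂ Ψ) (h0 : Ψ 0 = 0) {L : CSpace n ≃L[ℂ] CSpace n}
    (hL : HasFDerivAt Ψ (L : CSpace n →L[ℂ] CSpace n) 0) (hL2 : ∀ y, (L y).2 = y.2) :
    ∃ h' φ', IsGraphChart D p h' φ' ∧ ∀ (P : ParamSpace n → ℝ) (k : ℕ),
      ((fun x => (Ψ (graphMap φ x)).2.im - P (toP (Ψ (graphMap φ x)))) =o[𝓝 0]
        fun x => wnorm x ^ k) → (fun x => φ' x - P x) =o[𝓝 0] fun x => wnorm x ^ k := by
  obtain ⟨k, hk, hkΨ⟩ := exists_localBiholomorphism hΨ h0 hL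
  obtain ⟨V, hV, h0V, hφ⟩ := H.smooth
  have hLs : HasFDerivAt k.symm (L.symm : CSpace n →L[ℂ] CSpace n) 0 := by
    obtain ⟨L', h1, h2⟩ := hk.exists_hasFDerivAt
    have h3 : HasFDerivAt k (L : CSpace n →L[ℂ] CSpace n) 0 := by
      rwa [show ⇑k = Ψ from funext hkΨ]
    have h4 : L' = L := ContinuousLinearEquiv.coe_injective (h1.unique h3)
    rwa [h4] at h2
  -- The transformed domain is {σ < 0}. As the derivative of Ψ leaves w unchanged, dσ(0) is still
  -- −Im w, so the implicit function theorem gives a graph again.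
  let σ : CSpace n → ℝ := fun y => φ (toP (k.symm y)) - (k.symm y).2.im
  let U : Set (CSpace n) := k.target ∩ (fun y => toP (k.symm y)) ⁻¹' V
  have hcont : ContinuousOn (fun y => toP (k.symm y)) k.target :=
    continuous_toP.comp_continuousOn hk.symm.contDiffOn.continuousOn
  have hU : IsOpen U := hcont.isOpen_inter_preimage k.open_target hV
  have hsymm0 := hk.symm_map_eq
  have htoP0 : toP (0 : CSpace n) = 0 := _root_.map_zero (toPL n)
  have h0U : (0 : CSpace n) ∈ U := ⟨hk.mem_target, by
    change toP (k.symm 0) ∈ V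
    rwa [hsymm0, htoP0]⟩
  have hks : ContDiffOn ℝ ∞ k.symm U := hk.symm.contDiffOn.mono Set.inter_subset_left
  have hσ : ContDiffOn ℝ ∞ σ U := by
    refine ContDiffOn.sub (hφ.comp (contDiff_toP.comp_contDiffOn hks) fun y hy => hy.2) ?_
    exact Complex.imCLM.contDiff.comp_contDiffOn (contDiff_snd.comp_contDiffOn hks)
  have hσ0 : σ 0 = 0 := by simp [σ, hsymm0, htoP0, H.map_zero]
  have hσd : ∀ y, fderiv ℝ σ 0 y = -(1 * y.2.im) := by
    have h1 : HasFDerivAt k.symm ((L.symm : CSpace n →L[ℂ] CSpace n).restrictScalars ℝ) 0 :=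
      hLs.restrictScalars ℝ
    have h2 : HasFDerivAt φ (0 : ParamSpace n →L[ℝ] ℝ) (toP (k.symm 0)) := by
      rw [hsymm0, htoP0, ← H.fderiv_zero]
      exact H.differentiableAt.hasFDerivAt
    have h3 := h2.comp (0 : CSpace n) ((hasFDerivAt_toP (k.symm 0)).comp (0 : CSpace n) h1)
    have h4 := (Complex.imCLM.hasFDerivAt).comp (0 : CSpace n)
      ((ContinuousLinearMap.snd ℝ (EuclideanSpace ℂ (Fin n)) ℂ).hasFDerivAt.comp (0 : CSpace n) h1)
    have h5 : HasFDerivAt σ _ 0 := h3.sub h4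
    intro y
    rw [h5.fderiv]
    have h6 : (L.symm y).2 = y.2 := by
      rw [← hL2, L.apply_symm_apply]
    simp [h6]
  obtain ⟨V', φ', hV', h0V', hφ', hφ'0, hφ'd, hev⟩ := exists_graph hU h0U hσ hσ0 one_pos hσd
  refine ⟨h.trans k, φ', ⟨H.isLocalBiholomorphism.trans hk, ⟨V', hV', h0V', hφ'⟩, hφ'0, hφ'd, ?_⟩,
    ?_⟩
  · filter_upwards [hev, hk.symm.tendsto.eventually H.eventually_mem] with y hy1 hy2
    rw [OpenPartialHomeomorph.coe_trans_symm, Function.comp_apply, hy2, ← hy1.1]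
    simp [σ]
  · intro P m hP
    have hg := contDiffAt_infty.1 (contDiffAt_graphMap le_rfl H.contDiffAt) 2
    have hg0 := graphMap_zero H.map_zero
    have hΨ2 : ContDiffAt ℝ 2 Ψ 0 := contDiffAt_infty.1
      ((contDiffOn_real_of_differentiableOn isOpen_univ hΨ.differentiableOn).contDiffAt univ_mem) 2
    have hχ : ContDiffAt ℝ 2 (fun x => toP (Ψ (graphMap φ x))) 0 := by
      refine (contDiff_infty.1 contDiff_toP 2).contDiffAt.comp (0 : ParamSpace n) ?_
      exact ContDiffAt.comp (0 : ParamSpace n) (by rwa [hg0]) hg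
    have hχd : HasFDerivAt (fun x => toP (Ψ (graphMap φ x)))
        ((toPL n).comp (((L : CSpace n →L[ℂ] CSpace n).restrictScalars ℝ).comp (inclL n))) 0 := by
      refine (hasFDerivAt_toP _).comp (0 : ParamSpace n) (HasFDerivAt.comp (0 : ParamSpace n) ?_
        (hasFDerivAt_graphMap H.differentiableAt H.fderiv_zero))
      rw [hg0]
      exact hL.restrictScalars ℝ
    have hval : ∀ x : ParamSpace n, (L (x.1, (x.2 : ℂ))).2 = x.2 := fun x => hL2 _
    -- χ parametrizes the new graph by the points of the old one; testing the error after
    -- composition with χ avoids expanding the inverse of Ψ.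
    refine isLittleO_of_comp (χ := fun x => toP (Ψ (graphMap φ x))) hχ
      (by simp only [hg0, h0, htoP0]) ?_ ?_ ?_
    · rw [hχd.fderiv]
      refine (injective_iff_map_eq_zero _).2 fun x hx => ?_
      have hx' : toP (L (x.1, (x.2 : ℂ))) = 0 := by
        simpa [inclL_apply, toPL_apply] using hx
      have hx1 : (L (x.1, (x.2 : ℂ))).1 = 0 := congrArg Prod.fst hx'
      have hx2 : ((L (x.1, (x.2 : ℂ))).2).re = 0 := congrArg Prod.snd hx'
      have hx3 : L (x.1, (x.2 : ℂ)) = 0 := by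
        refine Prod.ext hx1 ?_
        rw [hval] at hx2 ⊢
        simpa using hx2
      have hx4 := (map_eq_zero_iff L L.injective).1 hx3
      have h5 : x.1 = 0 := congrArg Prod.fst hx4
      have h6 : (x.2 : ℂ) = 0 := congrArg Prod.snd hx4
      exact Prod.ext h5 (by simpa using h6)
    · intro z
      rw [hχd.fderiv]
      change ((L (inclL n (z, 0))).2).re = 0
      rw [inclL_apply, hval]
      simp
    · refine hP.congr' ?_ EventuallyEq.rfl
      have ht : Tendsto (fun x => Ψ (graphMap φ x)) (𝓝 0) (𝓝 0) := by
        have := hΨ.continuous.tendsto 0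
        rw [h0] at this
        exact this.comp H.tendsto_graphMap
      filter_upwards [ht.eventually hev, H.tendsto_graphMap.eventually hk.eventually_left_inv]
        with x hx1 hx2
      have hx3 : σ (Ψ (graphMap φ x)) = 0 := by
        rw [hkΨ] at hx2
        simp [σ, hx2]
      rw [hx1.2.1 hx3]

end IsGraphChart

end Charts

/-! ### Linear normalization of the tangent space and of a Hermitian form -/

section LinearNormalization

open Asymptotics Filter
open scoped ComplexOrder

variable {n : ℕ}

/-- A defining function of a domain vanishes on the boundary. -/
lemma IsDomainDefiningFunctionAt.eq_zero {D : Set (CSpace n)} {p : CSpace n} {ρ : CSpace n → ℝ}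
    (hρ : IsDomainDefiningFunctionAt D p ρ) (hD : IsOpen D) (hp : p ∈ frontier D) : ρ p = 0 := by
  obtain ⟨U, hU, hpU, hsm, -, hiff⟩ := hρ
  refine le_antisymm ?_ ?_
  · have h1 : (𝓝[D] p).NeBot := mem_closure_iff_nhdsWithin_neBot.1 (frontier_subset_closure hp)
    have h2 : Tendsto ρ (𝓝[D] p) (𝓝 (ρ p)) :=
      ((hsm.contDiffAt (hU.mem_nhds hpU)).continuousAt).mono_left nhdsWithin_le_nhds
    refine le_of_tendsto h2 ?_
    filter_upwards [self_mem_nhdsWithin, mem_nhdsWithin_of_mem_nhds (hU.mem_nhds hpU)] with x h1 h2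
    exact ((hiff x h2).1 h1).le
  · rw [← not_lt, ← hiff p hpU]
    rw [hD.frontier_eq] at hp
    exact hp.2

/-- A real linear form is `-Im w` in suitable complex linear coordinates. -/
lemma exists_linear_coordinates {ℓ : CSpace n →L[ℝ] ℝ} (hℓ : ℓ ≠ 0) :
    ∃ T : CSpace n ≃L[ℂ] CSpace n, ∀ y, ℓ (T y) = -y.2.im := by
  let m : Module.Dual ℝ (CSpace n) := (ℓ : CSpace n →ₗ[ℝ] ℝ)
  -- A real form is the real part of a complex linear one; multiplied by −i the latter has imaginary
  -- part −ℓ. This θ becomes the new coordinate w, and its kernel the space of z.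
  let θ : Module.Dual ℂ (CSpace n) := (-Complex.I) • m.extendRCLike (𝕜 := ℂ)
  have hθ : ∀ v, (θ v).im = -ℓ v := by
    intro v
    have h := Module.Dual.re_extendRCLike_apply (𝕜 := ℂ) m v
    have h' : (m.extendRCLike (𝕜 := ℂ) v).re = ℓ v := h
    simp [θ, h']
  obtain ⟨v, hv⟩ : ∃ v, θ v ≠ 0 := by
    by_contra! h
    refine hℓ (ContinuousLinearMap.ext fun x => ?_)
    have := hθ x
    rw [h] at this
    simpa using this.symm
  have hrange : LinearMap.range θ = ⊤ := LinearMap.range_eq_top.2 fun c =>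
    ⟨(c / θ v) • v, by rw [map_smul, smul_eq_mul, div_mul_cancel₀ _ hv]⟩
  have hrank : Module.finrank ℂ (EuclideanSpace ℂ (Fin n)) = Module.finrank ℂ (LinearMap.ker θ) := by
    have h1 := LinearMap.finrank_range_add_finrank_ker θ
    rw [hrange, finrank_top, Module.finrank_self, Module.finrank_prod, Module.finrank_self] at h1
    omega
  let e := LinearEquiv.ofFinrankEq _ _ hrank
  let T₀ : CSpace n →ₗ[ℂ] CSpace n :=
    ((LinearMap.ker θ).subtype.comp (e : _ →ₗ[ℂ] LinearMap.ker θ)).coprod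
      (LinearMap.toSpanSingleton ℂ (CSpace n) ((θ v)⁻¹ • v))
  have hT₀ : ∀ y, T₀ y = (e y.1 : CSpace n) + y.2 • (θ v)⁻¹ • v := fun y => by
    simp [T₀, LinearMap.coprod_apply]
  have hθT : ∀ y, θ (T₀ y) = y.2 := by
    intro y
    rw [hT₀, map_add, (e y.1).2, map_smul, map_smul]
    simp [hv]
  have hinj : Function.Injective T₀ := by
    refine (injective_iff_map_eq_zero _).2 fun y hy => ?_
    have h2 : y.2 = 0 := by rw [← hθT, hy, map_zero]
    rw [hT₀, h2, zero_smul, add_zero] at hy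
    have h1 : y.1 = 0 := e.map_eq_zero_iff.1 (Subtype.ext hy)
    exact Prod.ext h1 h2
  let T := (LinearEquiv.ofInjectiveEndo T₀ hinj).toContinuousLinearEquiv
  refine ⟨T, fun y => ?_⟩
  have h3 : T y = T₀ y := rfl
  have := hθ (T y)
  rw [h3, hθT] at this
  rw [h3]
  linarith

/-- Linear normalization of the tangent space of the boundary. -/
lemma exists_graphChart_linear {D : Set (CSpace n)} {p : CSpace n} {ρ : CSpace n → ℝ}
    (hρ : IsDomainDefiningFunctionAt D p ρ) (hρ0 : ρ p = 0) :
    ∃ (T : CSpace n ≃L[ℂ] CSpace n) (h : OpenPartialHomeomorph (CSpace n) (CSpace n))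
      (φ : ParamSpace n → ℝ), (∀ y, fderiv ℝ ρ p (T y) = -y.2.im) ∧ IsGraphChart D p h φ ∧
      ∀ᶠ x in 𝓝 0, ρ (p + T (graphMap φ x)) = 0 := by
  obtain ⟨U, hU, hpU, hsm, hd, hiff⟩ := hρ
  obtain ⟨T, hT⟩ := exists_linear_coordinates hd
  let h := ((Homeomorph.addLeft (-p)).trans T.symm.toHomeomorph).toOpenPartialHomeomorph
  have hh : ∀ x, h x = T.symm (-p + x) := fun _ => rfl
  have hhs : ∀ y, h.symm y = p + T y := fun y => by
    change -(-p) + T y = p + T y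
    rw [neg_neg]
  have hbi : IsLocalBiholomorphism h p 0 := by
    refine ⟨Set.mem_univ _, by simp [hh], ?_, ?_⟩
    · have : Differentiable ℂ h := by
        rw [show ⇑h = fun x => T.symm (-p + x) from funext hh]
        fun_prop
      exact this.differentiableOn
    · have : Differentiable ℂ h.symm := by
        rw [show ⇑h.symm = fun x => p + T x from funext hhs]
        fun_prop
      exact this.differentiableOn
  let σ : CSpace n → ℝ := fun y => ρ (p + T y)
  have hTs : ContDiff ℝ ∞ (fun y => p + T y) :=
    contDiff_const.add ((T : CSpace n →L[ℂ] CSpace n).restrictScalars ℝ).contDiff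
  have hσ : ContDiffOn ℝ ∞ σ ((fun y => p + T y) ⁻¹' U) :=
    hsm.comp hTs.contDiffOn fun y hy => hy
  have h0U : (0 : CSpace n) ∈ (fun y => p + T y) ⁻¹' U := by simpa using hpU
  have hσd : ∀ y, fderiv ℝ σ 0 y = -(1 * y.2.im) := by
    have h1 : HasFDerivAt ρ (fderiv ℝ ρ p) (p + T 0) := by
      rw [map_zero, add_zero]
      exact ((hsm.contDiffAt (hU.mem_nhds hpU)).differentiableAt (by simp)).hasFDerivAt
    have h2 : HasFDerivAt (fun y => p + T y)
        ((T : CSpace n →L[ℂ] CSpace n).restrictScalars ℝ) 0 :=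
      ((T : CSpace n →L[ℂ] CSpace n).restrictScalars ℝ).hasFDerivAt.const_add p
    intro y
    rw [(show HasFDerivAt σ _ 0 from h1.comp (0 : CSpace n) h2).fderiv, one_mul, ← hT]
    rfl
  obtain ⟨V, φ, hV, h0V, hφ, hφ0, hφd, hev⟩ := exists_graph (hU.preimage hTs.continuous) h0U hσ
    (by simp [σ, hρ0]) one_pos hσd
  have H : IsGraphChart D p h φ := by
    refine ⟨hbi, ⟨V, hV, h0V, hφ⟩, hφ0, hφd, ?_⟩
    filter_upwards [hev, (hU.preimage hTs.continuous).mem_nhds h0U] with y hy hyU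
    rw [hhs, ← hy.1]
    exact hiff _ hyU
  refine ⟨T, h, φ, hT, H, ?_⟩
  filter_upwards [H.tendsto_graphMap.eventually hev] with x hx
  exact hx.2.2 (by simp)

/-- The (2,0) part is a holomorphic quadratic polynomial, so that it can be absorbed into w. -/
lemma exists_holo_of_mem_triSpan {f : ParamSpace n → ℂ} (hf : f ∈ triSpan n (2, 0, 0)) :
    ∃ s : EuclideanSpace ℂ (Fin n) → ℂ, Differentiable ℂ s ∧
      (∀ (c : ℂ) z, s (c • z) = c ^ 2 * s z) ∧ ∀ x, f x = s x.1 := by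
  refine Submodule.span_induction (p := fun f _ => ∃ s : EuclideanSpace ℂ (Fin n) → ℂ,
    Differentiable ℂ s ∧ (∀ (c : ℂ) z, s (c • z) = c ^ 2 * s z) ∧ ∀ x, f x = s x.1)
    ?_ ?_ ?_ ?_ hf
  · rintro _ ⟨⟨s, t⟩, rfl⟩
    refine ⟨fun z => z (s 0) * z (s 1), ?_, fun c z => ?_, fun x => ?_⟩
    · have : ∀ i, Differentiable ℂ fun z : EuclideanSpace ℂ (Fin n) => z i := fun i =>
        (EuclideanSpace.proj (𝕜 := ℂ) i).differentiable
      exact (this _).mul (this _)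
    · simp only [PiLp.smul_apply, smul_eq_mul]
      ring
    · have h1 : ∏ k, x.1 (s k) = x.1 (s 0) * x.1 (s 1) := Fin.prod_univ_two _
      have h2 : ∏ k, conj (x.1 (t k)) = 1 := Fin.prod_univ_zero _
      simp [h1]
  · exact ⟨0, differentiable_const _, by simp, by simp⟩
  · rintro f g _ _ ⟨s, h1, h2, h3⟩ ⟨s', h1', h2', h3'⟩
    refine ⟨s + s', h1.add h1', fun c z => ?_, fun x => ?_⟩
    · rw [Pi.add_apply, h2, h2', Pi.add_apply, mul_add]
    · rw [Pi.add_apply, h3, h3', Pi.add_apply]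
  · rintro c f _ ⟨s, h1, h2, h3⟩
    refine ⟨c • s, h1.const_smul c, fun d z => ?_, fun x => ?_⟩
    · rw [Pi.smul_apply, h2, Pi.smul_apply, smul_eq_mul, smul_eq_mul, mul_left_comm]
    · rw [Pi.smul_apply, h3, Pi.smul_apply]

lemma exists_form_of_mem_triSpan {f : ParamSpace n → ℂ} (hf : f ∈ triSpan n (1, 1, 0)) :
    ∃ M : Matrix (Fin n) (Fin n) ℂ, ∀ x, f x = ∑ i, ∑ j, M i j * (x.1 i * conj (x.1 j)) := by
  refine Submodule.span_induction (p := fun f _ => ∃ M : Matrix (Fin n) (Fin n) ℂ,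
    ∀ x, f x = ∑ i, ∑ j, M i j * (x.1 i * conj (x.1 j))) ?_ ?_ ?_ ?_ hf
  · rintro _ ⟨⟨s, t⟩, rfl⟩
    refine ⟨fun i j => if i = s 0 then if j = t 0 then 1 else 0 else 0, fun x => ?_⟩
    have h1 : ∏ k, x.1 (s k) = x.1 (s 0) := Fin.prod_univ_one _
    have h2 : ∏ k, conj (x.1 (t k)) = conj (x.1 (t 0)) := Fin.prod_univ_one _
    simp only [h1, h2, ite_mul, zero_mul, one_mul, Finset.sum_ite_irrel,
      Finset.sum_const_zero, Finset.sum_ite_eq', Finset.mem_univ, if_true, pow_zero, mul_one]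
  · exact ⟨0, fun x => by simp⟩
  · rintro f g _ _ ⟨a, ha⟩ ⟨a', ha'⟩
    exact ⟨a + a', fun x => by
      simp only [Pi.add_apply, ha, ha', Matrix.add_apply, add_mul, Finset.sum_add_distrib]⟩
  · rintro c f _ ⟨a, ha⟩
    exact ⟨c • a, fun x => by
      simp only [Pi.smul_apply, ha, Matrix.smul_apply, smul_eq_mul, Finset.mul_sum, mul_assoc]⟩

lemma eq_smul_of_mem_triSpan {f : ParamSpace n → ℂ} (hf : f ∈ triSpan n (0, 0, 1)) :
    ∃ c : ℂ, ∀ x, f x = c * x.2 := by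
  refine Submodule.span_induction (p := fun f _ => ∃ c : ℂ, ∀ x, f x = c * x.2) ?_ ?_ ?_ ?_ hf
  · rintro _ ⟨⟨s, t⟩, rfl⟩
    refine ⟨1, fun x => ?_⟩
    simp
  · exact ⟨0, by simp⟩
  · rintro f g _ _ ⟨a, ha⟩ ⟨a', ha'⟩
    exact ⟨a + a', fun x => by rw [Pi.add_apply, ha, ha', add_mul]⟩
  · rintro c f _ ⟨a, ha⟩
    exact ⟨c * a, fun x => by rw [Pi.smul_apply, ha, smul_eq_mul, mul_assoc]⟩

/-- A positive Hermitian form is the standard one in suitable linear coordinates. -/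
lemma exists_norm_sq_eq {M : Matrix (Fin n) (Fin n) ℂ}
    (hM : ∀ z : EuclideanSpace ℂ (Fin n), z ≠ 0 → 0 < (∑ i, ∑ j, M i j * (z i * conj (z j))).re) :
    ∃ B : EuclideanSpace ℂ (Fin n) ≃L[ℂ] EuclideanSpace ℂ (Fin n),
      ∀ z, (∑ i, ∑ j, M i j * (z i * conj (z j))).re = ‖B z‖ ^ 2 := by
  -- The Hermitian part of M, transposed so that z*Az is the real part of the form. Positivity
  -- yields A = C*C, and C is injective because the form is definite.
  let A : Matrix (Fin n) (Fin n) ℂ := Matrix.of fun i j => (M j i + conj (M i j)) / 2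
  have hA : ∀ z : Fin n → ℂ, dotProduct (star z) (A.mulVec z) =
      ((∑ i, ∑ j, M i j * (z i * conj (z j))).re : ℂ) := by
    intro z
    have h1 : ((∑ i, ∑ j, M i j * (z i * conj (z j))).re : ℂ) =
        ((∑ i, ∑ j, M j i * (z j * conj (z i))) +
          ∑ i, ∑ j, conj (M i j) * (conj (z i) * z j)) / 2 := by
      rw [Complex.re_eq_add_conj]
      congr 2
      · exact Finset.sum_comm
      · simp [map_sum]
    rw [h1]
    simp only [dotProduct, Matrix.mulVec, Finset.mul_sum, ← Finset.sum_add_distrib,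
      Finset.sum_div, A, Matrix.of_apply]
    refine Finset.sum_congr rfl fun i _ => Finset.sum_congr rfl fun j _ => ?_
    simp only [Pi.star_apply, RCLike.star_def]
    ring
  have hherm : A.IsHermitian := by
    ext i j
    simp only [A, Matrix.conjTranspose_apply, Matrix.of_apply, RCLike.star_def, map_div₀, map_add, Complex.conj_conj,
      map_ofNat, add_comm]
  have hre : ∀ z : Fin n → ℂ, 0 ≤ (∑ i, ∑ j, M i j * (z i * conj (z j))).re := by
    intro z
    rcases eq_or_ne z 0 with rfl | hz
    · simp
    · exact (hM (WithLp.toLp 2 z) (by simpa using hz)).le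
  have hpos : A.PosSemidef := by
    refine Matrix.PosSemidef.of_dotProduct_mulVec_nonneg hherm fun z => ?_
    rw [hA]
    exact_mod_cast hre z
  obtain ⟨C, hC⟩ : ∃ C : Matrix (Fin n) (Fin n) ℂ, A = C.conjTranspose * C := by
    open scoped MatrixOrder in
    exact CStarAlgebra.nonneg_iff_eq_star_mul_self.1 hpos.nonneg
  let L := Matrix.toEuclideanLin C
  have hL : ∀ z, (∑ i, ∑ j, M i j * (z i * conj (z j))).re = ‖L z‖ ^ 2 := by
    intro z
    have h1 := hA z
    rw [hC, ← Matrix.mulVec_mulVec, Matrix.dotProduct_mulVec, ← Matrix.star_mulVec] at h1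
    have h2 : ((‖L z‖ ^ 2 : ℝ) : ℂ) = dotProduct (star (C.mulVec z)) (C.mulVec z) := by
      push_cast
      rw [norm_sq_eq_sum]
      refine Finset.sum_congr rfl fun i _ => ?_
      rw [mul_comm]
      rfl
    rw [← h2] at h1
    exact_mod_cast h1.symm
  have hinj : Function.Injective L := by
    refine (injective_iff_map_eq_zero _).2 fun z hz => ?_
    by_contra h
    have := hM z h
    rw [hL, hz] at this
    simp at this
  exact ⟨(LinearEquiv.ofInjectiveEndo L hinj).toContinuousLinearEquiv, hL⟩

end LinearNormalization

/-! ### Weight two: the Levi form -/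

section WeightTwo

open Asymptotics Filter

variable {n : ℕ}

/-- The leading weighted homogeneous part of a smooth function. -/
lemma exists_leading_part {ψ : ParamSpace n → ℝ} (hψ : ContDiffAt ℝ ∞ ψ 0) {k : ℕ}
    (hk : k ≤ 4) (h0 : ψ =o[𝓝 0] fun x => wnorm x ^ k) :
    ∃ q : ℕ × ℕ × ℕ → ParamSpace n → ℂ, (∀ i, q i ∈ triSpan n i) ∧
      (fun x => ψ x - ∑ i ∈ lowIdx with wt i = k + 1, (q i x).re) =o[𝓝 0]
        fun x => wnorm x ^ (k + 1) := by
  obtain ⟨q, hq, hexp⟩ := exists_weighted_expansion hψ (by omega) h0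
  refine ⟨q, hq, ?_⟩
  have h1 : (fun x => ψ x - ∑ i ∈ lowIdx with k < wt i, (q i x).re) =o[𝓝 0]
      fun x => wnorm x ^ (k + 1) :=
    (hexp.trans (norm_isBigO_wnorm.pow 6)).trans_isLittleO (wnorm_pow_isLittleO (by omega))
  have h2 : (fun x => ∑ i ∈ lowIdx with k + 1 < wt i, (q i x).re) =o[𝓝 0]
      fun x => wnorm x ^ (k + 1) := by
    have h4 : ∀ i ∈ lowIdx.filter (fun i => k + 1 < wt i), (fun x => (q i x).re) =o[𝓝 0]
        fun x => wnorm x ^ (k + 1) := ?_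
    · exact (IsLittleO.sum h4).congr_left fun x => Finset.sum_apply x _ _
    intro i hi
    have h3 : (fun x => (q i x).re) =O[𝓝 0] q i :=
      IsBigO.of_bound 1 (Eventually.of_forall fun x => by
        simpa using Complex.abs_re_le_norm (q i x))
    exact (h3.trans (triSpan_isBigO (hq i))).trans_isLittleO
      (wnorm_pow_isLittleO (by simpa using (Finset.mem_filter.1 hi).2))
  refine (h1.add h2).congr_left fun x => ?_
  have h4 : lowIdx.filter (fun i => k < wt i) =
      lowIdx.filter (fun i => wt i = k + 1) ∪ lowIdx.filter (fun i => k + 1 < wt i) := by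
    ext i
    simp only [Finset.mem_filter, Finset.mem_union, ← and_or_left]
    exact and_congr_right fun _ => by omega
  rw [h4, Finset.sum_union (Finset.disjoint_filter.2
    fun i _ (h : wt i = k + 1) (h' : k + 1 < wt i) => by omega)]
  ring

/-- Limits along weighted dilations. -/
lemma tendsto_dil_div {ψ q : ParamSpace n → ℝ} {k : ℕ}
    (h : (fun x => ψ x - q x) =o[𝓝 0] fun x => wnorm x ^ k)
    (hq : ∀ t x, q (dil t x) = t ^ k * q x) (x : ParamSpace n) :
    Tendsto (fun t : ℝ => ψ (dil t x) / t ^ k) (𝓝[>] 0) (𝓝 (q x)) := by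
  have h1 : (fun t : ℝ => ψ (dil t x) - q (dil t x)) =o[𝓝[>] 0] fun t => t ^ k :=
    (h.comp_tendsto (tendsto_dil x)).trans_isBigO (wnorm_dil_pow_isBigO x k)
  have h2 := h1.tendsto_div_nhds_zero.add_const (q x)
  rw [zero_add] at h2
  refine h2.congr' ?_
  filter_upwards [self_mem_nhdsWithin] with t ht
  have : t ^ k ≠ 0 := pow_ne_zero _ (ne_of_gt ht)
  rw [hq]
  field_simp
  ring

set_option maxRecDepth 10000 in
lemma lowIdx_filter_wt_two :
    lowIdx.filter (fun i => wt i = 2) = {(2, 0, 0), (1, 1, 0), (0, 2, 0), (0, 0, 1)} := by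
  decide

lemma second_order_isBigO {ρ : CSpace n → ℝ} {p : CSpace n} (hρ : ContDiffAt ℝ ∞ ρ p)
    (hρ0 : ρ p = 0) :
    (fun y => ρ (p + y) - fderiv ℝ ρ p y - 1 / 2 * fderiv ℝ (fderiv ℝ ρ) p y y) =O[𝓝 0]
      fun y => ‖y‖ ^ 3 := by
  have h1 : ContDiffAt ℝ ∞ (fun y => ρ (p + y)) 0 := by
    refine ContDiffAt.comp (0 : CSpace n) (by rwa [add_zero])
      (contDiff_const.add contDiff_id).contDiffAt
  refine (taylor_isBigO (N := 2) (contDiffAt_infty.1 h1 _)).congr_left fun y => ?_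
  simp only [Finset.sum_range_succ, Finset.range_zero, Finset.sum_empty, iteratedFDeriv_comp_add_left,
    add_zero, iteratedFDeriv_zero_apply, iteratedFDeriv_one_apply, iteratedFDeriv_two_apply, hρ0]
  simp
  ring

/-- The second order part of a graph in terms of a defining function. -/
lemma tendsto_graph_second_order {ρ : CSpace n → ℝ} {p : CSpace n} (hρ : ContDiffAt ℝ ∞ ρ p)
    (hρ0 : ρ p = 0) {T : CSpace n ≃L[ℂ] CSpace n} (hT : ∀ y, fderiv ℝ ρ p (T y) = -y.2.im)
    {φ : ParamSpace n → ℝ} (hφ : φ =O[𝓝 0] fun x => ‖x‖ ^ 2)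
    (hφρ : ∀ᶠ x in 𝓝 0, ρ (p + T (graphMap φ x)) = 0) (z : EuclideanSpace ℂ (Fin n)) :
    Tendsto (fun t : ℝ => φ (dil t (z, 0)) / t ^ 2) (𝓝[>] 0)
      (𝓝 (1 / 2 * fderiv ℝ (fderiv ℝ ρ) p (T (z, 0)) (T (z, 0)))) := by
  let y : ℝ → CSpace n := fun t => graphMap φ (dil t (z, 0))
  -- The graph point over (tz, 0) divided by t. It tends to (z, 0) because φ is O(t²) there, so in
  -- the limit only the second derivative of ρ in the direction T(z, 0) remains.
  let y' : ℝ → CSpace n := fun t => (z, Complex.I * (φ (dil t (z, 0)) / t : ℝ))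
  have hdO : (fun t : ℝ => dil t (z, (0 : ℝ))) =O[𝓝[>] 0] fun t => t := by
    refine IsBigO.of_bound ‖z‖ ?_
    filter_upwards with t
    simp [dil, norm_smul, mul_comm, mul_nonneg]
  have hφt : (fun t : ℝ => φ (dil t (z, 0))) =O[𝓝[>] 0] fun t => t ^ 2 :=
    (hφ.comp_tendsto (tendsto_dil _)).trans (hdO.norm_left.pow 2)
  have hyy : ∀ t : ℝ, t ≠ 0 → y t = t • y' t := by
    intro t ht
    refine Prod.ext rfl ?_
    simp only [y, y', graphMap, toC, dil, Prod.smul_mk, Complex.real_smul]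
    push_cast
    have : (t : ℂ) ≠ 0 := by exact_mod_cast ht
    field_simp
    simp
  have hy' : Tendsto y' (𝓝[>] 0) (𝓝 (z, 0)) := by
    refine tendsto_const_nhds.prodMk_nhds ?_
    have h1 : Tendsto (fun t : ℝ => φ (dil t (z, 0)) / t) (𝓝[>] 0) (𝓝 0) := by
      have h2 : (fun t : ℝ => φ (dil t (z, 0))) =o[𝓝[>] 0] fun t => t := by
        refine hφt.trans_isLittleO ?_
        have := (isLittleO_pow_pow (𝕜 := ℝ) (show 1 < 2 by norm_num)).mono
          (nhdsWithin_le_nhds (s := Set.Ioi (0 : ℝ)))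
        simpa using this
      exact h2.tendsto_div_nhds_zero
    have h3 := ((Complex.continuous_ofReal.tendsto _).comp h1).const_mul Complex.I
    simpa using! h3
  have hyO : (fun t => T (y t)) =O[𝓝[>] 0] fun t => t := by
    have h1 : (fun t => T (y' t)) =O[𝓝[>] 0] fun _ => (1 : ℝ) :=
      ((T.continuous.tendsto _).comp hy').isBigO_one ℝ
    have h2 : (fun t : ℝ => t • T (y' t)) =O[𝓝[>] 0] fun t => t • (1 : ℝ) :=
      (isBigO_refl _ _).smul h1
    refine (h2.congr' ?_ (by simp))
    filter_upwards [self_mem_nhdsWithin] with t ht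
    rw [hyy t (ne_of_gt ht), ← Complex.coe_smul, ← Complex.coe_smul, map_smul]
  have hy0 : Tendsto (fun t => T (y t)) (𝓝[>] 0) (𝓝 0) :=
    hyO.trans_tendsto (tendsto_id.mono_left nhdsWithin_le_nhds)
  have h1 := ((second_order_isBigO hρ hρ0).comp_tendsto hy0).trans (hyO.norm_left.pow 3)
  have h2 : (fun t => φ (dil t (z, 0)) - 1 / 2 * fderiv ℝ (fderiv ℝ ρ) p (T (y t)) (T (y t)))
      =o[𝓝[>] 0] fun t => t ^ 2 := by
    have h3 : (fun t : ℝ => t ^ 3) =o[𝓝[>] 0] fun t : ℝ => t ^ 2 :=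
      (isLittleO_pow_pow (𝕜 := ℝ) (show 2 < 3 by norm_num)).mono nhdsWithin_le_nhds
    refine (h1.trans_isLittleO h3).congr' ?_ EventuallyEq.rfl
    filter_upwards [(tendsto_dil (z, (0 : ℝ))).eventually hφρ] with t ht
    have ht' : ρ (p + T (y t)) = 0 := ht
    simp only [Function.comp_apply, ht', hT]
    simp [y]
  have h4 : Tendsto (fun t => 1 / 2 * fderiv ℝ (fderiv ℝ ρ) p (T (y' t)) (T (y' t))) (𝓝[>] 0)
      (𝓝 (1 / 2 * fderiv ℝ (fderiv ℝ ρ) p (T (z, 0)) (T (z, 0)))) := by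
    have hc : Continuous fun v => 1 / 2 * fderiv ℝ (fderiv ℝ ρ) p (T v) (T v) := by fun_prop
    exact (hc.tendsto _).comp hy'
  have h5 := h2.tendsto_div_nhds_zero.add h4
  rw [zero_add] at h5
  refine h5.congr' ?_
  filter_upwards [self_mem_nhdsWithin] with t ht
  have ht0 : t ≠ 0 := ne_of_gt ht
  have h6 : T (y t) = t • T (y' t) := by
    rw [hyy t ht0, ← Complex.coe_smul, ← Complex.coe_smul, map_smul]
  rw [h6]
  simp only [map_smul, smul_apply, smul_eq_mul]
  field_simp
  ring

/-- Normalization of the Levi form. -/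
theorem exists_graphChart_two {D : Set (CSpace n)} {p : CSpace n} (hD : IsOpen D)
    (hp : p ∈ frontier D) (hpsc : IsStronglyPseudoconvexAt D p) :
    ∃ h φ, IsGraphChart D p h φ ∧
      (fun x => φ x - ‖x.1‖ ^ 2) =o[𝓝 0] fun x => wnorm x ^ 2 := by
  obtain ⟨ρ, hρ, hlevi⟩ := hpsc
  have hρ0 := hρ.eq_zero hD hp
  obtain ⟨T, h, φ, hT, H, hφρ⟩ := exists_graphChart_linear hρ hρ0
  have hρs : ContDiffAt ℝ ∞ ρ p := by
    obtain ⟨U, hU, hpU, hsm, -⟩ := hρ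
    exact hsm.contDiffAt (hU.mem_nhds hpU)
  have hφ2 : φ =O[𝓝 0] fun x => wnorm x ^ 2 := H.isBigO.trans (norm_isBigO_wnorm.pow 2)
  obtain ⟨q, hq, hexp⟩ := exists_leading_part H.contDiffAt (k := 1) (by norm_num)
    (hφ2.trans_isLittleO (wnorm_pow_isLittleO (by norm_num)))
  norm_num at hexp
  rw [lowIdx_filter_wt_two] at hexp
  obtain ⟨s, hs, hs2, hqs⟩ := exists_holo_of_mem_triSpan (hq (2, 0, 0))
  obtain ⟨s', hs', hs2', hqs'⟩ := exists_holo_of_mem_triSpan (triSpan_conj (hq (0, 2, 0)))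
  obtain ⟨M, hM⟩ := exists_form_of_mem_triSpan (hq (1, 1, 0))
  obtain ⟨c, hc⟩ := eq_smul_of_mem_triSpan (hq (0, 0, 1))
  let lam : EuclideanSpace ℂ (Fin n) → ℝ := fun z => (∑ i, ∑ j, M i j * (z i * conj (z j))).re
  let Q : ParamSpace n → ℝ := fun x => (s x.1 + s' x.1).re + lam x.1 + c.re * x.2
  have hQ : ∀ x, ∑ i ∈ ({(2, 0, 0), (1, 1, 0), (0, 2, 0), (0, 0, 1)} : Finset (ℕ × ℕ × ℕ)),
      (q i x).re = Q x := by
    intro x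
    have h1 : (q (0, 2, 0) x).re = (s' x.1).re := by rw [← hqs', Complex.conj_re]
    simp [hqs, hM, hc, h1, Q, lam]
    ring
  simp only [hQ] at hexp
  have hdil : ∀ (t : ℝ) x, Q (dil t x) = t ^ 2 * Q x := by
    intro t x
    rw [← hQ, ← hQ, Finset.mul_sum]
    refine Finset.sum_congr rfl fun i hi => ?_
    have hi2 : wt i = 2 := by
      fin_cases hi <;> rfl
    rw [triSpan_dil (hq i), hi2, ← Complex.ofReal_pow, Complex.re_ofReal_mul]
  have hlim := fun x => tendsto_dil_div hexp hdil x
  -- Since φ = O(‖x‖²), it has no term linear in u, although such a term has weight only 2.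
  have hc0 : c.re = 0 := by
    have h1 := hlim (0, 1)
    have h2 : Tendsto (fun t : ℝ => φ (dil t ((0 : EuclideanSpace ℂ (Fin n)), 1)) / t ^ 2)
        (𝓝[>] 0) (𝓝 0) := by
      have h3 : (fun t : ℝ => dil t ((0 : EuclideanSpace ℂ (Fin n)), (1 : ℝ))) =O[𝓝[>] 0]
          fun t => t ^ 2 := IsBigO.of_bound 1 (by filter_upwards with t; simp [dil, sq_nonneg])
      have h4 : (fun t : ℝ => (t ^ 2) ^ 2) =o[𝓝[>] 0] fun t : ℝ => t ^ 2 := by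
        have := (isLittleO_pow_pow (𝕜 := ℝ) (show 2 < 4 by norm_num)).mono
          (nhdsWithin_le_nhds (s := Set.Ioi (0 : ℝ)))
        simpa only [← pow_mul] using this
      exact (((H.isBigO.comp_tendsto (tendsto_dil _)).trans
        (h3.norm_left.pow 2)).trans_isLittleO h4).tendsto_div_nhds_zero
    have h5 := tendsto_nhds_unique h1 h2
    have h6 : s 0 = 0 := by simpa using hs2 0 0
    have h7 : s' 0 = 0 := by simpa using hs2' 0 0
    simpa [Q, lam, h6, h7] using h5
  -- The holomorphic quadratic parts change sign under z ↦ iz, so Q(z, 0) + Q(iz, 0) = 2 lam z; by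
  -- the second order formula this is half the Levi expression at T(z, 0).
  have hpos : ∀ z : EuclideanSpace ℂ (Fin n), z ≠ 0 → 0 < lam z := by
    intro z hz
    have h1 : ∀ z, Q (z, 0) = 1 / 2 * fderiv ℝ (fderiv ℝ ρ) p (T (z, 0)) (T (z, 0)) := fun z =>
      tendsto_nhds_unique (hlim (z, 0)) (tendsto_graph_second_order hρs hρ0 hT H.isBigO hφρ z)
    have h2 : Complex.I • T (z, 0) = T (Complex.I • z, 0) := by
      rw [← map_smul]
      simp
    have h3 := hlevi (T (z, 0)) (by
      rw [Ne, map_eq_zero_iff T T.injective]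
      exact fun h => hz (congrArg Prod.fst h)) (by rw [hT]; simp) (by rw [h2, hT]; simp)
    rw [h2] at h3
    have h4 := h1 z
    have h5 := h1 (Complex.I • z)
    have h6 : lam (Complex.I • z) = lam z := by
      simp only [lam]
      congr 1
      refine Finset.sum_congr rfl fun i _ => Finset.sum_congr rfl fun j _ => ?_
      simp only [PiLp.smul_apply, smul_eq_mul, map_mul, Complex.conj_I]
      linear_combination (-(M i j * (z i * conj (z j)))) * Complex.I_sq
    simp only [Q, hs2, hs2', h6, Complex.I_sq] at h4 h5
    simp at h4 h5
    linarith
  obtain ⟨B, hB⟩ := exists_norm_sq_eq hpos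
  let S : EuclideanSpace ℂ (Fin n) → ℂ := fun z => s z + s' z
  have hSd : Differentiable ℂ S := hs.add hs'
  have hS2 : ∀ (a : ℂ) z, S (a • z) = a ^ 2 * S z := fun a z => by simp only [S, hs2, hs2']; ring
  -- B turns the Levi form into ‖z‖², and Im(w − iS) = Im w − Re S removes the pluriharmonic
  -- quadratic terms.
  let Ψ : CSpace n → CSpace n := fun y => (B y.1, y.2 - Complex.I * S y.1)
  have hΨ : Differentiable ℂ Ψ := by
    have h1 : Differentiable ℂ fun y : CSpace n => S y.1 := hSd.comp differentiable_fst
    exact (B.differentiable.comp differentiable_fst).prodMk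
      (differentiable_snd.sub (h1.const_mul _))
  have hS0 : S 0 = 0 := by simpa using hS2 0 0
  have hdS : HasFDerivAt S (0 : EuclideanSpace ℂ (Fin n) →L[ℂ] ℂ) 0 := by
    have h1 := (hSd 0).hasFDerivAt
    convert h1 using 1
    refine (ContinuousLinearMap.ext fun z => ?_).symm
    have h2 := (show HasFDerivAt S (fderiv ℂ S 0) ((0 : ℂ) • z) by rwa [zero_smul]).comp_hasDerivAt
      (0 : ℂ) ((hasDerivAt_id (0 : ℂ)).smul_const z)
    have h3 : HasDerivAt (fun a : ℂ => S (a • z)) 0 0 := by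
      simp only [hS2]
      have := ((hasDerivAt_id (0 : ℂ)).pow 2).mul_const (S z)
      simpa using! this
    have h4 := h2.unique h3
    simpa using h4
  have hL : HasFDerivAt Ψ ((B.prodCongr (ContinuousLinearEquiv.refl ℂ ℂ) :
      CSpace n ≃L[ℂ] CSpace n) : CSpace n →L[ℂ] CSpace n) 0 := by
    have h1 : HasFDerivAt (fun y : CSpace n => S y.1) (0 : CSpace n →L[ℂ] ℂ) 0 := by
      have := (show HasFDerivAt S (0 : EuclideanSpace ℂ (Fin n) →L[ℂ] ℂ) (0 : CSpace n).1
        from hdS).comp (0 : CSpace n) hasFDerivAt_fst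
      simpa using! this
    have h2 : HasFDerivAt Ψ _ 0 :=
      (((B : EuclideanSpace ℂ (Fin n) →L[ℂ] EuclideanSpace ℂ (Fin n)).comp
        (ContinuousLinearMap.fst ℂ _ ℂ)).hasFDerivAt).prodMk
        ((ContinuousLinearMap.snd ℂ (EuclideanSpace ℂ (Fin n)) ℂ).hasFDerivAt.sub
          (h1.const_mul Complex.I))
    refine h2.congr_fderiv (ContinuousLinearMap.ext fun y => ?_)
    simp [Prod.map]
  obtain ⟨h', φ', H', hstep⟩ := H.exists_trans hΨ (by simp [Ψ, hS0]) hL (fun y => rfl)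
  refine ⟨h', φ', H', hstep (fun x => ‖x.1‖ ^ 2) 2 (hexp.congr_left fun x => ?_)⟩
  have h1 : ‖B x.1‖ ^ 2 = lam x.1 := (hB x.1).symm
  simp only [Ψ, toP_fst, graphMap_fst, h1, Complex.sub_im, graphMap_im, Q, hc0]
  simp [S]
  ring

end WeightTwo

/-! ### Weighted homogeneous maps and slowly varying functions -/

section Normalization

open Asymptotics Filter

variable {n : ℕ}

section WeightedHomogeneous

variable {F : Type*} [NormedAddCommGroup F] [NormedSpace ℂ F] {m : ℕ} {f : CSpace n → F}

lemma weighted_scale (hf : ∀ (t : ℝ) (y : CSpace n),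
      f ((t : ℂ) • y.1, (t : ℂ) ^ 2 * y.2) = (t : ℂ) ^ m • f y)
    {t : ℝ} (ht : t ≠ 0) (y : CSpace n) :
    f y = (t : ℂ) ^ m • f (((t⁻¹ : ℝ) : ℂ) • y.1, ((t⁻¹ : ℝ) : ℂ) ^ 2 * y.2) := by
  rw [← hf]
  congr 1
  have h : (t : ℂ) ≠ 0 := by exact_mod_cast ht
  refine Prod.ext ?_ ?_
  · simp [smul_smul, h]
  · push_cast
    field_simp

lemma wHol_zero (hf : f ∈ wHol n m F) (hm : m ≠ 0) : f 0 = 0 := by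
  have := hf.2 0 0
  rw [Complex.ofReal_zero, zero_pow hm, zero_smul] at this
  simpa using! this

lemma norm_scale_le {C r : ℝ} (hr : 0 < r) {y : CSpace n}
    (h : ‖y.1‖ ≤ C * r ∧ ‖y.2‖ ≤ C * r ^ 2) :
    ‖((((r⁻¹ : ℝ) : ℂ) • y.1, ((r⁻¹ : ℝ) : ℂ) ^ 2 * y.2) : CSpace n)‖ ≤ C := by
  refine max_le ?_ ?_
  · rw [norm_smul, Complex.norm_real, Real.norm_of_nonneg (inv_nonneg.2 hr.le),
      inv_mul_le_iff₀ hr, mul_comm]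
    exact h.1
  · rw [norm_mul, norm_pow, Complex.norm_real, Real.norm_of_nonneg (inv_nonneg.2 hr.le), inv_pow,
      inv_mul_le_iff₀ (by positivity), mul_comm]
    exact h.2

/-- Weighted homogeneous maps are bounded by powers of the weighted size of the argument. -/
lemma weighted_isBigO (hc : Continuous f) (hf : ∀ (t : ℝ) (y : CSpace n),
      f ((t : ℂ) • y.1, (t : ℂ) ^ 2 * y.2) = (t : ℂ) ^ m • f y)
    {α : Type*} {l : Filter α} {u : α → CSpace n} {r : α → ℝ}
    (hr : ∀ᶠ x in l, 0 ≤ r x) {C : ℝ} (hC : 0 ≤ C)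
    (hu : ∀ᶠ x in l, ‖(u x).1‖ ≤ C * r x ∧ ‖(u x).2‖ ≤ C * r x ^ 2) :
    (fun x => f (u x)) =O[l] fun x => r x ^ m := by
  obtain ⟨M, hM⟩ := (isCompact_closedBall (0 : CSpace n) C).exists_bound_of_continuousOn
    hc.continuousOn
  refine IsBigO.of_bound M ?_
  filter_upwards [hr, hu] with x h0 h1
  rw [norm_pow, Real.norm_of_nonneg h0]
  rcases h0.eq_or_lt with h0 | h0
  · rw [← h0] at h1 ⊢
    have h2 : u x = 0 := Prod.ext (by simpa using h1.1) (by simpa using h1.2)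
    have h3 := hf 0 0
    rw [Complex.ofReal_zero] at h3
    have h4 : f (u x) = (0 : ℂ) ^ m • f 0 := by
      rw [h2, ← h3]
      congr 1
      exact Prod.ext (by simp) (by simp)
    rw [h4, norm_smul, norm_pow, norm_zero, mul_comm]
    exact mul_le_mul_of_nonneg_right (hM 0 (by simpa using hC)) (by positivity)
  · rw [weighted_scale hf h0.ne', norm_smul, norm_pow, Complex.norm_real, Real.norm_of_nonneg h0.le,
      mul_comm]
    refine mul_le_mul_of_nonneg_right (hM _ ?_) (by positivity)
    simpa using norm_scale_le h0 h1

/-- Weighted homogeneous maps under perturbations of the argument of higher weight. -/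
lemma weighted_sub_isLittleO (hc : Continuous f) (hf : ∀ (t : ℝ) (y : CSpace n),
      f ((t : ℂ) • y.1, (t : ℂ) ^ 2 * y.2) = (t : ℂ) ^ m • f y)
    {α : Type*} {l : Filter α} {u v : α → CSpace n}
    {r : α → ℝ} (hr : ∀ᶠ x in l, 0 ≤ r x) {C : ℝ}
    (hu : ∀ᶠ x in l, ‖(u x).1‖ ≤ C * r x ∧ ‖(u x).2‖ ≤ C * r x ^ 2)
    (h1 : (fun x => (v x).1 - (u x).1) =o[l] r)
    (h2 : (fun x => (v x).2 - (u x).2) =o[l] fun x => r x ^ 2) :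
    (fun x => f (v x) - f (u x)) =o[l] fun x => r x ^ m := by
  have huc := (isCompact_closedBall (0 : CSpace n) (C + 1)).uniformContinuousOn_of_continuous
    hc.continuousOn
  refine IsLittleO.of_bound fun ε hε => ?_
  obtain ⟨δ, hδ, hδε⟩ := Metric.uniformContinuousOn_iff.1 huc ε hε
  have hη : 0 < min (δ / 2) 1 := lt_min (by linarith) one_pos
  filter_upwards [hr, hu, h1.bound hη, h2.bound hη] with x h0 hx hx1 hx2
  rw [norm_pow, Real.norm_of_nonneg h0] at hx2 ⊢
  rw [Real.norm_of_nonneg h0] at hx1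
  rcases h0.eq_or_lt with h0 | h0
  · rw [← h0] at hx1 hx2
    have h3 : v x = u x := Prod.ext (by simpa [sub_eq_zero] using hx1)
      (by simpa [sub_eq_zero] using hx2)
    rw [h3, sub_self, norm_zero]
    positivity
  · rw [weighted_scale hf h0.ne' (v x), weighted_scale hf h0.ne' (u x), ← smul_sub, norm_smul, norm_pow,
      Complex.norm_real, Real.norm_of_nonneg h0.le, mul_comm]
    refine mul_le_mul_of_nonneg_right ?_ (by positivity)
    have h4 := norm_scale_le (y := v x - u x) h0 ⟨hx1, hx2⟩
    have h5 := norm_scale_le h0 hx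
    have h6 : ∀ a : ℂ, ((a • (v x - u x).1, a ^ 2 * (v x - u x).2) : CSpace n) =
        (a • (v x).1, a ^ 2 * (v x).2) - (a • (u x).1, a ^ 2 * (u x).2) := fun a =>
      Prod.ext (by simp [smul_sub]) (by simp [mul_sub])
    rw [h6] at h4
    rw [← dist_eq_norm]
    refine (hδε _ ?_ _ ?_ ?_).le
    · rw [mem_closedBall_zero_iff]
      have h7 := norm_le_norm_add_norm_sub' (((((r x)⁻¹ : ℝ) : ℂ) • (v x).1,
        (((r x)⁻¹ : ℝ) : ℂ) ^ 2 * (v x).2) : CSpace n) ((((r x)⁻¹ : ℝ) : ℂ) • (u x).1,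
        (((r x)⁻¹ : ℝ) : ℂ) ^ 2 * (u x).2)
      linarith [h4.trans (min_le_right _ _)]
    · rw [mem_closedBall_zero_iff]
      linarith
    · rw [dist_eq_norm]
      linarith [h4.trans (min_le_left _ _)]

/-- The function t ↦ f(tz, 0) equals t^m f(z, 0), with vanishing derivative at 0 as soon as m ≥ 2.
-/
lemma fderiv_wHol_fst (hf : f ∈ wHol n m F) (hm : 2 ≤ m) (z : EuclideanSpace ℂ (Fin n)) :
    fderiv ℂ f 0 (z, 0) = 0 := by
  have h1 : HasFDerivAt f ((fderiv ℂ f 0).restrictScalars ℝ) ((0 : ℝ) • ((z, 0) : CSpace n)) := by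
    rw [zero_smul]
    exact (hf.1 0).hasFDerivAt.restrictScalars ℝ
  have h2 := h1.comp_hasDerivAt (0 : ℝ) ((hasDerivAt_id (0 : ℝ)).smul_const ((z, 0) : CSpace n))
  have h3 : HasDerivAt (fun t : ℝ => f (t • ((z, 0) : CSpace n))) 0 0 := by
    have h4 : (fun t : ℝ => f (t • ((z, 0) : CSpace n))) = fun t : ℝ => (t ^ m) • f (z, 0) := by
      funext t
      have := hf.2 t (z, 0)
      rw [mul_zero, ← Complex.ofReal_pow, Complex.coe_smul, Complex.coe_smul] at this
      rw [← this, Prod.smul_mk, smul_zero]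
    rw [h4]
    have h5 := ((hasDerivAt_id (0 : ℝ)).pow m).smul_const (f (z, 0))
    have h6 : (0 : ℝ) ^ (m - 1) = 0 := zero_pow (by omega)
    simpa [h6] using! h5
  simpa using! h2.unique h3

/-- Because w has weight 2, the slope at parameter t² is t^{m−2} f(0, w); it tends to 0 once m ≥ 3.
-/
lemma fderiv_wHol_snd (hf : f ∈ wHol n m F) (hm : 3 ≤ m) (w : ℂ) :
    fderiv ℂ f 0 (0, w) = 0 := by
  have h1 : HasFDerivAt f ((fderiv ℂ f 0).restrictScalars ℝ) ((0 : ℝ) • ((0, w) : CSpace n)) := by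
    rw [zero_smul]
    exact (hf.1 0).hasFDerivAt.restrictScalars ℝ
  have h2 := h1.comp_hasDerivAt (0 : ℝ) ((hasDerivAt_id (0 : ℝ)).smul_const ((0, w) : CSpace n))
  have h3 := h2.tendsto_slope_zero_right
  have h4 : Tendsto (fun t : ℝ => t ^ 2) (𝓝[>] 0) (𝓝[>] 0) := by
    refine tendsto_nhdsWithin_iff.2 ⟨?_, ?_⟩
    · have : Continuous fun t : ℝ => t ^ 2 := by fun_prop
      simpa using (this.tendsto 0).mono_left (nhdsWithin_le_nhds (s := Set.Ioi 0))
    · filter_upwards [self_mem_nhdsWithin] with t ht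
      exact pow_pos (Set.mem_Ioi.1 ht) 2
  have h5 := h3.comp h4
  have h6 : Tendsto (fun t : ℝ => t ^ (m - 2) • f (0, w)) (𝓝[>] 0) (𝓝 0) := by
    have : Continuous fun t : ℝ => t ^ (m - 2) • f (0, w) := by fun_prop
    have h7 : (0 : ℝ) ^ (m - 2) = 0 := zero_pow (by omega)
    simpa [h7] using (this.tendsto 0).mono_left (nhdsWithin_le_nhds (s := Set.Ioi 0))
  have h8 := tendsto_nhds_unique (h6.congr' ?_) h5
  · simpa using! h8.symm
  · filter_upwards [self_mem_nhdsWithin] with t ht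
    have ht0 : t ≠ 0 := ne_of_gt ht
    have h9 := hf.2 t (0, w)
    rw [smul_zero, ← Complex.ofReal_pow, ← Complex.ofReal_pow, Complex.coe_smul] at h9
    have h10 : f ((t ^ 2 : ℝ) • ((0, w) : CSpace n)) = t ^ m • f (0, w) := by
      rw [← h9, Prod.smul_mk, smul_zero, Complex.real_smul]
    simp only [Function.comp_apply, id_eq, zero_add, zero_smul]
    have hf0 : f 0 = 0 := wHol_zero hf (by omega)
    rw [h10, hf0, sub_zero, smul_smul]
    congr 1
    obtain ⟨j, rfl⟩ := Nat.exists_eq_add_of_le (show 2 ≤ m by omega)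
    rw [Nat.add_sub_cancel_left]
    field_simp
    ring

end WeightedHomogeneous

/-- Smooth functions on `ℂⁿ` which, like homogeneous polynomials of degree at least `4`, vary slowly
near the origin. -/
def IsSlowlyVarying (N : EuclideanSpace ℂ (Fin n) → ℝ) : Prop :=
  ContDiff ℝ ∞ N ∧ ∀ δ : ParamSpace n → EuclideanSpace ℂ (Fin n), δ =o[𝓝 0] wnorm →
    (fun x => N (x.1 + δ x) - N x.1) =O[𝓝 0] fun x => wnorm x ^ 3 * ‖δ x‖

lemma isSlowlyVarying_zero : IsSlowlyVarying (n := n) fun _ => 0 :=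
  ⟨contDiff_const, fun δ _ => by simpa using isBigO_zero _ _⟩

lemma IsSlowlyVarying.add {N N' : EuclideanSpace ℂ (Fin n) → ℝ} (h : IsSlowlyVarying N)
    (h' : IsSlowlyVarying N') : IsSlowlyVarying fun z => N z + N' z :=
  ⟨h.1.add h'.1, fun δ hδ => ((h.2 δ hδ).add (h'.2 δ hδ)).congr_left fun x => by ring⟩

/-- The derivative is homogeneous of degree m, hence controlled by its maximum on the unit ball. At
the origin, scaling by 2 shows that it vanishes when m > 0. -/
lemma norm_fderiv_le_of_homogeneous {N : EuclideanSpace ℂ (Fin n) → ℝ} (hN : ContDiff ℝ ∞ N) {m : ℕ}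
    (hm : ∀ (t : ℝ) z, N (t • z) = t ^ (m + 1) * N z) :
    ∃ C, 0 ≤ C ∧ ∀ z, ‖fderiv ℝ N z‖ ≤ C * ‖z‖ ^ m := by
  have hc : Continuous (fderiv ℝ N) := hN.continuous_fderiv (by simp)
  obtain ⟨C, hC⟩ := (isCompact_closedBall (0 : EuclideanSpace ℂ (Fin n)) 1).exists_bound_of_continuousOn
    hc.continuousOn
  have hhom : ∀ t : ℝ, t ≠ 0 → ∀ z, fderiv ℝ N (t • z) = t ^ m • fderiv ℝ N z := by
    intro t ht z
    have h1 := (hN.differentiable (by simp) z).hasFDerivAt.const_mul (t ^ (m + 1))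
    have h2 : HasFDerivAt (fun z => N (t • z)) _ z :=
      ((hN.differentiable (by simp) (t • z)).hasFDerivAt.comp z
        ((hasFDerivAt_id z).const_smul t))
    simp only [hm] at h2
    have h3 := h2.unique h1
    refine ContinuousLinearMap.ext fun v => ?_
    have h4 := DFunLike.congr_fun h3 v
    simp at h4 ⊢
    rw [pow_succ] at h4
    refine mul_left_cancel₀ ht ?_
    linarith
  have hC0 : 0 ≤ C := (norm_nonneg _).trans (hC 0 (by simp))
  refine ⟨C, hC0, fun z => ?_⟩
  rcases eq_or_ne z 0 with rfl | hz
  · rcases eq_or_ne m 0 with rfl | hm0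
    · simpa using hC 0 (by simp)
    · have h2 : fderiv ℝ N 0 = (2 : ℝ) ^ m • fderiv ℝ N 0 := by
        simpa using hhom 2 two_ne_zero 0
      have h3 : ((2 : ℝ) ^ m - 1) • fderiv ℝ N 0 = 0 := by
        rw [sub_smul, one_smul, ← h2, sub_self]
      have h4 : (2 : ℝ) ^ m - 1 ≠ 0 := by
        have := one_lt_pow₀ (one_lt_two (α := ℝ)) hm0
        linarith
      rw [(smul_eq_zero.1 h3).resolve_left h4]
      simp [hm0]
  · have hz0 : 0 < ‖z‖ := norm_pos_iff.2 hz
    have h1 := hhom ‖z‖ hz0.ne' (‖z‖⁻¹ • z)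
    rw [smul_smul, mul_inv_cancel₀ hz0.ne', one_smul] at h1
    rw [h1, norm_smul, norm_pow, norm_norm, mul_comm]
    refine mul_le_mul_of_nonneg_right (hC _ ?_) (by positivity)
    rw [mem_closedBall_zero_iff, norm_smul, norm_inv, norm_norm, inv_mul_cancel₀ hz0.ne']

/-- The mean value inequality on the ball of radius 2 `wnorm x`, which contains both points since δ
= o(`wnorm`). -/
lemma isSlowlyVarying_of_homogeneous {N : EuclideanSpace ℂ (Fin n) → ℝ} (hN : ContDiff ℝ ∞ N) {m : ℕ}
    (hm3 : 3 ≤ m) (hm : ∀ (t : ℝ) z, N (t • z) = t ^ (m + 1) * N z) : IsSlowlyVarying N := by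
  obtain ⟨C, hC, hbound⟩ := norm_fderiv_le_of_homogeneous hN hm
  refine ⟨hN, fun δ hδ => IsBigO.of_bound (C * 2 ^ m) ?_⟩
  filter_upwards [hδ.bound one_pos, eventually_wnorm_le (n := n) one_pos] with x hx hx1
  have hw := wnorm_nonneg x
  rw [one_mul, Real.norm_of_nonneg hw] at hx
  have h1 : ∀ ξ ∈ Metric.closedBall (0 : EuclideanSpace ℂ (Fin n)) (2 * wnorm x),
      ‖fderiv ℝ N ξ‖ ≤ C * (2 * wnorm x) ^ m := by
    intro ξ hξ
    rw [mem_closedBall_zero_iff] at hξ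
    exact (hbound ξ).trans (by gcongr)
  have h2 := (convex_closedBall (0 : EuclideanSpace ℂ (Fin n)) (2 * wnorm x)).norm_image_sub_le_of_norm_fderiv_le
    (fun ξ _ => hN.differentiable (by simp) ξ) h1 (x := x.1) (y := x.1 + δ x)
    (by
      rw [mem_closedBall_zero_iff]
      linarith [norm_fst_le_wnorm x])
    (by
      rw [mem_closedBall_zero_iff]
      linarith [norm_fst_le_wnorm x, norm_add_le x.1 (δ x)])
  rw [add_sub_cancel_left] at h2
  refine h2.trans ?_
  rw [norm_mul, norm_pow, Real.norm_of_nonneg hw, norm_norm, mul_pow, ← mul_assoc, ← mul_assoc]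
  refine mul_le_mul_of_nonneg_right ?_ (norm_nonneg _)
  exact mul_le_mul_of_nonneg_left (pow_le_pow_of_le_one hw hx1 hm3) (by positivity)

end Normalization

/-! ### Weights three to five: existence of normal coordinates -/

section NormalizationStep

open Asymptotics Filter

variable {n : ℕ}

/-- A map g of weight k ≥ 3 has no linear part, and the linear part of f, of weight at least 2, can
involve only w. The derivative is therefore a shear, inverted by changing a sign. -/
lemma exists_hasFDerivAt_shear {k : ℕ} (hk : 3 ≤ k)
    {f : CSpace n → EuclideanSpace ℂ (Fin n)} (hf : f ∈ wHol n (k - 1) (EuclideanSpace ℂ (Fin n)))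
    {g : CSpace n → ℂ} (hg : g ∈ wHol n k ℂ) :
    ∃ L : CSpace n ≃L[ℂ] CSpace n, (∀ y, (L y).2 = y.2) ∧
      HasFDerivAt (fun y : CSpace n => ((y.1 + f y, y.2 + g y) : CSpace n))
        (L : CSpace n →L[ℂ] CSpace n) 0 := by
  let A : ℂ →L[ℂ] EuclideanSpace ℂ (Fin n) :=
    (fderiv ℂ f 0).comp (ContinuousLinearMap.inr ℂ (EuclideanSpace ℂ (Fin n)) ℂ)
  have hfd : ∀ y : CSpace n, fderiv ℂ f 0 y = A y.2 := by
    intro y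
    have h1 : y = (y.1, 0) + (0, y.2) := by simp
    have h2 : fderiv ℂ f 0 y = fderiv ℂ f 0 (y.1, 0) + fderiv ℂ f 0 (0, y.2) := by
      rw [← map_add, ← h1]
    rw [h2, fderiv_wHol_fst hf (by omega), zero_add]
    rfl
  have hgd : ∀ y : CSpace n, fderiv ℂ g 0 y = 0 := by
    intro y
    have h1 : y = (y.1, 0) + (0, y.2) := by simp
    have h2 : fderiv ℂ g 0 y = fderiv ℂ g 0 (y.1, 0) + fderiv ℂ g 0 (0, y.2) := by
      rw [← map_add, ← h1]
    rw [h2, fderiv_wHol_fst hg (by omega), fderiv_wHol_snd hg hk, add_zero]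
  let fstL := ContinuousLinearMap.fst ℂ (EuclideanSpace ℂ (Fin n)) ℂ
  let sndL := ContinuousLinearMap.snd ℂ (EuclideanSpace ℂ (Fin n)) ℂ
  let L : CSpace n ≃L[ℂ] CSpace n := ContinuousLinearEquiv.equivOfInverse
    ((fstL + A.comp sndL).prod sndL) ((fstL - A.comp sndL).prod sndL)
    (fun y => by simp [fstL, sndL]) (fun y => by simp [fstL, sndL])
  refine ⟨L, fun y => rfl, ?_⟩
  have h1 : HasFDerivAt (fun y : CSpace n => ((y.1 + f y, y.2 + g y) : CSpace n)) _ 0 :=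
    (fstL.hasFDerivAt.add (hf.1 0).hasFDerivAt).prodMk
      (sndL.hasFDerivAt.add (hg.1 0).hasFDerivAt)
  refine h1.congr_fderiv (ContinuousLinearMap.ext fun y => ?_)
  refine Prod.ext ?_ ?_
  · change y.1 + fderiv ℂ f 0 y = y.1 + A y.2
    rw [hfd]
  · change y.2 + fderiv ℂ g 0 y = y.2
    rw [hgd, add_zero]

lemma norm_modelW_le (x : ParamSpace n) : ‖modelW x‖ ≤ 2 * wnorm x ^ 2 := by
  have h1 := abs_snd_le_wnorm x
  have h2 := pow_le_pow_left₀ (norm_nonneg _) (norm_fst_le_wnorm x) 2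
  refine (norm_add_le _ _).trans ?_
  rw [Complex.norm_real, norm_mul, Complex.norm_I, one_mul, norm_pow, Complex.norm_real, norm_norm,
    Real.norm_eq_abs]
  linarith

lemma eventually_norm_model_le : ∀ᶠ x : ParamSpace n in 𝓝 0,
    ‖((x.1, modelW x) : CSpace n).1‖ ≤ 2 * wnorm x ∧
      ‖((x.1, modelW x) : CSpace n).2‖ ≤ 2 * wnorm x ^ 2 :=
  Eventually.of_forall fun x =>
    ⟨(norm_fst_le_wnorm x).trans (by linarith [wnorm_nonneg x]), norm_modelW_le x⟩

/-- On the graph, w may be replaced by its model value u + i‖z‖² without affecting the leading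
weight; this makes the normalization step linear to leading order. -/
lemma wHol_graphMap_sub {F : Type*} [NormedAddCommGroup F] [NormedSpace ℂ F] {m : ℕ}
    {f : CSpace n → F} (hf : f ∈ wHol n m F) {φ : ParamSpace n → ℝ}
    (hφ : (fun x => φ x - ‖x.1‖ ^ 2) =o[𝓝 0] fun x => wnorm x ^ 2) :
    (fun x => f (graphMap φ x) - f (x.1, modelW x)) =o[𝓝 0] fun x => wnorm x ^ m := by
  refine weighted_sub_isLittleO hf.1.continuous hf.2 (Eventually.of_forall wnorm_nonneg)
    eventually_norm_model_le ?_ ?_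
  · simpa only [graphMap_fst, sub_self] using isLittleO_zero _ _
  · refine IsBigO.trans_isLittleO (IsBigO.of_bound 1 (Eventually.of_forall fun x => ?_)) hφ
    have h1 : (graphMap φ x).2 - modelW x = Complex.I * ((φ x - ‖x.1‖ ^ 2 : ℝ) : ℂ) := by
      simp only [graphMap, toC, modelW]
      push_cast
      ring
    rw [h1, norm_mul, Complex.norm_I, Complex.norm_real]

lemma wHol_model_isBigO {F : Type*} [NormedAddCommGroup F] [NormedSpace ℂ F] {m : ℕ}
    {f : CSpace n → F} (hf : f ∈ wHol n m F) :
    (fun x : ParamSpace n => f (x.1, modelW x)) =O[𝓝 0] fun x => wnorm x ^ m :=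
  weighted_isBigO hf.1.continuous hf.2 (Eventually.of_forall wnorm_nonneg) zero_le_two eventually_norm_model_le

/-- One step of the normalization: the terms of weight `k` are brought to normal form. -/
theorem IsGraphChart.exists_normalization {D : Set (CSpace n)} {p : CSpace n}
    {h : OpenPartialHomeomorph (CSpace n) (CSpace n)} {φ : ParamSpace n → ℝ}
    (H : IsGraphChart D p h φ) {N : EuclideanSpace ℂ (Fin n) → ℝ} (hN : IsSlowlyVarying N) {k : ℕ}
    (hk : 2 ≤ k) (hk4 : k ≤ 4)
    (hφ2 : (fun x => φ x - ‖x.1‖ ^ 2) =o[𝓝 0] fun x => wnorm x ^ 2)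
    (hφ : (fun x => φ x - (‖x.1‖ ^ 2 + N x.1)) =o[𝓝 0] fun x => wnorm x ^ k)
    {S : Submodule ℝ (ParamSpace n → ℝ)}
    (hS : ∀ i, wt i = k + 1 → ∀ f ∈ triSpan n i, (fun x => (f x).re) ∈ homSub n (k + 1) ⊔ S)
    (hSN : ∀ r ∈ S, ∃ R : EuclideanSpace ℂ (Fin n) → ℝ, IsSlowlyVarying R ∧ ∀ x, r x = R x.1) :
    ∃ h' φ', IsGraphChart D p h' φ' ∧ ∃ r ∈ S,
      (fun x => φ' x - (‖x.1‖ ^ 2 + N x.1 + r x)) =o[𝓝 0] fun x => wnorm x ^ (k + 1) := by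
  have hsq : ContDiff ℝ ∞ fun x : ParamSpace n => ‖x.1‖ ^ 2 := contDiff_fst.norm_sq ℂ
  obtain ⟨q, hq, hexp⟩ := exists_leading_part
    (H.contDiffAt.sub (hsq.add (hN.1.comp contDiff_fst)).contDiffAt) hk4 hφ
  have hmem : (∑ i ∈ lowIdx with wt i = k + 1, fun x => (q i x).re) ∈ homSub n (k + 1) ⊔ S :=
    Submodule.sum_mem _ fun i hi => hS i (Finset.mem_filter.1 hi).2 _ (hq i)
  -- The terms of weight k + 1 split into q₁, which the shear by f and g will absorb, and r, which
  -- stays in the normal form.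
  obtain ⟨q₁, ⟨f, hf, g, hg, hq₁⟩, r, hr, hqr⟩ := Submodule.mem_sup.1 hmem
  obtain ⟨R, hR, hrR⟩ := hSN r hr
  rw [Nat.add_sub_cancel] at hf
  have hsum : ∀ x, ∑ i ∈ lowIdx with wt i = k + 1, (q i x).re = q₁ x + r x := fun x => by
    rw [← Finset.sum_apply x _ (fun i x => (q i x).re), ← hqr, Pi.add_apply]
  simp only [hsum] at hexp
  obtain ⟨L, hL2, hL⟩ := exists_hasFDerivAt_shear (k := k + 1) (by omega)
    (by rwa [Nat.add_sub_cancel]) hg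
  obtain ⟨h', φ', H', hstep⟩ := H.exists_trans
    (Ψ := fun y => ((y.1 + f y, y.2 + g y) : CSpace n))
    ((differentiable_fst.add hf.1).prodMk (differentiable_snd.add hg.1))
    (by simp [wHol_zero hf (by omega), wHol_zero hg (by omega)]) hL hL2
  refine ⟨h', φ', H', r, hr, hstep _ (k + 1) ?_⟩
  have ef := wHol_graphMap_sub hf hφ2
  have eg := wHol_graphMap_sub hg hφ2
  have fO : (fun x => f (graphMap φ x)) =O[𝓝 0] fun x => wnorm x ^ k :=
    (ef.isBigO.add (wHol_model_isBigO hf)).congr_left fun x => by simp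
  have hfo : (fun x => f (graphMap φ x)) =o[𝓝 0] wnorm := by
    refine fO.trans_isLittleO ?_
    simpa using wnorm_pow_isLittleO (n := n) (show 1 < k by omega)
  have t2 : (fun x => (g (graphMap φ x)).im - (g (x.1, modelW x)).im) =o[𝓝 0]
      fun x => wnorm x ^ (k + 1) := by
    refine IsBigO.trans_isLittleO (IsBigO.of_bound 1 (Eventually.of_forall fun x => ?_)) eg
    rw [one_mul, ← Complex.sub_im]
    exact Complex.abs_im_le_norm _
  have hfst : (fun x : ParamSpace n => x.1) =O[𝓝 0] wnorm :=
    IsBigO.of_bound 1 (Eventually.of_forall fun x => by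
      rw [one_mul, Real.norm_of_nonneg (wnorm_nonneg x)]
      exact norm_fst_le_wnorm x)
  have t3 : (fun x => 2 * (inner ℂ x.1 (f (graphMap φ x) - f (x.1, modelW x))).re) =o[𝓝 0]
      fun x => wnorm x ^ (k + 1) := by
    have h1 : (fun x : ParamSpace n => 2 * (inner ℂ x.1 (f (graphMap φ x) - f (x.1, modelW x))).re)
        =O[𝓝 0] fun x => ‖x.1‖ * ‖f (graphMap φ x) - f (x.1, modelW x)‖ := by
      refine IsBigO.of_bound 2 (Eventually.of_forall fun x => ?_)
      rw [norm_mul, Real.norm_two, norm_mul, norm_norm, norm_norm]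
      refine mul_le_mul_of_nonneg_left ?_ zero_le_two
      exact (Complex.abs_re_le_norm _).trans (norm_inner_le_norm _ _)
    refine (h1.trans_isLittleO (hfst.norm_left.mul_isLittleO ef.norm_left)).congr_right fun x => ?_
    ring
  -- The quadratic error has weight 2k, which exceeds k + 1 because k ≥ 2.
  have t4 : (fun x => ‖f (graphMap φ x)‖ ^ 2) =o[𝓝 0] fun x => wnorm x ^ (k + 1) := by
    refine (fO.norm_left.pow 2).trans_isLittleO ?_
    simp only [← pow_mul]
    exact wnorm_pow_isLittleO (by omega)
  have t5 : ∀ N : EuclideanSpace ℂ (Fin n) → ℝ, IsSlowlyVarying N →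
      (fun x : ParamSpace n => N (x.1 + f (graphMap φ x)) - N x.1) =o[𝓝 0]
        fun x => wnorm x ^ (k + 1) := by
    intro N hN
    refine ((hN.2 _ hfo).trans ((isBigO_refl _ _).mul fO.norm_left)).trans_isLittleO ?_
    simp only [← pow_add]
    exact wnorm_pow_isLittleO (by omega)
  -- Moving z by f changes ‖z‖² by 2 Re⟨z, f⟩ + ‖f‖², and moving w by g changes Im w by Im g. To
  -- leading order the difference is exactly q₁; N and R change only in higher weight.
  refine (((((hexp.add t2).sub t3).sub t4).sub (t5 N hN)).sub (t5 R hR)).congr_left fun x => ?_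
  have h1 : ‖x.1 + f (graphMap φ x)‖ ^ 2 = ‖x.1‖ ^ 2 + 2 * (inner ℂ x.1 (f (graphMap φ x))).re +
      ‖f (graphMap φ x)‖ ^ 2 := by
    rw [norm_add_sq (𝕜 := ℂ)]
    rfl
  simp only [toP_fst, graphMap_fst, Complex.add_im, graphMap_im, hrR, h1, hq₁, inner_sub_right,
    Complex.sub_re, Function.comp_apply]
  ring

lemma contDiff_coord (i : Fin n) : ContDiff ℝ ∞ fun z : EuclideanSpace ℂ (Fin n) => z i :=
  ((EuclideanSpace.proj (𝕜 := ℂ) i).restrictScalars ℝ).contDiff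

lemma contDiff_conj_coord (i : Fin n) :
    ContDiff ℝ ∞ fun z : EuclideanSpace ℂ (Fin n) => conj (z i) :=
  Complex.conjCLE.contDiff.comp (contDiff_coord i)

lemma contDiff_poly22 (a : Fin n → Fin n → Fin n → Fin n → ℂ) : ContDiff ℝ ∞ (poly22 a) :=
  ContDiff.sum fun i _ => ContDiff.sum fun j _ => ContDiff.sum fun k _ => ContDiff.sum fun l _ =>
    contDiff_const.mul ((((contDiff_coord i).mul (contDiff_coord j)).mul
      (contDiff_conj_coord k)).mul (contDiff_conj_coord l))

lemma contDiff_poly32 (b : Fin n → Fin n → Fin n → Fin n → Fin n → ℂ) : ContDiff ℝ ∞ (poly32 b) :=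
  ContDiff.sum fun i _ => ContDiff.sum fun j _ => ContDiff.sum fun k _ => ContDiff.sum fun l _ =>
    ContDiff.sum fun m _ => contDiff_const.mul (((((contDiff_coord i).mul (contDiff_coord j)).mul
      (contDiff_coord k)).mul (contDiff_conj_coord l)).mul (contDiff_conj_coord m))

lemma poly22_smul_arg (a : Fin n → Fin n → Fin n → Fin n → ℂ) (c : ℂ)
    (z : EuclideanSpace ℂ (Fin n)) : poly22 a (c • z) = c ^ 2 * conj c ^ 2 * poly22 a z := by
  simp only [poly22, Finset.mul_sum, PiLp.smul_apply, smul_eq_mul, map_mul]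
  refine Finset.sum_congr rfl fun i _ => Finset.sum_congr rfl fun j _ =>
    Finset.sum_congr rfl fun k _ => Finset.sum_congr rfl fun l _ => by ring

lemma poly32_smul_arg (b : Fin n → Fin n → Fin n → Fin n → Fin n → ℂ) (c : ℂ)
    (z : EuclideanSpace ℂ (Fin n)) : poly32 b (c • z) = c ^ 3 * conj c ^ 2 * poly32 b z := by
  simp only [poly32, Finset.mul_sum, PiLp.smul_apply, smul_eq_mul, map_mul]
  refine Finset.sum_congr rfl fun i _ => Finset.sum_congr rfl fun j _ =>
    Finset.sum_congr rfl fun k _ => Finset.sum_congr rfl fun l _ =>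
    Finset.sum_congr rfl fun m _ => by ring

lemma poly22_re_smul (a : Fin n → Fin n → Fin n → Fin n → ℂ) (t : ℝ)
    (z : EuclideanSpace ℂ (Fin n)) : (poly22 a (t • z)).re = t ^ 4 * (poly22 a z).re := by
  rw [← Complex.coe_smul, poly22_smul_arg, Complex.conj_ofReal, ← pow_add, ← Complex.ofReal_pow,
    Complex.re_ofReal_mul]

lemma poly32_re_smul (b : Fin n → Fin n → Fin n → Fin n → Fin n → ℂ) (t : ℝ)
    (z : EuclideanSpace ℂ (Fin n)) : (poly32 b (t • z)).re = t ^ 5 * (poly32 b z).re := by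
  rw [← Complex.coe_smul, poly32_smul_arg, Complex.conj_ofReal, ← pow_add, ← Complex.ofReal_pow,
    Complex.re_ofReal_mul]

lemma isBigO_of_homogeneous {N : EuclideanSpace ℂ (Fin n) → ℝ} (hN : Continuous N) {m : ℕ}
    (hm : ∀ (t : ℝ) z, N (t • z) = t ^ m * N z) :
    (fun x : ParamSpace n => N x.1) =O[𝓝 0] fun x => wnorm x ^ m := by
  obtain ⟨C, hC⟩ := (isCompact_closedBall (0 : EuclideanSpace ℂ (Fin n)) 1).exists_bound_of_continuousOn
    hN.continuousOn
  refine IsBigO.of_bound C (Eventually.of_forall fun x => ?_)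
  have hw := wnorm_nonneg x
  have h1 : x.1 = wnorm x • (wnorm x)⁻¹ • x.1 := by
    rcases eq_or_ne (wnorm x) 0 with h | h
    · have := norm_fst_le_wnorm x
      rw [h] at this
      rw [h, zero_smul, norm_le_zero_iff.1 this]
    · rw [smul_smul, mul_inv_cancel₀ h, one_smul]
  rw [h1, hm, norm_mul, mul_comm]
  refine mul_le_mul_of_nonneg_right (hC _ ?_) (norm_nonneg _)
  rw [mem_closedBall_zero_iff, norm_smul, norm_inv, Real.norm_of_nonneg hw, inv_mul_eq_div]
  exact div_le_one_of_le₀ (norm_fst_le_wnorm x) hw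

lemma isSlowlyVarying_poly22 (a : Fin n → Fin n → Fin n → Fin n → ℂ) :
    IsSlowlyVarying fun z => (poly22 a z).re := by
  exact isSlowlyVarying_of_homogeneous (m := 3)
    (Complex.reCLM.contDiff.comp (contDiff_poly22 a)) le_rfl (poly22_re_smul a)

lemma isSlowlyVarying_poly32 (b : Fin n → Fin n → Fin n → Fin n → Fin n → ℂ) :
    IsSlowlyVarying fun z => 2 * (poly32 b z).re := by
  refine isSlowlyVarying_of_homogeneous (m := 4)
    (contDiff_const.mul (Complex.reCLM.contDiff.comp (contDiff_poly32 b))) (by norm_num)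
    fun t z => ?_
  rw [poly32_re_smul]
  ring

/-- At strongly pseudoconvex boundary points there are Chern–Moser normal coordinates. -/
theorem exists_normalChart {D : Set (CSpace n)} {p : CSpace n} (hD : IsOpen D)
    (hp : p ∈ frontier D) (hpsc : IsStronglyPseudoconvexAt D p) :
    ∃ h φ, IsGraphChart D p h φ ∧ IsChernMoserGraph φ := by
  obtain ⟨h₂, φ₂, H₂, e₂⟩ := exists_graphChart_two hD hp hpsc
  -- All terms of weight 3 are removable, so the complement is zero here.
  obtain ⟨h₃, φ₃, H₃, r, hr, e₃⟩ := H₂.exists_normalization isSlowlyVarying_zero le_rfl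
    (by norm_num) e₂ (by simpa using e₂) (S := ⊥)
    (fun i hi f hf => Submodule.mem_sup_left (re_mem_of_weight_three hi hf))
    (fun r hr => ⟨_, isSlowlyVarying_zero, fun x => by simp [(Submodule.mem_bot ℝ).1 hr]⟩)
  rw [(Submodule.mem_bot ℝ).1 hr] at e₃
  simp only [add_zero, Pi.zero_apply] at e₃
  have hlow : ∀ {φ : ParamSpace n → ℝ} {N : EuclideanSpace ℂ (Fin n) → ℝ} {k : ℕ},
      ((fun x => φ x - (‖x.1‖ ^ 2 + N x.1)) =o[𝓝 0] fun x => wnorm x ^ k) → 3 ≤ k →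
      ((fun x : ParamSpace n => N x.1) =O[𝓝 0] fun x => wnorm x ^ 3) →
      (fun x => φ x - ‖x.1‖ ^ 2) =o[𝓝 0] fun x => wnorm x ^ 2 := by
    intro φ N k h1 hk h2
    refine ((h1.trans_isBigO (wnorm_pow_isBigO (show 2 ≤ k by omega))).add (h2.trans_isLittleO
      (wnorm_pow_isLittleO (show 2 < 3 by norm_num)))).congr_left fun x => by ring
  obtain ⟨h₄, φ₄, H₄, _, ⟨a, ha, hra⟩, e₄⟩ := H₃.exists_normalization isSlowlyVarying_zero
    (k := 3) (by norm_num) (by norm_num) (hlow (N := fun _ => 0) (by simpa using e₃) le_rfl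
    (isBigO_zero _ _)) (by simpa using e₃) (S := nor22 n)
    (fun i hi f hf => re_mem_of_weight_four hi hf) (by
      rintro r ⟨a, ha, hr⟩
      exact ⟨_, isSlowlyVarying_poly22 a, hr⟩)
  simp only [hra, add_zero] at e₄
  have hO : (fun x : ParamSpace n => (poly22 a x.1).re) =O[𝓝 0] fun x => wnorm x ^ 3 :=
    (isBigO_of_homogeneous (Complex.continuous_re.comp (contDiff_poly22 a).continuous)
      (poly22_re_smul a)).trans (wnorm_pow_isBigO (by norm_num))
  obtain ⟨h₅, φ₅, H₅, _, ⟨b, hb, hrb⟩, e₅⟩ := H₄.exists_normalization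
    (isSlowlyVarying_poly22 a) (k := 4) (by norm_num) (by norm_num) (hlow (N := fun z => (poly22 a z).re) e₄
      (show 3 ≤ 3 + 1 by norm_num) hO) e₄
    (S := nor32 n) (fun i hi f hf => re_mem_of_weight_five hi hf) (by
      rintro r ⟨a, ha, hr⟩
      exact ⟨_, isSlowlyVarying_poly32 a, hr⟩)
  simp only [hrb] at e₅
  exact ⟨h₅, φ₅, H₅, a, b, ha, hb, e₅⟩

end NormalizationStep

/-! ### Nonnegative trace-free polynomials of bidegree (2,2) -/

section TraceFree

variable {n : ℕ}

lemma IsNormal22.sub {a a' : Fin n → Fin n → Fin n → Fin n → ℂ} (h : IsNormal22 a)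
    (h' : IsNormal22 a') : IsNormal22 fun i j k l => a i j k l + -1 * a' i j k l where
  symm_left i j k l := by rw [h.symm_left, h'.symm_left]
  symm_right i j k l := by rw [h.symm_right, h'.symm_right]
  real i j k l := by rw [h.real, h'.real]; simp
  trace_eq_zero i k := by
    rw [Finset.sum_add_distrib, ← Finset.mul_sum, h.trace_eq_zero, h'.trace_eq_zero]
    simp

/-- The character of `ℤ/4` with values in the fourth roots of unity. -/
noncomputable def quarter (s : ZMod 4) : ℂ := Complex.I ^ s.val

lemma quarter_zero : quarter 0 = 1 := by simp [quarter]

lemma quarter_add_one (s : ZMod 4) : quarter (s + 1) = Complex.I * quarter s := by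
  have h : ∀ s : ZMod 4, (s + 1).val = s.val + 1 ∨ (s + 1).val + 4 = s.val + 1 := by decide
  rcases h s with h | h
  · rw [quarter, quarter, h, pow_succ']
  · rw [quarter, quarter, ← pow_succ', ← h, pow_add, Complex.I_pow_four, mul_one]

lemma quarter_mul_conj (s : ZMod 4) : quarter s * conj (quarter s) = 1 := by
  rw [Complex.mul_conj, quarter, Complex.normSq_eq_norm_sq, norm_pow, Complex.norm_I]
  simp

/-- Orthogonality of the characters occurring in a polynomial of bidegree `(2, 2)`. -/
lemma sum_quarter (i j k l : Fin n) :
    ∑ s : Fin n → ZMod 4, quarter (s i) * quarter (s j) * conj (quarter (s k)) *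
      conj (quarter (s l)) = if (i = k ∧ j = l) ∨ (i = l ∧ j = k) then (4 : ℂ) ^ n else 0 := by
  split_ifs with h
  · have h1 : ∀ s : Fin n → ZMod 4, quarter (s i) * quarter (s j) * conj (quarter (s k)) *
        conj (quarter (s l)) = 1 := by
      intro s
      have hi := quarter_mul_conj (s i)
      have hj := quarter_mul_conj (s j)
      rcases h with ⟨rfl, rfl⟩ | ⟨rfl, rfl⟩
      · linear_combination quarter (s j) * conj (quarter (s j)) * hi + hj
      · linear_combination quarter (s j) * conj (quarter (s j)) * hi + hj
    simp [h1]
  · let f : (Fin n → ZMod 4) → ℂ := fun s => quarter (s i) * quarter (s j) *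
      conj (quarter (s k)) * conj (quarter (s l))
    have hshift : ∀ (a b : Fin n) (s : Fin n → ZMod 4),
        quarter ((s + Pi.single a 1 : Fin n → ZMod 4) b) = (if b = a then Complex.I else 1) * quarter (s b) := by
      intro a b s
      rw [Pi.add_apply, Pi.single_apply]
      split_ifs
      · exact quarter_add_one _
      · rw [add_zero, one_mul]
    -- If translation in one coordinate multiplies the summand by c ≠ 1, the sum vanishes. The
    -- exponent of each coordinate lies between −2 and 2, so a nonzero one is visible on fourth
    -- roots of unity.
    have key : ∀ (a : Fin n), (if i = a then Complex.I else 1) * (if j = a then Complex.I else 1) *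
        (if k = a then -Complex.I else 1) * (if l = a then -Complex.I else 1) ≠ 1 →
        ∑ s, f s = 0 := by
      intro a ha
      set c := (if i = a then Complex.I else 1) * (if j = a then Complex.I else 1) *
        (if k = a then -Complex.I else 1) * (if l = a then -Complex.I else 1)
      have h1 : ∀ s, f (s + Pi.single a 1) = c * f s := by
        intro s
        simp only [f, hshift, map_mul, apply_ite (starRingEnd ℂ), Complex.conj_I, map_one, c]
        ring
      have h2 : ∑ s, f s = c * ∑ s, f s := by
        rw [Finset.mul_sum, ← Equiv.sum_comp (Equiv.addRight (Pi.single a 1)) f]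
        exact Finset.sum_congr rfl fun s _ => h1 s
      have h3 : (c - 1) * ∑ s, f s = 0 := by linear_combination -h2
      exact (mul_eq_zero.1 h3).resolve_left (sub_ne_zero.2 ha)
    have hI : Complex.I ≠ 1 := fun h => by simpa using congrArg Complex.re h
    have hI' : -Complex.I ≠ 1 := fun h => by simpa using congrArg Complex.re h
    have hII : Complex.I * Complex.I ≠ 1 := by rw [Complex.I_mul_I]; norm_num
    have hII' : -Complex.I * -Complex.I ≠ 1 := by rw [neg_mul_neg, Complex.I_mul_I]; norm_num
    by_cases hik : i = k
    · have hjl : j ≠ l := fun h' => h (Or.inl ⟨hik, h'⟩)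
      refine key j ?_
      subst hik
      by_cases hij : i = j
      · subst hij
        simpa [hjl.symm] using hI
      · simpa [hij, hjl.symm] using hI
    · by_cases hil : i = l
      · have hjk : j ≠ k := fun h' => h (Or.inr ⟨hil, h'⟩)
        refine key j ?_
        subst hil
        by_cases hij : i = j
        · subst hij
          simpa [hjk.symm] using hI
        · simpa [hij, hjk.symm] using hI
      · refine key i ?_
        by_cases hij : j = i
        · simpa [hij, Ne.symm hik, Ne.symm hil, eq_comm] using hII
        · simpa [hij, Ne.symm hik, Ne.symm hil, eq_comm] using hI

/-- The average of a polynomial of bidegree `(2, 2)` over a torus orbit. -/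
lemma sum_poly22_quarter {c : Fin n → Fin n → Fin n → Fin n → ℂ}
    (h₁ : ∀ i j k l, c i j l k = c i j k l) (z : EuclideanSpace ℂ (Fin n)) :
    ∑ s : Fin n → ZMod 4, poly22 c (WithLp.toLp 2 fun i => quarter (s i) * z i) =
      4 ^ n * (2 * ∑ i, ∑ j, c i j i j * ((‖z i‖ ^ 2 * ‖z j‖ ^ 2 : ℝ) : ℂ) -
        ∑ i, c i i i i * ((‖z i‖ ^ 4 : ℝ) : ℂ)) := by
  have h0 : ∀ i, z i * conj (z i) = (‖z i‖ : ℂ) ^ 2 := fun i => Complex.mul_conj' _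
  have hsum : ∑ s : Fin n → ZMod 4, poly22 c (WithLp.toLp 2 fun i => quarter (s i) * z i) =
      ∑ i, ∑ j, ∑ k, ∑ l, c i j k l * (z i * z j * conj (z k) * conj (z l)) *
        ∑ s : Fin n → ZMod 4, quarter (s i) * quarter (s j) * conj (quarter (s k)) *
          conj (quarter (s l)) := by
    simp only [poly22, Finset.mul_sum]
    rw [Finset.sum_comm]
    refine Finset.sum_congr rfl fun i _ => ?_
    rw [Finset.sum_comm]
    refine Finset.sum_congr rfl fun j _ => ?_
    rw [Finset.sum_comm]
    refine Finset.sum_congr rfl fun k _ => ?_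
    rw [Finset.sum_comm]
    refine Finset.sum_congr rfl fun l _ => Finset.sum_congr rfl fun s _ => ?_
    simp only [map_mul]
    ring
  -- The two matchings of {i, j} with {k, l} coincide exactly when all four indices are equal; that
  -- case is subtracted once.
  have hite : ∀ i j k l : Fin n, (if (i = k ∧ j = l) ∨ (i = l ∧ j = k) then (4 : ℂ) ^ n else 0) =
      4 ^ n * ((if i = k then if j = l then 1 else 0 else 0) +
        (if i = l then if j = k then 1 else 0 else 0) -
        (if i = j then if i = k then if i = l then 1 else 0 else 0 else 0)) := by
    intro i j k l
    by_cases h1 : i = k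
    · subst h1
      by_cases h2 : j = l
      · subst h2
        by_cases h3 : i = j
        · subst h3
          simp
        · simp [h3]
      · by_cases h3 : i = l
        · subst h3
          simp [h2, Ne.symm h2]
        · simp [h2, h3]
    · by_cases h3 : i = l
      · subst h3
        simp [h1]
      · simp [h1, h3]
  rw [hsum]
  simp only [sum_quarter, hite, mul_add, mul_sub, Finset.sum_add_distrib, Finset.sum_sub_distrib,
    mul_ite, mul_one, mul_zero, Finset.sum_ite_irrel, Finset.sum_const_zero, Finset.sum_ite_eq,
    Finset.mem_univ, if_true]
  have e1 : ∑ i, ∑ j, c i j i j * (z i * z j * conj (z i) * conj (z j)) * 4 ^ n =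
      4 ^ n * ∑ i, ∑ j, c i j i j * ((‖z i‖ ^ 2 * ‖z j‖ ^ 2 : ℝ) : ℂ) := by
    simp only [Finset.mul_sum]
    refine Finset.sum_congr rfl fun i _ => Finset.sum_congr rfl fun j _ => ?_
    push_cast
    rw [← h0, ← h0]
    ring
  have e2 : ∑ i, ∑ j, c i j j i * (z i * z j * conj (z j) * conj (z i)) * 4 ^ n =
      4 ^ n * ∑ i, ∑ j, c i j i j * ((‖z i‖ ^ 2 * ‖z j‖ ^ 2 : ℝ) : ℂ) := by
    rw [← e1]
    refine Finset.sum_congr rfl fun i _ => Finset.sum_congr rfl fun j _ => ?_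
    rw [h₁]
    ring
  have e3 : ∑ i, c i i i i * (z i * z i * conj (z i) * conj (z i)) * 4 ^ n =
      4 ^ n * ∑ i, c i i i i * ((‖z i‖ ^ 4 : ℝ) : ℂ) := by
    simp only [Finset.mul_sum]
    refine Finset.sum_congr rfl fun i _ => ?_
    push_cast
    rw [show (‖z i‖ : ℂ) ^ 4 = ((‖z i‖ : ℂ) ^ 2) * (‖z i‖ : ℂ) ^ 2 by ring, ← h0]
    ring
  rw [e1, e2, e3]
  ring

/-- A nonnegative real polynomial of bidegree `(2, 2)` with vanishing trace is zero. -/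
theorem IsNormal22.re_eq_zero {c : Fin n → Fin n → Fin n → Fin n → ℂ} (hc : IsNormal22 c)
    (h : ∀ z, 0 ≤ (poly22 c z).re) (z : EuclideanSpace ℂ (Fin n)) : (poly22 c z).re = 0 := by
  have havg : ∀ z : EuclideanSpace ℂ (Fin n),
      ∑ s : Fin n → ZMod 4, (poly22 c (WithLp.toLp 2 fun i => quarter (s i) * z i)).re =
      4 ^ n * (2 * ∑ i, ∑ j, (c i j i j).re * (‖z i‖ ^ 2 * ‖z j‖ ^ 2) -
        ∑ i, (c i i i i).re * ‖z i‖ ^ 4) := by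
    intro z
    have h1 := congrArg Complex.re (sum_poly22_quarter hc.symm_right z)
    have h4 : (4 : ℂ) ^ n = ((4 ^ n : ℝ) : ℂ) := by push_cast; rfl
    rw [h4, Complex.re_ofReal_mul, Complex.re_sum] at h1
    rw [h1, Complex.sub_re, Complex.re_sum, show (2 : ℂ) = ((2 : ℝ) : ℂ) by norm_num,
      Complex.re_ofReal_mul, Complex.re_sum]
    simp only [Complex.re_sum, Complex.re_mul_ofReal]
  have hnn : ∀ z : EuclideanSpace ℂ (Fin n), 0 ≤ 2 * ∑ i, ∑ j, (c i j i j).re *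
      (‖z i‖ ^ 2 * ‖z j‖ ^ 2) - ∑ i, (c i i i i).re * ‖z i‖ ^ 4 := by
    intro z
    have h1 : 0 ≤ ∑ s : Fin n → ZMod 4,
        (poly22 c (WithLp.toLp 2 fun i => quarter (s i) * z i)).re :=
      Finset.sum_nonneg fun s _ => h _
    rw [havg] at h1
    exact nonneg_of_mul_nonneg_right h1 (by positivity)
  have htr : ∀ i, ∑ j, (c i j i j).re = 0 := fun i => by
    rw [← Complex.re_sum, hc.trace_eq_zero, Complex.zero_re]
  have hdiag : ∀ i, 0 ≤ (c i i i i).re := by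
    intro i
    have h1 := h (EuclideanSpace.single i 1)
    simpa [poly22, PiLp.single_apply, Finset.sum_ite_irrel] using h1
  have hdiag0 : ∀ i, (c i i i i).re = 0 := by
    -- At z = (1, …, 1) the trace condition kills the double sum and leaves −∑ Re c_{iiii} ≥ 0,
    -- against the nonnegativity of each diagonal coefficient.
    have h1 := hnn (WithLp.toLp 2 fun _ => 1)
    simp only [norm_one, one_pow, mul_one, htr, Finset.sum_const_zero, mul_zero, zero_sub] at h1
    have h2 : ∑ i, (c i i i i).re = 0 :=
      le_antisymm (by linarith) (Finset.sum_nonneg fun i _ => hdiag i)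
    exact fun i => (Finset.sum_eq_zero_iff_of_nonneg fun i _ => hdiag i).1 h2 i (Finset.mem_univ i)
  have hoff : ∀ i j, 0 ≤ (c i j i j).re := by
    intro i j
    rcases eq_or_ne i j with rfl | hij
    · exact hdiag i
    -- With vanishing diagonal the expression at e_i + e_j is 4 Re c_{ijij}; its nonnegativity and
    -- the trace condition make all these coefficients have zero real part.
    have h1 := hnn (EuclideanSpace.single i 1 + EuclideanSpace.single j 1)
    simp only [hdiag0, zero_mul, Finset.sum_const_zero, sub_zero] at h1
    have h2 : ∀ k, ‖(EuclideanSpace.single i (1 : ℂ) + EuclideanSpace.single j 1 :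
        EuclideanSpace ℂ (Fin n)) k‖ ^ 2 = (if k = i then 1 else 0) + if k = j then 1 else 0 := by
      intro k
      by_cases hki : k = i
      · subst hki
        simp [hij]
      · by_cases hkj : k = j <;> simp [hki, hkj, hij.symm]
    simp only [h2, mul_add, mul_ite, mul_one, mul_zero, Finset.sum_add_distrib, Finset.sum_ite_eq',
      Finset.mem_univ, if_true, hdiag0] at h1
    have h3 : c j i j i = c i j i j := by rw [hc.symm_left, hc.symm_right]
    rw [h3] at h1
    linarith
  have hall : ∀ i j, (c i j i j).re = 0 := fun i j =>
    (Finset.sum_eq_zero_iff_of_nonneg fun j _ => hoff i j).1 (htr i) j (Finset.mem_univ j)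
  have h1 := havg z
  simp only [hall, zero_mul, Finset.sum_const_zero, mul_zero, sub_zero] at h1
  -- A nonnegative function with zero average over the orbit vanishes on it; s = 0 is the point z
  -- itself.
  have h2 := (Finset.sum_eq_zero_iff_of_nonneg fun s _ => h _).1 h1 0 (Finset.mem_univ _)
  simpa [quarter_zero] using h2

end TraceFree

/-! ### Positivity and rotations: comparison of normal terms -/

section FlatAlgebra

open Asymptotics Filter

variable {n : ℕ}

/-- Functions that are homogeneous of bidegree `(p, q)`. -/
def IsBihomogeneous (p q : ℕ) (f : EuclideanSpace ℂ (Fin n) → ℂ) : Prop :=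
  ∀ (s : ℂ) (z : EuclideanSpace ℂ (Fin n)), f (s • z) = s ^ p * conj s ^ q * f z

lemma IsBihomogeneous.real_smul {p q : ℕ} {f : EuclideanSpace ℂ (Fin n) → ℂ}
    (hf : IsBihomogeneous p q f) (t : ℝ) (z : EuclideanSpace ℂ (Fin n)) :
    f (t • z) = ((t ^ (p + q) : ℝ) : ℂ) * f z := by
  rw [← Complex.coe_smul, hf, Complex.conj_ofReal, ← pow_add, ← Complex.ofReal_pow]

lemma nonneg_of_isLittleO {r q : ℝ → ℝ} {k : ℕ} (hr : ∀ᶠ t in 𝓝[>] (0 : ℝ), 0 ≤ r t)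
    (hq : Continuous q) (h : (fun t => r t - t ^ k * q t) =o[𝓝[>] 0] fun t => t ^ k) : 0 ≤ q 0 := by
  have h1 := h.tendsto_div_nhds_zero.add
    ((hq.tendsto 0).mono_left (nhdsWithin_le_nhds (s := Set.Ioi (0 : ℝ))))
  rw [zero_add] at h1
  refine ge_of_tendsto h1 ?_
  filter_upwards [hr, self_mem_nhdsWithin] with t ht ht0
  have hk : 0 < t ^ k := pow_pos ht0 k
  rw [sub_div, mul_div_cancel_left₀ _ hk.ne', sub_add_cancel]
  exact div_nonneg ht hk.le

/-- The successive nonnegativity of the lowest order weighted parts. -/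
lemma nonneg_parts {R q₃ q₄ q₅ : ParamSpace n → ℝ} (hR : ∀ᶠ x in 𝓝 0, 0 ≤ R x)
    (h : (fun x => R x - (q₃ x + q₄ x + q₅ x)) =o[𝓝 0] fun x => wnorm x ^ 5)
    (h₃ : ∀ t x, q₃ (dil t x) = t ^ 3 * q₃ x) (h₄ : ∀ t x, q₄ (dil t x) = t ^ 4 * q₄ x)
    (h₅ : ∀ t x, q₅ (dil t x) = t ^ 5 * q₅ x) :
    (∀ x, 0 ≤ q₃ x) ∧ ((∀ x, q₃ x = 0) → (∀ x, 0 ≤ q₄ x) ∧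
      ((∀ x, q₄ x = 0) → ∀ x, 0 ≤ q₅ x)) := by
  have h1 : ∀ x, (fun t : ℝ => R (dil t x) - (t ^ 3 * q₃ x + t ^ 4 * q₄ x + t ^ 5 * q₅ x))
      =o[𝓝[>] 0] fun t => t ^ 5 := fun x =>
    ((h.comp_tendsto (tendsto_dil x)).trans_isBigO (wnorm_dil_pow_isBigO x 5)).congr_left
      fun t => by simp only [Function.comp_apply, h₃, h₄, h₅]
  have hlow : ∀ k ≤ 5, (fun t : ℝ => t ^ 5) =O[𝓝[>] 0] fun t => t ^ k := by
    intro k hk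
    rcases hk.eq_or_lt with rfl | hk
    · exact isBigO_refl _ _
    · exact ((isLittleO_pow_pow hk).mono nhdsWithin_le_nhds).isBigO
  have hRt : ∀ x, ∀ᶠ t in 𝓝[>] (0 : ℝ), 0 ≤ R (dil t x) := fun x => (tendsto_dil x).eventually hR
  refine ⟨fun x => ?_, fun hz3 => ⟨fun x => ?_, fun hz4 x => ?_⟩⟩
  · have := nonneg_of_isLittleO (k := 3) (q := fun t => q₃ x + t * q₄ x + t ^ 2 * q₅ x) (hRt x)
      (by fun_prop) (((h1 x).trans_isBigO (hlow 3 (by norm_num))).congr_left fun t => by ring)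
    simpa using this
  · have := nonneg_of_isLittleO (k := 4) (q := fun t => q₄ x + t * q₅ x) (hRt x)
      (by fun_prop) (((h1 x).trans_isBigO (hlow 4 (by norm_num))).congr_left fun t => by
        rw [hz3]; ring)
    simpa using this
  · have := nonneg_of_isLittleO (k := 5) (q := fun t => q₅ x) (hRt x)
      (by fun_prop) ((h1 x).congr_left fun t => by rw [hz3, hz4]; ring)
    simpa using this

/-- The terms of weight at most `5` of a nonnegative function of the form arising from a `2`-flat
map are restricted by their behaviour under rotations. -/
theorem normal_terms_eq_zero {c : Fin n → Fin n → Fin n → Fin n → ℂ} (hc : IsNormal22 c)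
    {α X β e p₅ p₃ p₁ e₄ e₂ m : EuclideanSpace ℂ (Fin n) → ℂ}
    (hα : IsBihomogeneous 3 0 α) (hX : IsBihomogeneous 4 0 X) (hβ : IsBihomogeneous 2 0 β)
    (he : IsBihomogeneous 3 1 e) (hp₅ : IsBihomogeneous 5 0 p₅) (hp₃ : IsBihomogeneous 3 0 p₃)
    (hp₁ : IsBihomogeneous 1 0 p₁) (he₄ : IsBihomogeneous 4 1 e₄) (he₂ : IsBihomogeneous 2 1 e₂)
    (hm : IsBihomogeneous 3 2 m) {R : ParamSpace n → ℝ} (hR : ∀ᶠ x in 𝓝 0, 0 ≤ R x)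
    (h : (fun x : ParamSpace n => R x - ((α x.1).im +
      ((X x.1).im + x.2 * (β x.1).im + ‖x.1‖ ^ 2 * (β x.1).re - 2 * (e x.1).re +
        (poly22 c x.1).re) +
      ((p₅ x.1).im + x.2 * (p₃ x.1).im + ‖x.1‖ ^ 2 * (p₃ x.1).re +
        (x.2 ^ 2 - ‖x.1‖ ^ 4) * (p₁ x.1).im + 2 * x.2 * ‖x.1‖ ^ 2 * (p₁ x.1).re -
        2 * (e₄ x.1).re - 2 * x.2 * (e₂ x.1).re + 2 * ‖x.1‖ ^ 2 * (e₂ x.1).im +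
        2 * (m x.1).re))) =o[𝓝 0] fun x => wnorm x ^ 5) :
    (∀ z, (poly22 c z).re = 0) ∧ ∀ z, (m z).re = 0 := by
  obtain ⟨h3, h4⟩ := nonneg_parts hR h
    (fun t x => by
      simp only [dil_fst, hα.real_smul, Complex.im_ofReal_mul])
    (fun t x => by
      simp only [dil_fst, dil_snd, hX.real_smul, hβ.real_smul, he.real_smul, poly22_re_smul,
        Complex.im_ofReal_mul, Complex.re_ofReal_mul, norm_smul, mul_pow, Real.norm_eq_abs, sq_abs]
      ring)
    (fun t x => by
      have h4 : |t| ^ 4 = t ^ 4 := by rw [← Even.pow_abs (by decide : Even 4) t]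
      simp only [dil_fst, dil_snd, hp₅.real_smul, hp₃.real_smul, hp₁.real_smul, he₄.real_smul,
        he₂.real_smul, hm.real_smul, Complex.im_ofReal_mul, Complex.re_ofReal_mul, norm_smul,
        mul_pow, Real.norm_eq_abs, sq_abs, h4]
      ring)
  have hneg : ∀ z : EuclideanSpace ℂ (Fin n), (-1 : ℝ) • z = -z := fun z => by simp
  -- The weight 3 part is odd under z ↦ −z, so nonnegativity forces it to vanish.
  have hα0 : ∀ x : ParamSpace n, (α x.1).im = 0 := by
    intro x
    have h1 := h3 x
    have h2 := h3 (-x.1, 0)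
    have h5 : α (-x.1) = -α x.1 := by
      rw [← hneg, hα.real_smul]
      norm_num
    simp only [h5, Complex.neg_im] at h2
    linarith
  obtain ⟨h4, h5⟩ := h4 hα0
  -- An unnormalized eighth root of unity, √2 e^{iπ/4}, which keeps square roots out of the
  -- arithmetic. Bidegree (p, q) responds to a rotation through p − q only.
  let s : ℂ := 1 + Complex.I
  have hs2 : s ^ 2 = 2 * Complex.I := by
    simp only [s]; linear_combination Complex.I_sq
  have hsc : s * conj s = 2 := by
    simp only [s, map_add, map_one, Complex.conj_I]; linear_combination -Complex.I_sq
  have hns : ∀ z : EuclideanSpace ℂ (Fin n), ‖s • z‖ ^ 2 = 2 * ‖z‖ ^ 2 := by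
    intro z
    have h1 : ((‖s‖ ^ 2 : ℝ) : ℂ) = ((2 : ℝ) : ℂ) := by
      push_cast
      rw [← Complex.mul_conj', hsc]
    rw [norm_smul, mul_pow, Complex.ofReal_injective h1]
  have hnI : ∀ z : EuclideanSpace ℂ (Fin n), ‖Complex.I • z‖ = ‖z‖ := fun z => by
    rw [norm_smul, Complex.norm_I, one_mul]
  have rot : ∀ {p q : ℕ} {f : EuclideanSpace ℂ (Fin n) → ℂ} (_ : IsBihomogeneous p q f)
      (a : ℂ) (b : ℂ), a ^ p * conj a ^ q = b → ∀ z, f (a • z) = b * f z :=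
    fun hf a b hab z => by rw [hf, hab]
  have hc0 : IsBihomogeneous 2 2 (poly22 c) := fun a z => poly22_smul_arg c a z
  have hI3 : Complex.I ^ 3 = -Complex.I := Complex.I_pow_three
  have hI4 : Complex.I ^ 4 = 1 := Complex.I_pow_four
  have hI2 : Complex.I ^ 2 = -1 := Complex.I_sq
  have hIc : conj Complex.I = -Complex.I := Complex.conj_I
  have hs3 : s ^ 3 = -2 + 2 * Complex.I := by
    rw [pow_succ, hs2]; simp only [s]; linear_combination 2 * Complex.I_sq
  have hs4 : s ^ 4 = -4 := by
    rw [show s ^ 4 = (s ^ 2) ^ 2 by ring, hs2]; linear_combination 4 * Complex.I_sq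
  -- rotations of the parts of weight `4`
  have XI := rot hX Complex.I 1 (by rw [hI4]; simp)
  have Xs := rot hX s (-4) (by rw [hs4]; simp)
  have βI := rot hβ Complex.I (-1) (by rw [hI2]; simp)
  have βs := rot hβ s (2 * Complex.I) (by rw [hs2]; simp)
  have eI := rot he Complex.I (-1) (by rw [hI3, hIc]; linear_combination Complex.I_sq)
  have es := rot he s (4 * Complex.I) (by
    rw [show s ^ 3 * conj s ^ 1 = s ^ 2 * (s * conj s) by ring, hs2, hsc]; ring)
  have cI := rot hc0 Complex.I 1 (by rw [← mul_pow, hIc]; simp)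
  have cs := rot hc0 s 4 (by rw [← mul_pow, hsc]; norm_num)
  -- For X, β, e the number p − q is 4, 2, 2, so a positive combination of the values at z, iz, sz,
  -- isz with u = 0 leaves only the (2,2) term. That term is then nonnegative and trace-free.
  have hM : ∀ z, (poly22 c z).re = 0 := by
    refine hc.re_eq_zero fun z => ?_
    have k1 := h4 (z, 0)
    have k2 := h4 (Complex.I • z, 0)
    have k3 := h4 (s • z, 0)
    have k4 := h4 (Complex.I • s • z, 0)
    simp only [XI, Xs, βI, βs, eI, es, cI, cs, hnI, hns] at k1 k2 k3 k4
    simp at k1 k2 k3 k4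
    linarith
  -- Without the (2,2) term the rest has zero mean under the same rotations: i flips the sign of β
  -- and e, and s that of X. Nonnegativity kills each piece.
  have hzero4 : ∀ z, (X z).im = 0 ∧ ‖z‖ ^ 2 * (β z).re - 2 * (e z).re = 0 := by
    intro z
    have k1 := h4 (z, 0)
    have k2 := h4 (Complex.I • z, 0)
    have k3 := h4 (s • z, 0)
    have k4 := h4 (Complex.I • s • z, 0)
    simp only [XI, Xs, βI, βs, eI, es, cI, cs, hnI, hns, hM] at k1 k2 k3 k4
    simp [hM] at k1 k2 k3 k4
    constructor <;> linarith
  -- Only a term linear in u is left, and u takes both signs.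
  have hβ0 : ∀ z, (β z).im = 0 := by
    intro z
    have k1 := h4 (z, 1)
    have k2 := h4 (z, -1)
    have k3 := hzero4 z
    simp only [hM] at k1 k2
    linarith [k3.1, k3.2]
  have hz4 : ∀ x : ParamSpace n, (X x.1).im + x.2 * (β x.1).im + ‖x.1‖ ^ 2 * (β x.1).re -
      2 * (e x.1).re + (poly22 c x.1).re = 0 := by
    intro x
    rw [hM, hβ0]
    linarith [hzero4 x.1]
  have h5 := h5 hz4
  refine ⟨hM, ?_⟩
  -- rotations of the parts of weight `5`
  have hneg5 : ∀ {p q : ℕ} {f : EuclideanSpace ℂ (Fin n) → ℂ}, IsBihomogeneous p q f →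
      (-1 : ℝ) ^ (p + q) = -1 → ∀ z, f (-z) = -f z := by
    intro p q f hf hpq z
    rw [← hneg, hf.real_smul, hpq]
    simp
  -- Every weight 5 term has odd degree in z, so the nonnegative weight 5 part vanishes identically.
  have T0 : ∀ (z : EuclideanSpace ℂ (Fin n)) (u : ℝ), (p₅ z).im + u * (p₃ z).im +
      ‖z‖ ^ 2 * (p₃ z).re + (u ^ 2 - ‖z‖ ^ 4) * (p₁ z).im + 2 * u * ‖z‖ ^ 2 * (p₁ z).re -
        2 * (e₄ z).re - 2 * u * (e₂ z).re + 2 * ‖z‖ ^ 2 * (e₂ z).im + 2 * (m z).re = 0 := by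
    intro z u
    have k1 := h5 (z, u)
    have k2 := h5 (-z, u)
    simp only [hneg5 hp₅ (by norm_num), hneg5 hp₃ (by norm_num), hneg5 hp₁ (by norm_num),
      hneg5 he₄ (by norm_num), hneg5 he₂ (by norm_num), hneg5 hm (by norm_num), norm_neg,
      Complex.neg_re, Complex.neg_im] at k2
    simp only at k1
    linarith
  -- The second difference in u isolates the coefficient of u²; rotation by i then carries the
  -- conclusion to the real part.
  have p1im : ∀ z, (p₁ z).im = 0 := by
    intro z
    have k1 := T0 z 1
    have k2 := T0 z (-1)
    have k3 := T0 z 0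
    linarith
  have p1I := rot hp₁ Complex.I Complex.I (by simp)
  have p1re : ∀ z, (p₁ z).re = 0 := by
    intro z
    have := p1im (Complex.I • z)
    rw [p1I] at this
    simpa using this
  have hu : ∀ z, (p₃ z).im - 2 * (e₂ z).re = 0 := by
    intro z
    have k1 := T0 z 1
    have k2 := T0 z (-1)
    rw [p1re, p1im] at k1 k2
    linarith
  have p3I := rot hp₃ Complex.I (-Complex.I) (by rw [hI3]; simp)
  have p3s := rot hp₃ s (-2 + 2 * Complex.I) (by rw [hs3]; simp)
  have e2I := rot he₂ Complex.I Complex.I (by rw [hI2, hIc]; simp)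
  have e2s := rot he₂ s (2 + 2 * Complex.I) (by
    rw [show s ^ 2 * conj s ^ 1 = s * (s * conj s) by ring, hsc]; simp only [s]; ring)
  -- In the coefficient of u, the terms p₃ and e₂ have p − q equal to 3 and 1, and rotations by
  -- multiples of π/4 separate them.
  have he2 : ∀ z, (e₂ z).im = 0 := by
    intro z
    have k1 := hu z
    have k2 := hu (Complex.I • z)
    have k3 := hu (s • z)
    have k4 := hu (Complex.I • s • z)
    simp only [p3I, p3s, e2I, e2s] at k2 k3 k4
    simp at k2 k3 k4
    linarith
  have T1 : ∀ z, (p₅ z).im + ‖z‖ ^ 2 * (p₃ z).re - 2 * (e₄ z).re + 2 * (m z).re = 0 := by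
    intro z
    have k1 := T0 z 0
    rw [p1re, p1im, he2] at k1
    linarith
  have hsc' : conj s * s = 2 := by rw [mul_comm]; exact hsc
  have hcs : conj s = 1 - Complex.I := by simp [s, sub_eq_add_neg]
  have hns' : ∀ z : EuclideanSpace ℂ (Fin n), ‖conj s • z‖ ^ 2 = 2 * ‖z‖ ^ 2 := by
    intro z
    rw [← hns, norm_smul, norm_smul, RCLike.norm_conj]
  have conj_rot : ∀ {p q : ℕ} {b : ℂ}, s ^ p * conj s ^ q = b →
      conj s ^ p * conj (conj s) ^ q = conj b := by
    rintro p q b rfl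
    simp
  have p5e : s ^ 5 * conj s ^ 0 = -4 - 4 * Complex.I := by
    rw [pow_succ, hs4]; simp only [s]; ring
  have p3e : s ^ 3 * conj s ^ 0 = -2 + 2 * Complex.I := by rw [hs3]; simp
  have e4e : s ^ 4 * conj s ^ 1 = -4 + 4 * Complex.I := by rw [hs4, hcs]; ring
  have me : s ^ 3 * conj s ^ 2 = 4 + 4 * Complex.I := by
    rw [show s ^ 3 * conj s ^ 2 = s * (s * conj s) ^ 2 by ring, hsc]; simp only [s]; ring
  intro z
  have k1 := T1 z
  -- Adding the values at sz and s̄z leaves cosines of (p − q)π/4. Since cos(5π/4) = cos(3π/4) =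
  -- −cos(π/4), the term m, with p − q = 1, has the opposite sign to all others, and comparison with
  -- the value at z isolates Re m.
  have k2 := T1 (s • z)
  have k3 := T1 (conj s • z)
  simp only [rot hp₅ _ _ p5e, rot hp₃ _ _ p3e, rot he₄ _ _ e4e, rot hm _ _ me, hns] at k2
  simp only [rot hp₅ _ _ (conj_rot p5e), rot hp₃ _ _ (conj_rot p3e), rot he₄ _ _ (conj_rot e4e),
    rot hm _ _ (conj_rot me), hns'] at k3
  simp at k2 k3
  linarith

end FlatAlgebra

/-! ### Expansion of maps tangent to the identity to second order -/

section FlatExpansion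

open Asymptotics Filter

variable {n : ℕ}

lemma eq_zero_of_isLittleO_sq {F : Type*} [NormedAddCommGroup F] [NormedSpace ℝ F] {a b c : F}
    (h : (fun t : ℝ => a + t • b + t ^ 2 • c) =o[𝓝[>] 0] fun t => t ^ 2) :
    a = 0 ∧ b = 0 ∧ c = 0 := by
  have lim : ∀ {f : ℝ → F} (_ : Continuous f) {k : ℕ},
      ((fun t : ℝ => t ^ k • f t) =o[𝓝[>] 0] fun t => t ^ 2) → k ≤ 2 → f 0 = 0 := by
    intro f hf k hk hk2
    have hO : (fun t : ℝ => t ^ 2) =O[𝓝[>] 0] fun t => t ^ k := by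
      rcases hk2.eq_or_lt with rfl | hk2
      · exact isBigO_refl _ _
      · exact ((isLittleO_pow_pow hk2).mono nhdsWithin_le_nhds).isBigO
    have h1 := (hk.trans_isBigO hO).tendsto_inv_smul_nhds_zero
    refine tendsto_nhds_unique
      ((hf.tendsto 0).mono_left (nhdsWithin_le_nhds (s := Set.Ioi (0 : ℝ)))) (h1.congr' ?_)
    filter_upwards [self_mem_nhdsWithin] with t ht
    rw [smul_smul, inv_mul_cancel₀ (pow_ne_zero k (ne_of_gt ht)), one_smul]
  have ha : a = 0 := by
    have := lim (f := fun t => a + t • b + t ^ 2 • c) (by fun_prop) (k := 0)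
      (h.congr_left fun t => by rw [pow_zero, one_smul]) (by norm_num)
    simpa [pow_two] using this
  subst ha
  have hb : b = 0 := by
    simpa using lim (f := fun t => b + t • c) (by fun_prop) (k := 1)
      (h.congr_left fun t => by rw [zero_add, smul_add, pow_one, smul_smul, pow_two]) (by norm_num)
  subst hb
  have hc : c = 0 := by
    simpa using lim (f := fun _ => c) (by fun_prop) (k := 2) (by simpa using h) le_rfl
  exact ⟨rfl, rfl, hc⟩

/-- The Taylor expansion of a map tangent to the identity to second order. -/
lemma exists_flat_expansion {G : CSpace n → CSpace n} (hG : ContDiffAt ℝ ∞ G 0)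
    {Ω : Set (CSpace n)} (hΩ : IsOpen Ω) (hp : 0 ∈ closure Ω) (hol : DifferentiableOn ℂ G Ω)
    (hflat : (fun y => G y - y) =o[𝓝 0] fun y => ‖y‖ ^ 2) :
    ∃ Q : ℕ → ℕ → EuclideanSpace ℂ (Fin n) → CSpace n, (∀ m a, Continuous (Q m a)) ∧
      (∀ m, ∀ a ≤ m, ∀ (s : ℂ) z, Q m a (s • z) = s ^ a • Q m a z) ∧
      (fun y => G y - (y + ∑ m ∈ Finset.Icc 3 5, ∑ a ∈ Finset.range (m + 1),
        y.2 ^ (m - a) • Q m a y.1)) =O[𝓝 0] fun y => ‖y‖ ^ 6 := by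
  obtain ⟨P, hPc, hP, hexp⟩ := exists_bihomogeneous_expansion hG hΩ hp hol
  let H : ℕ → CSpace n → CSpace n := fun m y => ∑ a ∈ Finset.range (m + 1), P m a y
  have hH : ∀ m (t : ℝ) y, H m (t • y) = t ^ m • H m y := by
    intro m t y
    simp only [H, Finset.smul_sum]
    refine Finset.sum_congr rfl fun a ha => ?_
    have ha' : a ≤ m := by simpa [Nat.lt_succ_iff] using ha
    have h1 := hP m a ha' t t y.1 y.2
    rw [← pow_add, Nat.add_sub_cancel' ha', ← Complex.ofReal_pow, Complex.coe_smul,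
      Complex.coe_smul, ← Complex.real_smul] at h1
    exact h1
  have hlow : ∀ y, H 0 y = 0 ∧ H 1 y - y = 0 ∧ H 2 y = 0 := by
    intro y
    refine eq_zero_of_isLittleO_sq ?_
    have hty : Tendsto (fun t : ℝ => t • y) (𝓝[>] 0) (𝓝 0) := by
      have : Continuous fun t : ℝ => t • y := by fun_prop
      simpa using (this.tendsto 0).mono_left (nhdsWithin_le_nhds (s := Set.Ioi (0 : ℝ)))
    have htO : (fun t : ℝ => ‖t • y‖) =O[𝓝[>] 0] fun t => t :=
      IsBigO.of_bound ‖y‖ (Eventually.of_forall fun t => by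
        rw [norm_norm, norm_smul, mul_comm])
    have h1 := (hexp.comp_tendsto hty).trans (htO.pow 6)
    have h2 := (hflat.comp_tendsto hty).trans_isBigO (htO.pow 2)
    have ht : ∀ k, 2 < k → (fun t : ℝ => t ^ k) =o[𝓝[>] 0] fun t => t ^ 2 := fun k hk =>
      (isLittleO_pow_pow hk).mono nhdsWithin_le_nhds
    have h3 : ∀ (k : ℕ) (v : CSpace n), 2 < k →
        (fun t : ℝ => t ^ k • v) =o[𝓝[>] 0] fun t => t ^ 2 := fun k v hk =>
      (IsBigO.of_bound ‖v‖ (Eventually.of_forall fun t => by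
        rw [norm_smul, mul_comm])).trans_isLittleO (ht k hk)
    refine (((((h2.sub (h1.trans_isLittleO (ht 6 (by norm_num)))).sub (h3 3 (H 3 y) (by norm_num))).sub
      (h3 4 (H 4 y) (by norm_num))).sub (h3 5 (H 5 y) (by norm_num)))).congr_left fun t => ?_
    have h4 : ∑ m ∈ Finset.range 6, ∑ a ∈ Finset.range (m + 1), P m a (t • y) =
        ∑ m ∈ Finset.range 6, t ^ m • H m y :=
      Finset.sum_congr rfl fun m _ => hH m t y
    simp only [Function.comp_apply, h4]
    simp only [Finset.sum_range_succ, Finset.range_zero, Finset.sum_empty, pow_zero, one_smul,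
      pow_one, smul_sub]
    abel
  -- By homogeneity in w, P m a (z, w) = w^{m−a} P m a (z, 1), so setting w = 1 loses nothing.
  refine ⟨fun m a z => P m a (z, 1), fun m a => (hPc m a).comp (by fun_prop), fun m a ha s z => ?_,
    hexp.congr_left fun y => ?_⟩
  · have := hP m a ha s 1 z 1
    simpa using this
  · congr 1
    have h5 : ∀ m, ∑ a ∈ Finset.range (m + 1), y.2 ^ (m - a) • P m a (y.1, 1) = H m y := by
      intro m
      refine Finset.sum_congr rfl fun a ha => ?_
      have ha' : a ≤ m := by simpa [Nat.lt_succ_iff] using ha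
      have := hP m a ha' 1 y.2 y.1 1
      simpa using this.symm
    simp only [h5]
    change ∑ m ∈ Finset.range 6, H m y = _
    obtain ⟨k0, k1, k2⟩ := hlow y
    rw [sub_eq_zero] at k1
    have h6 : Finset.Icc 3 5 = {3, 4, 5} := by decide
    rw [h6, Finset.sum_insert (by decide), Finset.sum_insert (by decide), Finset.sum_singleton]
    simp only [Finset.sum_range_succ, Finset.range_zero, Finset.sum_empty, k0, k1, k2]
    abel

lemma isBigO_of_complex_homogeneous {F : Type*} [NormedAddCommGroup F] [NormedSpace ℂ F]
    {Q : EuclideanSpace ℂ (Fin n) → F} (hQ : Continuous Q) {m : ℕ}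
    (hm : ∀ (s : ℂ) z, Q (s • z) = s ^ m • Q z) :
    (fun x : ParamSpace n => Q x.1) =O[𝓝 0] fun x => wnorm x ^ m := by
  obtain ⟨C, hC⟩ := (isCompact_closedBall (0 : EuclideanSpace ℂ (Fin n)) 1).exists_bound_of_continuousOn
    hQ.continuousOn
  refine IsBigO.of_bound C (Eventually.of_forall fun x => ?_)
  have hw := wnorm_nonneg x
  have h1 : x.1 = (wnorm x : ℂ) • ((wnorm x)⁻¹ : ℂ) • x.1 := by
    rcases eq_or_ne (wnorm x) 0 with h | h
    · have := norm_fst_le_wnorm x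
      rw [h] at this
      rw [h, Complex.ofReal_zero, zero_smul, norm_le_zero_iff.1 this]
    · rw [smul_smul, mul_inv_cancel₀ (by exact_mod_cast h), one_smul]
  rw [h1, hm, norm_smul, norm_pow, norm_pow, Complex.norm_real, mul_comm]
  refine mul_le_mul_of_nonneg_right (hC _ ?_) (by positivity)
  rw [mem_closedBall_zero_iff, norm_smul, norm_inv, Complex.norm_real, Real.norm_of_nonneg hw,
    inv_mul_eq_div]
  exact div_le_one_of_le₀ (norm_fst_le_wnorm x) hw

/-- The expansion of a `2`-flat map along the graph. -/
lemma flat_expansion_graphMap {G : CSpace n → CSpace n}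
    {Q : ℕ → ℕ → EuclideanSpace ℂ (Fin n) → CSpace n} (hQc : ∀ m a, Continuous (Q m a))
    (hQ : ∀ m, ∀ a ≤ m, ∀ (s : ℂ) z, Q m a (s • z) = s ^ a • Q m a z)
    (hexp : (fun y => G y - (y + ∑ m ∈ Finset.Icc 3 5, ∑ a ∈ Finset.range (m + 1),
        y.2 ^ (m - a) • Q m a y.1)) =O[𝓝 0] fun y => ‖y‖ ^ 6) {φ : ParamSpace n → ℝ}
    (ht : Tendsto (graphMap φ) (𝓝 0) (𝓝 0))
    (hφ : (fun x => φ x - ‖x.1‖ ^ 2) =o[𝓝 0] fun x => wnorm x ^ 3) :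
    (fun x : ParamSpace n => G (graphMap φ x) - (graphMap φ x + Q 3 3 x.1 +
      (Q 4 4 x.1 + modelW x • Q 3 2 x.1) +
      (Q 5 5 x.1 + modelW x • Q 4 3 x.1 + modelW x ^ 2 • Q 3 1 x.1))) =o[𝓝 0]
        fun x => wnorm x ^ 5 := by
  have hW : (fun x : ParamSpace n => modelW x) =O[𝓝 0] fun x => wnorm x ^ 2 :=
    IsBigO.of_bound 2 (Eventually.of_forall fun x => by
      rw [norm_pow, Real.norm_of_nonneg (wnorm_nonneg x)]
      exact norm_modelW_le x)
  have hd : (fun x : ParamSpace n => (graphMap φ x).2 - modelW x) =o[𝓝 0]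
      fun x => wnorm x ^ 3 := by
    refine IsBigO.trans_isLittleO (IsBigO.of_bound 1 (Eventually.of_forall fun x => ?_)) hφ
    have h1 : (graphMap φ x).2 - modelW x = Complex.I * ((φ x - ‖x.1‖ ^ 2 : ℝ) : ℂ) := by
      simp only [graphMap, toC, modelW]
      push_cast
      ring
    rw [h1, norm_mul, Complex.norm_I, Complex.norm_real]
  have hω : (fun x : ParamSpace n => (graphMap φ x).2) =O[𝓝 0] fun x => wnorm x ^ 2 :=
    ((hd.isBigO.trans (wnorm_pow_isBigO (by norm_num))).add hW).congr_left fun x => by ring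
  have hfst : (fun x : ParamSpace n => x.1) =O[𝓝 0] wnorm :=
    IsBigO.of_bound 1 (Eventually.of_forall fun x => by
      rw [one_mul, Real.norm_of_nonneg (wnorm_nonneg x)]
      exact norm_fst_le_wnorm x)
  have hy : (fun x : ParamSpace n => graphMap φ x) =O[𝓝 0] wnorm :=
    IsBigO.prod_left (by simpa only [graphMap_fst] using hfst)
      (hω.trans (by simpa using wnorm_pow_isBigO (n := n) (show 1 ≤ 2 by norm_num)))
  have hQO : ∀ m, ∀ a ≤ m, (fun x : ParamSpace n => Q m a x.1) =O[𝓝 0] fun x => wnorm x ^ a :=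
    fun m a ha => isBigO_of_complex_homogeneous (hQc m a) (hQ m a ha)
  have e0 : (fun x => G (graphMap φ x) - (graphMap φ x + ∑ m ∈ Finset.Icc 3 5,
      ∑ a ∈ Finset.range (m + 1), (graphMap φ x).2 ^ (m - a) • Q m a x.1)) =o[𝓝 0]
        fun x => wnorm x ^ 5 :=
    ((hexp.comp_tendsto ht).trans (hy.norm_left.pow 6)).trans_isLittleO
      (wnorm_pow_isLittleO (by norm_num))
  -- The term w^{m−a}Q_{m,a}(z) has weight 2m − a. In degrees 3 to 5 just six terms have weight at
  -- most 5, and in these w may be replaced by u + i‖z‖².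
  have high : ∀ m a, a ≤ m → 5 < a + 2 * (m - a) →
      (fun x : ParamSpace n => (graphMap φ x).2 ^ (m - a) • Q m a x.1) =o[𝓝 0]
        fun x => wnorm x ^ 5 := by
    intro m a ha h5
    refine (((hω.pow (m - a)).smul (hQO m a ha))).trans_isLittleO ?_
    simp only [← pow_mul, smul_eq_mul, ← pow_add]
    exact wnorm_pow_isLittleO (by omega)
  have lin : ∀ m a, a ≤ m → 2 ≤ a →
      (fun x : ParamSpace n => ((graphMap φ x).2 - modelW x) • Q m a x.1) =o[𝓝 0]
        fun x => wnorm x ^ 5 := by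
    intro m a ha h2
    refine (hd.smul_isBigO (hQO m a ha)).trans_isBigO ?_
    simp only [smul_eq_mul, ← pow_add]
    exact wnorm_pow_isBigO (by omega)
  have quad : (fun x : ParamSpace n => ((graphMap φ x).2 ^ 2 - modelW x ^ 2) • Q 3 1 x.1)
      =o[𝓝 0] fun x => wnorm x ^ 5 := by
    have h1 := (hd.mul_isBigO (hω.add hW)).smul_isBigO (hQO 3 1 (by norm_num))
    refine (h1.trans_isBigO ?_).congr_left fun x => ?_
    · simp only [smul_eq_mul, ← pow_add]
      exact wnorm_pow_isBigO (by norm_num)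
    · congr 1
      ring
  have h6 : Finset.Icc 3 5 = {3, 4, 5} := by decide
  refine ((((((((((((((e0.add (high 3 0 (by norm_num) (by norm_num))).add
    (high 4 2 (by norm_num) (by norm_num))).add (high 4 1 (by norm_num) (by norm_num))).add
    (high 4 0 (by norm_num) (by norm_num))).add (high 5 4 (by norm_num) (by norm_num))).add
    (high 5 3 (by norm_num) (by norm_num))).add (high 5 2 (by norm_num) (by norm_num))).add
    (high 5 1 (by norm_num) (by norm_num))).add (high 5 0 (by norm_num) (by norm_num))).add
    (lin 3 2 (by norm_num) (by norm_num))).add (lin 4 3 (by norm_num) (by norm_num))).add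
    quad)).congr_left fun x => ?_)
  rw [h6, Finset.sum_insert (by decide), Finset.sum_insert (by decide), Finset.sum_singleton]
  simp only [Finset.sum_range_succ, Finset.range_zero, Finset.sum_empty, sub_smul]
  norm_num
  abel

end FlatExpansion

/-! ### Normal graphs, their boundaries, and germs in graph coordinates -/

section Comparison

open Asymptotics Filter

variable {n : ℕ}

/-- The normalized part of weight at most `5` of a graph. -/
noncomputable def normalPart (a : Fin n → Fin n → Fin n → Fin n → ℂ)
    (b : Fin n → Fin n → Fin n → Fin n → Fin n → ℂ) (z : EuclideanSpace ℂ (Fin n)) : ℝ :=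
  (poly22 a z).re + 2 * (poly32 b z).re

lemma isSlowlyVarying_normalPart (a : Fin n → Fin n → Fin n → Fin n → ℂ)
    (b : Fin n → Fin n → Fin n → Fin n → Fin n → ℂ) : IsSlowlyVarying (normalPart a b) :=
  (isSlowlyVarying_poly22 a).add (isSlowlyVarying_poly32 b)

lemma normalPart_isBigO (a : Fin n → Fin n → Fin n → Fin n → ℂ)
    (b : Fin n → Fin n → Fin n → Fin n → Fin n → ℂ) :
    (fun x : ParamSpace n => normalPart a b x.1) =O[𝓝 0] fun x => wnorm x ^ 4 := by
  refine (isBigO_of_homogeneous (Complex.continuous_re.comp (contDiff_poly22 a).continuous)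
    (poly22_re_smul a)).add (IsBigO.const_mul_left ?_ 2)
  exact (isBigO_of_homogeneous (Complex.continuous_re.comp (contDiff_poly32 b).continuous)
    (poly32_re_smul b)).trans (wnorm_pow_isBigO (by norm_num))

lemma isChernMoserGraph_iff {φ : ParamSpace n → ℝ} : IsChernMoserGraph φ ↔
    ∃ a b, IsNormal22 a ∧ IsNormal32 b ∧
      (fun x => φ x - (‖x.1‖ ^ 2 + normalPart a b x.1)) =o[𝓝 0] fun x => wnorm x ^ 5 := by
  simp only [normalPart, ← add_assoc]
  rfl

lemma wnorm_sq_isBigO : (fun x : ParamSpace n => wnorm x ^ 2) =O[𝓝 0] fun x => ‖x‖ := by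
  refine IsBigO.of_bound 4 ?_
  filter_upwards [Metric.closedBall_mem_nhds (0 : ParamSpace n) one_pos] with x hx
  rw [mem_closedBall_zero_iff] at hx
  have h1 : ‖x.1‖ ≤ ‖x‖ := norm_fst_le x
  have h2 : |x.2| ≤ ‖x‖ := norm_snd_le x
  have h3 := Real.sq_sqrt (abs_nonneg x.2)
  have h4 : ‖x.1‖ ^ 2 ≤ ‖x‖ := by nlinarith [norm_nonneg x.1]
  rw [norm_pow, norm_norm, Real.norm_of_nonneg (wnorm_nonneg x), wnorm]
  nlinarith [sq_nonneg (‖x.1‖ - √|x.2|)]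

/-- As u has weight 2, weighted order two controls ordinary order one. This is what gives values and
first derivatives at 0 from weighted conditions. -/
lemma isLittleO_norm_of_wnorm {F : Type*} [NormedAddCommGroup F] {ψ : ParamSpace n → F} {k : ℕ}
    (hk : 2 ≤ k) (h : ψ =o[𝓝 0] fun x => wnorm x ^ k) : ψ =o[𝓝 0] fun x => ‖x‖ :=
  (h.trans_isBigO (wnorm_pow_isBigO hk)).trans_isBigO wnorm_sq_isBigO

lemma sub_isLittleO_of_normal {φ : ParamSpace n → ℝ} {a b}
    (h : (fun x => φ x - (‖x.1‖ ^ 2 + normalPart a b x.1)) =o[𝓝 0] fun x => wnorm x ^ 5) :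
    (fun x => φ x - ‖x.1‖ ^ 2) =o[𝓝 0] fun x => wnorm x ^ 3 := by
  refine ((h.trans_isBigO (wnorm_pow_isBigO (show 3 ≤ 5 by norm_num))).add
    ((normalPart_isBigO a b).trans_isLittleO
      (wnorm_pow_isLittleO (show 3 < 4 by norm_num)))).congr_left fun x => by ring

lemma isLittleO_normal {φ : ParamSpace n → ℝ} {a b}
    (h : (fun x => φ x - (‖x.1‖ ^ 2 + normalPart a b x.1)) =o[𝓝 0] fun x => wnorm x ^ 5) :
    φ =o[𝓝 0] fun x => ‖x‖ := by
  have h1 := isLittleO_norm_of_wnorm (by norm_num) (sub_isLittleO_of_normal h)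
  have h2 : (fun x : ParamSpace n => ‖x.1‖ ^ 2) =o[𝓝 0] fun x => ‖x‖ := by
    have h3 : (fun x : ParamSpace n => ‖x.1‖ ^ 2) =O[𝓝 0] fun x => ‖x‖ ^ 2 :=
      IsBigO.pow (IsBigO.of_bound 1 (Eventually.of_forall fun x => by
        rw [one_mul, norm_norm, norm_norm]
        exact norm_fst_le x)) 2
    refine h3.trans_isLittleO ?_
    have := (isLittleO_pow_pow (𝕜 := ℝ) (show 1 < 2 by norm_num)).comp_tendsto
      (tendsto_norm_zero (E := ParamSpace n))
    simpa only [Function.comp_def, pow_one] using this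
  exact (h1.add h2).congr_left fun x => by ring

/-- The normal form itself contains φ(0) = 0 and dφ(0) = 0, as all its terms are o(‖x‖). -/
lemma IsChernMoserChart.exists_graphChart {D : Set (CSpace n)} {p : CSpace n}
    {h : OpenPartialHomeomorph (CSpace n) (CSpace n)} (H : IsChernMoserChart D p h) :
    ∃ φ, IsGraphChart D p h φ ∧ IsChernMoserGraph φ := by
  obtain ⟨hbi, V, φ, hV, h0, hφ, hCM, hev⟩ := H
  obtain ⟨a, b, -, -, hexp⟩ := isChernMoserGraph_iff.1 hCM
  have h1 := isLittleO_normal hexp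
  have hφ0 : φ 0 = 0 := by
    simpa using (h1.bound one_pos).self_of_nhds
  refine ⟨φ, ⟨hbi, ⟨V, hV, h0, hφ⟩, hφ0, ?_, hev⟩, hCM⟩
  have h2 : HasFDerivAt φ (0 : ParamSpace n →L[ℝ] ℝ) 0 := by
    refine HasFDerivAt.of_isLittleO ?_
    simpa [hφ0] using h1.of_norm_right
  exact h2.fderiv

namespace IsGraphChart

variable {D : Set (CSpace n)} {p : CSpace n} {h : OpenPartialHomeomorph (CSpace n) (CSpace n)}
  {φ : ParamSpace n → ℝ}

lemma isChernMoserChart (H : IsGraphChart D p h φ) (hφ : IsChernMoserGraph φ) :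
    IsChernMoserChart D p h := by
  obtain ⟨V, hV, h0, hs⟩ := H.smooth
  exact ⟨H.isLocalBiholomorphism, V, φ, hV, h0, hs, hφ, H.eventually_mem⟩

/-- A neighbourhood on which the description of `D` as a supergraph is valid. -/
lemma exists_isOpen (H : IsGraphChart D p h φ) : ∃ B : Set (CSpace n), IsOpen B ∧ 0 ∈ B ∧
    B ⊆ h.target ∧ ContinuousOn (fun y => φ (toP y)) B ∧
    ∀ y ∈ B, (h.symm y ∈ D ↔ φ (toP y) < y.2.im) := by
  obtain ⟨V, hV, h0, hs⟩ := H.smooth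
  obtain ⟨B, hB, hBo, h0B⟩ := eventually_nhds_iff.1 H.eventually_mem
  refine ⟨B ∩ h.target ∩ toP ⁻¹' V, (hBo.inter h.open_target).inter (hV.preimage continuous_toP),
    ⟨⟨h0B, H.isLocalBiholomorphism.mem_target⟩, h0⟩, fun y hy => hy.1.2, ?_,
    fun y hy => hB y hy.1.1⟩
  exact hs.continuousOn.comp continuous_toP.continuousOn fun y hy => hy.2

lemma add_vertical_tendsto (y : CSpace n) :
    Tendsto (fun t : ℝ => (y.1, y.2 + Complex.I * t)) (𝓝[>] 0) (𝓝 y) := by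
  have : Continuous fun t : ℝ => (y.1, y.2 + Complex.I * t) := by fun_prop
  simpa using (this.tendsto 0).mono_left (nhdsWithin_le_nhds (s := Set.Ioi (0 : ℝ)))

lemma toP_vertical (y : CSpace n) (t : ℝ) : toP ((y.1, y.2 + Complex.I * t) : CSpace n) = toP y := by
  simp [toP]

/-- The boundary in graph coordinates. -/
lemma eventually_mem_frontier (H : IsGraphChart D p h φ) (hD : IsOpen D) :
    ∀ᶠ y in 𝓝 0, (h.symm y ∈ frontier D ↔ φ (toP y) = y.2.im) := by
  obtain ⟨B, hB, h0B, hBt, hc, hiff⟩ := H.exists_isOpen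
  filter_upwards [hB.mem_nhds h0B] with y hy
  have hcs : ContinuousAt h.symm y := h.continuousAt_symm (hBt hy)
  rw [hD.frontier_eq, Set.mem_sdiff, hiff y hy, not_lt]
  -- A point strictly below the graph has a neighbourhood outside D, and a point on the graph is the
  -- limit of the points of D vertically above it.
  constructor
  · rintro ⟨h1, h2⟩
    refine le_antisymm ?_ h2
    by_contra! h3
    have h4 : ∀ᶠ y' in 𝓝 y, h.symm y' ∉ D := by
      have hc2 : ContinuousAt (fun y' : CSpace n => y'.2.im) y := by fun_prop
      filter_upwards [hc2.eventually_lt (hc.continuousAt (hB.mem_nhds hy)) h3, hB.mem_nhds hy]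
        with y' k1 k2
      rw [hiff y' k2]
      exact not_lt.2 k1.le
    have h5 : ∀ᶠ q in 𝓝 (h.symm y), q ∉ D := by
      have h6 : Tendsto h (𝓝 (h.symm y)) (𝓝 y) := by
        have := h.continuousAt (h.map_target (hBt hy))
        rwa [ContinuousAt, h.right_inv (hBt hy)] at this
      filter_upwards [h6.eventually h4,
        h.eventually_left_inverse (h.map_target (hBt hy))] with q k1 k2
      rwa [k2] at k1
    rw [mem_closure_iff_frequently] at h1
    exact h1 h5
  · intro h1
    refine ⟨?_, h1.ge⟩
    have h2 : Tendsto (fun t : ℝ => h.symm (y.1, y.2 + Complex.I * t)) (𝓝[>] 0) (𝓝 (h.symm y)) :=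
      hcs.tendsto.comp (add_vertical_tendsto y)
    refine mem_closure_of_tendsto h2 ?_
    filter_upwards [self_mem_nhdsWithin,
      (add_vertical_tendsto y).eventually (hB.mem_nhds hy)] with t ht htB
    rw [hiff _ htB, toP_vertical, h1]
    have : (0 : ℝ) < t := ht
    simpa using this

end IsGraphChart

/-- Germs of maps between domains in graph coordinates. -/
lemma eventually_graph_le {D D' : Set (CSpace n)} {p p' : CSpace n}
    {h g : OpenPartialHomeomorph (CSpace n) (CSpace n)} {φ φ' : ParamSpace n → ℝ}
    (H : IsGraphChart D p h φ) (H' : IsGraphChart D' p' g φ') {F : CSpace n → CSpace n}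
    (hF : IsSmoothMapGerm D D' p p' F) :
    ∃ Ω : Set (CSpace n), IsOpen Ω ∧ 0 ∈ closure Ω ∧
      ContDiffAt ℝ ∞ (fun y => g (F (h.symm y))) 0 ∧
      DifferentiableOn ℂ (fun y => g (F (h.symm y))) Ω ∧
      ∀ᶠ x in 𝓝 0, φ' (toP (g (F (h.symm (graphMap φ x))))) ≤
        (g (F (h.symm (graphMap φ x)))).2.im := by
  obtain ⟨U, hU, hpU, hFs, hFh, hFm, hFp⟩ := hF
  obtain ⟨B, hB, h0B, hBt, hc, hiff⟩ := H.exists_isOpen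
  obtain ⟨B', hB', h0B', hBt', hc', hiff'⟩ := H'.exists_isOpen
  have hbi := H.isLocalBiholomorphism
  have hbi' := H'.isLocalBiholomorphism
  have hsmooth : ContDiffAt ℝ ∞ (fun y => g (F (h.symm y))) 0 := by
    have h1 : ContDiffAt ℝ ∞ F (h.symm 0) := by
      rw [hbi.symm_map_eq]
      exact hFs.contDiffAt (hU.mem_nhds hpU)
    have h2 : ContDiffAt ℝ ∞ g (F (h.symm 0)) := by
      rw [hbi.symm_map_eq, hFp]
      exact hbi'.contDiffAt
    exact h2.comp (0 : CSpace n) (h1.comp (0 : CSpace n) hbi.symm.contDiffAt)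
  have hG0 : g (F (h.symm 0)) = 0 := by rw [hbi.symm_map_eq, hFp, hbi'.map_eq]
  -- an open neighbourhood of the origin where everything is defined
  have hev : ∀ᶠ y in 𝓝 (0 : CSpace n), y ∈ B ∧ h.symm y ∈ U ∧ F (h.symm y) ∈ g.source ∧
      g (F (h.symm y)) ∈ B' := by
    have t1 : Tendsto h.symm (𝓝 0) (𝓝 p) := hbi.symm.tendsto
    have t2 : Tendsto F (𝓝 p) (𝓝 p') := by
      have := (hFs.contDiffAt (hU.mem_nhds hpU)).continuousAt
      rwa [ContinuousAt, hFp] at this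
    have t3 : Tendsto (fun y => g (F (h.symm y))) (𝓝 0) (𝓝 0) := by
      have := hsmooth.continuousAt
      rwa [ContinuousAt, hG0] at this
    exact Filter.Eventually.and (hB.mem_nhds h0B) ((t1.eventually (hU.mem_nhds hpU)).and
      (((t2.comp t1).eventually hbi'.source_mem).and (t3.eventually (hB'.mem_nhds h0B'))))
  obtain ⟨C, hCsub, hC, h0C⟩ := eventually_nhds_iff.1 hev
  have hmem : ∀ y ∈ C, φ (toP y) < y.2.im →
      φ' (toP (g (F (h.symm y)))) < (g (F (h.symm y))).2.im := by
    intro y hy hlt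
    obtain ⟨k1, k2, k3, k4⟩ := hCsub y hy
    rw [← hiff' _ k4, g.left_inv k3]
    exact hFm ⟨k2, (hiff y k1).2 hlt⟩
  -- Ω is the part of a neighbourhood that corresponds to D, where F is holomorphic; the vertical
  -- half-line shows that 0 lies in its closure.
  refine ⟨C ∩ {y | φ (toP y) < y.2.im}, ?_, ?_, hsmooth, ?_, ?_⟩
  · have h1 : ContinuousOn (fun y : CSpace n => (φ (toP y), y.2.im)) C :=
      (hc.mono fun y hy => (hCsub y hy).1).prodMk (by fun_prop)
    exact h1.isOpen_inter_preimage hC (isOpen_lt continuous_fst continuous_snd)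
  · have h1 := IsGraphChart.add_vertical_tendsto (0 : CSpace n)
    refine mem_closure_of_tendsto h1 ?_
    filter_upwards [self_mem_nhdsWithin, h1.eventually (hC.mem_nhds h0C)] with t ht htC
    refine ⟨htC, ?_⟩
    have h2 : toP (0 : CSpace n) = 0 := map_zero (toPL n)
    rw [Set.mem_ofPred_eq, IsGraphChart.toP_vertical, h2, H.map_zero]
    simpa using ht
  · have h1 : DifferentiableOn ℂ h.symm (C ∩ {y | φ (toP y) < y.2.im}) :=
      hbi.holomorphic_symm.mono fun y hy => hBt (hCsub y hy.1).1
    have h2 : DifferentiableOn ℂ (fun y => F (h.symm y)) (C ∩ {y | φ (toP y) < y.2.im}) :=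
      hFh.comp h1 fun y hy => ⟨(hCsub y hy.1).2.1, (hiff y (hCsub y hy.1).1).2 hy.2⟩
    exact hbi'.holomorphic.comp h2 fun y hy => (hCsub y hy.1).2.2.1
  -- The strict inequality holds at points pushed vertically into D; in the limit it becomes the
  -- weak one on the boundary.
  · filter_upwards [H.tendsto_graphMap.eventually (hC.mem_nhds h0C)] with x hx
    obtain ⟨k1, k2, k3, k4⟩ := hCsub _ hx
    set y := graphMap φ x
    have hG : ContinuousAt (fun y => g (F (h.symm y))) y := by
      refine ContinuousAt.comp (f := fun y => F (h.symm y)) (g.continuousAt k3) ?_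
      exact ContinuousAt.comp ((hFs.continuousOn).continuousAt (hU.mem_nhds k2))
        (h.continuousAt_symm (hBt k1))
    have t1 := hG.tendsto.comp (IsGraphChart.add_vertical_tendsto y)
    have t2 := ((hc'.continuousAt (hB'.mem_nhds k4)).tendsto).comp t1
    have t3 : Tendsto (fun t : ℝ => (g (F (h.symm (y.1, y.2 + Complex.I * t)))).2.im) (𝓝[>] 0)
        (𝓝 (g (F (h.symm y))).2.im) :=
      ((Complex.continuous_im.comp continuous_snd).tendsto _).comp t1
    refine le_of_tendsto_of_tendsto t2 t3 ?_
    filter_upwards [self_mem_nhdsWithin,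
      (IsGraphChart.add_vertical_tendsto y).eventually (hC.mem_nhds hx)] with t ht htC
    have ht' : (0 : ℝ) < t := ht
    refine (hmem _ htC ?_).le
    rw [IsGraphChart.toP_vertical]
    simpa [y] using ht'

end Comparison

/-! ### A 2-flat map preserves the normal terms -/

section FlatComparison

open Asymptotics Filter

variable {n : ℕ}

lemma isBigO_fst_wnorm : (fun x : ParamSpace n => x.1) =O[𝓝 0] wnorm :=
  IsBigO.of_bound 1 (Eventually.of_forall fun x => by
    rw [one_mul, Real.norm_of_nonneg (wnorm_nonneg x)]
    exact norm_fst_le_wnorm x)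

lemma norm_add_sq_complex (z δ : EuclideanSpace ℂ (Fin n)) :
    ‖z + δ‖ ^ 2 = ‖z‖ ^ 2 + 2 * (inner ℂ z δ).re + ‖δ‖ ^ 2 :=
  norm_add_sq (𝕜 := ℂ) z δ

/-- The defining function of a normal graph along the image of a normal graph under a map tangent
to the identity. -/
lemma flat_comparison {φ φ' : ParamSpace n → ℝ} {a b a' b'}
    (hφs : ContDiffAt ℝ ∞ φ 0) (hφ0 : φ 0 = 0)
    (hφ : (fun x => φ x - (‖x.1‖ ^ 2 + normalPart a b x.1)) =o[𝓝 0] fun x => wnorm x ^ 5)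
    (hφ' : (fun x => φ' x - (‖x.1‖ ^ 2 + normalPart a' b' x.1)) =o[𝓝 0] fun x => wnorm x ^ 5)
    {G : CSpace n → CSpace n} (hG : ContDiffAt ℝ ∞ G 0) (hG0 : G 0 = 0)
    (hGd : HasFDerivAt G (ContinuousLinearMap.id ℝ (CSpace n)) 0)
    {T : ParamSpace n → CSpace n} (hT : T =O[𝓝 0] fun x => wnorm x ^ 3)
    (hGT : (fun x => G (graphMap φ x) - (graphMap φ x + T x)) =o[𝓝 0] fun x => wnorm x ^ 5) :
    (fun x => ((G (graphMap φ x)).2.im - φ' (toP (G (graphMap φ x)))) -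
      (normalPart a b x.1 - normalPart a' b' x.1 + (T x).2.im - 2 * (inner ℂ x.1 (T x).1).re))
      =o[𝓝 0] fun x => wnorm x ^ 5 := by
  have hgr0 := graphMap_zero hφ0
  have hφd : HasFDerivAt φ (0 : ParamSpace n →L[ℝ] ℝ) (0 : ParamSpace n) := by
    refine HasFDerivAt.of_isLittleO ?_
    simpa [hφ0] using (isLittleO_normal hφ).of_norm_right
  have hgrd : HasFDerivAt (graphMap φ) (inclL n) 0 :=
    hasFDerivAt_graphMap hφd.differentiableAt hφd.fderiv
  set κ : ParamSpace n → ParamSpace n := fun x => toP (G (graphMap φ x)) with hκdef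
  have htoP0 : toP (0 : CSpace n) = 0 := map_zero (toPL n)
  have hκ0 : κ 0 = 0 := by simp only [hκdef, hgr0, hG0, htoP0]
  have hκs : ContDiffAt ℝ ∞ κ 0 := by
    refine contDiff_toP.contDiffAt.comp (0 : ParamSpace n) ?_
    exact ContDiffAt.comp (0 : ParamSpace n) (by rwa [hgr0]) (contDiffAt_graphMap le_rfl hφs)
  have hκd : HasFDerivAt κ ((toPL n).comp ((ContinuousLinearMap.id ℝ (CSpace n)).comp (inclL n)))
      0 := by
    refine (hasFDerivAt_toP _).comp (0 : ParamSpace n) (HasFDerivAt.comp (0 : ParamSpace n) ?_ hgrd)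
    rwa [hgr0]
  have hκw : (fun x => wnorm (κ x)) =O[𝓝 0] wnorm := by
    refine wnorm_comp_isBigO (contDiffAt_infty.1 hκs 2) hκ0 fun z => ?_
    rw [hκd.fderiv]
    simp [inclL_apply, toPL_apply, toP]
  have hκt : Tendsto κ (𝓝 0) (𝓝 0) := by
    have := hκs.continuousAt
    rwa [ContinuousAt, hκ0] at this
  have he' : (fun x => φ' (κ x) - (‖(κ x).1‖ ^ 2 + normalPart a' b' (κ x).1)) =o[𝓝 0]
      fun x => wnorm x ^ 5 := (hφ'.comp_tendsto hκt).trans_isBigO (hκw.pow 5)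
  have hA : (fun x => (G (graphMap φ x)).2.im - (φ x + (T x).2.im)) =o[𝓝 0]
      fun x => wnorm x ^ 5 := by
    refine IsBigO.trans_isLittleO (IsBigO.of_bound 1 (Eventually.of_forall fun x => ?_)) hGT
    have h1 : (G (graphMap φ x)).2.im - (φ x + (T x).2.im) =
        (G (graphMap φ x) - (graphMap φ x + T x)).2.im := by simp
    rw [h1, one_mul]
    exact (Complex.abs_im_le_norm _).trans (norm_snd_le _)
  set δ : ParamSpace n → EuclideanSpace ℂ (Fin n) := fun x => (G (graphMap φ x)).1 - x.1 with hδdef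
  have hδT : (fun x => δ x - (T x).1) =o[𝓝 0] fun x => wnorm x ^ 5 := by
    refine IsBigO.trans_isLittleO (IsBigO.of_bound 1 (Eventually.of_forall fun x => ?_)) hGT
    have h1 : δ x - (T x).1 = (G (graphMap φ x) - (graphMap φ x + T x)).1 := by
      simp [hδdef, sub_sub, graphMap_fst]
    rw [h1, one_mul]
    exact norm_fst_le _
  have hT1 : (fun x => (T x).1) =O[𝓝 0] fun x => wnorm x ^ 3 :=
    (IsBigO.of_bound 1 (Eventually.of_forall fun x => by
      rw [one_mul]; exact norm_fst_le _)).trans hT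
  have hδ : δ =O[𝓝 0] fun x => wnorm x ^ 3 :=
    ((hδT.isBigO.trans (wnorm_pow_isBigO (by norm_num))).add hT1).congr_left fun x => by simp
  have hin : (fun x => 2 * (inner ℂ x.1 (δ x - (T x).1)).re) =o[𝓝 0] fun x => wnorm x ^ 5 := by
    refine IsLittleO.const_mul_left ?_ 2
    have h1 : (fun x : ParamSpace n => ‖x.1‖ * ‖δ x - (T x).1‖) =o[𝓝 0]
        fun x => wnorm x * wnorm x ^ 5 := isBigO_fst_wnorm.norm_left.mul_isLittleO hδT.norm_left
    refine (IsBigO.of_bound 1 (Eventually.of_forall fun x => ?_)).trans_isLittleO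
      (h1.trans_isBigO ((wnorm_pow_isBigO (show 5 ≤ 6 by norm_num)).congr_left fun x => by ring))
    rw [one_mul, norm_mul, norm_norm, norm_norm]
    exact (Complex.abs_re_le_norm _).trans (norm_inner_le_norm _ _)
  have hsq : (fun x => ‖δ x‖ ^ 2) =o[𝓝 0] fun x => wnorm x ^ 5 :=
    ((hδ.norm_left.pow 2).congr_right fun x => by ring).trans_isLittleO
      (wnorm_pow_isLittleO (show 5 < 6 by norm_num))
  have hδw : δ =o[𝓝 0] wnorm := hδ.trans_isLittleO
    (by simpa using wnorm_pow_isLittleO (n := n) (show 1 < 3 by norm_num))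
  -- The normal part starts in weight 4, so a displacement of weight 3 changes it only in weight 6
  -- and beyond.
  have hN : (fun x => normalPart a' b' (x.1 + δ x) - normalPart a' b' x.1) =o[𝓝 0]
      fun x => wnorm x ^ 5 :=
    (((isSlowlyVarying_normalPart a' b').2 δ hδw).trans
      (((isBigO_refl _ _).mul hδ.norm_left).congr_right fun x => by ring)).trans_isLittleO
      (wnorm_pow_isLittleO (show 5 < 6 by norm_num))
  refine (((((hA.add hφ).sub he').sub hin).sub hsq).sub hN).congr_left fun x => ?_
  have hκ1 : (κ x).1 = x.1 + δ x := by simp [hκdef, hδdef, toP]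
  have hI : (inner ℂ x.1 (δ x - (T x).1)).re =
      (inner ℂ x.1 (δ x)).re - (inner ℂ x.1 (T x).1).re := by
    rw [inner_sub_right x.1 (δ x) (T x).1, Complex.sub_re]
  have hκx : φ' (κ x) = φ' (toP (G (graphMap φ x))) := rfl
  rw [hκ1, norm_add_sq_complex, hI, hκx]
  ring

lemma IsBihomogeneous.snd {F : Type*} [NormedAddCommGroup F] [NormedSpace ℂ F] {p : ℕ}
    {Q : EuclideanSpace ℂ (Fin n) → F × ℂ} (hQ : ∀ (s : ℂ) z, Q (s • z) = s ^ p • Q z) :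
    IsBihomogeneous p 0 fun z => (Q z).2 := fun s z => by
  simp [hQ]

lemma IsBihomogeneous.inner_fst {p : ℕ} {Q : EuclideanSpace ℂ (Fin n) → CSpace n}
    (hQ : ∀ (s : ℂ) z, Q (s • z) = s ^ p • Q z) :
    IsBihomogeneous p 1 fun z => inner ℂ z (Q z).1 := fun s z => by
  simp only [hQ, Prod.smul_fst, inner_smul_left, inner_smul_right]
  ring

lemma isBihomogeneous_poly32 (b : Fin n → Fin n → Fin n → Fin n → Fin n → ℂ) :
    IsBihomogeneous 3 2 (poly32 b) := fun s z => by
  simp only [poly32, Finset.mul_sum]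
  refine Finset.sum_congr rfl fun i _ => Finset.sum_congr rfl fun j _ =>
    Finset.sum_congr rfl fun k _ => Finset.sum_congr rfl fun l _ => Finset.sum_congr rfl fun m _ => ?_
  simp only [PiLp.smul_apply, smul_eq_mul, map_mul]
  ring

lemma poly22_sub (a a' : Fin n → Fin n → Fin n → Fin n → ℂ) (z : EuclideanSpace ℂ (Fin n)) :
    poly22 (fun i j k l => a i j k l + -1 * a' i j k l) z = poly22 a z - poly22 a' z := by
  simp only [poly22, ← Finset.sum_sub_distrib]
  refine Finset.sum_congr rfl fun i _ => Finset.sum_congr rfl fun j _ =>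
    Finset.sum_congr rfl fun k _ => Finset.sum_congr rfl fun l _ => ?_
  ring

lemma hasFDerivAt_id_of_flat {G : CSpace n → CSpace n} (hG0 : G 0 = 0)
    (hflat : (fun y => G y - y) =o[𝓝 0] fun y => ‖y‖ ^ 2) :
    HasFDerivAt G (ContinuousLinearMap.id ℝ (CSpace n)) 0 := by
  refine HasFDerivAt.of_isLittleO ?_
  have h1 : (fun y : CSpace n => ‖y‖ ^ 2) =o[𝓝 0] fun y => y := by
    have := (isLittleO_pow_pow (𝕜 := ℝ) (show 1 < 2 by norm_num)).comp_tendsto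
      (tendsto_norm_zero (E := CSpace n))
    simp only [Function.comp_def, pow_one] at this
    exact this.of_norm_right
  simpa [hG0] using hflat.trans h1

/-- A `2`-flat map of normal supergraphs preserves the normal form up to weighted order `5`. -/
theorem normalPart_eq_of_flat {φ φ' : ParamSpace n → ℝ} {a b a' b'}
    (ha : IsNormal22 a) (ha' : IsNormal22 a')
    (hφs : ContDiffAt ℝ ∞ φ 0) (hφ0 : φ 0 = 0)
    (hφ : (fun x => φ x - (‖x.1‖ ^ 2 + normalPart a b x.1)) =o[𝓝 0] fun x => wnorm x ^ 5)
    (hφ' : (fun x => φ' x - (‖x.1‖ ^ 2 + normalPart a' b' x.1)) =o[𝓝 0] fun x => wnorm x ^ 5)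
    {G : CSpace n → CSpace n} (hG : ContDiffAt ℝ ∞ G 0) (hG0 : G 0 = 0)
    {Ω : Set (CSpace n)} (hΩ : IsOpen Ω) (hp : 0 ∈ closure Ω) (hol : DifferentiableOn ℂ G Ω)
    (hflat : (fun y => G y - y) =o[𝓝 0] fun y => ‖y‖ ^ 2)
    (hle : ∀ᶠ x in 𝓝 0, φ' (toP (G (graphMap φ x))) ≤ (G (graphMap φ x)).2.im)
    (z : EuclideanSpace ℂ (Fin n)) : normalPart a b z = normalPart a' b' z := by
  obtain ⟨Q, hQc, hQ, hexp⟩ := exists_flat_expansion hG hΩ hp hol hflat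
  have hgr : Tendsto (graphMap φ) (𝓝 0) (𝓝 0) := by
    have := (contDiffAt_graphMap le_rfl hφs).continuousAt
    rwa [ContinuousAt, graphMap_zero hφ0] at this
  have hexp' := flat_expansion_graphMap hQc hQ hexp hgr (sub_isLittleO_of_normal hφ)
  have hGd := hasFDerivAt_id_of_flat hG0 hflat
  let T : ParamSpace n → CSpace n := fun x => Q 3 3 x.1 + (Q 4 4 x.1 + modelW x • Q 3 2 x.1) +
      (Q 5 5 x.1 + modelW x • Q 4 3 x.1 + modelW x ^ 2 • Q 3 1 x.1)
  have hW : (fun x : ParamSpace n => modelW x) =O[𝓝 0] fun x => wnorm x ^ 2 :=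
    IsBigO.of_bound 2 (Eventually.of_forall fun x => by
      rw [norm_pow, Real.norm_of_nonneg (wnorm_nonneg x)]
      exact norm_modelW_le x)
  have hQO : ∀ m, ∀ a ≤ m, (fun x : ParamSpace n => Q m a x.1) =O[𝓝 0] fun x => wnorm x ^ a :=
    fun m a ha => isBigO_of_complex_homogeneous (hQc m a) (hQ m a ha)
  have hlow : ∀ m a c, a ≤ m → 3 ≤ 2 * c + a →
      (fun x : ParamSpace n => modelW x ^ c • Q m a x.1) =O[𝓝 0] fun x => wnorm x ^ 3 := by
    intro m a c ha h3
    refine (((hW.pow c).smul (hQO m a ha))).trans ?_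
    simp only [← pow_mul, smul_eq_mul, ← pow_add]
    exact wnorm_pow_isBigO h3
  have hT : T =O[𝓝 0] fun x => wnorm x ^ 3 := by
    refine ((((((hlow 3 3 0 (by norm_num) (by norm_num)).add
      (hlow 4 4 0 (by norm_num) (by norm_num))).add (hlow 3 2 1 (by norm_num) (by norm_num))).add
      (hlow 5 5 0 (by norm_num) (by norm_num))).add (hlow 4 3 1 (by norm_num) (by norm_num))).add
      (hlow 3 1 2 (by norm_num) (by norm_num))).congr_left fun x => ?_
    simp only [T, pow_zero, one_smul, pow_one]
    abel
  have hGT : (fun x => G (graphMap φ x) - (graphMap φ x + T x)) =o[𝓝 0] fun x => wnorm x ^ 5 :=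
    hexp'.congr_left fun x => by simp only [T]; abel
  have hmain := flat_comparison hφs hφ0 hφ hφ' hG hG0 hGd hT hGT
  have key := normal_terms_eq_zero (ha.sub ha')
    (α := fun z => (Q 3 3 z).2) (X := fun z => (Q 4 4 z).2) (β := fun z => (Q 3 2 z).2)
    (e := fun z => inner ℂ z (Q 3 3 z).1) (p₅ := fun z => (Q 5 5 z).2)
    (p₃ := fun z => (Q 4 3 z).2) (p₁ := fun z => (Q 3 1 z).2)
    (e₄ := fun z => inner ℂ z (Q 4 4 z).1) (e₂ := fun z => inner ℂ z (Q 3 2 z).1)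
    (m := fun z => poly32 b z - poly32 b' z)
    (.snd (hQ 3 3 le_rfl)) (.snd (hQ 4 4 le_rfl)) (.snd (hQ 3 2 (by norm_num)))
    (.inner_fst (hQ 3 3 le_rfl)) (.snd (hQ 5 5 le_rfl)) (.snd (hQ 4 3 (by norm_num)))
    (.snd (hQ 3 1 (by norm_num))) (.inner_fst (hQ 4 4 le_rfl)) (.inner_fst (hQ 3 2 (by norm_num)))
    (fun s z => by simp only; rw [isBihomogeneous_poly32 b, isBihomogeneous_poly32 b']; ring)
    (R := fun x => (G (graphMap φ x)).2.im - φ' (toP (G (graphMap φ x))))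
    (by filter_upwards [hle] with x hx; exact sub_nonneg.2 hx) ?_
  · have h1 := key.1 z
    have h2 := key.2 z
    rw [poly22_sub, Complex.sub_re] at h1
    rw [Complex.sub_re] at h2
    simp only [normalPart]
    linarith
  -- The weight 5 terms of T contribute through their w-components only: pairing their z-components
  -- with z gives weight 6, and these pairings are discarded here.
  · have e5 : (fun x : ParamSpace n => -2 * (inner ℂ x.1 ((Q 5 5 x.1 + modelW x • Q 4 3 x.1 +
        modelW x ^ 2 • Q 3 1 x.1).1)).re) =o[𝓝 0] fun x => wnorm x ^ 5 := by
      refine IsLittleO.const_mul_left ?_ _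
      have h5 : ∀ m a c, a ≤ m → 5 ≤ 2 * c + a →
          (fun x : ParamSpace n => modelW x ^ c • Q m a x.1) =O[𝓝 0] fun x => wnorm x ^ 5 := by
        intro m a c ha h3
        refine (((hW.pow c).smul (hQO m a ha))).trans ?_
        simp only [← pow_mul, smul_eq_mul, ← pow_add]
        exact wnorm_pow_isBigO h3
      have h6 := ((h5 5 5 0 (by norm_num) (by norm_num)).add
        (h5 4 3 1 (by norm_num) (by norm_num))).add (h5 3 1 2 (by norm_num) (by norm_num))
      have h7 := isBigO_fst_wnorm.norm_left.mul h6.norm_left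
      refine (IsBigO.of_bound 1 (Eventually.of_forall fun x => ?_)).trans_isLittleO
        (h7.trans_isLittleO ((wnorm_pow_isLittleO (show 5 < 6 by norm_num)).congr_left
          fun x => by ring))
      rw [one_mul, norm_mul, norm_norm, norm_norm]
      refine (Complex.abs_re_le_norm _).trans ((norm_inner_le_norm _ _).trans ?_)
      simp only [pow_zero, one_smul, pow_one]
      gcongr
      exact norm_fst_le _
    refine (hmain.add e5).congr_left fun x => ?_
    have hWr : (modelW x).re = x.2 := by simp [modelW, ← Complex.ofReal_pow]
    have hWi : (modelW x).im = ‖x.1‖ ^ 2 := by simp [modelW, ← Complex.ofReal_pow]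
    have hW2r : (modelW x ^ 2).re = x.2 ^ 2 - ‖x.1‖ ^ 4 := by
      rw [pow_two, Complex.mul_re, hWr, hWi]; ring
    have hW2i : (modelW x ^ 2).im = 2 * x.2 * ‖x.1‖ ^ 2 := by
      rw [pow_two, Complex.mul_im, hWr, hWi]; ring
    rw [poly22_sub]
    simp only [T, normalPart, Prod.fst_add, Prod.snd_add, Prod.smul_fst, Prod.smul_snd,
      inner_add_right, inner_smul_right, Complex.add_re, Complex.add_im, smul_eq_mul,
      Complex.mul_re, Complex.mul_im, hWr, hWi, hW2r, hW2i, Complex.sub_re]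
    ring

end FlatComparison

/-! ### Graphs that agree to weighted order five are equivalent -/

section EquivalenceOfGraphs

open Asymptotics Filter

variable {n : ℕ} {M : Set (CSpace n)} {p : CSpace n}
  {g : OpenPartialHomeomorph (CSpace n) (CSpace n)} {φ : ParamSpace n → ℝ}

/-- The parametrization of a hypersurface as a graph in local coordinates is adapted. -/
lemma isAdaptedParametrization_graph (hg : IsLocalBiholomorphism g p 0)
    (hφ : ∃ V : Set (ParamSpace n), IsOpen V ∧ (0 : ParamSpace n) ∈ V ∧ ContDiffOn ℝ ∞ φ V)
    (hφ0 : φ 0 = 0) (hφd : fderiv ℝ φ 0 = 0)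
    (hM : ∀ᶠ q in 𝓝 p, (q ∈ M ↔ φ (toP (g q)) = (g q).2.im)) :
    IsAdaptedParametrization M p fun x => g.symm (graphMap φ x) := by
  obtain ⟨V, hV, h0V, hφs⟩ := hφ
  obtain ⟨L, -, hL⟩ := hg.exists_hasFDerivAt
  have hgr0 := graphMap_zero hφ0
  have hφat := hφs.contDiffAt (hV.mem_nhds h0V)
  have hgrt : Tendsto (graphMap φ) (𝓝 0) (𝓝 0) := by
    have := (contDiffAt_graphMap le_rfl hφat).continuousAt
    rwa [ContinuousAt, hgr0] at this
  have hgrd := hasFDerivAt_graphMap (hφat.differentiableAt (by simp)) hφd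
  have hγd : HasFDerivAt (fun x => g.symm (graphMap φ x))
      (((L.symm : CSpace n →L[ℂ] CSpace n).restrictScalars ℝ).comp (inclL n)) 0 := by
    refine HasFDerivAt.comp (0 : ParamSpace n) ?_ hgrd
    rw [hgr0]
    exact hL.restrictScalars ℝ
  have hγx : ∀ x, fderiv ℝ (fun x => g.symm (graphMap φ x)) 0 x =
      L.symm (x.1, (x.2 : ℂ)) := fun x => by
    rw [hγd.fderiv]
    simp [inclL_apply]
  have hγt : Tendsto (fun x => g.symm (graphMap φ x)) (𝓝 0) (𝓝 p) := hg.symm.tendsto.comp hgrt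
  have hgs : ContDiffOn ℝ ∞ (graphMap φ) V :=
    contDiff_toC.comp_contDiffOn (contDiffOn_id.prodMk hφs)
  refine ⟨by simp only [hgr0, hg.symm_map_eq],
    ⟨V ∩ graphMap φ ⁻¹' g.target, hgs.continuousOn.isOpen_inter_preimage hV g.open_target,
      ⟨h0V, by rw [Set.mem_preimage, hgr0]; exact hg.mem_target⟩,
      hg.symm.contDiffOn.comp (hgs.mono Set.inter_subset_left) fun x hx => hx.2⟩, ?_, ?_, ?_⟩
  · refine (injective_iff_map_eq_zero _).2 fun x hx => ?_
    rw [hγx] at hx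
    have h1 := (map_eq_zero_iff L.symm L.symm.injective).1 hx
    have h2 : x.1 = 0 := congrArg Prod.fst h1
    have h3 : (x.2 : ℂ) = 0 := congrArg Prod.snd h1
    exact Prod.ext h2 (by simpa using h3)
  · refine le_antisymm ?_ ?_
    · refine tendsto_nhdsWithin_iff.2 ⟨hγt, ?_⟩
      filter_upwards [hγt.eventually hM, hgrt.eventually hg.eventually_right_inv] with x h1 h2
      rw [h1, h2]
      simp
    · intro s hs
      rw [mem_map] at hs
      have h0 : Tendsto (fun q => toP (g q)) (𝓝 p) (𝓝 0) := by
        have := continuous_toP.tendsto (0 : CSpace n)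
        rw [toP_zero] at this
        exact this.comp hg.tendsto
      rw [mem_nhdsWithin_iff_eventually]
      filter_upwards [h0.eventually hs, hM, hg.eventually_left_inv] with q h1 h2 h3 hq
      have h4 : graphMap φ (toP (g q)) = g q := by
        rw [graphMap, h2.1 hq, toC_toP]
      rw [h4, h3] at h1
      exact h1
  · ext v
    simp only [Set.mem_range, hγx, Set.mem_ofPred_eq]
    constructor
    · rintro ⟨z, rfl⟩
      refine ⟨⟨(z, 0), rfl⟩, ⟨(Complex.I • z, 0), ?_⟩⟩
      rw [← map_smul]
      simp
    -- In the coordinates the tangent space is ℂⁿ × ℝ, and i(z, u) stays in it only if u = 0.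
    · rintro ⟨⟨x, rfl⟩, ⟨x', hx'⟩⟩
      rw [← map_smul] at hx'
      have h1 := congrArg (fun y : CSpace n => y.2.im) (L.symm.injective hx')
      simp only [Prod.smul_snd, smul_eq_mul, Complex.I_mul_im, Complex.ofReal_im,
        Complex.ofReal_re] at h1
      exact ⟨x.1, by rw [← h1]⟩

lemma isHypersurfaceDefiningFunctionAt_graph (hg : IsLocalBiholomorphism g p 0)
    (hφ : ∃ V : Set (ParamSpace n), IsOpen V ∧ (0 : ParamSpace n) ∈ V ∧ ContDiffOn ℝ ∞ φ V)
    (hφd : fderiv ℝ φ 0 = 0)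
    (hM : ∀ᶠ q in 𝓝 p, (q ∈ M ↔ φ (toP (g q)) = (g q).2.im)) :
    IsHypersurfaceDefiningFunctionAt M p fun q => (g q).2.im - φ (toP (g q)) := by
  obtain ⟨V, hV, h0V, hφs⟩ := hφ
  obtain ⟨L, hL, -⟩ := hg.exists_hasFDerivAt
  obtain ⟨U, hU, hUo, hpU⟩ := eventually_nhds_iff.1 hM
  have hc : ContDiffOn ℝ ∞ (fun q => toP (g q)) g.source :=
    contDiff_toP.comp_contDiffOn hg.contDiffOn
  refine ⟨U ∩ (g.source ∩ (fun q => toP (g q)) ⁻¹' V),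
    hUo.inter (hc.continuousOn.isOpen_inter_preimage g.open_source hV),
    ⟨hpU, hg.mem_source, by rw [Set.mem_preimage, hg.map_eq]; exact h0V⟩, ?_, ?_, ?_⟩
  · have h1 : ContDiffOn ℝ ∞ (fun q => (g q).2.im) g.source :=
      Complex.imCLM.contDiff.comp_contDiffOn (contDiff_snd.comp_contDiffOn hg.contDiffOn)
    exact (h1.mono fun q hq => hq.2.1).sub
      (hφs.comp (hc.mono fun q hq => hq.2.1) fun q hq => hq.2.2)
  · have hLr : HasFDerivAt g ((L : CSpace n →L[ℂ] CSpace n).restrictScalars ℝ) p :=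
      hL.restrictScalars ℝ
    have h1 := ((Complex.imCLM.comp (ContinuousLinearMap.snd ℝ _ ℂ)).hasFDerivAt (x := g p)).comp p
      hLr
    have h2 : HasFDerivAt φ (0 : ParamSpace n →L[ℝ] ℝ) (toP (g p)) := by
      rw [hg.map_eq, toP_zero, ← hφd]
      exact ((hφs.contDiffAt (hV.mem_nhds h0V)).differentiableAt (by simp)).hasFDerivAt
    have h3 : HasFDerivAt (fun q => (g q).2.im - φ (toP (g q))) _ p :=
      h1.sub (h2.comp p ((hasFDerivAt_toP (g p)).comp p hLr))
    intro h0
    have h4 := DFunLike.congr_fun (h3.fderiv.symm.trans h0) (L.symm (0, Complex.I))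
    simp at h4
  · intro q hq
    rw [hU q hq.1, sub_eq_zero, eq_comm]

/-- Domains whose boundaries are graphs that agree up to weighted order `5`. -/
theorem IsGraphChart.areEquivalentToWeightedOrder {D D' : Set (CSpace n)} {p p' : CSpace n}
    {h g : OpenPartialHomeomorph (CSpace n) (CSpace n)} {φ φ' : ParamSpace n → ℝ}
    (hD : IsOpen D) (hD' : IsOpen D') (H : IsGraphChart D p h φ) (H' : IsGraphChart D' p' g φ')
    {k : ℕ} (hk : (fun x => φ x - φ' x) =o[𝓝 0] fun x => wnorm x ^ k) :
    AreEquivalentToWeightedOrder k (frontier D) (frontier D') p p' := by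
  have hh := H.isLocalBiholomorphism
  have hg := H'.isLocalBiholomorphism
  have hΦ := hh.trans hg.symm
  have hM' : ∀ᶠ q in 𝓝 p', (q ∈ frontier D' ↔ φ' (toP (g q)) = (g q).2.im) := by
    filter_upwards [hg.tendsto.eventually (H'.eventually_mem_frontier hD'),
      hg.eventually_left_inv] with q h1 h2
    rwa [h2] at h1
  have hM : ∀ᶠ q in 𝓝 p', (q ∈ (h.trans g.symm) '' ((h.trans g.symm).source ∩ frontier D) ↔
      φ (toP (g q)) = (g q).2.im) := by
    filter_upwards [hg.tendsto.eventually (H.eventually_mem_frontier hD),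
      hΦ.symm.source_mem] with q h1 h2
    rw [← h1]
    have h3 : h.symm (g q) = (h.trans g.symm).symm q := by
      simp
    rw [h3]
    constructor
    · rintro ⟨x, ⟨hx1, hx2⟩, rfl⟩
      rwa [(h.trans g.symm).left_inv hx1]
    · intro hq
      exact ⟨_, ⟨(h.trans g.symm).map_target h2, hq⟩, (h.trans g.symm).right_inv h2⟩
  refine ⟨h.trans g.symm, hΦ, _, _,
    isHypersurfaceDefiningFunctionAt_graph hg H'.smooth H'.fderiv_zero hM',
    isAdaptedParametrization_graph hg H.smooth H.map_zero H.fderiv_zero hM, ?_⟩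
  -- On the graph of φ the defining function Im w − φ' takes the value φ − φ'.
  refine IsLittleO.congr' (f₁ := fun x => φ x - φ' x) hk ?_ EventuallyEq.rfl
  filter_upwards [H.tendsto_graphMap.eventually hg.eventually_right_inv] with x hx
  simp [hx]

/-- A `2`-flat germ gives an equivalence up to weighted order `5`. -/
theorem areEquivalentToWeightedOrder_of_isTwoFlat {D D' : Set (CSpace n)} {p p' : CSpace n}
    (hD : IsOpen D) (hD' : IsOpen D') {F : CSpace n → CSpace n}
    (hF : IsSmoothMapGerm D D' p p' F) (hflat : IsTwoFlat D D' p p' F) :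
    AreEquivalentToWeightedOrder 5 (frontier D) (frontier D') p p' := by
  obtain ⟨h, g, Hh, Hg, hfl⟩ := hflat
  obtain ⟨φ, H, hφ⟩ := Hh.exists_graphChart
  obtain ⟨φ', H', hφ'⟩ := Hg.exists_graphChart
  obtain ⟨a, b, ha, -, hexp⟩ := isChernMoserGraph_iff.1 hφ
  obtain ⟨a', b', ha', -, hexp'⟩ := isChernMoserGraph_iff.1 hφ'
  obtain ⟨Ω, hΩ, h0Ω, hs, hol, hle⟩ := eventually_graph_le H H' hF
  obtain ⟨-, -, -, -, -, -, hFp⟩ := hF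
  have hG0 : g (F (h.symm 0)) = 0 := by
    rw [H.isLocalBiholomorphism.symm_map_eq, hFp, H'.isLocalBiholomorphism.map_eq]
  have key := normalPart_eq_of_flat ha ha' H.contDiffAt H.map_zero hexp hexp' hs hG0 hΩ h0Ω hol
    hfl hle
  -- The equivalence is g⁻¹ ∘ h and not F, which need not be holomorphic in a full neighbourhood of
  -- p.
  refine H.areEquivalentToWeightedOrder hD hD' H' ((hexp.sub hexp').congr_left fun x => ?_)
  rw [key]
  ring

end EquivalenceOfGraphs

/-! ### A hypersurface tangent to a graph is itself a graph -/

section GraphOfTangent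

open Asymptotics Filter

variable {n : ℕ}

/-- A defining function of a domain vanishes on the boundary near the base point. -/
lemma IsDomainDefiningFunctionAt.eventually_eq_zero {D : Set (CSpace n)} {p : CSpace n}
    {ρ : CSpace n → ℝ} (hρ : IsDomainDefiningFunctionAt D p ρ) (hD : IsOpen D) :
    ∀ᶠ q in 𝓝 p, q ∈ frontier D → ρ q = 0 := by
  obtain ⟨U, hU, hpU, hsm, -, hiff⟩ := hρ
  filter_upwards [hU.mem_nhds hpU] with q hqU hq
  refine le_antisymm ?_ ?_
  · have h1 : (𝓝[D] q).NeBot := mem_closure_iff_nhdsWithin_neBot.1 (frontier_subset_closure hq)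
    have h2 : Tendsto ρ (𝓝[D] q) (𝓝 (ρ q)) :=
      ((hsm.contDiffAt (hU.mem_nhds hqU)).continuousAt).mono_left nhdsWithin_le_nhds
    refine le_of_tendsto h2 ?_
    filter_upwards [self_mem_nhdsWithin, mem_nhdsWithin_of_mem_nhds (hU.mem_nhds hqU)] with x h1 h2
    exact ((hiff x h2).1 h1).le
  · rw [← not_lt, ← hiff q hqU]
    rw [hD.frontier_eq] at hq
    exact hq.2

lemma eq_ofReal_add_im (y : CSpace n) :
    y = inclL n (toP y) + y.2.im • ((0 : EuclideanSpace ℂ (Fin n)), Complex.I) := by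
  refine Prod.ext ?_ ?_
  · simp [inclL_apply]
  · simp [inclL_apply, Complex.re_add_im]

lemma apply_eq_of_inclL_eq_zero {ℓ : CSpace n →L[ℝ] ℝ} (h : ∀ x, ℓ (inclL n x) = 0)
    (y : CSpace n) : ℓ y = ℓ (0, Complex.I) * y.2.im := by
  conv_lhs => rw [eq_ofReal_add_im y]
  rw [map_add, h, zero_add, map_smul, smul_eq_mul, mul_comm]

/-- A defining function of a graph in local coordinates. -/
lemma IsHypersurfaceDefiningFunctionAt.exists_bound {M : Set (CSpace n)} {p : CSpace n}
    {g : OpenPartialHomeomorph (CSpace n) (CSpace n)} {φ : ParamSpace n → ℝ}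
    {ρ : CSpace n → ℝ} (hρ : IsHypersurfaceDefiningFunctionAt M p ρ)
    (hg : IsLocalBiholomorphism g p 0) (hφ : ContDiffAt ℝ ∞ φ 0)
    (hφ0 : φ 0 = 0) (hφd : fderiv ℝ φ 0 = 0)
    (hM : ∀ᶠ q in 𝓝 p, (q ∈ M ↔ φ (toP (g q)) = (g q).2.im)) :
    ∃ c : ℝ, c ≠ 0 ∧ ContDiffAt ℝ ∞ (fun y => ρ (g.symm y)) 0 ∧
      (∀ y, fderiv ℝ (fun y => ρ (g.symm y)) 0 y = c * y.2.im) ∧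
      (fun y => y.2.im - φ (toP y)) =O[𝓝 0] fun y => ρ (g.symm y) := by
  obtain ⟨U, hU, hpU, hsm, hd, hiff⟩ := hρ
  have hρat := hsm.contDiffAt (hU.mem_nhds hpU)
  obtain ⟨L, -, hL⟩ := hg.exists_hasFDerivAt
  have hs : ContDiffAt ℝ ∞ (fun y => ρ (g.symm y)) 0 := by
    refine ContDiffAt.comp (0 : CSpace n) ?_ hg.symm.contDiffAt
    rwa [hg.symm_map_eq]
  have hfd : HasFDerivAt (fun y => ρ (g.symm y))
      ((fderiv ℝ ρ p).comp ((L.symm : CSpace n →L[ℂ] CSpace n).restrictScalars ℝ)) 0 := by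
    refine HasFDerivAt.comp (0 : CSpace n) ?_ (hL.restrictScalars ℝ)
    rw [hg.symm_map_eq]
    exact (hρat.differentiableAt (by simp)).hasFDerivAt
  have hgr0 := graphMap_zero hφ0
  have hgrt : Tendsto (graphMap φ) (𝓝 0) (𝓝 0) := by
    have := (contDiffAt_graphMap le_rfl hφ).continuousAt
    rwa [ContinuousAt, hgr0] at this
  have hzero : ∀ᶠ x in 𝓝 0, ρ (g.symm (graphMap φ x)) = 0 := by
    have ht := hg.symm.tendsto.comp hgrt
    filter_upwards [ht.eventually hM, ht.eventually (hU.mem_nhds hpU),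
      hgrt.eventually hg.eventually_right_inv] with x h1 h2 h3
    simp only [Function.comp_apply] at h1 h2
    rw [← hiff _ h2, h1, h3]
    simp
  have hincl : ∀ x, fderiv ℝ (fun y => ρ (g.symm y)) 0 (inclL n x) = 0 := by
    have h1 : HasFDerivAt (fun x => ρ (g.symm (graphMap φ x)))
        ((fderiv ℝ (fun y => ρ (g.symm y)) 0).comp (inclL n)) 0 := by
      refine HasFDerivAt.comp (g := fun y => ρ (g.symm y)) (0 : ParamSpace n) ?_
        (hasFDerivAt_graphMap (hφ.differentiableAt (by simp)) hφd)
      rw [hgr0]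
      exact hfd.differentiableAt.hasFDerivAt
    have h2 := h1.unique ((hasFDerivAt_const (0 : ℝ) (0 : ParamSpace n)).congr_of_eventuallyEq hzero)
    exact fun x => DFunLike.congr_fun h2 x
  have hc := apply_eq_of_inclL_eq_zero hincl
  set c := fderiv ℝ (fun y => ρ (g.symm y)) 0 (0, Complex.I)
  have hc0 : c ≠ 0 := by
    intro h0
    refine hd (ContinuousLinearMap.ext fun v => ?_)
    have h1 := hc (L v)
    rw [hfd.fderiv, h0, zero_mul] at h1
    simpa using h1
  refine ⟨c, hc0, hs, hc, IsBigO.of_bound (2 / |c|) ?_⟩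
  have hstrict := hs.hasStrictFDerivAt (by simp)
  have ht2 : Tendsto (fun y : CSpace n => (y, graphMap φ (toP y))) (𝓝 0)
      (𝓝 ((0 : CSpace n), (0 : CSpace n))) := by
    refine tendsto_id.prodMk_nhds (hgrt.comp ?_)
    have := continuous_toP.tendsto (0 : CSpace n)
    rwa [toP_zero] at this
  have htP : Tendsto toP (𝓝 (0 : CSpace n)) (𝓝 0) := by
    have := continuous_toP.tendsto (0 : CSpace n)
    rwa [toP_zero] at this
  -- The defining function vanishes at the graph point on the vertical line through y. Strict
  -- differentiability between the two points shows that its value at y is c times the vertical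
  -- distance, up to an error of half that size.
  have hb := (hstrict.isLittleO.comp_tendsto ht2).bound (half_pos (abs_pos.2 hc0))
  filter_upwards [hb, htP.eventually hzero] with y h1 h2
  have h3 : y - graphMap φ (toP y) =
      (y.2.im - φ (toP y)) • ((0 : EuclideanSpace ℂ (Fin n)), Complex.I) := by
    refine Prod.ext ?_ ?_
    · simp [graphMap_fst]
    · apply Complex.ext <;> simp [graphMap]
  have h4 : ‖((0 : EuclideanSpace ℂ (Fin n)), Complex.I)‖ = 1 := by simp [Prod.norm_def]
  simp only [Function.comp_apply, h2, sub_zero, h3, norm_smul, h4, mul_one, hc, Prod.smul_snd,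
    Complex.smul_im, smul_eq_mul, Complex.I_im] at h1
  set d := y.2.im - φ (toP y)
  rw [mul_comm c d] at h1
  have h5 : ‖d * c‖ ≤ ‖ρ (g.symm y)‖ + |c| / 2 * ‖d‖ := by
    calc ‖d * c‖ = ‖ρ (g.symm y) - (ρ (g.symm y) - d * c)‖ := by rw [sub_sub_cancel]
      _ ≤ _ := (norm_sub_le _ _).trans (by gcongr)
  rw [norm_mul, Real.norm_eq_abs c] at h5
  have h6 := abs_pos.2 hc0
  rw [div_mul_eq_mul_div, le_div_iff₀ h6]
  nlinarith

/-- An adapted parametrization in local coordinates whose tangent space is `Im w = 0`. -/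
lemma IsAdaptedParametrization.exists_fderiv {M : Set (CSpace n)} {p : CSpace n}
    {g : OpenPartialHomeomorph (CSpace n) (CSpace n)} {γ : ParamSpace n → CSpace n}
    (hγ : IsAdaptedParametrization M p γ) (hg : IsLocalBiholomorphism g p 0)
    (him : ∀ A : ParamSpace n →L[ℝ] CSpace n, HasFDerivAt (fun x => g (γ x)) A (0 : ParamSpace n) → ∀ x, (A x).2.im = 0) :
    ∃ A : ParamSpace n →L[ℝ] CSpace n, HasFDerivAt (fun x => g (γ x)) A (0 : ParamSpace n) ∧
      (∀ x, ∃ x', A x' = inclL n x) ∧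
      Function.Injective ((toPL n).comp A) ∧ ∀ z, ((toPL n).comp A (z, 0)).2 = 0 := by
  obtain ⟨V, hV, h0V, hs⟩ := hγ.smooth
  have hγd := ((hs.contDiffAt (hV.mem_nhds h0V)).differentiableAt (by simp)).hasFDerivAt
  obtain ⟨L, hL, -⟩ := hg.exists_hasFDerivAt
  let A := ((L : CSpace n →L[ℂ] CSpace n).restrictScalars ℝ).comp (fderiv ℝ γ 0)
  have hA : HasFDerivAt (fun x => g (γ x)) A (0 : ParamSpace n) := by
    refine HasFDerivAt.comp (0 : ParamSpace n) ?_ hγd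
    rw [hγ.map_zero]
    exact hL.restrictScalars ℝ
  have him' := him A hA
  have hAx : ∀ x, A x = L (fderiv ℝ γ 0 x) := fun x => rfl
  have hval : ∀ x, A x = inclL n (toP (A x)) := fun x => by
    conv_lhs => rw [eq_ofReal_add_im (A x), him', zero_smul, add_zero]
  have hinj : Function.Injective ((toPL n).comp A) := by
    intro x y hxy
    have h1 : toP (A x) = toP (A y) := hxy
    have h2 : A x = A y := by rw [hval x, hval y, h1]
    exact hγ.immersion (L.injective h2)
  refine ⟨A, hA, fun x => ?_, hinj, fun z => ?_⟩
  · obtain ⟨x', hx'⟩ := LinearMap.surjective_of_injective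
      (f := ((toPL n).comp A : ParamSpace n →ₗ[ℝ] ParamSpace n)) hinj x
    have hx'' : toP (A x') = x := hx'
    exact ⟨x', by rw [hval, hx'']⟩
  -- By adaptedness i times this vector is also tangent, hence has Im w = 0; so the vector itself
  -- has Re w = 0.
  · have h1 : fderiv ℝ γ 0 (z, 0) ∈ Set.range fun z => fderiv ℝ γ 0 (z, 0) := ⟨z, rfl⟩
    rw [hγ.adapted] at h1
    obtain ⟨-, ⟨x', hx'⟩⟩ := h1
    have h2 := him' x'
    rw [hAx, hx', map_smul] at h2
    simpa [toPL_apply, hAx] using h2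

/-- A domain whose boundary is tangent to a graph is locally a supergraph or a subgraph. -/
theorem exists_graph_of_tangent {D : Set (CSpace n)} (hD : IsOpen D) {p p' : CSpace n}
    {ρD : CSpace n → ℝ} (hρD : IsDomainDefiningFunctionAt D p ρD) (hp : p ∈ frontier D)
    {Φ g : OpenPartialHomeomorph (CSpace n) (CSpace n)} (hΦ : IsLocalBiholomorphism Φ p p')
    {D' : Set (CSpace n)} (hD' : IsOpen D') {φ' : ParamSpace n → ℝ} (H' : IsGraphChart D' p' g φ')
    {k : ℕ} (hk : 2 ≤ k)
    (htan : IsTangentToWeightedOrder k (Φ '' (Φ.source ∩ frontier D)) (frontier D') p') :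
    ∃ φ : ParamSpace n → ℝ, (∃ V : Set (ParamSpace n), IsOpen V ∧ (0 : ParamSpace n) ∈ V ∧
      ContDiffOn ℝ ∞ φ V) ∧ φ 0 = 0 ∧ fderiv ℝ φ 0 = 0 ∧
      ((fun x => φ x - φ' x) =o[𝓝 0] fun x => wnorm x ^ k) ∧
      ((∀ᶠ y in 𝓝 0, ((Φ.trans g).symm y ∈ D ↔ φ (toP y) < y.2.im)) ∨
        ∀ᶠ y in 𝓝 0, ((Φ.trans g).symm y ∈ D ↔ y.2.im < φ (toP y))) := by
  obtain ⟨ρ, γ, hρ, hγ, hvan⟩ := htan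
  have hg := H'.isLocalBiholomorphism
  have hh := hΦ.trans hg
  have hM' : ∀ᶠ q in 𝓝 p', (q ∈ frontier D' ↔ φ' (toP (g q)) = (g q).2.im) := by
    filter_upwards [hg.tendsto.eventually (H'.eventually_mem_frontier hD'),
      hg.eventually_left_inv] with q h1 h2
    rwa [h2] at h1
  obtain ⟨c', hc', hρs, hρd, hρO⟩ := hρ.exists_bound hg H'.contDiffAt H'.map_zero H'.fderiv_zero hM'
  have hγt : Tendsto γ (𝓝 0) (𝓝[Φ '' (Φ.source ∩ frontier D)] p') := hγ.onto_germ.le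
  have hγt' : Tendsto γ (𝓝 0) (𝓝 p') := tendsto_nhdsWithin_iff.1 hγt |>.1
  have hgγ : Tendsto (fun x => g (γ x)) (𝓝 0) (𝓝 0) := hg.tendsto.comp hγt'
  have hvan' : (fun x => ρ (g.symm (g (γ x)))) =o[𝓝 0] fun x => wnorm x ^ k := by
    refine IsLittleO.congr' (f₁ := fun x => ρ (γ x)) hvan ?_ EventuallyEq.rfl
    filter_upwards [hγt'.eventually hg.eventually_left_inv] with x hx
    rw [hx]
  have hgγ0 : g (γ 0) = 0 := by rw [hγ.map_zero, hg.map_eq]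
  -- As k ≥ 2, the function ρ ∘ γ vanishes to first order; the derivative of ρ in the coordinates is
  -- a nonzero multiple of Im w, so the tangent space lies in Im w = 0.
  have him : ∀ A : ParamSpace n →L[ℝ] CSpace n, HasFDerivAt (fun x => g (γ x)) A (0 : ParamSpace n) → ∀ x, (A x).2.im = 0 := by
    intro A hA x
    have h1 : HasFDerivAt (fun x => ρ (g.symm (g (γ x))))
        ((fderiv ℝ (fun y => ρ (g.symm y)) 0).comp A) (0 : ParamSpace n) := by
      refine HasFDerivAt.comp (g := fun y => ρ (g.symm y)) (0 : ParamSpace n) ?_ hA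
      rw [hgγ0]
      exact (hρs.differentiableAt (by simp)).hasFDerivAt
    have h2 := isLittleO_norm_of_wnorm hk hvan'
    have h3 : ρ (g.symm (g (γ 0))) = 0 := by simpa using (h2.bound one_pos).self_of_nhds
    have h4 : HasFDerivAt (fun x => ρ (g.symm (g (γ x)))) (0 : ParamSpace n →L[ℝ] ℝ) 0 := by
      refine HasFDerivAt.of_isLittleO ?_
      simpa [h3] using h2.of_norm_right
    have h5 := DFunLike.congr_fun (h1.unique h4) x
    simp only [ContinuousLinearMap.comp_apply, hρd, zero_apply] at h5
    exact (mul_eq_zero.1 h5).resolve_left hc'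
  obtain ⟨A, hA, hAsurj, hAinj, hAT⟩ := hγ.exists_fderiv hg him
  -- the defining function of `D` in the coordinates
  let σ : CSpace n → ℝ := fun y => ρD ((Φ.trans g).symm y)
  have hev0 := hρD.eventually_eq_zero hD
  have hρp := hev0.self_of_nhds hp
  obtain ⟨U, hU, hpU, hsm, hd, hiff⟩ := hρD
  obtain ⟨L, -, hL⟩ := hh.exists_hasFDerivAt
  have hσd : HasFDerivAt σ
      ((fderiv ℝ ρD p).comp ((L.symm : CSpace n →L[ℂ] CSpace n).restrictScalars ℝ)) 0 := by
    refine HasFDerivAt.comp (0 : CSpace n) ?_ (hL.restrictScalars ℝ)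
    rw [hh.symm_map_eq]
    exact ((hsm.contDiffAt (hU.mem_nhds hpU)).differentiableAt (by simp)).hasFDerivAt
  have hσγ : ∀ᶠ x in 𝓝 0, σ (g (γ x)) = 0 := by
    have hΦγ : Tendsto (fun x => Φ.symm (γ x)) (𝓝 0) (𝓝 p) := hΦ.symm.tendsto.comp hγt'
    filter_upwards [(tendsto_nhdsWithin_iff.1 hγt).2, hγt'.eventually hg.eventually_left_inv,
      hΦγ.eventually hev0] with x h1 h2 h3
    obtain ⟨q, ⟨hq1, hq2⟩, hq3⟩ := h1
    have h4 : (Φ.trans g).symm (g (γ x)) = q := by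
      rw [OpenPartialHomeomorph.coe_trans_symm, Function.comp_apply, h2, ← hq3, Φ.left_inv hq1]
    have h5 : Φ.symm (γ x) = q := by rw [← hq3, Φ.left_inv hq1]
    rw [h5] at h3
    change ρD _ = 0
    rw [h4, h3 hq2]
  have hincl : ∀ x, fderiv ℝ σ 0 (inclL n x) = 0 := by
    intro x
    have h1 : HasFDerivAt (fun x => σ (g (γ x))) ((fderiv ℝ σ 0).comp A) (0 : ParamSpace n) := by
      refine HasFDerivAt.comp (g := σ) (0 : ParamSpace n) ?_ hA
      rw [hgγ0]
      exact hσd.differentiableAt.hasFDerivAt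
    have h2 := h1.unique ((hasFDerivAt_const (0 : ℝ) (0 : ParamSpace n)).congr_of_eventuallyEq hσγ)
    obtain ⟨x', hx'⟩ := hAsurj x
    rw [← hx']
    exact DFunLike.congr_fun h2 x'
  have hc := apply_eq_of_inclL_eq_zero hincl
  set c := fderiv ℝ σ 0 (0, Complex.I)
  have hc0 : c ≠ 0 := by
    intro h0
    refine hd (ContinuousLinearMap.ext fun v => ?_)
    have h1 := hc (L v)
    rw [hσd.fderiv, h0, zero_mul] at h1
    simpa using h1
  have hcont : ContinuousOn (Φ.trans g).symm (Φ.trans g).target := (Φ.trans g).continuousOn_symm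
  have hW : IsOpen ((Φ.trans g).target ∩ (Φ.trans g).symm ⁻¹' U) :=
    hcont.isOpen_inter_preimage (Φ.trans g).open_target hU
  have h0W : (0 : CSpace n) ∈ (Φ.trans g).target ∩ (Φ.trans g).symm ⁻¹' U :=
    ⟨hh.mem_target, by rw [Set.mem_preimage, hh.symm_map_eq]; exact hpU⟩
  have hσs : ContDiffOn ℝ ∞ σ ((Φ.trans g).target ∩ (Φ.trans g).symm ⁻¹' U) :=
    hsm.comp (hh.symm.contDiffOn.mono Set.inter_subset_left) fun y hy => hy.2
  have hσ0 : σ 0 = 0 := by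
    change ρD _ = 0
    rw [hh.symm_map_eq, hρp]
  have hDσ : ∀ᶠ y in 𝓝 0, ((Φ.trans g).symm y ∈ D ↔ σ y < 0) := by
    filter_upwards [hW.mem_nhds h0W] with y hy
    exact hiff _ hy.2
  -- comparison of the two graphs
  have hcomp : ∀ φ : ParamSpace n → ℝ, (∀ᶠ y in 𝓝 0, σ y = 0 → φ (toP y) = y.2.im) →
      (fun x => φ x - φ' x) =o[𝓝 0] fun x => wnorm x ^ k := by
    intro φ hφ
    obtain ⟨V, hV, h0V, hγs⟩ := hγ.smooth
    have hχs : ContDiffAt ℝ 2 (fun x => toP (g (γ x))) 0 := by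
      refine contDiffAt_infty.1 (contDiff_toP.contDiffAt.comp (0 : ParamSpace n) ?_) 2
      refine ContDiffAt.comp (0 : ParamSpace n) ?_ (hγs.contDiffAt (hV.mem_nhds h0V))
      rw [hγ.map_zero]
      exact hg.contDiffAt
    have hχd : HasFDerivAt (fun x => toP (g (γ x))) ((toPL n).comp A) (0 : ParamSpace n) :=
      (hasFDerivAt_toP _).comp (0 : ParamSpace n) hA
    refine isLittleO_of_comp (χ := fun x => toP (g (γ x))) hχs (by simp only [hgγ0, toP_zero])
      (by rwa [hχd.fderiv]) (by rwa [hχd.fderiv]) ?_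
    refine ((hρO.comp_tendsto hgγ).trans_isLittleO hvan').congr' ?_ EventuallyEq.rfl
    filter_upwards [hσγ, hgγ.eventually hφ] with x h1 h2
    simp only [Function.comp_apply]
    rw [h2 h1]
  -- Tangency of boundaries carries no orientation: the sign of c decides whether D lies above or
  -- below.
  rcases lt_or_gt_of_ne hc0 with hneg | hpos
  · obtain ⟨V, φ, hV, h0V, hφs, hφ0, hφd, hev⟩ := exists_graph hW h0W hσs hσ0 (neg_pos.2 hneg)
      (fun y => by rw [hc y]; ring)
    refine ⟨φ, ⟨V, hV, h0V, hφs⟩, hφ0, hφd, hcomp φ ?_, Or.inl ?_⟩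
    · filter_upwards [hev] with y hy h
      exact hy.2.1 h
    · filter_upwards [hev, hDσ] with y h1 h2
      rw [h2, h1.1]
  · obtain ⟨V, φ, hV, h0V, hφs, hφ0, hφd, hev⟩ := exists_graph (σ := fun y => -σ y) hW h0W hσs.neg
      (by rw [hσ0, neg_zero]) hpos (fun y => by
        have : HasFDerivAt (fun y => -σ y) (-fderiv ℝ σ 0) 0 :=
          hσd.differentiableAt.hasFDerivAt.neg
        rw [this.fderiv, neg_apply, hc y])
    refine ⟨φ, ⟨V, hV, h0V, hφs⟩, hφ0, hφd, hcomp φ ?_, Or.inr ?_⟩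
    · filter_upwards [hev] with y hy h
      exact hy.2.1 (by rw [h, neg_zero])
    · filter_upwards [hev, hDσ] with y h1 h2
      rw [h2]
      have h3 := h1.1
      have h4 := h1.2
      rw [neg_lt_zero] at h3
      rw [neg_eq_zero] at h4
      constructor
      · intro h
        rcases lt_trichotomy y.2.im (φ (toP y)) with h5 | h5 | h5
        · exact h5
        · exact absurd (h4.2 h5.symm) h.ne
        · exact absurd (h3.2 h5) h.not_gt
      · intro h
        rcases lt_trichotomy (σ y) 0 with h5 | h5 | h5
        · exact h5
        · exact absurd (h4.1 h5) h.ne'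
        · exact absurd (h3.1 h5) h.not_gt

end GraphOfTangent

/-! ### Strong pseudoconvexity determines the side -/

section Orientation

open Asymptotics Filter

variable {n : ℕ}

lemma add_sq_sqrt_le (z : EuclideanSpace ℂ (Fin n)) (u : ℝ) :
    wnorm ((z, u) : ParamSpace n) ^ 2 ≤ 2 * (‖z‖ ^ 2 + |u|) := by
  have h := Real.sq_sqrt (abs_nonneg u)
  simp only [wnorm]
  nlinarith [sq_nonneg (‖z‖ - √|u|)]

/-- A strongly pseudoconvex domain is not the subgraph of a strictly convex function. -/
theorem not_eventually_subgraph (hn : 1 ≤ n) {D : Set (CSpace n)} (hD : IsOpen D) {p : CSpace n}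
    (hp : p ∈ frontier D) (hpsc : IsStronglyPseudoconvexAt D p)
    {h : OpenPartialHomeomorph (CSpace n) (CSpace n)} (hh : IsLocalBiholomorphism h p 0)
    {φ : ParamSpace n → ℝ} (hφ : (fun x => φ x - ‖x.1‖ ^ 2) =o[𝓝 0] fun x => wnorm x ^ 2) :
    ¬ ∀ᶠ y in 𝓝 0, (h.symm y ∈ D ↔ y.2.im < φ (toP y)) := by
  intro hev
  obtain ⟨g, ψ, H, hψ⟩ := exists_graphChart_two hD hp hpsc
  have hg := H.isLocalBiholomorphism
  -- The hypothesis n ≥ 1 provides a complex tangent direction, and with it the disc ζ ↦ (ζe, 0).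
  let e : EuclideanSpace ℂ (Fin n) := EuclideanSpace.single ⟨0, hn⟩ 1
  have he : ‖e‖ = 1 := by simp [e]
  let d : ℂ → CSpace n := fun ζ => (ζ • e, 0)
  have hdd : Differentiable ℂ d := by
    have : Differentiable ℂ fun ζ : ℂ => ζ • e := differentiable_id.smul_const e
    exact this.prodMk (differentiable_const _)
  have hd0 : d 0 = 0 := by simp [d]
  have hdt : Tendsto d (𝓝 0) (𝓝 0) := by
    have := hdd.continuous.tendsto 0
    rwa [hd0] at this
  have hP : Tendsto toP (𝓝 (0 : CSpace n)) (𝓝 0) := by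
    have := continuous_toP.tendsto (0 : CSpace n)
    rwa [toP_zero] at this
  have hsymm : Tendsto (fun ζ => h.symm (d ζ)) (𝓝 0) (𝓝 p) := hh.symm.tendsto.comp hdt
  have hf : Tendsto (fun ζ => g (h.symm (d ζ))) (𝓝 0) (𝓝 0) := hg.tendsto.comp hsymm
  let F : ℂ → ℂ := fun ζ => (g (h.symm (d ζ))).2
  have hF0 : F 0 = 0 := by
    simp only [F, hd0, hh.symm_map_eq, hg.map_eq, Prod.snd_zero]
  have hFan : AnalyticAt ℂ F 0 := by
    have h1 : ∀ᶠ ζ in 𝓝 0, DifferentiableAt ℂ F ζ := by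
      filter_upwards [hdt.eventually hh.symm.source_mem, hsymm.eventually hg.source_mem] with ζ h1 h2
      refine DifferentiableAt.snd ?_
      refine DifferentiableAt.comp ζ
        (hg.holomorphic.differentiableAt (g.open_source.mem_nhds h2)) ?_
      exact DifferentiableAt.comp ζ
        (hh.holomorphic_symm.differentiableAt (h.open_target.mem_nhds h1)) (hdd ζ)
    exact DifferentiableOn.analyticAt (fun ζ hζ => DifferentiableAt.differentiableWithinAt hζ) h1
  -- Below a graph that is positive on the punctured disc, the disc minus its centre lies in D. In
  -- the chart g, points of D satisfy Im w > ψ ≥ ‖z‖² − wnorm²/4 ≥ −|Re w|/2.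
  have hmain : ∀ᶠ ζ in 𝓝 0, ζ ≠ 0 → -(|(F ζ).re| / 2) < (F ζ).im := by
    filter_upwards [hdt.eventually hev, (hP.comp hdt).eventually (hφ.bound one_half_pos),
      (hP.comp hf).eventually (hψ.bound (show (0 : ℝ) < 1 / 4 by norm_num)),
      hf.eventually H.eventually_mem, hsymm.eventually hg.eventually_left_inv]
      with ζ h1 h2 h3 h4 h5 hζ
    have hpos : 0 < ‖ζ‖ := norm_pos_iff.2 hζ
    have h6 : h.symm (d ζ) ∈ D := by
      rw [h1]
      have h7 : wnorm (toP (d ζ)) = ‖ζ‖ := by simp [wnorm, toP, d, norm_smul, he]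
      have h8 : ‖(toP (d ζ)).1‖ = ‖ζ‖ := by simp [toP, d, norm_smul, he]
      simp only [Function.comp_apply, h7, h8, norm_pow, Real.norm_eq_abs, abs_norm] at h2
      have h9 := (abs_le.1 h2).1
      have h10 : (d ζ).2.im = 0 := by simp [d]
      rw [h10]
      have h11 := pow_pos hpos 2
      linarith
    rw [h5] at h4
    have h7 := h4.1 h6
    simp only [Function.comp_apply, Real.norm_eq_abs] at h3
    have h8 := (abs_le.1 h3).1
    have h9 := add_sq_sqrt_le (toP (g (h.symm (d ζ)))).1 (toP (g (h.symm (d ζ)))).2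
    rw [Prod.mk.eta, toP_snd] at h9
    rw [abs_of_nonneg (sq_nonneg _)] at h8
    have h10 := sq_nonneg ‖(toP (g (h.symm (d ζ)))).1‖
    change -(|(g (h.symm (d ζ))).2.re| / 2) < (g (h.symm (d ζ))).2.im
    linarith
  -- If F is constant it is 0, against the strict inequality; if it is open it attains −it for small
  -- t > 0, which violates the inequality too.
  rcases hFan.eventually_constant_or_nhds_le_map_nhds with hconst | hopen
  · have h1 : ∀ᶠ ζ in 𝓝[≠] (0 : ℂ), False := by
      filter_upwards [self_mem_nhdsWithin, mem_nhdsWithin_of_mem_nhds hmain,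
        mem_nhdsWithin_of_mem_nhds hconst] with ζ k1 k2 k3
      have k4 := k2 k1
      rw [k3, hF0] at k4
      simp at k4
    exact h1.exists.elim fun _ => id
  · rw [hF0] at hopen
    have h1 : {w : ℂ | w = 0 ∨ -(|w.re| / 2) < w.im} ∈ map F (𝓝 0) := by
      rw [mem_map]
      filter_upwards [hmain] with ζ hζ
      rcases eq_or_ne ζ 0 with h0 | h0
      · exact Or.inl (by rw [h0, hF0])
      · exact Or.inr (hζ h0)
    have h2 : Tendsto (fun t : ℝ => -(t * Complex.I)) (𝓝[>] 0) (𝓝 0) := by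
      have : Continuous fun t : ℝ => -(t * Complex.I) := by fun_prop
      simpa using (this.tendsto 0).mono_left (nhdsWithin_le_nhds (s := Set.Ioi (0 : ℝ)))
    have h3 : ∀ᶠ t : ℝ in 𝓝[>] 0, False := by
      filter_upwards [self_mem_nhdsWithin, h2.eventually (hopen h1)] with t ht k
      have ht' : (0 : ℝ) < t := ht
      rcases k with k | k
      · simp [ht'.ne'] at k
      · simp at k
        linarith
    exact h3.exists.elim fun _ => id

/-- Domains whose boundaries are equivalent up to weighted order `5` admit normal coordinates
in which they are graphs that agree up to weighted order `5`. -/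
theorem exists_graphCharts_of_equivalent (hn : 1 ≤ n) {D D' : Set (CSpace n)} {p p' : CSpace n}
    (hD : IsOpen D) (hD' : IsOpen D') (hp : p ∈ frontier D) (hp' : p' ∈ frontier D')
    (hpsc : IsStronglyPseudoconvexAt D p) (hpsc' : IsStronglyPseudoconvexAt D' p')
    (heq : AreEquivalentToWeightedOrder 5 (frontier D) (frontier D') p p') :
    ∃ h φ g φ' a b, IsGraphChart D p h φ ∧ IsGraphChart D' p' g φ' ∧
      IsNormal22 a ∧ IsNormal32 b ∧
      ((fun x => φ x - (‖x.1‖ ^ 2 + normalPart a b x.1)) =o[𝓝 0] fun x => wnorm x ^ 5) ∧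
      (fun x => φ' x - (‖x.1‖ ^ 2 + normalPart a b x.1)) =o[𝓝 0] fun x => wnorm x ^ 5 := by
  -- Only D' is normalized; the chart of D is g ∘ Φ, so its graph inherits the same normal part.
  obtain ⟨g, φ', H', hCM⟩ := exists_normalChart hD' hp' hpsc'
  obtain ⟨a, b, ha, hb, hexp'⟩ := isChernMoserGraph_iff.1 hCM
  obtain ⟨Φ, hΦ, htan⟩ := heq
  obtain ⟨ρ, hρ, -⟩ := id hpsc
  obtain ⟨φ, hφs, hφ0, hφd, hcomp, hev⟩ :=
    exists_graph_of_tangent hD hρ hp hΦ hD' H' (by norm_num) htan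
  have hexp : (fun x => φ x - (‖x.1‖ ^ 2 + normalPart a b x.1)) =o[𝓝 0] fun x => wnorm x ^ 5 :=
    (hcomp.add hexp').congr_left fun x => by ring
  have hh := hΦ.trans H'.isLocalBiholomorphism
  have hev' := hev.resolve_right (not_eventually_subgraph hn hD hp hpsc hh
    ((sub_isLittleO_of_normal hexp).trans_isBigO (wnorm_pow_isBigO (by norm_num))))
  exact ⟨Φ.trans g, φ, g, φ', a, b, ⟨hh, hφs, hφ0, hφd, hev'⟩, H', ha, hb, hexp, hexp'⟩

end Orientation

/-! ### Functions that vanish to weighted order five -/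

section HighOrder

open Asymptotics Filter

variable {n : ℕ}

/-- The derivative of a smooth function that vanishes to third order vanishes to second order. -/
lemma fderiv_isBigO_of_isBigO {X : Type*} [NormedAddCommGroup X] [NormedSpace ℝ X] {f : X → ℝ}
    (hf : ContDiffAt ℝ ∞ f 0) (h : f =O[𝓝 0] fun x => ‖x‖ ^ 3) :
    fderiv ℝ f =O[𝓝 0] fun x => ‖x‖ ^ 2 := by
  have hf0 : f 0 = 0 := by
    obtain ⟨C, hC⟩ := h.bound
    simpa using hC.self_of_nhds
  have hpow : ∀ k l : ℕ, k < l → (fun x : X => ‖x‖ ^ l) =o[𝓝 0] fun x => ‖x‖ ^ k := by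
    intro k l hkl
    exact (isLittleO_pow_pow (𝕜 := ℝ) hkl).comp_tendsto tendsto_norm_zero
  have h1 : fderiv ℝ f 0 = 0 := by
    have h2 : HasFDerivAt f (0 : X →L[ℝ] ℝ) 0 := by
      refine HasFDerivAt.of_isLittleO ?_
      have h3 := h.trans_isLittleO (hpow 1 3 (by norm_num))
      simp only [pow_one] at h3
      simpa [hf0] using h3.of_norm_right
    exact h2.fderiv
  -- The quadratic Taylor term is homogeneous of degree 2 and o(‖x‖²), hence zero; polarization then
  -- gives the full second derivative.
  have hquad : ∀ v, fderiv ℝ (fderiv ℝ f) 0 v v = 0 := by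
    intro v
    have h2 := taylor_isBigO (N := 2) (contDiffAt_infty.1 hf 3)
    have h3 : (fun x => fderiv ℝ (fderiv ℝ f) 0 x x) =o[𝓝 0] fun x => ‖x‖ ^ 2 := by
      refine ((h.sub h2).const_mul_left 2).trans_isLittleO (hpow 2 3 (by norm_num)) |>.congr_left
        fun x => ?_
      simp only [Finset.sum_range_succ, Finset.range_zero, Finset.sum_empty,
        iteratedFDeriv_zero_apply, iteratedFDeriv_one_apply, iteratedFDeriv_two_apply, hf0, h1]
      simp
    have h4 : Tendsto (fun t : ℝ => t • v) (𝓝[≠] 0) (𝓝 0) := by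
      have : Continuous fun t : ℝ => t • v := by fun_prop
      simpa using (this.tendsto 0).mono_left nhdsWithin_le_nhds
    have h5 : (fun _ : ℝ => fderiv ℝ (fderiv ℝ f) 0 v v) =o[𝓝[≠] 0] fun _ => (1 : ℝ) := by
      have h6 := h3.comp_tendsto h4
      have h7 : (fun t : ℝ => ‖t • v‖ ^ 2) =O[𝓝[≠] 0] fun t => t ^ 2 :=
        IsBigO.of_bound (‖v‖ ^ 2) (Eventually.of_forall fun t => by
          simp [norm_smul, mul_pow, mul_comm])
      have h8 := (isBigO_refl (fun t : ℝ => (t ^ 2)⁻¹) (𝓝[≠] 0)).mul_isLittleO (h6.trans_isBigO h7)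
      refine h8.congr' ?_ ?_
      · filter_upwards [self_mem_nhdsWithin] with t ht
        have ht' : t ≠ 0 := ht
        simp
        field_simp
      · filter_upwards [self_mem_nhdsWithin] with t ht
        have ht' : t ≠ 0 := ht
        field_simp
    have h9 := (isLittleO_one_iff ℝ).1 h5
    exact tendsto_nhds_unique tendsto_const_nhds h9
  have hsymm : IsSymmSndFDerivAt ℝ f 0 := (contDiffAt_infty.1 hf 2).isSymmSndFDerivAt (by simp)
  have hzero : fderiv ℝ (fderiv ℝ f) 0 = 0 := by
    ext v w
    have h2 := hquad (v + w)
    have h3 := hsymm.eq v w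
    simp only [map_add, add_apply, hquad] at h2
    simp only [zero_apply]
    linarith
  have hd : ContDiffAt ℝ 2 (fderiv ℝ f) 0 := (contDiffAt_infty.1 hf 3).fderiv_right (m := 2) (by
    norm_num)
  refine (sub_fderiv_isBigO hd).congr_left fun x => ?_
  simp [h1, hzero]

/-- Increments of a smooth function that vanishes to third order. -/
lemma exists_sub_le_of_isBigO {X : Type*} [NormedAddCommGroup X] [NormedSpace ℝ X] {f : X → ℝ}
    (hf : ContDiffAt ℝ ∞ f 0) (h : f =O[𝓝 0] fun x => ‖x‖ ^ 3) :
    ∃ C : ℝ, 0 ≤ C ∧ ∃ ε : ℝ, 0 < ε ∧ ∀ r < ε, ∀ x x', ‖x‖ ≤ r → ‖x'‖ ≤ r →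
      |f x' - f x| ≤ C * r ^ 2 * ‖x' - x‖ := by
  obtain ⟨C, hC, hb⟩ := (fderiv_isBigO_of_isBigO hf h).exists_nonneg
  have hdiff : ∀ᶠ x in 𝓝 0, DifferentiableAt ℝ f x := by
    filter_upwards [(contDiffAt_infty.1 hf 1).eventually (by simp)] with x hx
    exact hx.differentiableAt (by simp)
  obtain ⟨ε, hε, hball⟩ := Metric.eventually_nhds_iff_ball.1 (hb.bound.and hdiff)
  refine ⟨C, hC, ε, hε, fun r hr x x' hx hx' => ?_⟩
  have hmem : ∀ y ∈ Metric.closedBall (0 : X) r, y ∈ Metric.ball (0 : X) ε := fun y hy =>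
    Metric.closedBall_subset_ball hr hy
  have key := (convex_closedBall (0 : X) r).norm_image_sub_le_of_norm_fderiv_le (𝕜 := ℝ)
    (f := f) (C := C * r ^ 2) (fun y hy => (hball y (hmem y hy)).2) (fun y hy => by
      refine ((hball y (hmem y hy)).1).trans ?_
      rw [norm_pow, norm_norm]
      have := mem_closedBall_zero_iff.1 hy
      gcongr)
    (mem_closedBall_zero_iff.2 hx) (mem_closedBall_zero_iff.2 hx')
  exact key

/-- The terms of weight at least `6` other than `u³` are dominated by this function. -/
noncomputable def sexticBound (x : ParamSpace n) : ℝ :=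
  ‖x.1‖ ^ 6 + ‖x.1‖ ^ 2 * x.2 ^ 2 + x.2 ^ 4

lemma sexticBound_nonneg (x : ParamSpace n) : 0 ≤ sexticBound x := by
  have h4 : 0 ≤ x.2 ^ 4 := by positivity
  have h2 : 0 ≤ ‖x.1‖ ^ 2 * x.2 ^ 2 := by positivity
  have h6 : 0 ≤ ‖x.1‖ ^ 6 := by positivity
  simp only [sexticBound]
  linarith

/-- Monomials that are not multiples of one of the three terms are handled by 2r⁴t ≤ r⁶ + r²t² and
2rt³ ≤ r²t² + t⁴. The excluded monomial t³ is not bounded at r = 0. -/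
lemma monomial_le_sextic {r t : ℝ} (hr : 0 ≤ r) (hr1 : r ≤ 1) (ht : 0 ≤ t) (ht1 : t ≤ 1) {k c : ℕ}
    (h : 5 < k + 2 * c) (h' : ¬ (k = 0 ∧ c = 3)) :
    r ^ k * t ^ c ≤ r ^ 6 + r ^ 2 * t ^ 2 + t ^ 4 := by
  have hrp : ∀ {k l : ℕ}, k ≤ l → r ^ l ≤ r ^ k := fun hkl => pow_le_pow_of_le_one hr hr1 hkl
  have h4 : 0 ≤ t ^ 4 := by positivity
  have h2 : 0 ≤ r ^ 2 * t ^ 2 := by positivity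
  have h6 : 0 ≤ r ^ 6 := by positivity
  rcases Nat.lt_or_ge 3 c with hc | hc
  · have h1 : r ^ k * t ^ c ≤ 1 * t ^ 4 :=
      mul_le_mul (pow_le_one₀ hr hr1) (pow_le_pow_of_le_one ht ht1 hc) (by positivity) zero_le_one
    linarith
  · interval_cases c
    · have h1 := hrp (show 6 ≤ k by omega)
      linarith
    · have h1 : r ^ k * t ^ 1 ≤ r ^ 4 * t ^ 1 := by gcongr ?_ * _; exact hrp (by omega)
      nlinarith [sq_nonneg (r ^ 3 - r * t)]
    · have h1 : r ^ k * t ^ 2 ≤ r ^ 2 * t ^ 2 := by gcongr ?_ * _; exact hrp (by omega)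
      linarith
    · have h1 : r ^ k * t ^ 3 ≤ r ^ 1 * t ^ 3 := by gcongr ?_ * _; exact hrp (by omega)
      nlinarith [sq_nonneg (t ^ 2 - r * t)]

lemma monomial_isBigO_sexticBound {k c : ℕ} (h : 5 < k + 2 * c) (h' : ¬ (k = 0 ∧ c = 3)) :
    (fun x : ParamSpace n => ‖x.1‖ ^ k * |x.2| ^ c) =O[𝓝 0] sexticBound := by
  refine IsBigO.of_bound 1 ?_
  filter_upwards [Metric.closedBall_mem_nhds (0 : ParamSpace n) one_pos] with x hx
  rw [mem_closedBall_zero_iff] at hx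
  have h1 : ‖x.1‖ ≤ 1 := (norm_fst_le x).trans hx
  have h2 : |x.2| ≤ 1 := (norm_snd_le x).trans hx
  have h3 := monomial_le_sextic (norm_nonneg x.1) h1 (abs_nonneg x.2) h2 h h'
  rw [sq_abs, show |x.2| ^ 4 = x.2 ^ 4 from Even.pow_abs (by decide) _] at h3
  rw [Real.norm_of_nonneg (by positivity), Real.norm_of_nonneg (sexticBound_nonneg x), one_mul]
  exact h3

lemma triSpan_zero_zero {c : ℕ} {f : ParamSpace n → ℂ} (hf : f ∈ triSpan n (0, 0, c))
    (x : ParamSpace n) : f x = f (0, 1) * (x.2 : ℂ) ^ c := by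
  refine Submodule.span_induction (p := fun f _ => f x = f (0, 1) * (x.2 : ℂ) ^ c)
    ?_ ?_ ?_ ?_ hf
  · rintro _ ⟨st, rfl⟩
    simp
  · simp
  · intro f g _ _ h1 h2
    simp only [Pi.add_apply, h1, h2, add_mul]
  · intro a f _ h1
    simp only [Pi.smul_apply, h1, smul_eq_mul, mul_assoc]

/-- A smooth function that vanishes up to weighted order `5`. -/
lemma exists_sub_cube_isBigO {E : ParamSpace n → ℝ} (hE : ContDiffAt ℝ ∞ E 0)
    (h : E =o[𝓝 0] fun x => wnorm x ^ 5) :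
    ∃ e : ℝ, (fun x => E x - e * x.2 ^ 3) =O[𝓝 0] sexticBound := by
  obtain ⟨q, hq, hexp⟩ := exists_weighted_expansion hE le_rfl h
  -- The coefficient of u³, read off at the point (0, 1).
  refine ⟨(q (0, 0, 3) (0, 1)).re, ?_⟩
  have hrem : (fun x : ParamSpace n => ‖x‖ ^ 6) =O[𝓝 0] sexticBound := by
    have h1 := (monomial_isBigO_sexticBound (n := n) (k := 6) (c := 0) (by norm_num)
      (by norm_num)).add (monomial_isBigO_sexticBound (n := n) (k := 0) (c := 6) (by norm_num)
      (by norm_num))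
    refine (IsBigO.of_bound 1 (Eventually.of_forall fun x => ?_)).trans h1
    have h2 : 0 ≤ ‖x.1‖ ^ 6 := by positivity
    have h3 : 0 ≤ |x.2| ^ 6 := by positivity
    rw [one_mul, norm_pow, norm_norm, pow_zero, pow_zero, mul_one, one_mul,
      Real.norm_of_nonneg (by linarith), Prod.norm_def, Real.norm_eq_abs]
    rcases max_cases ‖x.1‖ |x.2| with h | h <;> rw [h.1] <;> linarith
  have hmem : (0, 0, 3) ∈ lowIdx.filter (fun i => 5 < wt i)  :=
    Finset.mem_filter.2 ⟨mem_lowIdx.2 (by norm_num), by norm_num [wt]⟩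
  have hsum : (fun x => ∑ i ∈ (lowIdx.filter (fun i => 5 < wt i)).erase (0, 0, 3), (q i x).re)
      =O[𝓝 0] sexticBound := by
    refine IsBigO.fun_sum fun i hi => ?_
    rw [Finset.mem_erase, Finset.mem_filter] at hi
    obtain ⟨C, hC, hb⟩ := triSpan_bound (hq i)
    refine (IsBigO.of_bound C (Eventually.of_forall fun x => ?_)).trans
      (monomial_isBigO_sexticBound (n := n) (k := i.1 + i.2.1) (c := i.2.2) hi.2.2 ?_)
    · rw [Real.norm_of_nonneg (by positivity : 0 ≤ ‖x.1‖ ^ (i.1 + i.2.1) * |x.2| ^ i.2.2)]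
      exact (Complex.abs_re_le_norm _).trans (hb x)
    · rintro ⟨h1, h2⟩
      refine hi.1 (Prod.ext (by simp only; omega) (Prod.ext (by simp only; omega) h2))
  refine ((hexp.trans hrem).add hsum).congr_left fun x => ?_
  rw [← Finset.add_sum_erase _ _ hmem]
  have h1 : (q (0, 0, 3) x).re = (q (0, 0, 3) (0, 1)).re * x.2 ^ 3 := by
    rw [triSpan_zero_zero (hq (0, 0, 3)) x, ← Complex.ofReal_pow, Complex.re_mul_ofReal]
  rw [h1]
  ring

lemma sexticBound_isBigO : (sexticBound (n := n)) =O[𝓝 0] fun x => ‖x‖ ^ 3 := by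
  refine IsBigO.of_bound 3 ?_
  filter_upwards [Metric.closedBall_mem_nhds (0 : ParamSpace n) one_pos] with x hx
  rw [mem_closedBall_zero_iff] at hx
  have h1 : ‖x.1‖ ≤ ‖x‖ := norm_fst_le x
  have h2 : |x.2| ≤ ‖x‖ := norm_snd_le x
  rw [Real.norm_of_nonneg (sexticBound_nonneg x), norm_pow, norm_norm, sexticBound,
    ← sq_abs x.2, show x.2 ^ 4 = |x.2| ^ 4 from (Even.pow_abs (by decide) _).symm]
  have hp : ∀ {k : ℕ}, 3 ≤ k → ‖x‖ ^ k ≤ ‖x‖ ^ 3 := fun hk =>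
    pow_le_pow_of_le_one (norm_nonneg x) hx hk
  have e1 : ‖x.1‖ ^ 6 ≤ ‖x‖ ^ 3 := (pow_le_pow_left₀ (norm_nonneg _) h1 6).trans (hp (by norm_num))
  have e2 : ‖x.1‖ ^ 2 * |x.2| ^ 2 ≤ ‖x‖ ^ 3 := by
    calc ‖x.1‖ ^ 2 * |x.2| ^ 2 ≤ ‖x‖ ^ 2 * ‖x‖ ^ 2 := by gcongr
      _ = ‖x‖ ^ 4 := by ring
      _ ≤ _ := hp (by norm_num)
  have e3 : |x.2| ^ 4 ≤ ‖x‖ ^ 3 := (pow_le_pow_left₀ (abs_nonneg _) h2 4).trans (hp (by norm_num))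
  linarith

lemma normalPart_isBigO_norm (a : Fin n → Fin n → Fin n → Fin n → ℂ)
    (b : Fin n → Fin n → Fin n → Fin n → Fin n → ℂ) :
    (fun x : ParamSpace n => normalPart a b x.1) =O[𝓝 0] fun x => ‖x‖ ^ 3 := by
  have h0 : Tendsto (fun x : ParamSpace n => ((x.1, 0) : ParamSpace n)) (𝓝 0) (𝓝 0) := by
    have : Continuous fun x : ParamSpace n => ((x.1, 0) : ParamSpace n) := by fun_prop
    exact this.tendsto 0
  have h1 := ((normalPart_isBigO a b).trans
    (wnorm_pow_isBigO (show 3 ≤ 4 by norm_num))).comp_tendsto h0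
  refine h1.trans (IsBigO.of_bound 1 (Eventually.of_forall fun x => ?_))
  have h2 : wnorm ((x.1, 0) : ParamSpace n) = ‖x.1‖ := by simp [wnorm]
  simp only [Function.comp_apply, h2, norm_pow, norm_norm, one_mul]
  exact pow_le_pow_left₀ (norm_nonneg _) (norm_fst_le x) 3

lemma contDiffAt_sub_norm_sq {φ : ParamSpace n → ℝ} (hφ : ContDiffAt ℝ ∞ φ 0) :
    ContDiffAt ℝ ∞ (fun x => φ x - ‖x.1‖ ^ 2) 0 :=
  hφ.sub (contDiff_fst.norm_sq ℂ).contDiffAt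

/-- A normal graph agrees with the model to third order. -/
lemma sub_isBigO_of_normal {φ : ParamSpace n → ℝ} {a b} (hs : ContDiffAt ℝ ∞ φ 0)
    (h : (fun x => φ x - (‖x.1‖ ^ 2 + normalPart a b x.1)) =o[𝓝 0] fun x => wnorm x ^ 5) :
    (fun x => φ x - ‖x.1‖ ^ 2) =O[𝓝 0] fun x => ‖x‖ ^ 3 := by
  have hsm : ContDiffAt ℝ ∞ (fun x : ParamSpace n => φ x - (‖x.1‖ ^ 2 + normalPart a b x.1)) 0 :=
    ((contDiffAt_sub_norm_sq hs).sub
      ((isSlowlyVarying_normalPart a b).1.comp contDiff_fst).contDiffAt).congr_of_eventuallyEq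
      (Eventually.of_forall fun x => by simp only [Function.comp_apply]; ring)
  obtain ⟨e, he⟩ := exists_sub_cube_isBigO hsm h
  have h3 : (fun x : ParamSpace n => e * x.2 ^ 3) =O[𝓝 0] fun x => ‖x‖ ^ 3 := by
    refine IsBigO.const_mul_left (IsBigO.pow (IsBigO.of_bound 1 (Eventually.of_forall fun x => ?_))
      3) e
    rw [one_mul, norm_norm]
    exact norm_snd_le x
  refine (((he.trans sexticBound_isBigO).add h3).add (normalPart_isBigO_norm a b)).congr_left
    fun x => by ring

end HighOrder

/-! ### A polynomial map into the closed supergraph -/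

section FlatGerm

open Asymptotics Filter

variable {n : ℕ}

/-- The factor in the perturbation of the identity by a polynomial map. -/
noncomputable def perturbationFactor (A α : ℝ) (y : CSpace n) : CSpace n :=
  ((A : ℂ) • y.1, (A + Complex.I * α) * y.2 + Complex.I * A * y.2 ^ 2)

/-- The map `(z, w) ↦ (z + A z w², w + A w³ + i α w³ + i A w⁴)`. -/
noncomputable def cubicPerturbation (A α : ℝ) (y : CSpace n) : CSpace n :=
  y + y.2 ^ 2 • perturbationFactor A α y

lemma differentiable_perturbationFactor (A α : ℝ) :
    Differentiable ℂ (perturbationFactor (n := n) A α) := by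
  unfold perturbationFactor
  fun_prop

lemma differentiable_cubicPerturbation (A α : ℝ) :
    Differentiable ℂ (cubicPerturbation (n := n) A α) := by
  have h := differentiable_perturbationFactor (n := n) A α
  unfold cubicPerturbation
  fun_prop

lemma tendsto_perturbationFactor (A α : ℝ) :
    Tendsto (perturbationFactor (n := n) A α) (𝓝 0) (𝓝 0) := by
  have := (differentiable_perturbationFactor (n := n) A α).continuous.tendsto 0
  have h0 : perturbationFactor A α (0 : CSpace n) = 0 :=
    Prod.ext (by simp [perturbationFactor]) (by simp [perturbationFactor])
  rwa [h0] at this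

lemma cubicPerturbation_zero (A α : ℝ) : cubicPerturbation (n := n) A α 0 = 0 := by
  simp [cubicPerturbation]

lemma cubicPerturbation_sub_isLittleO (A α : ℝ) :
    (fun y : CSpace n => cubicPerturbation A α y - y) =o[𝓝 0] fun y => ‖y‖ ^ 2 := by
  have h1 : (fun y : CSpace n => y.2 ^ 2) =O[𝓝 0] fun y => ‖y‖ ^ 2 :=
    IsBigO.pow (IsBigO.of_bound 1 (Eventually.of_forall fun y => by
      rw [one_mul, norm_norm]; exact norm_snd_le y)) 2
  have h2 := h1.smul_isLittleO ((isLittleO_one_iff ℝ).2 (tendsto_perturbationFactor (n := n) A α))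
  refine (h2.congr_left fun y => ?_).congr_right fun y => ?_
  · simp [cubicPerturbation]
  · simp

/-- Two normal graphs with the same normal part: a polynomial map that is tangent to the identity to
second order sends the first graph to the closed supergraph of the second one. -/
theorem exists_cubicPerturbation_graph_le {φ φ' : ParamSpace n → ℝ} {a b}
    (hφs : ContDiffAt ℝ ∞ φ 0) (hφ0 : φ 0 = 0)
    (hφ : (fun x => φ x - (‖x.1‖ ^ 2 + normalPart a b x.1)) =o[𝓝 0] fun x => wnorm x ^ 5)
    (hφs' : ContDiffAt ℝ ∞ φ' 0)
    (hφ' : (fun x => φ' x - (‖x.1‖ ^ 2 + normalPart a b x.1)) =o[𝓝 0] fun x => wnorm x ^ 5) :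
    ∃ A α : ℝ, ∀ᶠ x in 𝓝 0, φ' (toP (cubicPerturbation A α (graphMap φ x))) ≤
      (cubicPerturbation A α (graphMap φ x)).2.im := by
  obtain ⟨e, he⟩ := exists_sub_cube_isBigO (hφs.sub hφs')
    ((hφ.sub hφ').congr_left fun x => by ring)
  have hη3 := sub_isBigO_of_normal hφs hφ
  have hψ3 := sub_isBigO_of_normal hφs' hφ'
  obtain ⟨C, hC, ε, hε, hlip⟩ := exists_sub_le_of_isBigO (contDiffAt_sub_norm_sq hφs') hψ3
  -- On the graph, φ = O(q) and |w|² = O(s). All error terms will be compared with q·s, which is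
  -- O(`sexticBound`).
  let q : ParamSpace n → ℝ := fun x => ‖x.1‖ ^ 2 + x.2 ^ 2
  let s : ParamSpace n → ℝ := fun x => x.2 ^ 2 + q x ^ 2
  let u : ParamSpace n → ℝ := fun x => x.2
  let r2 : ParamSpace n → ℝ := fun x => ‖x.1‖ ^ 2
  have hq0 : ∀ x, 0 ≤ q x := fun x => by positivity
  have hs0 : ∀ x, 0 ≤ s x := fun x => by positivity
  have hgr0 := graphMap_zero hφ0
  have hgrt : Tendsto (graphMap φ) (𝓝 0) (𝓝 0) := by
    have := (contDiffAt_graphMap le_rfl hφs).continuousAt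
    rwa [ContinuousAt, hgr0] at this
  -- elementary estimates
  have hqt : q =o[𝓝 0] fun _ => (1 : ℝ) := by
    rw [isLittleO_one_iff]
    have : Continuous q := by fun_prop
    simpa [q] using this.tendsto 0
  have hst : s =o[𝓝 0] fun _ => (1 : ℝ) := by
    rw [isLittleO_one_iff]
    have : Continuous s := by fun_prop
    simpa [s, q] using this.tendsto 0
  have hr2q : r2 =O[𝓝 0] q := IsBigO.of_bound 1 (Eventually.of_forall fun x => by
    rw [one_mul, Real.norm_of_nonneg (hq0 x), Real.norm_of_nonneg (sq_nonneg ‖x.1‖)]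
    exact le_add_of_nonneg_right (sq_nonneg x.2))
  have hxq : (fun x : ParamSpace n => ‖x‖ ^ 2) =O[𝓝 0] q :=
    IsBigO.of_bound 1 (Eventually.of_forall fun x => by
      rw [one_mul, Real.norm_of_nonneg (hq0 x), norm_pow, norm_norm, Prod.norm_def,
        Real.norm_eq_abs]
      have h1 := sq_nonneg ‖x.1‖
      have h2 := sq_nonneg x.2
      rcases max_cases ‖x.1‖ |x.2| with h | h <;> rw [h.1]
      · exact le_add_of_nonneg_right h2
      · rw [sq_abs]
        exact le_add_of_nonneg_left h1)
  have hη : (fun x => φ x - r2 x) =o[𝓝 0] q := by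
    refine (hη3.trans_isLittleO ?_).trans_isBigO hxq
    exact (isLittleO_pow_pow (𝕜 := ℝ) (show 2 < 3 by norm_num)).comp_tendsto tendsto_norm_zero
  have hv : φ =O[𝓝 0] q := (hη.isBigO.add hr2q).congr_left fun x => by ring
  have hus : (fun x => u x ^ 2) =O[𝓝 0] s := IsBigO.of_bound 1 (Eventually.of_forall fun x => by
    rw [one_mul, Real.norm_of_nonneg (hs0 x), Real.norm_of_nonneg (sq_nonneg (u x))]
    exact le_add_of_nonneg_right (sq_nonneg (q x)))
  have hqs : (fun x => q x ^ 2) =O[𝓝 0] s := IsBigO.of_bound 1 (Eventually.of_forall fun x => by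
    rw [one_mul, Real.norm_of_nonneg (hs0 x), Real.norm_of_nonneg (sq_nonneg (q x))]
    exact le_add_of_nonneg_left (sq_nonneg x.2))
  have hvs : (fun x => φ x ^ 2) =O[𝓝 0] s := (hv.pow 2).trans hqs
  have d1 : (fun x => q x * u x ^ 2) =O[𝓝 0] sexticBound (n := n) :=
    IsBigO.of_bound 1 (Eventually.of_forall fun x => by
      rw [one_mul, Real.norm_of_nonneg (mul_nonneg (hq0 x) (sq_nonneg _)),
        Real.norm_of_nonneg (sexticBound_nonneg x)]
      have : 0 ≤ ‖x.1‖ ^ 6 := by positivity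
      simp only [q, u, sexticBound]
      linarith)
  have mono := fun {k c : ℕ} (h : 5 < k + 2 * c) (h' : ¬ (k = 0 ∧ c = 3)) =>
    monomial_isBigO_sexticBound (n := n) h h'
  have d3 : (fun x => u x * q x ^ 2) =O[𝓝 0] sexticBound (n := n) := by
    have h1 := ((mono (k := 4) (c := 1) (by norm_num) (by norm_num)).add
      ((mono (k := 2) (c := 3) (by norm_num) (by norm_num)).const_mul_left 2)).add
      (mono (k := 0) (c := 5) (by norm_num) (by norm_num))
    refine (IsBigO.of_bound 1 (Eventually.of_forall fun x => ?_)).trans h1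
    have h2 : ‖x.1‖ ^ 4 * |x.2| ^ 1 + 2 * (‖x.1‖ ^ 2 * |x.2| ^ 3) + ‖x.1‖ ^ 0 * |x.2| ^ 5 =
        ‖u x * q x ^ 2‖ := by
      rw [norm_mul, Real.norm_of_nonneg (sq_nonneg (q x)), Real.norm_eq_abs]
      simp only [q, u, ← sq_abs x.2]
      ring
    rw [one_mul, h2, norm_norm]
  have d2 : (fun x => q x * q x ^ 2) =O[𝓝 0] sexticBound (n := n) := by
    have h1 := (((mono (k := 6) (c := 0) (by norm_num) (by norm_num)).add
      ((mono (k := 4) (c := 2) (by norm_num) (by norm_num)).const_mul_left 3)).add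
      ((mono (k := 2) (c := 4) (by norm_num) (by norm_num)).const_mul_left 3)).add
      (mono (k := 0) (c := 6) (by norm_num) (by norm_num))
    refine h1.congr_left fun x => ?_
    simp only [q, ← sq_abs x.2]
    ring
  have d4 : (fun x => q x * s x) =O[𝓝 0] sexticBound (n := n) :=
    (d1.add d2).congr_left fun x => by simp only [s, u]; ring
  -- the choice of the coefficients
  have hlead : (fun x => (φ x - φ' x - e * u x ^ 3) + 3 * e * (u x * φ x ^ 2)) =O[𝓝 0]
      sexticBound (n := n) := by
    have h1 : (fun x => u x * φ x ^ 2) =O[𝓝 0] sexticBound (n := n) :=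
      ((isBigO_refl u _).mul (hv.pow 2)).trans d3
    exact (he.congr_left fun x => by simp only [u]).add (h1.const_mul_left (3 * e))
  obtain ⟨C₀, hC₀⟩ := hlead.bound
  -- With φ replaced by ‖z‖², the A-terms change Im w − ‖z‖² by A(3u²‖z‖² − ‖z‖⁶ + u⁴) − 2A‖z‖²(u² −
  -- ‖z‖⁴) = A·`sexticBound`. Of A, the part C₀ pays for the difference of the graphs and 1 for the
  -- remainder; the coefficient −e cancels e u³.
  let A := C₀ + 1
  refine ⟨A, -e, ?_⟩
  set G := cubicPerturbation (n := n) A (-e)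
  let δ : ParamSpace n → ParamSpace n := fun x => toP (G (graphMap φ x)) - x
  let ψ : ParamSpace n → ℝ := fun x => φ' x - ‖x.1‖ ^ 2
  -- The displacement is w² times a factor that tends to 0 at the origin.
  have hδ : δ =o[𝓝 0] s := by
    have h1 : (fun x => (graphMap φ x).2 ^ 2) =O[𝓝 0] s := by
      refine (IsBigO.of_bound 1 (Eventually.of_forall fun x => ?_)).trans (hus.add hvs)
      have h2 : ‖(graphMap φ x).2 ^ 2‖ = u x ^ 2 + φ x ^ 2 := by
        rw [norm_pow, Complex.sq_norm, Complex.normSq_apply]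
        simp [graphMap, u]
        ring
      rw [one_mul, h2]
      exact le_abs_self _
    have h2 : (fun x => perturbationFactor A (-e) (graphMap φ x)) =o[𝓝 0] fun _ => (1 : ℝ) :=
      (isLittleO_one_iff ℝ).2 ((tendsto_perturbationFactor A (-e)).comp hgrt)
    have h3 := h1.smul_isLittleO h2
    simp only [smul_eq_mul, mul_one] at h3
    refine (IsBigO.of_bound 1 (Eventually.of_forall fun x => ?_)).trans_isLittleO h3
    have h4 : δ x = toPL n ((graphMap φ x).2 ^ 2 • perturbationFactor A (-e) (graphMap φ x)) := by
      have h5 : toP (G (graphMap φ x)) = toPL n (graphMap φ x) +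
          toPL n ((graphMap φ x).2 ^ 2 • perturbationFactor A (-e) (graphMap φ x)) := by
        rw [← map_add]
        rfl
      simp only [δ, h5, toPL_apply, toP_graphMap, add_sub_cancel_left]
    rw [h4, one_mul, toPL_apply, Prod.norm_def, Prod.norm_def]
    exact max_le_max le_rfl (Complex.abs_re_le_norm _)
  -- Since ψ = O(‖x‖³) is smooth, its gradient is O(‖x‖²) = O(q), and the increment is q·o(s).
  have hψd : (fun x => ψ (x + δ x) - ψ x) =o[𝓝 0] sexticBound (n := n) := by
    have h1 : ∀ᶠ x in 𝓝 0, ‖δ x‖ ≤ ‖x‖ := by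
      have hsx : s =O[𝓝 0] fun x => ‖x‖ := by
        refine IsBigO.of_bound 5 ?_
        filter_upwards [Metric.closedBall_mem_nhds (0 : ParamSpace n) one_pos] with x hx
        rw [mem_closedBall_zero_iff] at hx
        have k1 : ‖x.1‖ ≤ ‖x‖ := norm_fst_le x
        have k2 : |x.2| ≤ ‖x‖ := norm_snd_le x
        have k3 : x.2 ^ 2 ≤ ‖x‖ ^ 2 := by
          rw [← sq_abs]; exact pow_le_pow_left₀ (abs_nonneg _) k2 2
        have k4 : ‖x.1‖ ^ 2 ≤ ‖x‖ ^ 2 := pow_le_pow_left₀ (norm_nonneg _) k1 2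
        have k5 : ‖x‖ ^ 2 ≤ ‖x‖ := by nlinarith [norm_nonneg x]
        have k6 : q x ≤ 2 * ‖x‖ := by simp only [q]; linarith
        have k7 : q x ^ 2 ≤ (2 * ‖x‖) ^ 2 := pow_le_pow_left₀ (hq0 x) k6 2
        rw [Real.norm_of_nonneg (hs0 x), norm_norm]
        simp only [s]
        nlinarith
      filter_upwards [(hδ.trans_isBigO hsx).bound one_pos] with x hx
      simpa using hx
    have h2 : (fun x => ψ (x + δ x) - ψ x) =O[𝓝 0] fun x => q x * ‖δ x‖ := by
      have h3 : (fun x => ψ (x + δ x) - ψ x) =O[𝓝 0] fun x => ‖x‖ ^ 2 * ‖δ x‖ := by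
        refine IsBigO.of_bound (4 * C) ?_
        filter_upwards [h1, Metric.ball_mem_nhds (0 : ParamSpace n) (half_pos hε)] with x k1 k2
        rw [mem_ball_zero_iff] at k2
        have k3 := hlip (2 * ‖x‖) (by linarith) x (x + δ x) (by linarith [norm_nonneg x])
          ((norm_add_le _ _).trans (by linarith))
        rw [add_sub_cancel_left] at k3
        rw [Real.norm_eq_abs, norm_mul, norm_pow, norm_norm, norm_norm]
        refine k3.trans (le_of_eq ?_)
        ring
      exact h3.trans (hxq.mul (isBigO_refl _ _))
    exact h2.trans_isLittleO (((isBigO_refl q _).mul_isLittleO hδ.norm_left).trans_isBigO d4)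
  have hη' : ∀ f : ParamSpace n → ℝ, (f =O[𝓝 0] fun x => u x ^ 2) ∨ (f =O[𝓝 0] fun x => q x ^ 2) →
      (fun x => (φ x - r2 x) * f x) =o[𝓝 0] sexticBound (n := n) := by
    rintro f (hf | hf)
    · exact (hη.mul_isBigO hf).trans_isBigO d1
    · exact (hη.mul_isBigO hf).trans_isBigO d2
  have t1 := (hη' (fun x => u x ^ 2) (Or.inl (isBigO_refl _ _))).const_mul_left (3 * A)
  have t2 := (hη' (fun x => φ x ^ 2 + φ x * r2 x + r2 x ^ 2) (Or.inr
    (((hv.pow 2).add ((hv.mul hr2q).congr_right fun x => by ring)).add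
      (hr2q.pow 2)))).const_mul_left A
  have t3 : (fun x => u x ^ 2 * φ x ^ 2) =o[𝓝 0] sexticBound (n := n) := by
    have h1 : (fun x => q x ^ 2) =o[𝓝 0] q :=
      (hqt.mul_isBigO (isBigO_refl q _)).congr (fun x => by ring) fun x => by ring
    exact (((isBigO_refl (fun x => u x ^ 2) _).mul_isLittleO
      ((hv.pow 2).trans_isLittleO h1)).congr_right fun x => by ring).trans_isBigO d1
  have t4 : (fun x => φ x ^ 4) =o[𝓝 0] sexticBound (n := n) :=
    ((hv.pow 4).trans_isLittleO ((hqt.mul_isBigO (isBigO_refl (fun x => q x * q x ^ 2) _)).congr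
      (fun x => by ring) fun x => by rw [one_mul])).trans_isBigO d2
  have t5 := (hη' (fun x => r2 x * (φ x + r2 x)) (Or.inr
    ((hr2q.mul (hv.add hr2q)).congr_right fun x => by ring))).const_mul_left (2 * A)
  have t6 : (fun x => r2 x * (u x ^ 2 + φ x ^ 2) ^ 2) =o[𝓝 0] sexticBound (n := n) := by
    have h1 : (fun x => s x ^ 2) =o[𝓝 0] s :=
      (hst.mul_isBigO (isBigO_refl s _)).congr (fun x => by ring) fun x => by ring
    exact (hr2q.mul_isLittleO (((hus.add hvs).pow 2).trans_isLittleO h1)).trans_isBigO d4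
  -- All deviations from the leading gain: φ in place of ‖z‖² in the cubic terms and in the change
  -- of ‖z‖², the φ-terms of Im(iAw⁴), the term quadratic in A, and the increment of ψ.
  have hrest := (((((t1.sub t2).add ((t4.const_mul_left A).sub (t3.const_mul_left (6 * A)))).add
    t5).sub (t6.const_mul_left (A ^ 2))).sub hψd)
  filter_upwards [hC₀, hrest.bound one_half_pos] with x h1 h2
  have hQ := sexticBound_nonneg x
  rw [Real.norm_of_nonneg hQ, Real.norm_eq_abs] at h1 h2
  have k1 := (abs_le.1 h1).1
  have k2 := (abs_le.1 h2).1
  have hG1 : (G (graphMap φ x)).1 = (1 + A * (graphMap φ x).2 ^ 2) • x.1 := by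
    simp only [G, cubicPerturbation, perturbationFactor, Prod.fst_add, Prod.smul_fst, graphMap_fst,
      add_smul, one_smul, smul_smul]
    congr 2
    ring
  have hw : (graphMap φ x).2 = u x + φ x * Complex.I := rfl
  have hnorm : ‖(G (graphMap φ x)).1‖ ^ 2 =
      r2 x * (1 + 2 * A * (u x ^ 2 - φ x ^ 2) + A ^ 2 * (u x ^ 2 + φ x ^ 2) ^ 2) := by
    rw [hG1, norm_smul, mul_pow, Complex.sq_norm, Complex.normSq_apply, hw]
    simp [pow_two]
    simp only [r2]
    ring
  have him : (G (graphMap φ x)).2.im = φ x + A * (3 * u x ^ 2 * φ x - φ x ^ 3) -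
      e * (u x ^ 3 - 3 * u x * φ x ^ 2) +
      A * (u x ^ 4 - 6 * u x ^ 2 * φ x ^ 2 + φ x ^ 4) := by
    simp only [G, cubicPerturbation, perturbationFactor, Prod.snd_add, Prod.smul_snd, smul_eq_mul,
      hw]
    simp [pow_succ]
    ring
  have hψx : φ' (toP (G (graphMap φ x))) = ‖(G (graphMap φ x)).1‖ ^ 2 + ψ (x + δ x) := by
    have h3 : x + δ x = toP (G (graphMap φ x)) := by simp only [δ, add_sub_cancel]
    rw [h3]
    simp only [ψ, toP_fst, add_sub_cancel]
  have hψ0 : φ' x = r2 x + ψ x := by simp only [ψ, r2, add_sub_cancel]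
  have hQdef : sexticBound x = r2 x ^ 3 + r2 x * u x ^ 2 + u x ^ 4 := by
    simp only [sexticBound, r2, u]
    ring
  rw [hψx, hnorm, him]
  have hA : A = C₀ + 1 := rfl
  have hAQ : A * sexticBound x = C₀ * sexticBound x + sexticBound x := by rw [hA]; ring
  have hAQ' : A * sexticBound x = A * (r2 x ^ 3 + r2 x * u x ^ 2 + u x ^ 4) := by rw [hQdef]
  rw [hψ0] at k1
  nlinarith [k1, k2, hAQ, hAQ', hQ]

end FlatGerm

/-! ### From the polynomial map to a 2-flat germ -/

section ExistenceOfFlatGerm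

open Asymptotics Filter

variable {n : ℕ}

/-- Points above the graph are mapped above the second graph. -/
lemma eventually_lt_of_graph_le {φ φ' : ParamSpace n → ℝ} (hφ : Tendsto (graphMap φ) (𝓝 0) (𝓝 0))
    (hφs' : ContDiffAt ℝ ∞ φ' 0) (hφd' : fderiv ℝ φ' 0 = 0) {G : CSpace n → CSpace n}
    (hG : ContDiffAt ℝ ∞ G 0) (hG0 : G 0 = 0)
    (hflat : (fun y => G y - y) =o[𝓝 0] fun y => ‖y‖ ^ 2)
    (hle : ∀ᶠ x in 𝓝 0, φ' (toP (G (graphMap φ x))) ≤ (G (graphMap φ x)).2.im) :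
    ∀ᶠ y in 𝓝 0, φ (toP y) < y.2.im → φ' (toP (G y)) < (G y).2.im := by
  have hGd := hasFDerivAt_id_of_flat hG0 hflat
  -- The derivative of R at 0 is Im w, so along a vertical segment starting on the graph, where R ≥
  -- 0, it grows by at least half the vertical distance; this makes the inequality strict.
  let R : CSpace n → ℝ := fun y => (G y).2.im - φ' (toP (G y))
  have hP0 : toP (G 0) = 0 := by rw [hG0, toP_zero]
  have hRs : ContDiffAt ℝ ∞ R 0 := by
    refine ContDiffAt.sub ?_ ?_
    · exact Complex.imCLM.contDiff.contDiffAt.comp (0 : CSpace n)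
        (contDiff_snd.contDiffAt.comp (0 : CSpace n) hG)
    · refine ContDiffAt.comp (0 : CSpace n) (by rwa [hP0])
        (contDiff_toP.contDiffAt.comp (0 : CSpace n) hG)
  have hRd : ∀ v, fderiv ℝ R 0 v = v.2.im := by
    have h1 := ((Complex.imCLM.comp (ContinuousLinearMap.snd ℝ (EuclideanSpace ℂ (Fin n)) ℂ)
      ).hasFDerivAt (x := G 0)).comp (0 : CSpace n) hGd
    have h2 : HasFDerivAt φ' (0 : ParamSpace n →L[ℝ] ℝ) (toP (G 0)) := by
      rw [hP0, ← hφd']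
      exact (hφs'.differentiableAt (by simp)).hasFDerivAt
    have h3 : HasFDerivAt R _ 0 :=
      h1.sub (h2.comp (0 : CSpace n) ((hasFDerivAt_toP (G 0)).comp (0 : CSpace n) hGd))
    intro v
    rw [h3.fderiv]
    simp
  have htP : Tendsto toP (𝓝 (0 : CSpace n)) (𝓝 0) := by
    have := continuous_toP.tendsto (0 : CSpace n)
    rwa [toP_zero] at this
  have ht2 : Tendsto (fun y : CSpace n => (y, graphMap φ (toP y))) (𝓝 0)
      (𝓝 ((0 : CSpace n), (0 : CSpace n))) := tendsto_id.prodMk_nhds (hφ.comp htP)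
  filter_upwards [((hRs.hasStrictFDerivAt (by simp)).isLittleO.comp_tendsto ht2).bound
    one_half_pos, htP.eventually hle] with y h1 h2 hlt
  have h3 : y - graphMap φ (toP y) =
      (y.2.im - φ (toP y)) • ((0 : EuclideanSpace ℂ (Fin n)), Complex.I) := by
    refine Prod.ext ?_ ?_
    · simp [graphMap_fst]
    · apply Complex.ext <;> simp [graphMap]
  have h4 : ‖((0 : EuclideanSpace ℂ (Fin n)), Complex.I)‖ = 1 := by simp [Prod.norm_def]
  have hd : 0 < y.2.im - φ (toP y) := sub_pos.2 hlt
  simp only [Function.comp_apply, h3, norm_smul, h4, mul_one, hRd, Prod.smul_snd, Complex.smul_im,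
    smul_eq_mul, Complex.I_im, Real.norm_eq_abs, abs_of_pos hd] at h1
  have h5 := (abs_le.1 h1).1
  have h6 : 0 ≤ R (graphMap φ (toP y)) := sub_nonneg.2 h2
  refine sub_pos.1 (?_ : 0 < R y)
  linarith

/-- A holomorphic map of supergraphs defines a germ of a map of domains. -/
theorem IsGraphChart.exists_isTwoFlat {D D' : Set (CSpace n)} {p p' : CSpace n}
    {h g : OpenPartialHomeomorph (CSpace n) (CSpace n)} {φ φ' : ParamSpace n → ℝ}
    (H : IsGraphChart D p h φ) (H' : IsGraphChart D' p' g φ') (hφ : IsChernMoserGraph φ)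
    (hφ' : IsChernMoserGraph φ') {G : CSpace n → CSpace n} (hG : Differentiable ℂ G)
    (hG0 : G 0 = 0) (hflat : (fun y => G y - y) =o[𝓝 0] fun y => ‖y‖ ^ 2)
    (hlt : ∀ᶠ y in 𝓝 0, φ (toP y) < y.2.im → φ' (toP (G y)) < (G y).2.im) :
    ∃ F : CSpace n → CSpace n, IsSmoothMapGerm D D' p p' F ∧ IsTwoFlat D D' p p' F := by
  have hh := H.isLocalBiholomorphism
  have hg := H'.isLocalBiholomorphism
  have hGt : Tendsto G (𝓝 0) (𝓝 0) := by
    have := hG.continuous.tendsto 0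
    rwa [hG0] at this
  have hev : ∀ᶠ q in 𝓝 p, q ∈ h.source ∧ G (h q) ∈ g.target ∧ (q ∈ D → g.symm (G (h q)) ∈ D') := by
    filter_upwards [hh.source_mem, (hGt.comp hh.tendsto).eventually hg.symm.source_mem,
      hh.tendsto.eventually H.eventually_mem, hh.tendsto.eventually hlt,
      (hGt.comp hh.tendsto).eventually H'.eventually_mem] with q h1 h2 h3 h4 h5
    refine ⟨h1, h2, fun hq => ?_⟩
    rw [h.left_inv h1] at h3
    exact h5.2 (h4 (h3.1 hq))
  obtain ⟨U, hU, hUo, hpU⟩ := eventually_nhds_iff.1 hev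
  have hhol : DifferentiableOn ℂ (fun q => g.symm (G (h q))) U := by
    have h1 : DifferentiableOn ℂ (fun q => G (h q)) U :=
      hG.comp_differentiableOn (hh.holomorphic.mono fun q hq => (hU q hq).1)
    exact hg.holomorphic_symm.comp h1 fun q hq => (hU q hq).2.1
  refine ⟨fun q => g.symm (G (h q)), ⟨U, hUo, hpU, contDiffOn_real_of_differentiableOn hUo hhol,
    hhol.mono Set.inter_subset_left, fun q hq => (hU q hq.1).2.2 hq.2, ?_⟩,
    h, g, H.isChernMoserChart hφ, H'.isChernMoserChart hφ', ?_⟩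
  · simp only [hh.map_eq, hG0, hg.symm_map_eq]
  · refine hflat.congr' ?_ EventuallyEq.rfl
    filter_upwards [hh.eventually_right_inv, hGt.eventually hg.eventually_right_inv] with y h1 h2
    rw [h1, h2]

end ExistenceOfFlatGerm

theorem theorem1p4 (n : ℕ) (hn : 1 ≤ n) (D D' : Set (CSpace n)) (p p' : CSpace n)
    (hD : IsSmoothDomain D) (hD' : IsSmoothDomain D')
    (hp : p ∈ frontier D) (hp' : p' ∈ frontier D')
    (hpsc : IsStronglyPseudoconvexAt D p) (hpsc' : IsStronglyPseudoconvexAt D' p') :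
    (∃ F : CSpace n → CSpace n, IsSmoothMapGerm D D' p p' F ∧ IsTwoFlat D D' p p' F) ↔
      AreEquivalentToWeightedOrder 5 (frontier D) (frontier D') p p' := by
  constructor
  · rintro ⟨F, hF, hflat⟩
    exact areEquivalentToWeightedOrder_of_isTwoFlat hD.isOpen hD'.isOpen hF hflat
  · intro heq
    obtain ⟨h, φ, g, φ', a, b, H, H', ha, hb, hφ, hφ'⟩ :=
      exists_graphCharts_of_equivalent hn hD.isOpen hD'.isOpen hp hp' hpsc hpsc' heq
    obtain ⟨A, α, hle⟩ := exists_cubicPerturbation_graph_le H.contDiffAt H.map_zero hφ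
      H'.contDiffAt hφ'
    have hG := differentiable_cubicPerturbation (n := n) A α
    have hGs : ContDiffAt ℝ ∞ (cubicPerturbation (n := n) A α) 0 :=
      (contDiffOn_real_of_differentiableOn isOpen_univ hG.differentiableOn).contDiffAt
        Filter.univ_mem
    exact H.exists_isTwoFlat H' (isChernMoserGraph_iff.2 ⟨a, b, ha, hb, hφ⟩)
      (isChernMoserGraph_iff.2 ⟨a, b, ha, hb, hφ'⟩) hG (cubicPerturbation_zero A α)
      (cubicPerturbation_sub_isLittleO A α)
      (eventually_lt_of_graph_le H.tendsto_graphMap H'.contDiffAt H'.fderiv_zero hGs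
        (cubicPerturbation_zero A α) (cubicPerturbation_sub_isLittleO A α) hle)
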